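/- **Setting.** The bulk polynomials $Q(x,u,v,y;\alpha,\beta)$, with complex lattice parameters $\alpha,\beta$ and a constant $\delta\in\mathbb C$ (and modulus $k\ne 0,\pm1$ for Q4), are - Q1($\delta$): $\alpha(x-v)(u-y)-\beta(x-u)(v-y)+\delta^2\alpha\beta(\alpha-\beta)$; - Q2: $\alpha(x-v)(u-y)-\beta(x-u)(v-y)+\alpha\beta(\alpha-\beta)(x+u+v+y)-\alpha\beta(\alpha-\beta)(\alpha^2-\alpha\beta+\beta^2)$; - Q3($\delta$): $\sinh\alpha\,(xu+vy)-\sinh\beta\,(xv+uy)-\sinh(\alpha-\beta)(xy+uv)+\delta\sinh(\alpha-\beta)\sinh\alpha\sinh\beta$; - Q4: $\operatorname{sn}\alpha\,(xu+vy)-\operatorname{sn}\beta\,(xv+uy)-\operatorname{sn}(\alpha-\beta)(xy+uv)+\operatorname{sn}(\alpha-\beta)\operatorname{sn}\alpha\operatorname{sn}\beta\,(1+k^2xuvy)$, where $\operatorname{sn}$ is the Jacobi function of modulus $k$ and $\alpha,\beta,\alpha-\beta$ are not poles of it; - H1: $(x-y)(u-v)+\beta-\alpha$; - H2: $(x-y)(u-v)+(\beta-\alpha)(x+u+v+y)+\beta^2-\alpha^2$;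 - H3($\delta$): $e^\alpha(xu+vy)-e^\beta(xv+uy)+\delta(e^{2\alpha}-e^{2\beta})$; - A1($\delta$): $\alpha(x+v)(u+y)-\beta(x+u)(v+y)-\delta^2\alpha\beta(\alpha-\beta)$; - A2: $\sinh\alpha\,(xv+uy)-\sinh\beta\,(xu+vy)-\sinh(\alpha-\beta)(1+xuvy)$. Let $D\subset\mathbb C^2$ be closed under $(\alpha,\beta)\mapsto(\beta,\alpha)$ and such that $Q$ is defined and irreducible for all $(\alpha,\beta)\in D$. A *boundary polynomial* on $D$ is a family $q(x,y,z;\alpha,\beta)$, $(\alpha,\beta)\in D$, of irreducible polynomials in $x,y,z$ of degree $1$ in $x$ and in $z$, with $q(x,y,z;\alpha,\beta)=\gamma\,q(z,y,x;\beta,\alpha)$ on $D$ for some $\gamma\in\{1,-1\}$. It is *nondegenerate* for $Q$ if, at each $(\alpha,\beta)\in D$, $q(x,u,y)$ does not divide $QQ_{uv}-Q_uQ_v$ and is not a linear combination $c_1\,Q|_{v=0}+c_0\,Q_v$ with $c_0,c_1\in\mathbb C$. A boundary polynomial $p$ is *dual* to a nondegenerate boundary polynomial $q$ if $$Q\,q_y-Q_y\,q=\chi(x,u;\alpha,\beta)\,p(u,x,v;\alpha,\beta),\qquad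 q=q(x,u,y;\alpha,\beta),$$ for some polynomial $\chi$ in $x,u$. Write $Q=S+Ty$ with $S,T$ independent of $y$. Below, $q$ is written in the arguments $(x,u,y)$ and $p$ in the arguments $(u,x,v)$. **Theorem.** For each of these bulk polynomials and each such $D$, let $p$ be dual to $q$. At each $(\alpha,\beta)\in D$, up to interchanging the roles of $q$ and $p$ and up to multiplying $q$ and $p$ by nonzero factors depending only on $\alpha,\beta$ (symmetric or antisymmetric under $\alpha\leftrightarrow\beta$), the pair $(q,p)$ is of one of the following three kinds. 1. *$\mathcal M_+$ and dual $\mathcal M_+$*: $q=r_1xy+r_2(x+y)+r_4$ and $p=r_1S x+r_2(S-Tx)-r_4T$, where $r_1,r_2,r_4$ are symmetric functions of $\alpha,\beta$ with $r_1r_4-r_2^2\neq0$; for H3($0$) with $r_4=0$ the latter expression is $x$ times a polynomial, and $p$ is that polynomial. Conversely, for every bulk polynomial and all symmetric $r_1,r_2,r_4$ with $r_1r_4-r_2^2\ne0$ on $D$, these $q,p$ are nondegenerate boundary polynomials dual to each other (each is dual to the other), so the pair is a three-parameter family. 2. *$\mathcal M_-$ and dual $\mathcal M_-$*: $q=x-y$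 and $p=(-S-Tx)/\kappa$, with $\kappa=\alpha-\beta$ for Q1, Q2, A1, H2, $\kappa=\sinh(\alpha-\beta)$ for Q3, A2, $\kappa=\operatorname{sn}(\alpha-\beta)$ for Q4, $\kappa=e^\alpha-e^\beta$ for H3; for H3($0$) this quotient is $-x(u+v)$ and $p=-(u+v)$. This case occurs, and these $q,p$ are nondegenerate and dual to each other, for every bulk polynomial except Q1($0$), A1($0$), H1; for these three no dual pair contains, at any $(\alpha,\beta)\in D$, a multiple of $x-y$ (respectively $u-v$). 3. *Singular case*, only for Q3($0$), Q1($\delta$), A2, A1($\delta$), H3($\delta\ne0$) and H2: $q=c_0\mathfrak q_0+c_1\mathfrak q_1$ and $p=c_0\mathfrak p_0+c_1\mathfrak p_1$, with $c_0,c_1$ depending at most symmetrically on $\alpha,\beta$ and not both zero. Here, for a sign $\varepsilon=\pm1$, the parameters $a,b$ are any numbers with $\varepsilon\alpha=a^2$, $\varepsilon\beta=b^2$ for Q1($\delta$), A1($\delta$); with $e^{\varepsilon\alpha}=\cosh a$, $e^{\varepsilon\beta}=\cosh b$ for Q3($0$), A2; and $a=\alpha$, $b=\beta$ for H2, H3($\delta$);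 exchanging $\alpha$ and $\beta$ exchanges $a$ and $b$. Explicitly: - Q1($\delta$): $\mathfrak q_0=(a+b)xy-(au-\delta ab^2)x-(bu-\delta a^2b)y$, $\mathfrak q_1=bx+ay+(a+b)(\delta ab-u)$, $\mathfrak p_0=-(a-b)uv+axu-bxv+\delta ab(a-b)(\delta ab+x)$, $\mathfrak p_1=bu-av+(a-b)(\delta ab+x)$; - A1($\delta$): $\mathfrak q_0=(a+b)xy+a(u+\delta b^2)x+b(u+\delta a^2)y$, $\mathfrak q_1=bx+ay+(a+b)(u+\delta ab)$, $\mathfrak p_0=(a-b)uv+axu-bxv-\delta ab(a-b)(x+\delta ab)$, $\mathfrak p_1=bu-av-(a-b)(x+\delta ab)$; - Q3($0$): $\mathfrak q_0=(\sinh a+\sinh b)xy-\sinh a\cosh b\,ux-\cosh a\sinh b\,uy$, $\mathfrak q_1=\sinh b\,x+\sinh a\,y-\sinh(a+b)\,u$, $\mathfrak p_0=(\sinh a+\sinh b)\bigl(-(\sinh a-\sinh b)uv+\sinh a\cosh b\,xu-\cosh a\sinh b\,xv\bigr)$, $\mathfrak p_1=\sinh(a+b)\bigl(\sinh b\,u-\sinh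 a\,v+\sinh(a-b)\,x\bigr)$; - A2: $\mathfrak q_0=(\sinh a+\sinh b)uxy-\sinh a\cosh b\,x-\cosh a\sinh b\,y$, $\mathfrak q_1=\sinh b\,ux+\sinh a\,uy-\sinh(a+b)$, $\mathfrak p_0=(\sinh a+\sinh b)\bigl(-\cosh a\sinh b\,xu+\sinh a\cosh b\,xv-(\sinh a-\sinh b)\bigr)$, $\mathfrak p_1=\sinh(a+b)\bigl(\sinh(a-b)\,xuv-\sinh a\,u+\sinh b\,v\bigr)$; - H2: $\mathfrak q_0=2xy+u(x+y)+bx+ay$, $\mathfrak q_1=x+y+a+b+2u$, $\mathfrak p_0=-(a-b)(u+v)+2x(u-v)-(a-b)(a+b+2x)$, $\mathfrak p_1=2(u-v)$; - H3($\delta$): $\mathfrak q_0=2uxy+\delta(e^bx+e^ay)$, $\mathfrak q_1=u(x+y)+\delta(e^a+e^b)$, $\mathfrak p_0=2x(e^au-e^bv)+\delta(e^{2a}-e^{2b})$, $\mathfrak p_1=(e^a+e^b)(u-v)$. Conversely, for these equations, for each choice of $\varepsilon,a,b$ as functions on $D$ and of symmetric $c_0,c_1$ without common zero on $D$, these $q,p$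 are nondegenerate boundary polynomials dual to each other, and at no $(\alpha,\beta)\in D$ are they, in either order, a pair of the first kind. Thus there is exactly one singular pair of families, up to interchanging $q$ and $p$, the sign $\varepsilon$ and the choice of $a,b$. -/

import Mathlib

open MvPolynomial

noncomputable section

/-! ### The Jacobi elliptic function `sn` -/

/-- `s`, `c`, `d` are the Jacobi elliptic functions `sn`, `cn`, `dn` of modulus `k`: the meromorphic
functions on `ℂ` solving `sn' = cn dn`, `cn' = - sn dn`, `dn' = - k ^ 2 sn cn` away from the poles,
with the values `0, 1, 1` at the origin. The normal form convention (no removable singularities,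
value `0` at a pole) makes the three functions unique as total functions. -/
structure IsJacobiElliptic (k : ℂ) (s c d : ℂ → ℂ) : Prop where
  meromorphic_s : MeromorphicNFOn s Set.univ
  meromorphic_c : MeromorphicNFOn c Set.univ
  meromorphic_d : MeromorphicNFOn d Set.univ
  analytic_zero : AnalyticAt ℂ s 0 ∧ AnalyticAt ℂ c 0 ∧ AnalyticAt ℂ d 0
  s_zero : s 0 = 0
  c_zero : c 0 = 1
  d_zero : d 0 = 1
  ode : ∀ z, AnalyticAt ℂ s z → AnalyticAt ℂ c z → AnalyticAt ℂ d z →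
    HasDerivAt s (c z * d z) z ∧ HasDerivAt c (-(s z * d z)) z ∧
      HasDerivAt d (-(k ^ 2 * s z * c z)) z

open Classical in
/-- The Jacobi function `sn` of modulus `k`. It exists for every `k`, so the second branch is
never taken; it is there only because the definition does not contain the existence proof. -/
def jacobiSn (k : ℂ) : ℂ → ℂ :=
  if h : ∃ s c d : ℂ → ℂ, IsJacobiElliptic k s c d then h.choose else 0

/-! ### The bulk polynomials of the Adler-Bobenko-Suris list -/

/-- The names in the Adler-Bobenko-Suris list, with their fixed constants: `δ` for Q1, Q3, H3, A1,
and the elliptic modulus `k` for Q4. -/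
inductive ABS : Type
  | Q1 (δ : ℂ)
  | Q2
  | Q3 (δ : ℂ)
  | Q4 (k : ℂ)
  | H1
  | H2
  | H3 (δ : ℂ)
  | A1 (δ : ℂ)
  | A2

/-- Polynomials in `x = X 0`, `u = X 1`, `v = X 2`, `y = X 3`. -/
abbrev QuadPoly : Type := MvPolynomial (Fin 4) ℂ

/-- Polynomials in three arguments: `X 0` and `X 2` are the boundary arguments, `X 1` is the
middle argument. -/
abbrev TriPoly : Type := MvPolynomial (Fin 3) ℂ

namespace ABS

/-- The canonical form `Q(x, u, v, y; α, β)`. -/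
def bulk : ABS → ℂ → ℂ → QuadPoly
  | Q1 δ, α, β =>
      C α * (X 0 - X 2) * (X 1 - X 3) - C β * (X 0 - X 1) * (X 2 - X 3)
        + C (δ ^ 2 * α * β * (α - β))
  | Q2, α, β =>
      C α * (X 0 - X 2) * (X 1 - X 3) - C β * (X 0 - X 1) * (X 2 - X 3)
        + C (α * β * (α - β)) * (X 0 + X 1 + X 2 + X 3)
        - C (α * β * (α - β) * (α ^ 2 - α * β + β ^ 2))
  | Q3 δ, α, β =>
      C (Complex.sinh α) * (X 0 * X 1 + X 2 * X 3) - C (Complex.sinh β) * (X 0 * X 2 + X 1 * X 3)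
        - C (Complex.sinh (α - β)) * (X 0 * X 3 + X 1 * X 2)
        + C (δ * Complex.sinh (α - β) * Complex.sinh α * Complex.sinh β)
  | Q4 k, α, β =>
      C (jacobiSn k α) * (X 0 * X 1 + X 2 * X 3) - C (jacobiSn k β) * (X 0 * X 2 + X 1 * X 3)
        - C (jacobiSn k (α - β)) * (X 0 * X 3 + X 1 * X 2)
        + C (jacobiSn k (α - β) * jacobiSn k α * jacobiSn k β)
            * (1 + C (k ^ 2) * (X 0 * X 1 * X 2 * X 3))
  | H1, α, β => (X 0 - X 3) * (X 1 - X 2) + C (β - α)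
  | H2, α, β =>
      (X 0 - X 3) * (X 1 - X 2) + C (β - α) * (X 0 + X 1 + X 2 + X 3) + C (β ^ 2 - α ^ 2)
  | H3 δ, α, β =>
      C (Complex.exp α) * (X 0 * X 1 + X 2 * X 3) - C (Complex.exp β) * (X 0 * X 2 + X 1 * X 3)
        + C (δ * (Complex.exp (2 * α) - Complex.exp (2 * β)))
  | A1 δ, α, β =>
      C α * (X 0 + X 2) * (X 1 + X 3) - C β * (X 0 + X 1) * (X 2 + X 3)
        - C (δ ^ 2 * α * β * (α - β))
  | A2, α, β =>
      C (Complex.sinh α) * (X 0 * X 2 + X 1 * X 3) - C (Complex.sinh β) * (X 0 * X 1 + X 2 * X 3)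
        - C (Complex.sinh (α - β)) * (1 + X 0 * X 1 * X 2 * X 3)

/-- The formula of the bulk polynomial makes sense at `(α, β)`: for Q4 the modulus is not
`0, 1, -1`, and `α`, `β`, `α - β` are not poles of `sn`. -/
def Regular : ABS → ℂ → ℂ → Prop
  | Q4 k, α, β => k ≠ 0 ∧ k ≠ 1 ∧ k ≠ -1 ∧ AnalyticAt ℂ (jacobiSn k) α ∧
      AnalyticAt ℂ (jacobiSn k) β ∧ AnalyticAt ℂ (jacobiSn k) (α - β)
  | _, _, _ => True

/-- A set of pairs of lattice parameters, closed under exchanging the two parameters, on which the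
bulk polynomial is defined and irreducible (this forces `α ≠ β`). -/
structure IsParameterDomain (E : ABS) (D : Set (ℂ × ℂ)) : Prop where
  symm : ∀ α β, (α, β) ∈ D → (β, α) ∈ D
  regular : ∀ α β, (α, β) ∈ D → E.Regular α β
  irreducible : ∀ α β, (α, β) ∈ D → Irreducible (E.bulk α β)

end ABS

/-! ### Boundary polynomials and duality -/

/-- A family of polynomials in three arguments depending on the lattice parameters `α, β`. -/
abbrev TriFamily : Type := ℂ → ℂ → TriPoly

/-- `q(x, y, z; α, β)` is a boundary polynomial for `(α, β) ∈ D`: irreducible, of degree one in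
`x` and in `z`, and `q(x, y, z; α, β) = γ q(z, y, x; β, α)` with a parity `γ = ± 1`. -/
structure IsBoundaryPolynomial (D : Set (ℂ × ℂ)) (q : TriFamily) : Prop where
  irreducible : ∀ α β, (α, β) ∈ D → Irreducible (q α β)
  affine_first : ∀ α β, (α, β) ∈ D → degreeOf 0 (q α β) = 1
  affine_last : ∀ α β, (α, β) ∈ D → degreeOf 2 (q α β) = 1
  parity : ∃ γ : ℂ, (γ = 1 ∨ γ = -1) ∧ ∀ α β, (α, β) ∈ D →
    q α β = C γ * rename ![2, 1, 0] (q β α)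

/-- `q(x, u, y)` as a polynomial on the quadrilateral. -/
def onXUY (q : TriPoly) : QuadPoly := rename ![0, 1, 3] q

/-- `p(u, x, v)` as a polynomial on the quadrilateral. -/
def onUXV (p : TriPoly) : QuadPoly := rename ![1, 0, 2] p

/-- `H = Q q_y - Q_y q`: elimination of `y` from `Q(x, u, v, y)` and `q(x, u, y)`. -/
def elimY (Q : QuadPoly) (q : TriPoly) : QuadPoly :=
  Q * pderiv 3 (onXUY q) - pderiv 3 Q * onXUY q

/-- The diagonal biquadratic polynomial `δ_{u,v} Q = Q Q_{uv} - Q_u Q_v`. -/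
def diagonalBiquadratic (Q : QuadPoly) : QuadPoly :=
  Q * pderiv 1 (pderiv 2 Q) - pderiv 1 Q * pderiv 2 Q

/-- `q = 0` is nondegenerate for `Q = 0`, i.e. does not lead to singular solutions: `δ_{u,v} Q` does
not vanish on `q = 0` (for an irreducible `q` this says that `q` does not divide it), and `q` is not
a linear combination of the two coefficients of `Q` as a polynomial in `v`. -/
def IsNondegenerate (Q : QuadPoly) (q : TriPoly) : Prop :=
  ¬ onXUY q ∣ diagonalBiquadratic Q ∧
    ¬ ∃ c₀ c₁ : ℂ, onXUY q = C c₁ * aeval ![X 0, X 1, 0, X 3] Q + C c₀ * pderiv 2 Q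

/-- `q` is a nondegenerate boundary polynomial that factorizes `Q`, and `p` is the dual boundary
polynomial: `Q q_y - Q_y q = χ(x, u; α, β) p(u, x, v; α, β)` for a polynomial `χ`. -/
structure IsDualTo (Q : ℂ → ℂ → QuadPoly) (D : Set (ℂ × ℂ)) (q p : TriFamily) : Prop where
  boundary_q : IsBoundaryPolynomial D q
  boundary_p : IsBoundaryPolynomial D p
  nondegenerate : ∀ α β, (α, β) ∈ D → IsNondegenerate (Q α β) (q α β)
  factorization : ∃ χ : ℂ → ℂ → MvPolynomial (Fin 2) ℂ, ∀ α β, (α, β) ∈ D →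
    elimY (Q α β) (q α β) = rename ![0, 1] (χ α β) * onUXV (p α β)

/-- The two families agree at `(α, β)` and `(β, α)`, up to a nonzero factor that depends on the
parameters only and is symmetric or antisymmetric in them. -/
def ParamEquivAt (α β : ℂ) (q q' : TriFamily) : Prop :=
  ∃ g σ : ℂ, g ≠ 0 ∧ (σ = 1 ∨ σ = -1) ∧
    q α β = C g * q' α β ∧ q β α = C (σ * g) * q' β α

/-- A function of `(α, β)` is symmetric on `D`. -/
def SymmOn (D : Set (ℂ × ℂ)) (r : ℂ → ℂ → ℂ) : Prop :=
  ∀ α β, (α, β) ∈ D → r α β = r β α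

namespace ABS

/-! ### The Möbius cases -/

/-- With `Q = S + T y`: the polynomial `S`, in the arguments `(u, x, v)`. -/
def coeffS (E : ABS) (α β : ℂ) : TriPoly :=
  aeval ![X 1, X 0, X 2, 0] (E.bulk α β)

/-- With `Q = S + T y`: the polynomial `T`, in the arguments `(u, x, v)`. -/
def coeffT (E : ABS) (α β : ℂ) : TriPoly :=
  aeval ![X 1, X 0, X 2, 0] (pderiv 3 (E.bulk α β))

/-- The `M₊` polynomial `r₁ x y + r₂ x + r₂ y + r₄`. -/
def mPlus (r₁ r₂ r₄ : ℂ → ℂ → ℂ) : TriFamily := fun α β =>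
  C (r₁ α β) * (X 0 * X 2) + C (r₂ α β) * X 0 + C (r₂ α β) * X 2 + C (r₄ α β)

/-- The combination `r₁ p₁ + r₂ p₂ + r₄ p₄` with `p₁ = S x`, `p₂ = S - T x`, `p₄ = - T`. -/
def mPlusCombination (E : ABS) (r₁ r₂ r₄ : ℂ → ℂ → ℂ) : TriFamily := fun α β =>
  C (r₁ α β) * (E.coeffS α β * X 1) + C (r₂ α β) * (E.coeffS α β - E.coeffT α β * X 1)
    + C (r₄ α β) * (-E.coeffT α β)

open Classical in
/-- The dual `M₊` polynomial `r₁ p₁ + r₂ p₂ + r₄ p₄`. For H3(0) with `r₄ = 0` this combination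
equals `x (r₁ x (exp α u - exp β v) + r₂ (exp α + exp β) (u - v))`, and the factor `x` is removed. -/
def dualMPlus (E : ABS) (r₁ r₂ r₄ : ℂ → ℂ → ℂ) : TriFamily := fun α β =>
  if E = H3 0 ∧ r₄ α β = 0 then
    C (r₁ α β) * (X 1 * (C (Complex.exp α) * X 0 - C (Complex.exp β) * X 2))
      + C (r₂ α β * (Complex.exp α + Complex.exp β)) * (X 0 - X 2)
  else E.mPlusCombination r₁ r₂ r₄ α β

/-- The `M₋` polynomial `x - y`. -/
def mMinus : TriFamily := fun _ _ => X 0 - X 2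

/-- The antisymmetric factor `κ` normalizing the dual `M₋` polynomial (not used for H1). -/
def kappa : ABS → ℂ → ℂ → ℂ
  | Q3 _, α, β => Complex.sinh (α - β)
  | A2, α, β => Complex.sinh (α - β)
  | Q4 k, α, β => jacobiSn k (α - β)
  | H3 _, α, β => Complex.exp α - Complex.exp β
  | _, α, β => α - β

open Classical in
/-- The dual `M₋` polynomial `(- S - T x) / κ`. For H3(0) this quotient equals `- x (u + v)`, and the
factor `x` is removed. -/
def dualMMinus (E : ABS) : TriFamily := fun α β =>
  if E = H3 0 then -(X 0 + X 2)
  else C (E.kappa α β)⁻¹ * (-E.coeffS α β - E.coeffT α β * X 1)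

/-- The equations to which the `M₋` case applies: all but Q1(0), A1(0) and H1. -/
def HasMMinus (E : ABS) : Prop := E ≠ Q1 0 ∧ E ≠ A1 0 ∧ E ≠ H1

/-! ### The singular case -/

/-- The equations with a singular case: Q3(0), Q1(δ), A2, A1(δ), H3(δ) with `δ ≠ 0`, and H2. -/
def HasSingular : ABS → Prop
  | Q1 _ => True
  | Q3 δ => δ = 0
  | H2 => True
  | H3 δ => δ ≠ 0
  | A1 _ => True
  | A2 => True
  | _ => False

/-- The change of lattice parameter used in the singular case: `± α = a ^ 2` for Q1(δ) and A1(δ),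
`exp (± α) = cosh a` for Q3(0) and A2, and no change for H2 and H3(δ). -/
def Uniformizes : ABS → ℂ → ℂ → ℂ → Prop
  | Q1 _, ε, α, a => ε * α = a ^ 2
  | A1 _, ε, α, a => ε * α = a ^ 2
  | Q3 _, ε, α, a => Complex.exp (ε * α) = Complex.cosh a
  | A2, ε, α, a => Complex.exp (ε * α) = Complex.cosh a
  | _, _, α, a => α = a

/-- `𝔮₀(x, u, y; a, b)`. -/
def q₀ : ABS → ℂ → ℂ → TriPoly
  | Q1 δ, a, b =>
      C (a + b) * (X 0 * X 2) - (C a * X 1 - C (δ * a * b ^ 2)) * X 0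
        - (C b * X 1 - C (δ * a ^ 2 * b)) * X 2
  | A1 δ, a, b =>
      C (a + b) * (X 0 * X 2) + C a * (X 1 + C (δ * b ^ 2)) * X 0
        + C b * (X 1 + C (δ * a ^ 2)) * X 2
  | Q3 _, a, b =>
      C (Complex.sinh a + Complex.sinh b) * (X 0 * X 2)
        - C (Complex.sinh a * Complex.cosh b) * (X 1 * X 0)
        - C (Complex.cosh a * Complex.sinh b) * (X 1 * X 2)
  | A2, a, b =>
      C (Complex.sinh a + Complex.sinh b) * (X 1 * X 0 * X 2)
        - C (Complex.sinh a * Complex.cosh b) * X 0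
        - C (Complex.cosh a * Complex.sinh b) * X 2
  | H2, a, b => C 2 * (X 0 * X 2) + X 1 * (X 0 + X 2) + C b * X 0 + C a * X 2
  | H3 δ, a, b =>
      C 2 * (X 1 * X 0 * X 2) + C δ * (C (Complex.exp b) * X 0 + C (Complex.exp a) * X 2)
  | _, _, _ => 0

/-- `𝔮₁(x, u, y; a, b)`. -/
def q₁ : ABS → ℂ → ℂ → TriPoly
  | Q1 δ, a, b => C b * X 0 + C a * X 2 + C (a + b) * (C (δ * a * b) - X 1)
  | A1 δ, a, b => C b * X 0 + C a * X 2 + C (a + b) * (X 1 + C (δ * a * b))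
  | Q3 _, a, b =>
      C (Complex.sinh b) * X 0 + C (Complex.sinh a) * X 2 - C (Complex.sinh (a + b)) * X 1
  | A2, a, b =>
      C (Complex.sinh b) * (X 1 * X 0) + C (Complex.sinh a) * (X 1 * X 2)
        - C (Complex.sinh (a + b))
  | H2, a, b => X 0 + X 2 + C (a + b) + C 2 * X 1
  | H3 δ, a, b => X 1 * (X 0 + X 2) + C (δ * (Complex.exp a + Complex.exp b))
  | _, _, _ => 0

/-- `𝔭₀(u, x, v; a, b)`. -/
def p₀ : ABS → ℂ → ℂ → TriPoly
  | Q1 δ, a, b =>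
      -(C (a - b) * (X 0 * X 2)) + C a * (X 1 * X 0) - C b * (X 1 * X 2)
        + C (δ * a * b * (a - b)) * (C (δ * a * b) + X 1)
  | A1 δ, a, b =>
      C (a - b) * (X 0 * X 2) + C a * (X 1 * X 0) - C b * (X 1 * X 2)
        - C (δ * a * b * (a - b)) * (X 1 + C (δ * a * b))
  | Q3 _, a, b =>
      C (Complex.sinh a + Complex.sinh b) *
        (-(C (Complex.sinh a - Complex.sinh b) * (X 0 * X 2))
          + C (Complex.sinh a * Complex.cosh b) * (X 1 * X 0)
          - C (Complex.cosh a * Complex.sinh b) * (X 1 * X 2))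
  | A2, a, b =>
      C (Complex.sinh a + Complex.sinh b) *
        (-(C (Complex.cosh a * Complex.sinh b) * (X 1 * X 0))
          + C (Complex.sinh a * Complex.cosh b) * (X 1 * X 2)
          - C (Complex.sinh a - Complex.sinh b))
  | H2, a, b =>
      -(C (a - b) * (X 0 + X 2)) + C 2 * (X 1 * (X 0 - X 2)) - C (a - b) * (C (a + b) + C 2 * X 1)
  | H3 δ, a, b =>
      C 2 * (X 1 * (C (Complex.exp a) * X 0 - C (Complex.exp b) * X 2))
        + C (δ * (Complex.exp (2 * a) - Complex.exp (2 * b)))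
  | _, _, _ => 0

/-- `𝔭₁(u, x, v; a, b)`. -/
def p₁ : ABS → ℂ → ℂ → TriPoly
  | Q1 δ, a, b => C b * X 0 - C a * X 2 + C (a - b) * (C (δ * a * b) + X 1)
  | A1 δ, a, b => C b * X 0 - C a * X 2 - C (a - b) * (X 1 + C (δ * a * b))
  | Q3 _, a, b =>
      C (Complex.sinh (a + b)) *
        (C (Complex.sinh b) * X 0 - C (Complex.sinh a) * X 2 + C (Complex.sinh (a - b)) * X 1)
  | A2, a, b =>
      C (Complex.sinh (a + b)) *
        (C (Complex.sinh (a - b)) * (X 1 * X 0 * X 2) - C (Complex.sinh a) * X 0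
          + C (Complex.sinh b) * X 2)
  | H2, _, _ => C 2 * (X 0 - X 2)
  | H3 _, a, b => C (Complex.exp a + Complex.exp b) * (X 0 - X 2)
  | _, _, _ => 0

/-- `c₀ 𝔮₀ + c₁ 𝔮₁`, with the parameters `a = a(α, β)` and `b = a(β, α)`. -/
def singularQ (E : ABS) (a c₀ c₁ : ℂ → ℂ → ℂ) : TriFamily := fun α β =>
  C (c₀ α β) * E.q₀ (a α β) (a β α) + C (c₁ α β) * E.q₁ (a α β) (a β α)

/-- `c₀ 𝔭₀ + c₁ 𝔭₁`, with the parameters `a = a(α, β)` and `b = a(β, α)`. -/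
def singularP (E : ABS) (a c₀ c₁ : ℂ → ℂ → ℂ) : TriFamily := fun α β =>
  C (c₀ α β) * E.p₀ (a α β) (a β α) + C (c₁ α β) * E.p₁ (a α β) (a β α)

/-! ### The three categories, for a pair `(q, p)` at the parameter values `α, β` -/

/-- `(q, p)` is an `M₊` / dual `M₊` pair. -/
def IsMPlusPairAt (E : ABS) (α β : ℂ) (q p : TriFamily) : Prop :=
  ∃ r₁ r₂ r₄ : ℂ → ℂ → ℂ,
    r₁ α β = r₁ β α ∧ r₂ α β = r₂ β α ∧ r₄ α β = r₄ β α ∧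
    r₁ α β * r₄ α β - r₂ α β ^ 2 ≠ 0 ∧
    ParamEquivAt α β q (mPlus r₁ r₂ r₄) ∧ ParamEquivAt α β p (E.dualMPlus r₁ r₂ r₄)

/-- `(q, p)` is an `M₋` / dual `M₋` pair. -/
def IsMMinusPairAt (E : ABS) (α β : ℂ) (q p : TriFamily) : Prop :=
  ParamEquivAt α β q mMinus ∧ ParamEquivAt α β p E.dualMMinus

/-- `(q, p)` is a pair of the singular case. -/
def IsSingularPairAt (E : ABS) (α β : ℂ) (q p : TriFamily) : Prop :=
  ∃ (ε : ℂ) (a c₀ c₁ : ℂ → ℂ → ℂ), (ε = 1 ∨ ε = -1) ∧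
    E.Uniformizes ε α (a α β) ∧ E.Uniformizes ε β (a β α) ∧
    c₀ α β = c₀ β α ∧ c₁ α β = c₁ β α ∧ (c₀ α β ≠ 0 ∨ c₁ α β ≠ 0) ∧
    ParamEquivAt α β q (E.singularQ a c₀ c₁) ∧ ParamEquivAt α β p (E.singularP a c₀ c₁)

end ABS

end

/-!
The polynomials of the list are all of the form
`e x u v y + a (x u + v y) + b (x v + u y) + c (x y + u v) + f (x + u + v + y) + g`,
which is invariant under the Klein four-group of permutations of the vertices; exchanging the
parameters exchanges `a` and `b` up to a common sign. Two biquadratics control everything: the edge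
biquadratic `Q Q_{vy} - Q_v Q_y` in `x, u`, and the diagonal one `Q Q_{uv} - Q_u Q_v` in `x, y`.

*Duality is an involution.* If elimination of `y` from `Q` and `q` gives `χ(x, u) p(u, x, v)`, then
elimination from `Q` and `p` gives `χ'(u, x) q`, and `χ χ'` is minus the edge biquadratic
(`KleinQuad.Elim.symm`). The parity of `q` and `p` turns duality at `(β, α)` into a second such
identity at `(α, β)`, with `u` and `v` exchanged and with its own factor (`DualPair`). Degrees in
the middle variable are bounded through `χ` (`KleinQuad.Elim.degree_le`).

*Classification.* The factor `χ` is a factor of the edge biquadratic, and its possible values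
decide.
* If the edge biquadratic is irreducible of degree two in each variable (Q2, Q3(`δ ≠ 0`), Q4), then
  `χ` or `χ'` is constant and one of `q`, `p` does not involve its middle argument
  (`DualPair.isMiddleFree_of_irreducible`).
* If it splits into two factors of degree one in each variable (Q1, A1, Q3(0), A2), there is also
  the case where `χ` is one of them, at `(α, β)` and at `(β, α)`. Eliminating `p` from the two
  identities leaves linear equations for the coefficients of `q`; their solvability fixes the square
  of the ratio `σ` of the two factors, and the choice of `σ` is the choice of the parameters `a`,
  `b` of the singular case (`coeffs_of_linear_factor`).
* For H1, H2 and H3 the edge biquadratic is constant, irreducible of lower degree, or a monomial,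
  and comparing the two identities coefficient by coefficient leaves either a polynomial free of its
  middle argument or the singular case (`ABS.isMiddleFree_H1`, `ABS.singular_of_elim_const_H2`,
  `flat_comparison`, `DualPair.isMiddleFree_bilinear`).

A polynomial free of its middle argument is Möbius, `r₁ x y + r₂ x + r₃ y + r₄`. It and its reversal
have the same dual, hence are proportional, which leaves the kinds `M₊` and `M₋`
(`DualPair.moebius`). The dual being unique up to a constant (`DualPair.unique`), the partner is the
displayed one.

*Existence.* A polynomial affine in its two boundary arguments is irreducible once it vanishes
identically for no value of the middle argument and its determinant in the boundary arguments is not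
identically zero (`IsBiaffine.irreducible`). The elimination identities are then direct
computations. Nondegeneracy comes for free in part: a linear combination of `Q|_{v = 0}` and `Q_v`
has no dual (`KleinQuad.Elim.not_combination`), and a polynomial that involves its middle argument
does not divide the diagonal biquadratic (`not_dvd_diag_of_middle`). For Q4 the determinants are
shown to be nonzero by the addition theorem of `sn`, which follows from the differential equations
(`IsJacobiElliptic.relation`).
-/

noncomputable section

/-! ### Polynomials of degree one in a variable -/

theorem eval_eq_of_degreeOf_eq_zero {σ : Type*} [Fintype σ] {i : σ} {p : MvPolynomial σ ℂ}
    (h : degreeOf i p = 0) {w z : σ → ℂ} (hwz : ∀ j, j ≠ i → w j = z j) :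
    eval w p = eval z p := by
  rw [eval_eq', eval_eq']
  refine Finset.sum_congr rfl fun m hm => ?_
  congr 1
  refine Finset.prod_congr rfl fun j _ => ?_
  by_cases hj : j = i
  · have := monomial_le_degreeOf i hm
    rw [h, Nat.le_zero, ← hj] at this
    simp [this]
  · rw [hwz j hj]

theorem eval_affine {σ : Type*} [Fintype σ] {i : σ} {p : MvPolynomial σ ℂ}
    (h : degreeOf i p ≤ 1) {w w₀ w₁ : σ → ℂ} (h₀ : w₀ i = 0) (h₁ : w₁ i = 1)
    (hw₀ : ∀ j, j ≠ i → w₀ j = w j) (hw₁ : ∀ j, j ≠ i → w₁ j = w j) :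
    eval w p = eval w₀ p + w i * (eval w₁ p - eval w₀ p) := by
  classical
  simp only [eval_eq', ← Finset.sum_sub_distrib, Finset.mul_sum, ← Finset.sum_add_distrib]
  refine Finset.sum_congr rfl fun m hm => ?_
  have key : ∀ v : σ → ℂ, (∀ j, j ≠ i → v j = w j) →
      ∏ j, v j ^ m j = v i ^ m i * ∏ j ∈ Finset.univ.erase i, w j ^ m j := by
    intro v hv
    rw [← Finset.mul_prod_erase _ _ (Finset.mem_univ i)]
    congr 1
    exact Finset.prod_congr rfl fun j hj => by rw [hv j (Finset.ne_of_mem_erase hj)]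
  rw [key w fun _ _ => rfl, key w₀ hw₀, key w₁ hw₁, h₀, h₁]
  have hm1 := (monomial_le_degreeOf i hm).trans h
  interval_cases m i <;> (simp; try ring)

theorem natDegree_aeval_le_degreeOf {σ : Type*} [Fintype σ] (i : σ) (p : MvPolynomial σ ℂ)
    (w : σ → Polynomial ℂ) (hi : w i = Polynomial.X) (hw : ∀ j, j ≠ i → (w j).natDegree = 0) :
    (aeval w p).natDegree ≤ degreeOf i p := by
  classical
  rw [aeval_eq_eval₂Hom, coe_eval₂Hom, eval₂_eq']
  refine Polynomial.natDegree_sum_le_of_forall_le _ _ fun m hm => ?_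
  refine (Polynomial.natDegree_C_mul_le _ _).trans ?_
  refine (Polynomial.natDegree_prod_le _ _).trans ?_
  rw [← Finset.add_sum_erase _ _ (Finset.mem_univ i), Finset.sum_eq_zero, add_zero, hi]
  · simpa using monomial_le_degreeOf i hm
  · intro j hj
    have := Polynomial.natDegree_pow_le (p := w j) (n := m j)
    rw [hw j (Finset.ne_of_mem_erase hj)] at this
    omega

theorem eval_fin_three_first {q : TriPoly} (h : degreeOf 0 q ≤ 1) (x u y : ℂ) :
    eval ![x, u, y] q = eval ![0, u, y] q + x * (eval ![1, u, y] q - eval ![0, u, y] q) :=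
  eval_affine h (i := 0) rfl rfl (by intro j hj; fin_cases j <;> simp_all)
    (by intro j hj; fin_cases j <;> simp_all)

theorem eval_fin_three_last {q : TriPoly} (h : degreeOf 2 q ≤ 1) (x u y : ℂ) :
    eval ![x, u, y] q = eval ![x, u, 0] q + y * (eval ![x, u, 1] q - eval ![x, u, 0] q) :=
  eval_affine h (i := 2) rfl rfl (by intro j hj; fin_cases j <;> simp_all)
    (by intro j hj; fin_cases j <;> simp_all)

/-- Two polynomials in three variables with the same values are equal. -/
theorem tri_ext {p q : TriPoly} (h : ∀ x u y, eval ![x, u, y] p = eval ![x, u, y] q) : p = q := by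
  refine MvPolynomial.funext fun w => ?_
  have : w = ![w 0, w 1, w 2] := by ext i; fin_cases i <;> rfl
  rw [this]; exact h _ _ _

/-- Two polynomials on the quadrilateral with the same values are equal. -/
theorem quad_ext {p q : QuadPoly} (h : ∀ x u v y, eval ![x, u, v, y] p = eval ![x, u, v, y] q) :
    p = q := by
  refine MvPolynomial.funext fun w => ?_
  have : w = ![w 0, w 1, w 2, w 3] := by ext i; fin_cases i <;> rfl
  rw [this]; exact h _ _ _ _

/-- The polynomial `a x y + b x + c y + d` whose coefficients are polynomials in the middle
argument. -/
def biaffine (a b c d : Polynomial ℂ) : TriPoly :=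
  Polynomial.aeval (X 1) a * (X 0 * X 2) + Polynomial.aeval (X 1) b * X 0
    + Polynomial.aeval (X 1) c * X 2 + Polynomial.aeval (X 1) d

theorem eval_polynomial_aeval {σ : Type*} (w : σ → ℂ) (i : σ) (a : Polynomial ℂ) :
    eval w (Polynomial.aeval (X i : MvPolynomial σ ℂ) a) = a.eval (w i) := by
  have h : (eval w).comp (algebraMap ℂ (MvPolynomial σ ℂ)) = RingHom.id ℂ :=
    RingHom.ext fun t => by simp [algebraMap_eq]
  rw [Polynomial.aeval_def, Polynomial.hom_eval₂, eval_X, h]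
  simp [Polynomial.eval₂_eq_eval_map]

@[simp] theorem eval_biaffine (a b c d : Polynomial ℂ) (x u y : ℂ) :
    eval ![x, u, y] (biaffine a b c d)
      = a.eval u * (x * y) + b.eval u * x + c.eval u * y + d.eval u := by
  simp [biaffine, eval_polynomial_aeval]

theorem degreeOf_polynomial_aeval_of_ne {σ : Type*} {i j : σ} (h : i ≠ j) (a : Polynomial ℂ) :
    degreeOf i (Polynomial.aeval (X j : MvPolynomial σ ℂ) a) = 0 := by
  classical
  rw [Polynomial.aeval_eq_sum_range, ← Nat.le_zero]
  refine (degreeOf_sum_le _ _ _).trans (Finset.sup_le fun k _ => ?_)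
  rw [MvPolynomial.smul_eq_C_mul]
  refine (degreeOf_C_mul_le _ _ _).trans ((degreeOf_pow_le _ _ _).trans ?_)
  simp [degreeOf_X, h]

theorem degreeOf_polynomial_aeval_le {σ : Type*} (i : σ) (a : Polynomial ℂ) :
    degreeOf i (Polynomial.aeval (X i : MvPolynomial σ ℂ) a) ≤ a.natDegree := by
  classical
  rw [Polynomial.aeval_eq_sum_range]
  refine (degreeOf_sum_le _ _ _).trans (Finset.sup_le fun k hk => ?_)
  rw [MvPolynomial.smul_eq_C_mul]
  refine (degreeOf_C_mul_le _ _ _).trans ?_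
  rw [degreeOf_X_self_pow]
  exact Nat.lt_succ_iff.mp (Finset.mem_range.mp hk)

/-- A polynomial of degree at most one in its boundary arguments is biaffine; the degrees of its
coefficients are bounded by the degree in the middle argument. -/
theorem exists_eq_biaffine {q : TriPoly} (h₀ : degreeOf 0 q ≤ 1) (h₂ : degreeOf 2 q ≤ 1) :
    ∃ a b c d : Polynomial ℂ, q = biaffine a b c d ∧ a.natDegree ≤ degreeOf 1 q ∧
      b.natDegree ≤ degreeOf 1 q ∧ c.natDegree ≤ degreeOf 1 q ∧ d.natDegree ≤ degreeOf 1 q := by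
  let r : ℂ → ℂ → Polynomial ℂ := fun s t =>
    aeval ![Polynomial.C s, Polynomial.X, Polynomial.C t] q
  have hr : ∀ s t u, (r s t).eval u = eval ![s, u, t] q := by
    intro s t u
    have h := MvPolynomial.comp_aeval_apply (Polynomial.aeval u : Polynomial ℂ →ₐ[ℂ] ℂ)
      (f := ![Polynomial.C s, Polynomial.X, Polynomial.C t]) q
    rw [Polynomial.coe_aeval_eq_eval] at h
    rw [h, ← MvPolynomial.coe_aeval_eq_eval, RingHom.coe_coe]
    congr 2
    ext i; fin_cases i <;> simp
  have hd : ∀ s t, (r s t).natDegree ≤ degreeOf 1 q := fun s t =>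
    natDegree_aeval_le_degreeOf 1 q _ rfl (by intro j hj; fin_cases j <;> simp_all)
  have hsub : ∀ {p₁ p₂ : Polynomial ℂ}, p₁.natDegree ≤ degreeOf 1 q → p₂.natDegree ≤ degreeOf 1 q →
      (p₁ - p₂).natDegree ≤ degreeOf 1 q := fun h₁ h₂ =>
    (Polynomial.natDegree_sub_le _ _).trans (max_le h₁ h₂)
  refine ⟨r 1 1 - r 1 0 - (r 0 1 - r 0 0), r 1 0 - r 0 0, r 0 1 - r 0 0, r 0 0, ?_,
    hsub (hsub (hd _ _) (hd _ _)) (hsub (hd _ _) (hd _ _)), hsub (hd _ _) (hd _ _),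
    hsub (hd _ _) (hd _ _), hd _ _⟩
  refine tri_ext fun x u y => ?_
  rw [eval_biaffine, eval_fin_three_first h₀, eval_fin_three_last h₂ 0, eval_fin_three_last h₂ 1]
  simp only [Polynomial.eval_sub, hr]
  ring

/-- A polynomial whose values are affine in one variable has degree at most one in it. -/
theorem degreeOf_le_one_of_eval {σ : Type*} [Fintype σ] [DecidableEq σ] {i : σ}
    {q : MvPolynomial σ ℂ}
    (h : ∀ w : σ → ℂ, eval w q = eval (Function.update w i 0) q
      + w i * (eval (Function.update w i 1) q - eval (Function.update w i 0) q)) :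
    degreeOf i q ≤ 1 := by
  let r : ℂ → MvPolynomial σ ℂ := fun s => aeval (Function.update X i (C s)) q
  have hev : ∀ s w, eval w (r s) = eval (Function.update w i s) q := by
    intro s w
    simp only [r]
    rw [← MvPolynomial.coe_aeval_eq_eval, RingHom.coe_coe, MvPolynomial.comp_aeval_apply,
      ← MvPolynomial.coe_aeval_eq_eval, RingHom.coe_coe]
    congr 2
    ext j
    by_cases hj : j = i
    · subst hj; simp
    · simp [hj]
  have hdeg : ∀ s : ℂ, degreeOf i (r s) = 0 := by
    intro s
    simp only [r]
    rw [aeval_eq_eval₂Hom, coe_eval₂Hom, eval₂_eq', ← Nat.le_zero]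
    refine (degreeOf_sum_le _ _ _).trans (Finset.sup_le fun m _ => ?_)
    refine (degreeOf_C_mul_le _ _ _).trans ((degreeOf_prod_le _ _ _).trans ?_)
    rw [Nat.le_zero]
    refine Finset.sum_eq_zero fun j _ => ?_
    rw [← Nat.le_zero]
    refine (degreeOf_pow_le _ _ _).trans ?_
    by_cases hj : j = i
    · subst hj; simp
    · simp [hj, degreeOf_X, Ne.symm hj]
  have hq : q = r 0 + X i * (r 1 - r 0) := by
    refine MvPolynomial.funext fun w => ?_
    rw [map_add, map_mul, map_sub, hev, hev, eval_X]
    exact h w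
  rw [hq]
  refine (degreeOf_add_le _ _ _).trans (max_le ((hdeg 0).le.trans zero_le_one) ?_)
  refine (degreeOf_mul_le _ _ _).trans ?_
  rw [degreeOf_X_self, sub_eq_add_neg]
  have := degreeOf_add_le i (r 1) (-r 0)
  rw [degreeOf_neg, hdeg, hdeg] at this
  omega

/-- The values of `q` are affine in the first and in the last argument. -/
def IsBiaffine (q : TriPoly) : Prop :=
  (∀ x u y, eval ![x, u, y] q = eval ![0, u, y] q + x * (eval ![1, u, y] q - eval ![0, u, y] q)) ∧
  (∀ x u y, eval ![x, u, y] q = eval ![x, u, 0] q + y * (eval ![x, u, 1] q - eval ![x, u, 0] q))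

theorem IsBiaffine.degreeOf_first {q : TriPoly} (h : IsBiaffine q) : degreeOf 0 q ≤ 1 := by
  refine degreeOf_le_one_of_eval fun w => ?_
  have e : ∀ s, Function.update w 0 s = ![s, w 1, w 2] := by
    intro s; ext j; fin_cases j <;> simp
  have e' : w = ![w 0, w 1, w 2] := by ext j; fin_cases j <;> simp
  rw [e, e]; nth_rw 1 [e']; exact h.1 _ _ _

theorem IsBiaffine.degreeOf_last {q : TriPoly} (h : IsBiaffine q) : degreeOf 2 q ≤ 1 := by
  refine degreeOf_le_one_of_eval fun w => ?_
  have e : ∀ s, Function.update w 2 s = ![w 0, w 1, s] := by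
    intro s; ext j; fin_cases j <;> simp
  have e' : w = ![w 0, w 1, w 2] := by ext j; fin_cases j <;> simp
  rw [e, e]; nth_rw 1 [e']; exact h.2 _ _ _

theorem isBiaffine_of_degreeOf {q : TriPoly} (h₀ : degreeOf 0 q ≤ 1) (h₂ : degreeOf 2 q ≤ 1) :
    IsBiaffine q :=
  ⟨eval_fin_three_first h₀, eval_fin_three_last h₂⟩

/-- A nonunit in the middle variable alone has a root, so dividing by it forces `q` to vanish on a
plane `u = t`. -/
theorem exists_root_of_not_isUnit {p : TriPoly} (h : ¬ IsUnit p) (hp : p ≠ 0)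
    (h₀ : degreeOf 0 p = 0) (h₂ : degreeOf 2 p = 0) : ∃ t, ∀ x y, eval ![x, t, y] p = 0 := by
  obtain ⟨a, b, c, d, rfl, -⟩ := exists_eq_biaffine (q := p) (by omega) (by omega)
  have h1 : ∀ x u y, eval ![x, u, y] (biaffine a b c d) = d.eval u := by
    intro x u y
    rw [eval_eq_of_degreeOf_eq_zero h₀ (z := ![0, u, y]) (by intro j hj; fin_cases j <;> simp_all),
      eval_eq_of_degreeOf_eq_zero h₂ (z := ![0, u, 0]) (by intro j hj; fin_cases j <;> simp_all)]
    simp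
  have hpd : biaffine a b c d = Polynomial.aeval (X 1) d :=
    tri_ext fun x u y => by rw [h1, eval_polynomial_aeval]; rfl
  have hd : d.degree ≠ 0 := by
    intro hd
    rw [hpd, Polynomial.eq_C_of_degree_eq_zero hd, Polynomial.aeval_C] at h hp
    exact h ((isUnit_iff_ne_zero.mpr fun h0 => hp (by rw [h0, map_zero])).map _)
  obtain ⟨t, ht⟩ := IsAlgClosed.exists_root d hd
  exact ⟨t, fun x y => by rw [h1]; exact ht⟩

/-- Irreducibility of a polynomial affine in its boundary arguments: it suffices that it does not
vanish identically for any value of the middle argument, and that its values, as functions of the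
two boundary arguments, do not factorize for some value of the middle argument. -/
theorem IsBiaffine.irreducible {q : TriPoly} (h : IsBiaffine q)
    (hc : ∀ t, ∃ x y, eval ![x, t, y] q ≠ 0)
    (hΔ : ∃ t, eval ![0, t, 0] q * eval ![1, t, 1] q - eval ![1, t, 0] q * eval ![0, t, 1] q ≠ 0) :
    Irreducible q := by
  have hq : q ≠ 0 := by rintro rfl; obtain ⟨t, ht⟩ := hΔ; simp at ht
  have indep : ∀ {r : TriPoly} {x u y : ℂ} (s : ℂ), degreeOf 0 r = 0 →
      eval ![x, u, y] r = eval ![s, u, y] r := fun s hr =>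
    eval_eq_of_degreeOf_eq_zero hr (by intro j hj; fin_cases j <;> simp_all)
  have indep' : ∀ {r : TriPoly} {x u y : ℂ} (s : ℂ), degreeOf 2 r = 0 →
      eval ![x, u, y] r = eval ![x, u, s] r := fun s hr =>
    eval_eq_of_degreeOf_eq_zero hr (by intro j hj; fin_cases j <;> simp_all)
  refine ⟨?_, ?_⟩
  · intro hu
    obtain ⟨r, -, hr⟩ := MvPolynomial.isUnit_iff_eq_C_of_isReduced.mp hu
    obtain ⟨t, ht⟩ := hΔ
    rw [hr] at ht; simp at ht
  · intro p₁ p₂ hp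
    have hp1 : p₁ ≠ 0 := by rintro rfl; simp at hp; exact hq hp
    have hp2 : p₂ ≠ 0 := by rintro rfl; simp at hp; exact hq hp
    have e₀ := h.degreeOf_first
    have e₂ := h.degreeOf_last
    rw [hp, degreeOf_mul_eq hp1 hp2] at e₀ e₂
    have hev : ∀ x u y, eval ![x, u, y] q = eval ![x, u, y] p₁ * eval ![x, u, y] p₂ := by
      intro x u y; rw [hp, map_mul]
    have unit : ∀ {p₁ p₂ : TriPoly}, q = p₁ * p₂ → p₁ ≠ 0 → degreeOf 0 p₁ = 0 →
        degreeOf 2 p₁ = 0 → IsUnit p₁ := by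
      intro p₁ p₂ hp hp1 h0 h2
      by_contra hu
      obtain ⟨t, ht⟩ := exists_root_of_not_isUnit hu hp1 h0 h2
      obtain ⟨x, y, hxy⟩ := hc t
      exact hxy (by rw [hp, map_mul, ht, zero_mul])
    obtain ⟨t, ht⟩ := hΔ
    rcases Nat.eq_zero_or_pos (degreeOf 0 p₁) with h01 | h01 <;>
      rcases Nat.eq_zero_or_pos (degreeOf 2 p₁) with h21 | h21
    · exact .inl (unit hp hp1 h01 h21)
    · exfalso; apply ht
      have h22 : degreeOf 2 p₂ = 0 := by omega
      rw [hev, hev, hev, hev, indep (r := p₁) (x := 1) (y := 1) 0 h01,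
        indep (r := p₁) (x := 1) (y := 0) 0 h01, indep' (r := p₂) (x := 1) (y := 1) 0 h22,
        indep' (r := p₂) (x := 0) (y := 1) 0 h22]
      ring
    · exfalso; apply ht
      have h02 : degreeOf 0 p₂ = 0 := by omega
      rw [hev, hev, hev, hev, indep (r := p₂) (x := 1) (y := 1) 0 h02,
        indep (r := p₂) (x := 1) (y := 0) 0 h02, indep' (r := p₁) (x := 1) (y := 1) 0 h21,
        indep' (r := p₁) (x := 0) (y := 1) 0 h21]
      ring
    · exact .inr (unit (hp.trans (mul_comm _ _)) hp2 (by omega) (by omega))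

theorem IsBiaffine.degreeOf_first_eq_one {q : TriPoly} (h : IsBiaffine q)
    (hΔ : ∃ t, eval ![0, t, 0] q * eval ![1, t, 1] q - eval ![1, t, 0] q * eval ![0, t, 1] q ≠ 0) :
    degreeOf 0 q = 1 := by
  refine le_antisymm h.degreeOf_first (Nat.one_le_iff_ne_zero.mpr fun h0 => ?_)
  obtain ⟨t, ht⟩ := hΔ
  apply ht
  have : ∀ y, eval ![1, t, y] q = eval ![0, t, y] q := fun y =>
    eval_eq_of_degreeOf_eq_zero h0 (by intro j hj; fin_cases j <;> simp_all)
  rw [this, this]; ring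

theorem IsBiaffine.degreeOf_last_eq_one {q : TriPoly} (h : IsBiaffine q)
    (hΔ : ∃ t, eval ![0, t, 0] q * eval ![1, t, 1] q - eval ![1, t, 0] q * eval ![0, t, 1] q ≠ 0) :
    degreeOf 2 q = 1 := by
  refine le_antisymm h.degreeOf_last (Nat.one_le_iff_ne_zero.mpr fun h0 => ?_)
  obtain ⟨t, ht⟩ := hΔ
  apply ht
  have : ∀ x, eval ![x, t, 1] q = eval ![x, t, 0] q := fun x =>
    eval_eq_of_degreeOf_eq_zero h0 (by intro j hj; fin_cases j <;> simp_all)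
  rw [this, this]; ring

/-- An irreducible polynomial of positive degree in the first argument does not vanish identically
for any value of the middle argument. -/
theorem exists_eval_ne_zero_of_irreducible {q : TriPoly} (hq : Irreducible q)
    (h₀ : degreeOf 0 q ≠ 0) (h₀' : degreeOf 0 q ≤ 1) (h₂ : degreeOf 2 q ≤ 1) (t : ℂ) :
    ∃ x y, eval ![x, t, y] q ≠ 0 := by
  by_contra! hc
  obtain ⟨a, b, c, d, rfl, -⟩ := exists_eq_biaffine h₀' h₂
  simp only [eval_biaffine] at hc
  have hd : d.eval t = 0 := by simpa using hc 0 0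
  have hb : b.eval t = 0 := by simpa [hd] using hc 1 0
  have hcc : c.eval t = 0 := by simpa [hd] using hc 0 1
  have ha : a.eval t = 0 := by simpa [hd, hb, hcc] using hc 1 1
  obtain ⟨a', rfl⟩ := Polynomial.dvd_iff_isRoot.mpr ha
  obtain ⟨b', rfl⟩ := Polynomial.dvd_iff_isRoot.mpr hb
  obtain ⟨c', rfl⟩ := Polynomial.dvd_iff_isRoot.mpr hcc
  obtain ⟨d', rfl⟩ := Polynomial.dvd_iff_isRoot.mpr hd
  have hfac : biaffine ((Polynomial.X - Polynomial.C t) * a') ((Polynomial.X - Polynomial.C t) * b')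
      ((Polynomial.X - Polynomial.C t) * c') ((Polynomial.X - Polynomial.C t) * d')
      = (X 1 - C t) * biaffine a' b' c' d' := tri_ext fun x u y => by simp; ring
  rw [hfac] at hq h₀
  have hdeg : degreeOf 0 (X 1 - C t : TriPoly) = 0 := by
    rw [sub_eq_add_neg, ← Nat.le_zero]
    refine (degreeOf_add_le _ _ _).trans ?_
    simp [degreeOf_neg, degreeOf_X]
  rcases hq.isUnit_or_isUnit rfl with hu | hu
  · have := (hu.map (eval ![0, t, 0])).ne_zero
    simp at this
  · obtain ⟨r, -, hr⟩ := MvPolynomial.isUnit_iff_eq_C_of_isReduced.mp hu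
    rw [hr] at h₀
    have := degreeOf_mul_le 0 (X 1 - C t : TriPoly) (C r)
    rw [hdeg, degreeOf_C] at this
    omega

/-! ### Quadrilateral polynomials invariant under the Klein four-group -/

/-- The coefficients of `e x u v y + a (x u + v y) + b (x v + u y) + c (x y + u v)
+ f (x + u + v + y) + g`, a multi-affine polynomial invariant under the double transpositions of
the four variables. Every polynomial of the Adler-Bobenko-Suris list has this form. -/
structure KleinQuad where
  /-- coefficient of `x u v y` -/
  e : ℂ
  /-- coefficient of `x u + v y` -/
  a : ℂ
  /-- coefficient of `x v + u y` -/
  b : ℂ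
  /-- coefficient of `x y + u v` -/
  c : ℂ
  /-- coefficient of the linear part -/
  f : ℂ
  /-- constant term -/
  g : ℂ

namespace KleinQuad

/-- The polynomial with the given coefficients. -/
def poly (K : KleinQuad) : QuadPoly :=
  C K.e * (X 0 * X 1 * X 2 * X 3) + C K.a * (X 0 * X 1 + X 2 * X 3)
    + C K.b * (X 0 * X 2 + X 1 * X 3) + C K.c * (X 0 * X 3 + X 1 * X 2)
    + C K.f * (X 0 + X 1 + X 2 + X 3) + C K.g

/-- Exchange of the variables `u` and `v`. -/
def swap (K : KleinQuad) : KleinQuad := ⟨K.e, K.b, K.a, K.c, K.f, K.g⟩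

/-- The part `S` of `Q = S + T y`. -/
def S (K : KleinQuad) (x u v : ℂ) : ℂ :=
  K.a * (x * u) + K.b * (x * v) + K.c * (u * v) + K.f * (x + u + v) + K.g

/-- The part `T` of `Q = S + T y`. -/
def T (K : KleinQuad) (x u v : ℂ) : ℂ :=
  K.e * (x * u * v) + K.a * v + K.b * u + K.c * x + K.f

/-- The edge biquadratic `Q Q_{vy} - Q_v Q_y`, a polynomial in `x` and `u`. -/
def edge (K : KleinQuad) (x u : ℂ) : ℂ :=
  (K.e * (x * u) + K.a) * (K.a * (x * u) + K.f * (x + u) + K.g)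
    - (K.b * u + K.c * x + K.f) * (K.b * x + K.c * u + K.f)

/-- The diagonal biquadratic `Q Q_{uv} - Q_u Q_v`, a polynomial in `x` and `y`. -/
def diag (K : KleinQuad) (x y : ℂ) : ℂ :=
  (K.e * (x * y) + K.c) * (K.c * (x * y) + K.f * (x + y) + K.g)
    - (K.a * y + K.b * x + K.f) * (K.a * x + K.b * y + K.f)

theorem eval_poly (K : KleinQuad) (x u v y : ℂ) :
    eval ![x, u, v, y] K.poly = K.S x u v + K.T x u v * y := by
  simp [poly, S, T]; ring

/-- `edge` as a polynomial. -/
def edgePoly (K : KleinQuad) : MvPolynomial (Fin 2) ℂ :=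
  (C K.e * (X 0 * X 1) + C K.a) * (C K.a * (X 0 * X 1) + C K.f * (X 0 + X 1) + C K.g)
    - (C K.b * X 1 + C K.c * X 0 + C K.f) * (C K.b * X 0 + C K.c * X 1 + C K.f)

theorem eval_edgePoly (K : KleinQuad) (x u : ℂ) : eval ![x, u] K.edgePoly = K.edge x u := by
  simp [edgePoly, edge]

/-- Elimination of `y` from `Q(x, u, v, y)` and `q(x, u, y)` yields `p(u, x, v)` up to the factor
`χ(x, u)`. -/
def Elim (K : KleinQuad) (q p : TriPoly) (χ : MvPolynomial (Fin 2) ℂ) : Prop :=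
  ∀ x u v, K.S x u v * (eval ![x, u, 1] q - eval ![x, u, 0] q) - K.T x u v * eval ![x, u, 0] q
    = eval ![x, u] χ * eval ![u, x, v] p

end KleinQuad

/-- An irreducible polynomial of degree one in each of the two boundary arguments. -/
structure IsBoundary (q : TriPoly) : Prop where
  irreducible : Irreducible q
  first : degreeOf 0 q = 1
  last : degreeOf 2 q = 1

theorem IsBoundary.isBiaffine {q : TriPoly} (h : IsBoundary q) : IsBiaffine q :=
  isBiaffine_of_degreeOf h.first.le h.last.le

theorem IsBoundary.ne_zero {q : TriPoly} (h : IsBoundary q) : q ≠ 0 := h.irreducible.ne_zero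

theorem eval_rename_xu (χ : MvPolynomial (Fin 2) ℂ) (x u y : ℂ) :
    eval ![x, u, y] (rename ![0, 1] χ : TriPoly) = eval ![x, u] χ := by
  rw [eval_rename]; congr 2; ext i; fin_cases i <;> rfl

theorem eval_rename_ux (χ : MvPolynomial (Fin 2) ℂ) (x u y : ℂ) :
    eval ![u, x, y] (rename ![1, 0] χ : TriPoly) = eval ![x, u] χ := by
  rw [eval_rename]; congr 2; ext i; fin_cases i <;> rfl

theorem degreeOf_rename_eq_zero {σ τ : Type*} {g : σ → τ} {i : τ} (h : ∀ j, g j ≠ i)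
    (χ : MvPolynomial σ ℂ) : degreeOf i (rename g χ) = 0 := by
  classical
  by_contra h0
  have hm : i ∈ (rename g χ).vars := by
    rw [vars_def, Multiset.mem_toFinset, ← Multiset.count_pos, ← degreeOf_def]
    exact Nat.pos_of_ne_zero h0
  obtain ⟨j, -, hj⟩ := mem_vars_rename g χ hm
  exact h j hj

namespace KleinQuad

/-- Duality is symmetric. Differentiating `Q q_y - Q_y q = χ p` by `v` gives
`χ (Q p_v - Q_v p) = - q h` with the edge biquadratic `h`, and `χ`, which does not involve `y`, is
prime to the irreducible `q`. -/
theorem Elim.symm {K : KleinQuad} {q p : TriPoly} {χ : MvPolynomial (Fin 2) ℂ}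
    (h : K.Elim q p χ) (hq : IsBoundary q) (hp : IsBoundary p) (hK : ∃ x u, K.edge x u ≠ 0) :
    ∃ χ' : MvPolynomial (Fin 2) ℂ, K.Elim p q χ' ∧
      K.edgePoly = -(χ * rename ![1, 0] χ') := by
  obtain ⟨a, b, c, d, rfl, -⟩ := exists_eq_biaffine hp.first.le hp.last.le
  set P : TriPoly := (C K.a * (X 0 * X 1) + C K.b * (X 1 * X 2) + C K.c * (X 0 * X 2)
      + C K.f * (X 0 + X 1 + X 2) + C K.g)
      * (Polynomial.aeval (X 0) a * X 1 + Polynomial.aeval (X 0) c)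
    - (C K.e * (X 0 * X 1 * X 2) + C K.a * X 2 + C K.b * X 0 + C K.c * X 1 + C K.f)
      * (Polynomial.aeval (X 0) b * X 1 + Polynomial.aeval (X 0) d) with hP
  have key : rename ![0, 1] χ * P = -(rename ![0, 1] K.edgePoly * q) := by
    refine tri_ext fun x u y => ?_
    have h0 := h x u 0
    have h1 := h x u 1
    have hy := hq.isBiaffine.2 x u y
    simp only [hP, map_neg, map_mul, map_add, map_sub, eval_rename_xu, eval_edgePoly,
      eval_polynomial_aeval, eval_X, eval_C, Matrix.cons_val_zero, Matrix.cons_val_one,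
      Matrix.cons_val, eval_biaffine, edge, S, T] at h0 h1 ⊢
    rw [hy]
    linear_combination (-(K.a * (x * u) + K.b * (u * y) + K.c * (x * y)
        + K.f * (x + u + y) + K.g)) * (h1 - h0)
      + (K.e * (x * u * y) + K.a * y + K.b * x + K.c * u + K.f) * h0
  have hedge : (rename ![0, 1] K.edgePoly : TriPoly) ≠ 0 := by
    intro h0
    obtain ⟨x, u, hxu⟩ := hK
    apply hxu
    rw [← eval_edgePoly, ← eval_rename_xu _ x u 0, h0, map_zero]
  have hχ : (rename ![0, 1] χ : TriPoly) ≠ 0 := by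
    intro h0
    rw [h0, zero_mul, eq_comm, neg_eq_zero] at key
    exact (mul_ne_zero hedge hq.ne_zero) key
  have hdeg : ∀ χ : MvPolynomial (Fin 2) ℂ, degreeOf 2 (rename ![0, 1] χ : TriPoly) = 0 :=
    degreeOf_rename_eq_zero (by intro j; fin_cases j <;> decide)
  have hrel : IsRelPrime (rename ![0, 1] χ : TriPoly) q := by
    refine (hq.irreducible.isRelPrime_iff_not_dvd.mpr ?_).symm
    rintro ⟨w, hw⟩
    have hw0 : w ≠ 0 := by rintro rfl; exact hχ (by rw [hw, mul_zero])
    have := hdeg χ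
    rw [hw, degreeOf_mul_eq hq.ne_zero hw0, hq.last] at this
    omega
  obtain ⟨w, hw⟩ : (rename ![0, 1] χ : TriPoly) ∣ rename ![0, 1] K.edgePoly :=
    hrel.dvd_of_dvd_mul_right ((dvd_neg.mp ⟨P, key.symm⟩))
  have hw0 : w ≠ 0 := by rintro rfl; exact hedge (by rw [hw, mul_zero])
  have hwdeg : degreeOf 2 w = 0 := by
    have := hdeg K.edgePoly
    rw [hw, degreeOf_mul_eq hχ hw0] at this
    omega
  have hwev : ∀ x u y, eval ![x, u, y] w = eval ![x, u, 0] w := fun x u y =>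
    eval_eq_of_degreeOf_eq_zero hwdeg (by intro j hj; fin_cases j <;> simp_all)
  have hPw : P = -(w * q) := by
    apply mul_left_cancel₀ hχ
    rw [key, hw]; ring
  have hχ' : ∀ x u, eval ![u, x] (-(aeval ![X 1, X 0, 0] w : MvPolynomial (Fin 2) ℂ))
      = -eval ![x, u, 0] w := by
    intro x u
    rw [map_neg, ← MvPolynomial.coe_aeval_eq_eval, RingHom.coe_coe, MvPolynomial.comp_aeval_apply,
      ← MvPolynomial.coe_aeval_eq_eval, RingHom.coe_coe]
    congr 3
    ext i; fin_cases i <;> simp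
  refine ⟨-(aeval ![X 1, X 0, 0] w), ?_, ?_⟩
  · intro u x y
    have := congrArg (eval ![x, u, y]) hPw
    simp only [hP, map_neg, map_mul, map_add, map_sub,
      eval_polynomial_aeval, eval_X, eval_C, Matrix.cons_val_zero, Matrix.cons_val_one,
      Matrix.cons_val] at this
    rw [hχ', eval_biaffine, eval_biaffine, ← hwev x u y]
    simp only [S, T]
    linear_combination this
  · refine MvPolynomial.funext fun z => ?_
    have hz : z = ![z 0, z 1] := by ext i; fin_cases i <;> rfl
    have := congrArg (eval ![z 0, z 1, 0]) hw
    rw [map_mul, eval_rename_xu, eval_rename_xu] at this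
    have e2 : ∀ r : MvPolynomial (Fin 2) ℂ, eval ![z 0, z 1] (rename ![1, 0] r)
        = eval ![z 1, z 0] r := by
      intro r; rw [eval_rename]; congr 2; ext i; fin_cases i <;> rfl
    rw [hz, map_neg, map_mul, e2, hχ', this]; ring

end KleinQuad

/-! ### Degrees in an elimination -/

theorem degreeOf_add_le_of_le {σ : Type*} {i : σ} {p q : MvPolynomial σ ℂ} {n : ℕ}
    (hp : degreeOf i p ≤ n) (hq : degreeOf i q ≤ n) : degreeOf i (p + q) ≤ n :=
  (degreeOf_add_le _ _ _).trans (max_le hp hq)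

theorem degreeOf_sub_le_of_le {σ : Type*} {i : σ} {p q : MvPolynomial σ ℂ} {n : ℕ}
    (hp : degreeOf i p ≤ n) (hq : degreeOf i q ≤ n) : degreeOf i (p - q) ≤ n := by
  rw [sub_eq_add_neg]
  exact degreeOf_add_le_of_le hp (by rwa [degreeOf_neg])

theorem degreeOf_mul_le_of_le {σ : Type*} {i : σ} {p q : MvPolynomial σ ℂ} {m n : ℕ}
    (hp : degreeOf i p ≤ m) (hq : degreeOf i q ≤ n) : degreeOf i (p * q) ≤ m + n :=
  (degreeOf_mul_le _ _ _).trans (add_le_add hp hq)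

namespace KleinQuad

theorem Elim.eq_mul {K : KleinQuad} {a b c d : Polynomial ℂ} {p : TriPoly}
    {χ : MvPolynomial (Fin 2) ℂ} (h : K.Elim (biaffine a b c d) p χ) :
    (C K.a * (X 1 * X 0) + C K.b * (X 1 * X 2) + C K.c * (X 0 * X 2)
        + C K.f * (X 1 + X 0 + X 2) + C K.g)
        * (Polynomial.aeval (X 0) a * X 1 + Polynomial.aeval (X 0) c)
      - (C K.e * (X 1 * X 0 * X 2) + C K.a * X 2 + C K.b * X 0 + C K.c * X 1 + C K.f)
        * (Polynomial.aeval (X 0) b * X 1 + Polynomial.aeval (X 0) d)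
      = rename ![1, 0] χ * p := by
  refine tri_ext fun u x v => ?_
  have := h x u v
  simp only [map_mul, map_add, map_sub, eval_rename_ux,
      eval_polynomial_aeval, eval_X, eval_C, Matrix.cons_val_zero, Matrix.cons_val_one,
      Matrix.cons_val, eval_biaffine, S, T] at this ⊢
  linear_combination this

/-- If `χ = 0`, the elimination gives `edge x u * q x u y = 0` for all `y`. -/
theorem Elim.ne_zero {K : KleinQuad} {q p : TriPoly} {χ : MvPolynomial (Fin 2) ℂ}
    (h : K.Elim q p χ) (hq : IsBoundary q) (hK : ∃ x u, K.edge x u ≠ 0) : χ ≠ 0 := by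
  rintro rfl
  obtain ⟨x, u, hxu⟩ := hK
  have hv : ∀ x u, K.edge x u ≠ 0 → ∀ y, eval ![x, u, y] q = 0 := by
    intro x u hxu y
    have h0 := h x u 0
    have h1 := h x u 1
    rw [map_zero, zero_mul] at h0 h1
    have e0 : K.edge x u * eval ![x, u, 0] q = 0 := by
      simp only [edge, S, T] at h0 h1 ⊢
      linear_combination -(K.a * (x * u) + K.f * (x + u) + K.g) * (h1 - h0)
        + (K.b * x + K.c * u + K.f) * h0
    have e1 : K.edge x u * (eval ![x, u, 1] q - eval ![x, u, 0] q) = 0 := by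
      simp only [edge, S, T] at h0 h1 ⊢
      linear_combination (K.e * (x * u) + K.a) * h0
        - (K.b * u + K.c * x + K.f) * (h1 - h0)
    rw [hq.isBiaffine.2, (mul_eq_zero.mp e1).resolve_left hxu,
      (mul_eq_zero.mp e0).resolve_left hxu]
    ring
  have hprod : (rename ![0, 1] K.edgePoly : TriPoly) * q = 0 := by
    refine tri_ext fun x u y => ?_
    rw [map_mul, eval_rename_xu, eval_edgePoly, map_zero]
    by_cases h : K.edge x u = 0
    · rw [h, zero_mul]
    · rw [hv x u h, mul_zero]
  refine (mul_ne_zero ?_ hq.ne_zero) hprod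
  intro h0
  apply hxu
  rw [← eval_edgePoly, ← eval_rename_xu _ x u 0, h0, map_zero]

/-- The eliminant `χ(x, u) p(u, x, v)` has degree at most two in `x` and at most one more than `q`
in `u`, while `p(u, x, v)` has degree one in `u`. -/
theorem Elim.degree_le {K : KleinQuad} {q p : TriPoly} {χ : MvPolynomial (Fin 2) ℂ}
    (h : K.Elim q p χ) (hq : IsBoundary q) (hp : IsBoundary p) (hK : ∃ x u, K.edge x u ≠ 0) :
    degreeOf 0 χ + degreeOf 1 p ≤ 2 ∧ degreeOf 1 χ ≤ degreeOf 1 q := by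
  classical
  have hχ := h.ne_zero hq hK
  obtain ⟨a, b, c, d, hbi, ha, hb, hc, hd⟩ := exists_eq_biaffine hq.first.le hq.last.le
  generalize degreeOf 1 q = m at *
  subst hbi
  have hinj : Function.Injective (![1, 0] : Fin 2 → Fin 3) := by decide
  have hmul := h.eq_mul
  have hχ' : (rename ![1, 0] χ : TriPoly) ≠ 0 := fun h0 =>
    hχ (rename_injective _ hinj (by rw [h0, map_zero]))
  have e₀ : degreeOf 1 (rename ![1, 0] χ : TriPoly) = degreeOf 0 χ :=
    degreeOf_rename_of_injective hinj 0
  have e₁ : degreeOf 0 (rename ![1, 0] χ : TriPoly) = degreeOf 1 χ :=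
    degreeOf_rename_of_injective hinj 1
  have hne : ∀ (i j : Fin 3) (n : ℕ), i ≠ j → degreeOf i (X j : TriPoly) ≤ n := by
    intro i j n hij; simp [degreeOf_X, hij]
  have hX : ∀ i : Fin 3, degreeOf i (X i : TriPoly) ≤ 1 := by intro i; simp
  have hC : ∀ (i : Fin 3) (s : ℂ) (n : ℕ), degreeOf i (C s : TriPoly) ≤ n := by
    intro i s n; simp
  constructor
  · have hp0 : ∀ a : Polynomial ℂ, degreeOf 1 (Polynomial.aeval (X 0 : TriPoly) a) ≤ 0 := fun a =>
      (degreeOf_polynomial_aeval_of_ne (by decide) a).le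
    rw [← e₀, ← degreeOf_mul_eq hχ' hp.ne_zero, ← hmul]
    have hS : degreeOf 1 (C K.a * (X 1 * X 0) + C K.b * (X 1 * X 2) + C K.c * (X 0 * X 2)
        + C K.f * (X 1 + X 0 + X 2) + C K.g : TriPoly) ≤ 1 := by
      refine degreeOf_add_le_of_le (degreeOf_add_le_of_le (degreeOf_add_le_of_le
        (degreeOf_add_le_of_le ?_ ?_) ?_) ?_) (hC _ _ _)
      · exact degreeOf_mul_le_of_le (hC 1 _ 0) (degreeOf_mul_le_of_le (hX 1)
          (hne 1 0 0 (by decide)))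
      · exact degreeOf_mul_le_of_le (hC 1 _ 0) (degreeOf_mul_le_of_le (hX 1)
          (hne 1 2 0 (by decide)))
      · exact degreeOf_mul_le_of_le (hC 1 _ 0) (degreeOf_mul_le_of_le (m := 1)
          (hne 1 0 1 (by decide)) (hne 1 2 0 (by decide)))
      · exact degreeOf_mul_le_of_le (hC 1 _ 0) (degreeOf_add_le_of_le (degreeOf_add_le_of_le (hX 1)
          (hne 1 0 1 (by decide))) (hne 1 2 1 (by decide)))
    have hT : degreeOf 1 (C K.e * (X 1 * X 0 * X 2) + C K.a * X 2 + C K.b * X 0 + C K.c * X 1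
        + C K.f : TriPoly) ≤ 1 := by
      refine degreeOf_add_le_of_le (degreeOf_add_le_of_le (degreeOf_add_le_of_le
        (degreeOf_add_le_of_le ?_ ?_) ?_) ?_) (hC _ _ _)
      · exact degreeOf_mul_le_of_le (hC 1 _ 0) (degreeOf_mul_le_of_le (degreeOf_mul_le_of_le (hX 1)
          (hne 1 0 0 (by decide))) (hne 1 2 0 (by decide)))
      · exact degreeOf_mul_le_of_le (hC 1 _ 0) (hne 1 2 1 (by decide))
      · exact degreeOf_mul_le_of_le (hC 1 _ 0) (hne 1 0 1 (by decide))
      · exact degreeOf_mul_le_of_le (hC 1 _ 0) (hX 1)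
    refine degreeOf_sub_le_of_le (degreeOf_mul_le_of_le (n := 1) hS ?_)
      (degreeOf_mul_le_of_le (n := 1) hT ?_)
    · exact degreeOf_add_le_of_le (degreeOf_mul_le_of_le (hp0 a) (hX 1)) ((hp0 c).trans zero_le_one)
    · exact degreeOf_add_le_of_le (degreeOf_mul_le_of_le (hp0 b) (hX 1)) ((hp0 d).trans zero_le_one)
  · have hp0 : ∀ a : Polynomial ℂ, a.natDegree ≤ m →
        degreeOf 0 (Polynomial.aeval (X 0 : TriPoly) a) ≤ m := fun a ha =>
      (degreeOf_polynomial_aeval_le 0 a).trans ha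
    suffices h2 : degreeOf 0 (rename ![1, 0] χ * p : TriPoly) ≤ 1 + m by
      rw [degreeOf_mul_eq hχ' hp.ne_zero, e₁, hp.first] at h2
      omega
    rw [← hmul]
    have hS : degreeOf 0 (C K.a * (X 1 * X 0) + C K.b * (X 1 * X 2) + C K.c * (X 0 * X 2)
        + C K.f * (X 1 + X 0 + X 2) + C K.g : TriPoly) ≤ 1 := by
      refine degreeOf_add_le_of_le (degreeOf_add_le_of_le (degreeOf_add_le_of_le
        (degreeOf_add_le_of_le ?_ ?_) ?_) ?_) (hC _ _ _)
      · exact degreeOf_mul_le_of_le (hC 0 _ 0) (degreeOf_mul_le_of_le (m := 0)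
          (hne 0 1 0 (by decide)) (hX 0))
      · exact degreeOf_mul_le_of_le (hC 0 _ 0) (degreeOf_mul_le_of_le (m := 1)
          (hne 0 1 1 (by decide)) (hne 0 2 0 (by decide)))
      · exact degreeOf_mul_le_of_le (hC 0 _ 0) (degreeOf_mul_le_of_le (hX 0)
          (hne 0 2 0 (by decide)))
      · exact degreeOf_mul_le_of_le (hC 0 _ 0) (degreeOf_add_le_of_le (degreeOf_add_le_of_le
          (hne 0 1 1 (by decide)) (hX 0)) (hne 0 2 1 (by decide)))
    have hT : degreeOf 0 (C K.e * (X 1 * X 0 * X 2) + C K.a * X 2 + C K.b * X 0 + C K.c * X 1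
        + C K.f : TriPoly) ≤ 1 := by
      refine degreeOf_add_le_of_le (degreeOf_add_le_of_le (degreeOf_add_le_of_le
        (degreeOf_add_le_of_le ?_ ?_) ?_) ?_) (hC _ _ _)
      · exact degreeOf_mul_le_of_le (hC 0 _ 0) (degreeOf_mul_le_of_le (degreeOf_mul_le_of_le
          (hne 0 1 0 (by decide)) (hX 0)) (hne 0 2 0 (by decide)))
      · exact degreeOf_mul_le_of_le (hC 0 _ 0) (hne 0 2 1 (by decide))
      · exact degreeOf_mul_le_of_le (hC 0 _ 0) (hX 0)
      · exact degreeOf_mul_le_of_le (hC 0 _ 0) (hne 0 1 1 (by decide))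
    refine degreeOf_sub_le_of_le (degreeOf_mul_le_of_le hS ?_) (degreeOf_mul_le_of_le hT ?_)
    · exact degreeOf_add_le_of_le (degreeOf_mul_le_of_le (n := 0) (hp0 a ha)
        (hne 0 1 0 (by decide))) (hp0 c hc)
    · exact degreeOf_add_le_of_le (degreeOf_mul_le_of_le (n := 0) (hp0 b hb)
        (hne 0 1 0 (by decide))) (hp0 d hd)

/-- A polynomial that is a linear combination of the two coefficients of `Q` with respect to `v`
has no dual: the elimination yields a product of a function of `v` and a function of `x, u`. -/
theorem Elim.not_combination {K : KleinQuad} {q p : TriPoly} {χ : MvPolynomial (Fin 2) ℂ}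
    (h : K.Elim q p χ) (hq : IsBoundary q) (hp : IsBoundary p) (hK : ∃ x u, K.edge x u ≠ 0)
    (c₀ c₁ : ℂ)
    (hc : ∀ x u y, eval ![x, u, y] q = c₁ * (K.S x u 0 + K.T x u 0 * y)
      + c₀ * (K.S x u 1 + K.T x u 1 * y - (K.S x u 0 + K.T x u 0 * y))) : False := by
  classical
  have hprod : (rename ![1, 0] χ : TriPoly) * p
      = (C c₀ - C c₁ * X 2) * rename ![1, 0] K.edgePoly := by
    refine tri_ext fun u x v => ?_
    have := h x u v
    rw [hc, hc] at this
    simp only [map_mul, map_sub, eval_rename_ux, eval_edgePoly, eval_C, eval_X, Matrix.cons_val,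
      edge, S, T] at this ⊢
    linear_combination -this
  have hdeg : ∀ r : MvPolynomial (Fin 2) ℂ, degreeOf 2 (rename ![1, 0] r : TriPoly) = 0 :=
    degreeOf_rename_eq_zero (by intro j; fin_cases j <;> decide)
  have hpp : Prime p := hp.irreducible.prime
  have hedge : (rename ![1, 0] K.edgePoly : TriPoly) ≠ 0 := by
    intro h0
    obtain ⟨x, u, hxu⟩ := hK
    apply hxu
    rw [← eval_edgePoly, ← eval_rename_ux _ x u 0, h0, map_zero]
  have hχ : (rename ![1, 0] χ : TriPoly) ≠ 0 := by
    intro h0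
    exact h.ne_zero hq hK (rename_injective (![1, 0] : Fin 2 → Fin 3) (by decide)
      (by rw [h0, map_zero]))
  have hlin : (C c₀ - C c₁ * X 2 : TriPoly) ≠ 0 := by
    intro h0
    rw [h0, zero_mul] at hprod
    exact mul_ne_zero hχ hp.ne_zero hprod
  have hdvd : p ∣ (C c₀ - C c₁ * X 2) * rename ![1, 0] K.edgePoly := ⟨_, by rw [← hprod, mul_comm]⟩
  rcases hpp.dvd_or_dvd hdvd with ⟨w, hw⟩ | ⟨w, hw⟩
  · have hw0 : w ≠ 0 := by rintro rfl; exact hlin (by rw [hw, mul_zero])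
    have h1 : degreeOf 0 (C c₀ - C c₁ * X 2 : TriPoly) ≤ 0 :=
      degreeOf_sub_le_of_le (by simp)
        (degreeOf_mul_le_of_le (m := 0) (n := 0) (by simp) (by simp [degreeOf_X]))
    rw [hw, degreeOf_mul_eq hp.ne_zero hw0, hp.first] at h1
    omega
  · have hw0 : w ≠ 0 := by rintro rfl; exact hedge (by rw [hw, mul_zero])
    have h1 := hdeg K.edgePoly
    rw [hw, degreeOf_mul_eq hp.ne_zero hw0, hp.last] at h1
    omega

end KleinQuad

/-! ### Dual pairs at a fixed value of the parameters -/

/-- Reversal of the arguments. -/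
def rev (q : TriPoly) : TriPoly := rename ![2, 1, 0] q

@[simp] theorem eval_rev (q : TriPoly) (x u y : ℂ) : eval ![x, u, y] (rev q) =
    eval ![y, u, x] q := by
  rw [rev, eval_rename]; congr 2; ext i; fin_cases i <;> rfl

theorem rev_rev (q : TriPoly) : rev (rev q) = q := tri_ext fun x u y => by simp

theorem rev_C_mul (s : ℂ) (q : TriPoly) : rev (C s * q) = C s * rev q := by simp [rev]

theorem degreeOf_rev (q : TriPoly) :
    degreeOf 0 (rev q) = degreeOf 2 q ∧ degreeOf 1 (rev q) = degreeOf 1 q ∧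
      degreeOf 2 (rev q) = degreeOf 0 q := by
  have hinj : Function.Injective (![2, 1, 0] : Fin 3 → Fin 3) := by decide
  exact ⟨degreeOf_rename_of_injective hinj 2, degreeOf_rename_of_injective hinj 1,
    degreeOf_rename_of_injective hinj 0⟩

theorem IsBoundary.map_rev {q : TriPoly} (h : IsBoundary q) : IsBoundary (rev q) := by
  refine ⟨?_, (degreeOf_rev q).1.trans h.last, (degreeOf_rev q).2.2.trans h.first⟩
  have : rev q = renameEquiv ℂ (Equiv.swap (0 : Fin 3) 2) q := by
    rw [renameEquiv_apply, rev, show (![2, 1, 0] : Fin 3 → Fin 3) = Equiv.swap (0 : Fin 3) 2 from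
      funext fun i => by fin_cases i <;> rfl]
  rw [this]
  exact (MulEquiv.irreducible_iff (renameEquiv ℂ (Equiv.swap (0 : Fin 3) 2))).mpr h.irreducible

/-- Two boundary polynomials are dual with respect to `K`, at given values of the lattice
parameters. The second elimination is the first one at exchanged parameters, after the parity
of the polynomials is used. -/
structure DualPair (K : KleinQuad) (q p : TriPoly) : Prop where
  left : IsBoundary q
  right : IsBoundary p
  elim : ∃ χ, K.Elim q p χ
  elim_swap : ∃ χ, K.swap.Elim (rev q) (rev p) χ

theorem DualPair.symm {K : KleinQuad} {q p : TriPoly} (h : DualPair K q p)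
    (hK : ∃ x u, K.edge x u ≠ 0) (hK' : ∃ x u, K.swap.edge x u ≠ 0) : DualPair K p q := by
  obtain ⟨χ, hχ⟩ := h.elim
  obtain ⟨χ', hχ'⟩ := h.elim_swap
  obtain ⟨w, hw, -⟩ := hχ.symm h.left h.right hK
  obtain ⟨w', hw', -⟩ := hχ'.symm h.left.map_rev h.right.map_rev hK'
  exact ⟨h.right, h.left, ⟨w, hw⟩, ⟨w', hw'⟩⟩

/-! ### Translation of the definitions into conditions on values -/

theorem eval_onXUY (q : TriPoly) (x u v y : ℂ) :
    eval ![x, u, v, y] (onXUY q) = eval ![x, u, y] q := by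
  rw [onXUY, eval_rename]; congr 2; ext i; fin_cases i <;> rfl

theorem eval_onUXV (p : TriPoly) (x u v y : ℂ) :
    eval ![x, u, v, y] (onUXV p) = eval ![u, x, v] p := by
  rw [onUXV, eval_rename]; congr 2; ext i; fin_cases i <;> rfl

theorem onXUY_biaffine (a b c d : Polynomial ℂ) :
    onXUY (biaffine a b c d) = Polynomial.aeval (X 1) a * (X 0 * X 3)
      + Polynomial.aeval (X 1) b * X 0 + Polynomial.aeval (X 1) c * X 3
      + Polynomial.aeval (X 1) d := by
  refine quad_ext fun x u v y => ?_
  rw [eval_onXUY]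
  simp [eval_polynomial_aeval]

theorem eval_pderiv_onXUY {q : TriPoly} (hq : IsBiaffine q) (x u v y : ℂ) :
    eval ![x, u, v, y] (pderiv 3 (onXUY q)) = eval ![x, u, 1] q - eval ![x, u, 0] q := by
  obtain ⟨a, b, c, d, rfl, -⟩ := exists_eq_biaffine hq.degreeOf_first hq.degreeOf_last
  have h0 : ∀ a : Polynomial ℂ, pderiv 3 (Polynomial.aeval (X 1 : QuadPoly) a) = 0 := by
    intro a
    rw [Derivation.map_aeval, pderiv_X_of_ne (by decide), smul_zero]
  rw [onXUY_biaffine]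
  simp [h0, eval_polynomial_aeval]
  ring

namespace KleinQuad

theorem pderiv_three_poly (K : KleinQuad) : pderiv 3 K.poly
    = C K.e * (X 0 * X 1 * X 2) + C K.a * X 2 + C K.b * X 1 + C K.c * X 0 + C K.f := by
  simp [poly]

theorem pderiv_two_poly (K : KleinQuad) : pderiv 2 K.poly
    = C K.e * (X 0 * X 1 * X 3) + C K.a * X 3 + C K.b * X 0 + C K.c * X 1 + C K.f := by
  simp [poly, -mul_eq_mul_left_iff]
  ring

theorem pderiv_one_poly (K : KleinQuad) : pderiv 1 K.poly
    = C K.e * (X 0 * X 2 * X 3) + C K.a * X 0 + C K.b * X 3 + C K.c * X 2 + C K.f := by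
  simp [poly, -mul_eq_mul_left_iff]
  ring

theorem pderiv_one_two_poly (K : KleinQuad) : pderiv 1 (pderiv 2 K.poly)
    = C K.e * (X 0 * X 3) + C K.c := by
  rw [pderiv_two_poly]
  simp [-mul_eq_mul_left_iff]
  ring

theorem eval_elimY (K : KleinQuad) {q : TriPoly} (hq : IsBiaffine q) (x u v y : ℂ) :
    eval ![x, u, v, y] (elimY K.poly q)
      = K.S x u v * (eval ![x, u, 1] q - eval ![x, u, 0] q) - K.T x u v * eval ![x, u, 0] q := by
  rw [elimY, map_sub, map_mul, map_mul, eval_pderiv_onXUY hq, pderiv_three_poly, eval_onXUY,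
    eval_poly, hq.2 x u y]
  simp [S, T]
  ring

/-- The diagonal biquadratic, as a polynomial in its two variables. -/
def diagPoly (K : KleinQuad) : MvPolynomial (Fin 2) ℂ :=
  (C K.e * (X 0 * X 1) + C K.c) * (C K.c * (X 0 * X 1) + C K.f * (X 0 + X 1) + C K.g)
    - (C K.a * X 1 + C K.b * X 0 + C K.f) * (C K.a * X 0 + C K.b * X 1 + C K.f)

theorem diagonalBiquadratic_poly (K : KleinQuad) :
    diagonalBiquadratic K.poly = rename ![0, 3] K.diagPoly := by
  rw [diagonalBiquadratic, pderiv_one_two_poly, pderiv_one_poly, pderiv_two_poly]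
  simp [poly, diagPoly]
  ring

theorem eval_diagonalBiquadratic (K : KleinQuad) (x u v y : ℂ) :
    eval ![x, u, v, y] (diagonalBiquadratic K.poly) = K.diag x y := by
  rw [diagonalBiquadratic_poly]
  simp [diagPoly, diag]

theorem elimY_eq_iff (K : KleinQuad) {q p : TriPoly} (hq : IsBiaffine q)
    (χ : MvPolynomial (Fin 2) ℂ) :
    elimY K.poly q = rename ![0, 1] χ * onUXV p ↔ K.Elim q p χ := by
  have h2 : ∀ x u v y, eval ![x, u, v, y] (rename ![0, 1] χ : QuadPoly) = eval ![x, u] χ := by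
    intro x u v y
    rw [eval_rename]; congr 2; ext i; fin_cases i <;> rfl
  constructor
  · intro h x u v
    have := congrArg (eval ![x, u, v, 0]) h
    rwa [eval_elimY K hq, map_mul, eval_onUXV, h2] at this
  · intro h
    refine quad_ext fun x u v y => ?_
    rw [eval_elimY K hq, map_mul, eval_onUXV, h2]
    exact h x u v

theorem aeval_poly_combination (K : KleinQuad) (x u v y : ℂ) :
    eval ![x, u, v, y] (aeval ![X 0, X 1, 0, X 3] K.poly : QuadPoly)
      = K.S x u 0 + K.T x u 0 * y := by
  rw [← eval_poly, ← MvPolynomial.coe_aeval_eq_eval, RingHom.coe_coe, MvPolynomial.comp_aeval_apply,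
    ← MvPolynomial.coe_aeval_eq_eval, RingHom.coe_coe]
  congr 2
  ext i; fin_cases i <;> simp

/-- Only the first condition of nondegeneracy has to be checked for a polynomial with a dual. -/
theorem Elim.isNondegenerate {K : KleinQuad} {q p : TriPoly} {χ : MvPolynomial (Fin 2) ℂ}
    (h : K.Elim q p χ) (hq : IsBoundary q) (hp : IsBoundary p) (hK : ∃ x u, K.edge x u ≠ 0)
    (hdiag : ¬ onXUY q ∣ diagonalBiquadratic K.poly) : IsNondegenerate K.poly q := by
  refine ⟨hdiag, ?_⟩
  rintro ⟨c₀, c₁, hc⟩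
  refine h.not_combination hq hp hK c₀ c₁ fun x u y => ?_
  have := congrArg (eval ![x, u, 0, y]) hc
  rw [eval_onXUY, map_add, map_mul, map_mul, aeval_poly_combination, pderiv_two_poly] at this
  rw [this]
  simp [S, T, -mul_eq_mul_left_iff]
  ring

theorem not_dvd_diag_of_eval {K : KleinQuad} {q : TriPoly}
    (h : ∃ x u y, eval ![x, u, y] q = 0 ∧ K.diag x y ≠ 0) :
    ¬ onXUY q ∣ diagonalBiquadratic K.poly := by
  rintro ⟨w, hw⟩
  obtain ⟨x, u, y, hq, hd⟩ := h
  have := congrArg (eval ![x, u, 0, y]) hw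
  rw [eval_diagonalBiquadratic, map_mul, eval_onXUY, hq, zero_mul] at this
  exact hd this

/-- A polynomial that involves its middle argument does not divide the diagonal biquadratic. -/
theorem not_dvd_diag_of_middle {K : KleinQuad} {q : TriPoly} (hK : ∃ x y, K.diag x y ≠ 0)
    (h : ∃ x u u' y, eval ![x, u, y] q ≠ eval ![x, u', y] q) :
    ¬ onXUY q ∣ diagonalBiquadratic K.poly := by
  rintro ⟨w, hw⟩
  obtain ⟨x, u, u', y, hne⟩ := h
  have hdne : diagonalBiquadratic K.poly ≠ 0 := by
    intro h0
    obtain ⟨x, y, hxy⟩ := hK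
    exact hxy (by rw [← eval_diagonalBiquadratic K x 0 0 y, h0, map_zero])
  have hq0 : onXUY q ≠ 0 := by intro h0; exact hdne (by rw [hw, h0, zero_mul])
  have hw0 : w ≠ 0 := by rintro rfl; exact hdne (by rw [hw, mul_zero])
  have hdeg : degreeOf 1 (diagonalBiquadratic K.poly) = 0 := by
    rw [diagonalBiquadratic_poly]
    exact degreeOf_rename_eq_zero (by intro j; fin_cases j <;> decide) _
  rw [hw, degreeOf_mul_eq hq0 hw0] at hdeg
  apply hne
  rw [← eval_onXUY q x u 0 y, ← eval_onXUY q x u' 0 y]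
  exact eval_eq_of_degreeOf_eq_zero (i := 1) (by omega)
    (by intro j hj; fin_cases j <;> simp_all)

end KleinQuad

theorem IsBoundaryPolynomial.isBoundary {D : Set (ℂ × ℂ)} {q : TriFamily}
    (h : IsBoundaryPolynomial D q) {α β : ℂ} (hD : (α, β) ∈ D) : IsBoundary (q α β) :=
  ⟨h.irreducible α β hD, h.affine_first α β hD, h.affine_last α β hD⟩

/-- Membership in `IsDualTo` from conditions at each value of the parameters. -/
theorem isDualTo_of_elim {Q : ℂ → ℂ → QuadPoly} {D : Set (ℂ × ℂ)} {q p : TriFamily}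
    (hbq : ∀ α β, (α, β) ∈ D → IsBoundary (q α β))
    (hbp : ∀ α β, (α, β) ∈ D → IsBoundary (p α β))
    (hq : ∃ γ : ℂ, (γ = 1 ∨ γ = -1) ∧ ∀ α β, (α, β) ∈ D → q α β = C γ * rev (q β α))
    (hp : ∃ γ : ℂ, (γ = 1 ∨ γ = -1) ∧ ∀ α β, (α, β) ∈ D → p α β = C γ * rev (p β α))
    (h : ∀ α β, (α, β) ∈ D → ∃ K : KleinQuad, Q α β = K.poly ∧ (∃ x u, K.edge x u ≠ 0) ∧
      (∃ χ, K.Elim (q α β) (p α β) χ) ∧ ¬ onXUY (q α β) ∣ diagonalBiquadratic K.poly) :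
    IsDualTo Q D q p := by
  refine ⟨⟨fun α β hD => (hbq α β hD).irreducible, fun α β hD => (hbq α β hD).first,
    fun α β hD => (hbq α β hD).last, hq⟩, ⟨fun α β hD => (hbp α β hD).irreducible,
    fun α β hD => (hbp α β hD).first, fun α β hD => (hbp α β hD).last, hp⟩, ?_, ?_⟩
  · intro α β hD
    obtain ⟨K, hK, hne, ⟨χ, hχ⟩, hd⟩ := h α β hD
    rw [hK]
    exact hχ.isNondegenerate (hbq α β hD) (hbp α β hD) hne hd
  · have : ∀ α β, ∃ χ : MvPolynomial (Fin 2) ℂ, (α, β) ∈ D →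
        elimY (Q α β) (q α β) = rename ![0, 1] χ * onUXV (p α β) := by
      intro α β
      by_cases hD : (α, β) ∈ D
      · obtain ⟨K, hK, hne, ⟨χ, hχ⟩, hd⟩ := h α β hD
        exact ⟨χ, fun _ => by rw [hK, K.elimY_eq_iff (hbq α β hD).isBiaffine]; exact hχ⟩
      · exact ⟨0, fun h => absurd h hD⟩
    choose χ hχ using this
    exact ⟨χ, hχ⟩

theorem elimY_neg (Q : QuadPoly) (q : TriPoly) : elimY (-Q) q = -elimY Q q := by
  simp only [elimY, map_neg]; ring

theorem KleinQuad.Elim.C_mul {K : KleinQuad} {q p : TriPoly} {χ : MvPolynomial (Fin 2) ℂ} {s t : ℂ}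
    (h : K.Elim (C s * q) (C t * p) χ) (hs : s ≠ 0) :
    K.Elim q p (C (t / s) * χ) := by
  intro x u v
  have := h x u v
  simp only [map_mul, eval_C] at this ⊢
  field_simp
  linear_combination this

/-- A dual pair of families yields a dual pair of polynomials at each value of the parameters. -/
theorem IsDualTo.dualPair {Q : ℂ → ℂ → QuadPoly} {D : Set (ℂ × ℂ)} {q p : TriFamily}
    (h : IsDualTo Q D q p) {α β : ℂ} (hD : (α, β) ∈ D) (hD' : (β, α) ∈ D) {K : KleinQuad}
    (hK : Q α β = K.poly) (hK' : Q β α = -K.swap.poly) : DualPair K (q α β) (p α β) := by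
  obtain ⟨χ, hχ⟩ := h.factorization
  have hq := h.boundary_q.isBoundary hD
  have hp := h.boundary_p.isBoundary hD
  have hqs := h.boundary_q.isBoundary hD'
  have unit : ∀ {γ : ℂ}, (γ = 1 ∨ γ = -1) → γ ≠ 0 := by rintro γ (rfl | rfl) <;> norm_num
  refine ⟨hq, hp, ⟨χ α β, ?_⟩, ?_⟩
  · rw [← K.elimY_eq_iff hq.isBiaffine, ← hK]
    exact hχ α β hD
  · obtain ⟨γ, hγ, hqr⟩ := h.boundary_q.parity
    obtain ⟨γ', hγ', hpr⟩ := h.boundary_p.parity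
    have h1 : K.swap.Elim (q β α) (p β α) (-χ β α) := by
      rw [← K.swap.elimY_eq_iff hqs.isBiaffine, map_neg, neg_mul, ← hχ β α hD', hK', elimY_neg,
        neg_neg]
    rw [hqr β α hD', hpr β α hD'] at h1
    exact ⟨_, h1.C_mul (unit hγ)⟩

/-- Agreement up to a factor at `(α, β)` suffices for `ParamEquivAt` when both families have
a parity. -/
theorem paramEquivAt_of_eq {q q' : TriFamily} {α β γ γ' g : ℂ} (hg : g ≠ 0)
    (hγ : γ = 1 ∨ γ = -1) (hγ' : γ' = 1 ∨ γ' = -1) (hq : q β α = C γ * rev (q α β))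
    (hq' : q' β α = C γ' * rev (q' α β)) (h : q α β = C g * q' α β) :
    ParamEquivAt α β q q' := by
  refine ⟨g, γ * γ', hg, ?_, h, ?_⟩
  · rcases hγ with rfl | rfl <;> rcases hγ' with rfl | rfl <;> norm_num
  · have h2 : γ' * γ' = 1 := by rcases hγ' with rfl | rfl <;> norm_num
    rw [hq, h, hq', rev_C_mul, ← mul_assoc, ← mul_assoc, ← C_mul, ← C_mul]
    congr 2
    linear_combination (-γ * g) * h2

/-! ### The Jacobi elliptic function -/

/-- The algebraic form of the addition theorem of `sn`: the relation between `a = sn (z + w)`,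
`b = sn z` and `c = sn w`. It is symmetric in the three squares. -/
def JacobiRelation (k a b c : ℂ) : Prop :=
  (a ^ 2 + k ^ 2 * a ^ 2 * b ^ 2 * c ^ 2 - b ^ 2 - c ^ 2) ^ 2
    = 4 * b ^ 2 * c ^ 2 * (1 - a ^ 2) * (1 - k ^ 2 * a ^ 2)

/-- Identity theorem: a function meromorphic on `ℂ` that vanishes near one point vanishes at every
point of continuity. -/
theorem eq_zero_of_meromorphicOn {F : ℂ → ℂ} (hF : ∀ z, MeromorphicAt F z) {z₀ z₁ : ℂ}
    (h₀ : ∀ᶠ z in nhds z₀, F z = 0) (h₁ : ContinuousAt F z₁) : F z₁ = 0 := by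
  have hmer : MeromorphicOn F Set.univ := fun z _ => hF z
  have htop : meromorphicOrderAt F z₁ = ⊤ := by
    by_contra hne
    have := hmer.meromorphicOrderAt_ne_top_of_isPreconnected isPreconnected_univ
      (Set.mem_univ z₁) (Set.mem_univ z₀) hne
    exact this (meromorphicOrderAt_eq_top_iff.mpr (h₀.filter_mono nhdsWithin_le_nhds))
  have hev := meromorphicOrderAt_eq_top_iff.mp htop
  have h2 : Filter.Tendsto F (nhdsWithin z₁ {z₁}ᶜ) (nhds 0) :=
    (tendsto_const_nhds (x := (0 : ℂ))).congr' (hev.mono fun z hz => hz.symm)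
  exact tendsto_nhds_unique (h₁.tendsto.mono_left nhdsWithin_le_nhds) h2

namespace IsJacobiElliptic

variable {k : ℂ} {s c d : ℂ → ℂ}

theorem meromorphicAt (h : IsJacobiElliptic k s c d) (z : ℂ) : MeromorphicAt s z :=
  (h.meromorphic_s (Set.mem_univ z)).meromorphicAt

theorem exists_ball (h : IsJacobiElliptic k s c d) : ∃ r > 0, ∀ z ∈ Metric.ball (0 : ℂ) r,
    (AnalyticAt ℂ s z ∧ AnalyticAt ℂ c z ∧ AnalyticAt ℂ d z) ∧ ‖k * s z ^ 2‖ < 1 := by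
  obtain ⟨hs, hc, hd⟩ := h.analytic_zero
  have hcont : ContinuousAt (fun z => ‖k * s z ^ 2‖) 0 :=
    (continuousAt_const.mul (hs.continuousAt.pow 2)).norm
  have hlt : ∀ᶠ z in nhds (0 : ℂ), ‖k * s z ^ 2‖ < 1 :=
    hcont.eventually_lt continuousAt_const (by simp [h.s_zero])
  have := ((hs.eventually_analyticAt.and (hc.eventually_analyticAt.and
    hd.eventually_analyticAt)).and hlt)
  obtain ⟨r, hr, hball⟩ := Metric.eventually_nhds_iff_ball.mp this
  exact ⟨r, hr, hball⟩

theorem sq_add_sq (h : IsJacobiElliptic k s c d) {r : ℝ} (hr : 0 < r)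
    (hball : ∀ z ∈ Metric.ball (0 : ℂ) r, AnalyticAt ℂ s z ∧ AnalyticAt ℂ c z ∧ AnalyticAt ℂ d z)
    {z : ℂ} (hz : z ∈ Metric.ball (0 : ℂ) r) :
    c z ^ 2 = 1 - s z ^ 2 ∧ d z ^ 2 = 1 - k ^ 2 * s z ^ 2 := by
  have h0 : (0 : ℂ) ∈ Metric.ball (0 : ℂ) r := Metric.mem_ball_self hr
  have hode : ∀ z ∈ Metric.ball (0 : ℂ) r, _ := fun z hz =>
    h.ode z (hball z hz).1 (hball z hz).2.1 (hball z hz).2.2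
  have hconst : ∀ F : ℂ → ℂ, (∀ z ∈ Metric.ball (0 : ℂ) r, HasDerivAt F 0 z) → F z = F 0 := by
    intro F hF
    exact Metric.isOpen_ball.is_const_of_deriv_eq_zero (convex_ball (0 : ℂ) r).isPreconnected
      (fun w hw => (hF w hw).differentiableAt.differentiableWithinAt)
      (fun w hw => (hF w hw).deriv) hz h0
  constructor
  · have := hconst (fun w => s w ^ 2 + c w ^ 2) (fun w hw => by
      obtain ⟨h1, h2, h3⟩ := hode w hw
      exact ((h1.pow 2).add (h2.pow 2)).congr_deriv (by push_cast; ring))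
    simp only [h.s_zero, h.c_zero] at this
    linear_combination this
  · have := hconst (fun w => k ^ 2 * s w ^ 2 + d w ^ 2) (fun w hw => by
      obtain ⟨h1, h2, h3⟩ := hode w hw
      exact (((h1.pow 2).const_mul (k ^ 2)).add (h3.pow 2)).congr_deriv (by push_cast; ring))
    simp only [h.s_zero, h.d_zero] at this
    linear_combination this

/-- The addition theorem near the origin: on the line `z + w = const` the quotient
`(sn z cn w dn w + sn w cn z dn z) / (1 - k² sn² z sn² w)` has derivative zero. -/
theorem relation_near_zero (h : IsJacobiElliptic k s c d) : ∃ r > 0, ∀ z ∈ Metric.ball (0 : ℂ) r,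
    ∀ w ∈ Metric.ball (0 : ℂ) r, AnalyticAt ℂ s (z + w) ∧
        JacobiRelation k (s (z + w)) (s z) (s w) := by
  obtain ⟨r, hr, hball⟩ := h.exists_ball
  have hsq := fun z hz => h.sq_add_sq hr (fun z hz => (hball z hz).1) (z := z) hz
  refine ⟨r / 4, by positivity, fun z hz w hw => ?_⟩
  rw [mem_ball_zero_iff] at hz hw
  set γ := z + w with hγ
  have hγr : ‖γ‖ < r / 2 := (norm_add_le z w).trans_lt (by linarith)
  have mem1 : ∀ t ∈ Metric.ball (0 : ℂ) (r / 2), t ∈ Metric.ball (0 : ℂ) r := by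
    intro t ht; rw [mem_ball_zero_iff] at ht ⊢; linarith
  have mem2 : ∀ t ∈ Metric.ball (0 : ℂ) (r / 2), γ - t ∈ Metric.ball (0 : ℂ) r := by
    intro t ht; rw [mem_ball_zero_iff] at ht ⊢
    exact (norm_sub_le γ t).trans_lt (by linarith)
  have hD : ∀ t ∈ Metric.ball (0 : ℂ) (r / 2), 1 - k ^ 2 * s t ^ 2 * s (γ - t) ^ 2 ≠ 0 := by
    intro t ht h0
    have h1 := (hball t (mem1 t ht)).2
    have h2 := (hball _ (mem2 t ht)).2
    have h3 : ‖k * s t ^ 2‖ * ‖k * s (γ - t) ^ 2‖ = 1 := by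
      rw [← norm_mul, show k * s t ^ 2 * (k * s (γ - t) ^ 2) = 1 by linear_combination -h0,
          norm_one]
    nlinarith [norm_nonneg (k * s t ^ 2), norm_nonneg (k * s (γ - t) ^ 2)]
  let F : ℂ → ℂ := fun t => (s t * (c (γ - t) * d (γ - t)) + s (γ - t) * (c t * d t))
    / (1 - k ^ 2 * s t ^ 2 * s (γ - t) ^ 2)
  have hF : ∀ t ∈ Metric.ball (0 : ℂ) (r / 2), HasDerivAt F 0 t := by
    intro t ht
    have a1 := (hball t (mem1 t ht)).1
    have a2 := (hball _ (mem2 t ht)).1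
    obtain ⟨s1, c1, d1⟩ := h.ode t a1.1 a1.2.1 a1.2.2
    obtain ⟨s2, c2, d2⟩ := h.ode _ a2.1 a2.2.1 a2.2.2
    replace s2 := s2.comp_const_sub γ t
    replace c2 := c2.comp_const_sub γ t
    replace d2 := d2.comp_const_sub γ t
    have hN := (s1.mul (c2.mul d2)).add (s2.mul (c1.mul d1))
    have hDen := (((s1.pow 2).const_mul (k ^ 2)).mul (s2.pow 2)).const_sub 1
    have := hN.div hDen (hD t ht)
    refine this.congr_deriv ?_
    rw [div_eq_zero_iff]
    left
    obtain ⟨ec1, ed1⟩ := hsq t (mem1 t ht)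
    obtain ⟨ec2, ed2⟩ := hsq _ (mem2 t ht)
    have p1 : c t ^ 2 * d t ^ 2 = (1 - s t ^ 2) * (1 - k ^ 2 * s t ^ 2) := by rw [ec1, ed1]
    have p2 : c (γ - t) ^ 2 * d (γ - t) ^ 2
      = (1 - s (γ - t) ^ 2) * (1 - k ^ 2 * s (γ - t) ^ 2) := by rw [ec2, ed2]
    simp only [Pi.add_apply, Pi.mul_apply, Pi.pow_apply]
    generalize s t = S1 at *
    generalize s (γ - t) = S2 at *
    generalize c t = C1 at *
    generalize c (γ - t) = C2 at *
    generalize d t = D1 at *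
    generalize d (γ - t) = D2 at *
    push_cast
    linear_combination (S1 * S2 * (1 - k ^ 2 * S1 ^ 2 * S2 ^ 2)) *
      (ed2 + k ^ 2 * ec2 - ed1 - k ^ 2 * ec1)
      + 2 * k ^ 2 * S1 * S2 * (S2 ^ 2 * p1 - S1 ^ 2 * p2)
  have hz' : z ∈ Metric.ball (0 : ℂ) (r / 2) := by rw [mem_ball_zero_iff]; linarith
  have hconst : F z = F 0 :=
    Metric.isOpen_ball.is_const_of_deriv_eq_zero (convex_ball (0 : ℂ) (r / 2)).isPreconnected
      (fun t ht => (hF t ht).differentiableAt.differentiableWithinAt)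
      (fun t ht => (hF t ht).deriv) hz' (Metric.mem_ball_self (by positivity))
  have hw' : γ - z = w := by rw [hγ]; ring
  have hDz := hD z hz'
  simp only [F, hw', h.s_zero, h.c_zero, h.d_zero, sub_zero] at hconst hDz
  rw [div_eq_iff hDz] at hconst
  have hγ1 : γ ∈ Metric.ball (0 : ℂ) r := by rw [mem_ball_zero_iff]; linarith
  refine ⟨(hball γ hγ1).1.1, ?_⟩
  obtain ⟨ec1, ed1⟩ := hsq z (mem1 z hz')
  obtain ⟨ec2, ed2⟩ := hsq w (by rw [mem_ball_zero_iff]; linarith)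
  have p1 : c z ^ 2 * d z ^ 2 = (1 - s z ^ 2) * (1 - k ^ 2 * s z ^ 2) := by rw [ec1, ed1]
  have p2 : c w ^ 2 * d w ^ 2 = (1 - s w ^ 2) * (1 - k ^ 2 * s w ^ 2) := by rw [ec2, ed2]
  have h1 : s z * (c w * d w) + s w * (c z * d z)
      = s γ * (1 - k ^ 2 * s z ^ 2 * s w ^ 2) := by linear_combination hconst
  have h2 : s γ * (s z * (c w * d w) - s w * (c z * d z)) = s z ^ 2 - s w ^ 2 := by
    apply mul_right_cancel₀ hDz
    linear_combination (-(s z * (c w * d w) - s w * (c z * d z))) * h1 + s z ^ 2 * p2 - s w ^ 2 * p1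
  have h3 : 2 * s γ * (s z * (c w * d w)) = s γ ^ 2 * (1 - k ^ 2 * s z ^ 2 * s w ^ 2)
      + s z ^ 2 - s w ^ 2 := by linear_combination s γ * h1 + h2
  have h4 : (s γ ^ 2 * (1 - k ^ 2 * s z ^ 2 * s w ^ 2) + s z ^ 2 - s w ^ 2) ^ 2
      = 4 * s γ ^ 2 * s z ^ 2 * ((1 - s w ^ 2) * (1 - k ^ 2 * s w ^ 2)) := by
    rw [← h3, ← p2]; ring
  unfold JacobiRelation
  linear_combination h4

/-- The relation spreads from the neighbourhood of the origin by the identity theorem, first in the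
first argument and then in the second. -/
theorem relation (h : IsJacobiElliptic k s c d) {α β : ℂ} (hα : AnalyticAt ℂ s α)
    (hβ : AnalyticAt ℂ s β) (hαβ : AnalyticAt ℂ s (α - β)) :
    JacobiRelation k (s α) (s β) (s (α - β)) := by
  obtain ⟨r, hr, hloc⟩ := h.relation_near_zero
  let R : ℂ → ℂ → ℂ := fun z w => (s (z + w) ^ 2 + k ^ 2 * s (z + w) ^ 2 * s z ^ 2 * s w ^ 2
    - s z ^ 2 - s w ^ 2) ^ 2
    - 4 * s z ^ 2 * s w ^ 2 * (1 - s (z + w) ^ 2) * (1 - k ^ 2 * s (z + w) ^ 2)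
  have m1 : ∀ v z, MeromorphicAt (fun z => s (v + z)) z := fun v z =>
    (h.meromorphicAt (v + z)).comp_analyticAt (g := fun z => v + z) (by fun_prop)
  have m2 : ∀ v z, MeromorphicAt (fun z => s (z + v)) z := fun v z =>
    (h.meromorphicAt (z + v)).comp_analyticAt (g := fun z => z + v) (by fun_prop)
  have m0 : ∀ z, MeromorphicAt (fun z => s z) z := h.meromorphicAt
  have of_ball : ∀ w ∈ Metric.ball (0 : ℂ) r, ∀ z, AnalyticAt ℂ s z → AnalyticAt ℂ s (z + w) →
      R z w = 0 := by
    intro w hw z hz hzw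
    have hc1 : ContinuousAt (fun z => s (z + w)) z :=
      ContinuousAt.comp (f := fun z : ℂ => z + w) hzw.continuousAt (by fun_prop)
    have hc2 := hz.continuousAt
    refine eq_zero_of_meromorphicOn (F := fun z => R z w) (z₀ := 0) (fun t => ?_) ?_ ?_
    · have := m2 w t
      have := m0 t
      simp only [R]
      fun_prop
    · filter_upwards [Metric.ball_mem_nhds (0 : ℂ) hr] with t ht
      exact sub_eq_zero.mpr (hloc t ht w hw).2
    · simp only [R]
      fun_prop
  have hR : R β (α - β) = 0 := by
    have hs0 := h.analytic_zero.1
    have hc1 : ContinuousAt s (β + (α - β)) := by simpa using hα.continuousAt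
    have hc2 := hαβ.continuousAt
    refine eq_zero_of_meromorphicOn (F := fun w => R β w) (z₀ := 0) (fun t => ?_) ?_ ?_
    · have := m1 β t
      have := m0 t
      simp only [R]
      fun_prop
    · have hev : ∀ᶠ w in nhds (0 : ℂ), AnalyticAt ℂ s (β + w) := by
        have hcont : ContinuousAt (fun w : ℂ => β + w) 0 := by fun_prop
        exact hcont.eventually (by simpa using hβ.eventually_analyticAt)
      filter_upwards [Metric.ball_mem_nhds (0 : ℂ) hr, hev] with w hw hw'
      exact of_ball w hw β hβ hw'
    · generalize α - β = γ at hc1 hc2 ⊢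
      simp only [R]
      fun_prop
  have := sub_eq_zero.mp hR
  simpa [JacobiRelation] using this

/-- Near the origin the relation at `(z, -z)`, where `sn (z - z) = 0`, gives
`sn² z = sn² (-z)`, and the derivative of `sn` at the origin selects the sign. -/
theorem odd (h : IsJacobiElliptic k s c d) {α : ℂ} (hα : AnalyticAt ℂ s α)
    (hα' : AnalyticAt ℂ s (-α)) : s (-α) = -s α := by
  obtain ⟨r, hr, hloc⟩ := h.relation_near_zero
  obtain ⟨hs, hc, hd⟩ := h.analytic_zero
  have hder : HasDerivAt s 1 0 := by
    have := (h.ode 0 hs hc hd).1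
    rwa [h.c_zero, h.d_zero, mul_one] at this
  have hdiff : HasDerivAt (fun z => s z - s (-z)) 2 0 := by
    have h1 : HasDerivAt (fun z => s (-z)) (-1) 0 := by
      have : HasDerivAt s 1 (-0) := by simpa using hder
      exact (this.comp 0 (hasDerivAt_neg 0)).congr_deriv (by norm_num)
    have := hder.sub h1
    norm_num at this
    exact this
  have hne : ∀ᶠ z in nhdsWithin (0 : ℂ) {0}ᶜ, s z - s (-z) ≠ 0 :=
    hdiff.eventually_ne (by norm_num)
  have hev : ∀ᶠ z in nhds (0 : ℂ), s z + s (-z) = 0 := by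
    rw [eventually_nhdsWithin_iff] at hne
    filter_upwards [Metric.ball_mem_nhds (0 : ℂ) hr, hne] with z hz hz'
    by_cases h0 : z = 0
    · simp [h0, h.s_zero]
    · have hzneg : -z ∈ Metric.ball (0 : ℂ) r := by
        rw [mem_ball_zero_iff] at hz ⊢; rwa [norm_neg]
      have hrel := (hloc z hz (-z) hzneg).2
      rw [JacobiRelation, add_neg_cancel, h.s_zero] at hrel
      have : ((s z - s (-z)) * (s z + s (-z))) ^ 2 = 0 := by linear_combination hrel
      exact (mul_eq_zero.mp (pow_eq_zero_iff (two_ne_zero)|>.mp this)).resolve_left (hz' h0)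
  have hcont : ContinuousAt (fun z => s (-z)) α :=
    ContinuousAt.comp (f := fun z : ℂ => -z) hα'.continuousAt (by fun_prop)
  have hcont' := hα.continuousAt
  have := eq_zero_of_meromorphicOn (F := fun z => s z + s (-z)) (z₀ := 0) (z₁ := α)
    (fun t => by
      have m1 := h.meromorphicAt t
      have m2 : MeromorphicAt (fun z => s (-z)) t :=
        (h.meromorphicAt (-t)).comp_analyticAt (g := fun z => -z) (by fun_prop)
      exact m1.add m2) hev (by fun_prop)
  linear_combination this

end IsJacobiElliptic

/-- The relations below hold for the default value `0` as well, so the existence of `sn` is not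
needed. -/
theorem jacobiSn_cases (k : ℂ) :
    (∃ c d, IsJacobiElliptic k (jacobiSn k) c d) ∨ jacobiSn k = 0 := by
  classical
  unfold jacobiSn
  split_ifs with h
  · exact .inl h.choose_spec
  · exact .inr rfl

theorem jacobiSn_relation {k α β : ℂ} (hα : AnalyticAt ℂ (jacobiSn k) α)
    (hβ : AnalyticAt ℂ (jacobiSn k) β) (hαβ : AnalyticAt ℂ (jacobiSn k) (α - β)) :
    JacobiRelation k (jacobiSn k α) (jacobiSn k β) (jacobiSn k (α - β)) := by
  rcases jacobiSn_cases k with ⟨c, d, h⟩ | h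
  · exact h.relation hα hβ hαβ
  · simp [JacobiRelation, h]

theorem jacobiSn_odd {k α : ℂ} (hα : AnalyticAt ℂ (jacobiSn k) α)
    (hα' : AnalyticAt ℂ (jacobiSn k) (-α)) : jacobiSn k (-α) = -jacobiSn k α := by
  rcases jacobiSn_cases k with ⟨c, d, h⟩ | h
  · exact h.odd hα hα'
  · simp [h]

/-! ### The coefficients of the bulk polynomials -/

theorem not_irreducible_mul_of_eval {σ : Type*} {p q : MvPolynomial σ ℂ} {w z : σ → ℂ}
    (hp : eval w p = 0) (hq : eval z q = 0) : ¬ Irreducible (p * q) := by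
  intro h
  rcases h.isUnit_or_isUnit rfl with hu | hu
  · exact (hu.map (eval w)).ne_zero hp
  · exact (hu.map (eval z)).ne_zero hq

namespace KleinQuad

theorem not_irreducible_of_bilinear {K : KleinQuad} (he : K.e = 0) (hf : K.f = 0) (hg : K.g = 0)
    (h : K.a = 0 ∧ K.b ^ 2 = K.c ^ 2 ∨ K.b = 0 ∧ K.a ^ 2 = K.c ^ 2 ∨ K.c = 0 ∧ K.a ^ 2 = K.b ^ 2) :
    ¬ Irreducible K.poly := by
  have key : ∀ {s t : ℂ}, s ^ 2 = t ^ 2 → ∃ σ : ℂ, σ ^ 2 = 1 ∧ t = σ * s := by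
    intro s t h
    rcases sq_eq_sq_iff_eq_or_eq_neg.mp h with h | h
    · exact ⟨1, by norm_num, by rw [h, one_mul]⟩
    · exact ⟨-1, by norm_num, by rw [h]; ring⟩
  rcases h with ⟨h0, h⟩ | ⟨h0, h⟩ | ⟨h0, h⟩ <;> obtain ⟨σ, hσ, ht⟩ := key h
  · have : K.poly = (C K.b * (X 0 + C σ * X 1)) * (X 2 + C σ * X 3) := by
      refine quad_ext fun x u v y => ?_
      simp [eval_poly, S, T, he, hf, hg, h0, ht]
      linear_combination (-K.b * u * y) * hσ
    rw [this]
    exact not_irreducible_mul_of_eval (w := fun _ => 0) (z := fun _ => 0) (by simp) (by simp)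
  · have : K.poly = (C K.a * (X 0 + C σ * X 2)) * (X 1 + C σ * X 3) := by
      refine quad_ext fun x u v y => ?_
      simp [eval_poly, S, T, he, hf, hg, h0, ht]
      linear_combination (-K.a * v * y) * hσ
    rw [this]
    exact not_irreducible_mul_of_eval (w := fun _ => 0) (z := fun _ => 0) (by simp) (by simp)
  · have : K.poly = (C K.a * (X 0 + C σ * X 3)) * (X 1 + C σ * X 2) := by
      refine quad_ext fun x u v y => ?_
      simp [eval_poly, S, T, he, hf, hg, h0, ht]
      linear_combination (-K.a * v * y) * hσ
    rw [this]
    exact not_irreducible_mul_of_eval (w := fun _ => 0) (z := fun _ => 0) (by simp) (by simp)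

theorem not_irreducible_of_biquadratic {K : KleinQuad} (hc : K.c = 0) (hf : K.f = 0)
    (hg : K.g = K.e) (h : K.a = 0 ∧ K.b ^ 2 = K.e ^ 2 ∨ K.b = 0 ∧ K.a ^ 2 = K.e ^ 2) :
    ¬ Irreducible K.poly := by
  have key : ∀ {s t : ℂ}, s ^ 2 = t ^ 2 → ∃ σ : ℂ, σ ^ 2 = 1 ∧ t = σ * s := by
    intro s t h
    rcases sq_eq_sq_iff_eq_or_eq_neg.mp h with h | h
    · exact ⟨1, by norm_num, by rw [h, one_mul]⟩
    · exact ⟨-1, by norm_num, by rw [h]; ring⟩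
  rcases h with ⟨h0, h⟩ | ⟨h0, h⟩ <;> obtain ⟨σ, hσ, ht⟩ := key h
  · have : K.poly = (C (σ * K.b) * (1 + C σ * (X 0 * X 2))) * (1 + C σ * (X 1 * X 3)) := by
      refine quad_ext fun x u v y => ?_
      simp [eval_poly, S, T, hc, hf, hg, h0, ht]
      linear_combination (-K.b * (x * v + u * y) - σ * K.b * (x * v * u * y)) * hσ
    rw [this]
    exact not_irreducible_mul_of_eval (w := ![-σ, 0, 1, 0]) (z := ![0, -σ, 0, 1])
      (by simp; right; linear_combination -hσ) (by simp; linear_combination -hσ)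
  · have : K.poly = (C (σ * K.a) * (1 + C σ * (X 0 * X 1))) * (1 + C σ * (X 2 * X 3)) := by
      refine quad_ext fun x u v y => ?_
      simp [eval_poly, S, T, hc, hf, hg, h0, ht]
      linear_combination (-K.a * (x * u + v * y) - σ * K.a * (x * v * u * y)) * hσ
    rw [this]
    exact not_irreducible_mul_of_eval (w := ![-σ, 1, 0, 0]) (z := ![0, 0, -σ, 1])
      (by simp; right; linear_combination -hσ) (by simp; linear_combination -hσ)

end KleinQuad

namespace ABS

/-- The coefficients of the bulk polynomial. -/
def coeffs : ABS → ℂ → ℂ → KleinQuad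
  | Q1 δ, α, β => ⟨0, α, -β, β - α, 0, δ ^ 2 * α * β * (α - β)⟩
  | Q2, α, β => ⟨0, α, -β, β - α, α * β * (α - β), -(α * β * (α - β) * (α ^ 2 - α * β + β ^ 2))⟩
  | Q3 δ, α, β => ⟨0, Complex.sinh α, -Complex.sinh β, -Complex.sinh (α - β), 0,
      δ * Complex.sinh (α - β) * Complex.sinh α * Complex.sinh β⟩
  | Q4 k, α, β => ⟨jacobiSn k (α - β) * jacobiSn k α * jacobiSn k β * k ^ 2, jacobiSn k α,
      -jacobiSn k β, -jacobiSn k (α - β), 0, jacobiSn k (α - β) * jacobiSn k α * jacobiSn k β⟩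
  | H1, α, β => ⟨0, 1, -1, 0, 0, β - α⟩
  | H2, α, β => ⟨0, 1, -1, 0, β - α, β ^ 2 - α ^ 2⟩
  | H3 δ, α, β => ⟨0, Complex.exp α, -Complex.exp β, 0, 0,
      δ * (Complex.exp (2 * α) - Complex.exp (2 * β))⟩
  | A1 δ, α, β => ⟨0, α, -β, α - β, 0, -(δ ^ 2 * α * β * (α - β))⟩
  | A2, α, β => ⟨-Complex.sinh (α - β), -Complex.sinh β, Complex.sinh α, 0, 0,
      -Complex.sinh (α - β)⟩

theorem bulk_eq (E : ABS) (α β : ℂ) : E.bulk α β = (E.coeffs α β).poly := by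
  refine quad_ext fun x u v y => ?_
  cases E <;> simp [bulk, coeffs, KleinQuad.eval_poly, KleinQuad.S, KleinQuad.T,
    -mul_eq_mul_left_iff] <;> ring

/-- The exchange of `α` and `β` changes the sign of the bulk polynomial and exchanges `u` and `v`.
For Q4 this is the oddness of `sn`. -/
theorem coeffs_neg_swap {E : ABS} {α β : ℂ} (h : E.Regular α β) (h' : E.Regular β α) :
    E.bulk β α = -(E.coeffs α β).swap.poly := by
  have hsinh : Complex.sinh (β - α) = -Complex.sinh (α - β) := by
    rw [← Complex.sinh_neg, neg_sub]
  rw [bulk_eq]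
  refine quad_ext fun x u v y => ?_
  cases E with
  | Q4 k =>
    have hodd : jacobiSn k (β - α) = -jacobiSn k (α - β) := by
      have h1 : AnalyticAt ℂ (jacobiSn k) (-(α - β)) := by
        rw [neg_sub]; exact h'.2.2.2.2.2
      rw [← jacobiSn_odd h.2.2.2.2.2 h1, neg_sub]
    simp [coeffs, KleinQuad.eval_poly, KleinQuad.S, KleinQuad.T, KleinQuad.swap, hodd]
    ring
  | _ =>
    simp [coeffs, KleinQuad.eval_poly, KleinQuad.S, KleinQuad.T, KleinQuad.swap, hsinh]
    try ring

theorem sinh_sub_sq_of_left {α β : ℂ} (h : Complex.sinh α = 0) :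
    Complex.sinh (α - β) ^ 2 = Complex.sinh β ^ 2 := by
  rw [Complex.sinh_sub, h]
  linear_combination Complex.sinh β ^ 2 * Complex.cosh_sq α
    + Complex.sinh β ^ 2 * Complex.sinh α * h

theorem sinh_sub_sq_of_right {α β : ℂ} (h : Complex.sinh β = 0) :
    Complex.sinh (α - β) ^ 2 = Complex.sinh α ^ 2 := by
  rw [Complex.sinh_sub, h]
  linear_combination Complex.sinh α ^ 2 * Complex.cosh_sq β
    + Complex.sinh α ^ 2 * Complex.sinh β * h

theorem sinh_sq_eq_of_sub {α β : ℂ} (h : Complex.sinh (α - β) = 0) :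
    Complex.sinh α ^ 2 = Complex.sinh β ^ 2 := by
  have h1 : Complex.sinh (α - (α - β)) ^ 2 = Complex.sinh α ^ 2 := sinh_sub_sq_of_right h
  rw [sub_sub_cancel] at h1
  exact h1.symm

/-- The conditions on the lattice parameters under which the bulk polynomial is irreducible. -/
def Admissible : ABS → ℂ → ℂ → Prop
  | Q1 _, α, β | Q2, α, β | A1 _, α, β => α ≠ 0 ∧ β ≠ 0 ∧ α ≠ β
  | Q3 _, α, β | A2, α, β =>
      Complex.sinh α ≠ 0 ∧ Complex.sinh β ≠ 0 ∧ Complex.sinh (α - β) ≠ 0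
  | Q4 k, α, β => jacobiSn k α ≠ 0 ∧ jacobiSn k β ≠ 0 ∧ jacobiSn k (α - β) ≠ 0 ∧
      k ≠ 0 ∧ k ^ 2 ≠ 1 ∧ JacobiRelation k (jacobiSn k α) (jacobiSn k β) (jacobiSn k (α - β))
  | H1, α, β | H2, α, β => α ≠ β
  | H3 _, α, β => Complex.exp α ^ 2 ≠ Complex.exp β ^ 2

/-- The excluded parameter values are those where the bulk polynomial is a product. -/
theorem admissible_of_irreducible {E : ABS} {α β : ℂ} (hr : E.Regular α β)
    (h : Irreducible (E.bulk α β)) : E.Admissible α β := by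
  rw [bulk_eq] at h
  have key := fun he hf hg h' => KleinQuad.not_irreducible_of_bilinear
      (K := E.coeffs α β) he hf hg h' h
  have key' := fun hc hf hg h' =>
    KleinQuad.not_irreducible_of_biquadratic (K := E.coeffs α β) hc hf hg h' h
  cases E with
  | Q1 δ =>
    refine ⟨?_, ?_, ?_⟩ <;> rintro rfl <;> refine key ?_ ?_ ?_ ?_ <;> simp [coeffs]
  | Q2 =>
    refine ⟨?_, ?_, ?_⟩ <;> rintro rfl <;> refine key ?_ ?_ ?_ ?_ <;> simp [coeffs]
  | A1 δ =>
    refine ⟨?_, ?_, ?_⟩ <;> rintro rfl <;> refine key ?_ ?_ ?_ ?_ <;> simp [coeffs]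
  | Q3 δ =>
    refine ⟨?_, ?_, ?_⟩ <;> intro h0
    · refine key ?_ ?_ ?_ ?_ <;> simp [coeffs, h0, sinh_sub_sq_of_left]
    · refine key ?_ ?_ ?_ ?_ <;> simp [coeffs, h0, sinh_sub_sq_of_right]
    · refine key ?_ ?_ ?_ (.inr (.inr ⟨?_, ?_⟩)) <;> simp [coeffs, h0, sinh_sq_eq_of_sub h0]
  | A2 =>
    refine ⟨?_, ?_, ?_⟩ <;> intro h0
    · refine key' ?_ ?_ ?_ ?_ <;> simp [coeffs, h0, sinh_sub_sq_of_left]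
    · refine key' ?_ ?_ ?_ ?_ <;> simp [coeffs, h0, sinh_sub_sq_of_right]
    · refine key ?_ ?_ ?_ (.inr (.inr ⟨?_, ?_⟩)) <;> simp [coeffs, h0, sinh_sq_eq_of_sub h0]
  | Q4 k =>
    have hrel := jacobiSn_relation hr.2.2.2.1 hr.2.2.2.2.1 hr.2.2.2.2.2
    have hk : k ^ 2 ≠ 1 := by
      intro hk
      rcases sq_eq_one_iff.mp hk with h | h
      · exact hr.2.1 h
      · exact hr.2.2.1 h
    have sq : ∀ {s t : ℂ}, (s ^ 2 - t ^ 2) ^ 2 = 0 → s ^ 2 = t ^ 2 := fun h =>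
      sub_eq_zero.mp (pow_eq_zero_iff two_ne_zero |>.mp h)
    refine ⟨?_, ?_, ?_, hr.1, hk, hrel⟩ <;> intro h0 <;> rw [JacobiRelation, h0] at hrel
    · refine key ?_ ?_ ?_ (.inl ⟨?_, ?_⟩) <;> simp [coeffs, h0]
      exact sq (by linear_combination hrel)
    · refine key ?_ ?_ ?_ (.inr (.inl ⟨?_, ?_⟩)) <;> simp [coeffs, h0]
      exact sq (by linear_combination hrel)
    · refine key ?_ ?_ ?_ (.inr (.inr ⟨?_, ?_⟩)) <;> simp [coeffs, h0]
      exact sq (by linear_combination hrel)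
  | H1 => rintro rfl; refine key ?_ ?_ ?_ ?_ <;> simp [coeffs]
  | H2 => rintro rfl; refine key ?_ ?_ ?_ ?_ <;> simp [coeffs]
  | H3 δ =>
    intro h0
    have h2 : Complex.exp (2 * α) = Complex.exp (2 * β) := by
      rw [two_mul, two_mul, Complex.exp_add, Complex.exp_add]; linear_combination h0
    refine key ?_ ?_ ?_ ?_ <;> simp [coeffs, h0, h2]

theorem IsParameterDomain.admissible {E : ABS} {D : Set (ℂ × ℂ)} (hD : E.IsParameterDomain D)
    {α β : ℂ} (h : (α, β) ∈ D) : E.Admissible α β :=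
  admissible_of_irreducible (hD.regular α β h) (hD.irreducible α β h)

end ABS

/-! ### Generic properties of the bulk polynomials -/

theorem quartic_coeffs {c₀ c₁ c₂ c₃ c₄ : ℂ}
    (h : ∀ x : ℂ, c₀ + c₁ * x + c₂ * x ^ 2 + c₃ * x ^ 3 + c₄ * x ^ 4 = 0) :
    c₀ = 0 ∧ c₁ = 0 ∧ c₂ = 0 ∧ c₃ = 0 ∧ c₄ = 0 := by
  have h0 := h 0
  have h1 := h 1
  have h2 := h (-1)
  have h3 := h 2
  have h4 := h (-2)
  refine ⟨?_, ?_, ?_, ?_, ?_⟩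
  · linear_combination h0
  · linear_combination (8 * (h1 - h2) - (h3 - h4)) / 12
  · linear_combination (-h3 - h4 + 16 * h1 + 16 * h2 - 30 * h0) / 24
  · linear_combination (h3 - h4 - 2 * h1 + 2 * h2) / 12
  · linear_combination (h3 + h4 - 4 * h1 - 4 * h2 + 6 * h0) / 24

namespace KleinQuad

/-- The discriminant, as a biaffine polynomial in `u` and `v`, of `A S - B T` at a given `x`. -/
def pencilDisc (K : KleinQuad) (x A B : ℂ) : ℂ :=
  (K.c * A - K.e * x * B) * ((K.f * x + K.g) * A - (K.c * x + K.f) * B)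
    - ((K.a * x + K.f) * A - K.b * B) * ((K.b * x + K.f) * A - K.a * B)

theorem pencilDisc_eq_diag (K : KleinQuad) (x : ℂ) {A B y : ℂ} (h : A * y + B = 0) :
    K.pencilDisc x A B = A ^ 2 * K.diag x y := by
  obtain rfl : B = -(A * y) := by linear_combination h
  simp only [pencilDisc, diag]; ring

/-- The general position of a quadrilateral polynomial that the analysis of duality needs. All
members of the list have these properties. -/
structure Generic (K : KleinQuad) : Prop where
  a_ne : K.a ≠ 0
  b_ne : K.b ≠ 0
  middle : K.a ≠ K.b ∨ K.c ≠ 0 ∨ K.e ≠ 0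
  edge_ne : ∃ x u, K.edge x u ≠ 0
  edge_swap_ne : ∃ x u, K.swap.edge x u ≠ 0
  disc : ∀ r₁ r₂ r₄, r₁ * r₄ - r₂ ^ 2 ≠ 0 → ∃ x, K.pencilDisc x (r₁ * x + r₂) (r₂ * x + r₄) ≠ 0
  indep : ∀ x A B, x ≠ 0 → (∀ u v, K.S x u v * A - K.T x u v * B = 0) → A = 0 ∧ B = 0

theorem exists_diag_ne {K : KleinQuad} (ha : K.a ≠ 0) (hb : K.b ≠ 0) : ∃ x y, K.diag x y ≠ 0 := by
  by_contra! h
  have h1 := h 1 0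
  have h2 := h (-1) 0
  have h3 := h 0 0
  simp only [diag] at h1 h2 h3
  exact mul_ne_zero ha hb (by linear_combination -(h1 + h2 - 2 * h3) / 2)

theorem edge_coeffs {K : KleinQuad} (h : ∀ x u, K.edge x u = 0) :
    K.e * K.a = 0 ∧ K.b * K.c = 0 ∧ K.a ^ 2 + K.e * K.g = K.b ^ 2 + K.c ^ 2 ∧
      K.f * (K.a - K.b - K.c) = 0 ∧ K.a * K.g = K.f ^ 2 := by
  simp only [edge] at h
  have h00 := h 0 0
  have h10 := h 1 0
  have hm0 := h (-1) 0
  have h11 := h 1 1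
  have h1m := h 1 (-1)
  have hmm := h (-1) (-1)
  refine ⟨?_, ?_, ?_, ?_, ?_⟩
  · linear_combination (h11 + hmm + 2 * h1m) / 4 - (h10 + hm0 - 2 * h00) - h00
  · linear_combination (-1 / 2 : ℂ) * (h10 + hm0 - 2 * h00)
  · linear_combination (h11 + hmm - 2 * h1m) / 4
  · linear_combination (h10 - hm0) / 2
  · linear_combination h00

theorem pencil_coeffs {K : KleinQuad} {x A B : ℂ}
    (h : ∀ u v, K.S x u v * A - K.T x u v * B = 0) :
    K.c * A = K.e * x * B ∧ (K.a * x + K.f) * A = K.b * B ∧ (K.b * x + K.f) * A = K.a * B ∧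
      (K.f * x + K.g) * A = (K.c * x + K.f) * B := by
  simp only [S, T] at h
  have h00 := h 0 0
  have h10 := h 1 0
  have h01 := h 0 1
  have h11 := h 1 1
  refine ⟨?_, ?_, ?_, ?_⟩
  · linear_combination h11 + h00 - h10 - h01
  · linear_combination h10 - h00
  · linear_combination h01 - h00
  · linear_combination h00

theorem pencilDisc_coeffs {K : KleinQuad} (hef : K.e * K.f = 0) {r₁ r₂ r₄ : ℂ}
    (h : ∀ x, K.pencilDisc x (r₁ * x + r₂) (r₂ * x + r₄) = 0) :
    K.e * K.c * r₂ ^ 2 = K.a * K.b * r₁ ^ 2 ∧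
    2 * K.e * K.c * r₂ * r₄ - 2 * K.a * K.b * r₁ * r₂
      - (K.e * K.g + K.c ^ 2 - K.a ^ 2 - K.b ^ 2) * r₁ * r₂
      + K.f * (K.c - K.a - K.b) * r₁ ^ 2 = 0 ∧
    K.e * K.c * r₄ ^ 2 - 2 * K.a * K.b * r₂ ^ 2
      - (K.e * K.g + K.c ^ 2 - K.a ^ 2 - K.b ^ 2) * (r₁ * r₄ + r₂ ^ 2)
      + K.f * (K.c - K.a - K.b) * (r₁ * r₂) + (K.c * K.g - K.f ^ 2) * r₁ ^ 2 = 0 ∧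
    -(K.a * K.b * r₄ ^ 2) - K.f * (K.c - K.a - K.b) * (r₂ * r₄)
      + (K.c * K.g - K.f ^ 2) * r₂ ^ 2 = 0 := by
  have key := quartic_coeffs
    (c₀ := -(K.a * K.b * r₄ ^ 2) - K.f * (K.c - K.a - K.b) * (r₂ * r₄)
      + (K.c * K.g - K.f ^ 2) * r₂ ^ 2)
    (c₁ := -2 * K.a * K.b * r₂ * r₄ - (K.e * K.g + K.c ^ 2 - K.a ^ 2 - K.b ^ 2) * r₂ * r₄
      - K.f * (K.c - K.a - K.b) * r₁ * r₄ + 2 * (K.c * K.g - K.f ^ 2) * r₁ * r₂)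
    (c₂ := K.e * K.c * r₄ ^ 2 - 2 * K.a * K.b * r₂ ^ 2
      - (K.e * K.g + K.c ^ 2 - K.a ^ 2 - K.b ^ 2) * (r₁ * r₄ + r₂ ^ 2)
      + K.f * (K.c - K.a - K.b) * (r₁ * r₂) + (K.c * K.g - K.f ^ 2) * r₁ ^ 2)
    (c₃ := 2 * K.e * K.c * r₂ * r₄ - 2 * K.a * K.b * r₁ * r₂
      - (K.e * K.g + K.c ^ 2 - K.a ^ 2 - K.b ^ 2) * r₁ * r₂ + K.f * (K.c - K.a - K.b) * r₁ ^ 2)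
    (c₄ := K.e * K.c * r₂ ^ 2 - K.a * K.b * r₁ ^ 2)
    (fun x => by
      have := h x
      simp only [pencilDisc] at this
      linear_combination this + x * ((r₁ * x + r₂) * (r₂ * x + r₄) * x
        - (r₂ * x + r₄) ^ 2) * hef)
  exact ⟨sub_eq_zero.mp key.2.2.2.2, key.2.2.2.1, key.2.2.1, key.1⟩

theorem exists_pencilDisc_ne {K : KleinQuad} (ha : K.a ≠ 0) (hb : K.b ≠ 0) (hef : K.e * K.f = 0)
    (hec : K.e * K.c = 0) (hM : K.e * K.g + K.c ^ 2 ≠ (K.a - K.b) ^ 2) {r₁ r₂ r₄ : ℂ}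
    (hr : r₁ * r₄ - r₂ ^ 2 ≠ 0) : ∃ x, K.pencilDisc x (r₁ * x + r₂) (r₂ * x + r₄) ≠ 0 := by
  by_contra! h
  obtain ⟨h4, -, h2, -⟩ := pencilDisc_coeffs hef h
  rw [hec, zero_mul, eq_comm, mul_eq_zero, or_iff_right (mul_ne_zero ha hb),
    pow_eq_zero_iff two_ne_zero] at h4
  subst h4
  have hr2 : r₂ ≠ 0 := by rintro rfl; simp at hr
  have : (K.e * K.g + K.c ^ 2 - (K.a - K.b) ^ 2) * r₂ ^ 2 = 0 := by
    linear_combination -h2 + r₄ ^ 2 * hec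
  rw [mul_eq_zero, or_iff_left (pow_ne_zero 2 hr2)] at this
  exact hM (sub_eq_zero.mp this)

/-- The pencil in the case of Q4. A common component of the diagonal biquadratic with a symmetric
biaffine polynomial makes the elliptic curve singular. -/
theorem exists_pencilDisc_ne_of_jacobi {k s t r : ℂ} (hs : s ≠ 0) (ht : t ≠ 0) (hr : r ≠ 0)
    (hk : k ≠ 0) (hk1 : k ^ 2 ≠ 1) (hJ : JacobiRelation k s t r) {r₁ r₂ r₄ : ℂ}
    (hdet : r₁ * r₄ - r₂ ^ 2 ≠ 0) :
    ∃ x, pencilDisc ⟨r * s * t * k ^ 2, s, -t, -r, 0, r * s * t⟩ x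
      (r₁ * x + r₂) (r₂ * x + r₄) ≠ 0 := by
  by_contra! h
  obtain ⟨h4, h3, -, h0⟩ := pencilDisc_coeffs (mul_zero _) h
  simp only at h4 h3 h0
  have hst : s * t ≠ 0 := mul_ne_zero hs ht
  have e1 : r₁ ^ 2 = k ^ 2 * r ^ 2 * r₂ ^ 2 := by
    apply mul_left_cancel₀ hst; linear_combination h4
  have e4 : r₄ ^ 2 = r ^ 2 * r₂ ^ 2 := by
    apply mul_left_cancel₀ hst; linear_combination h0
  have hr2 : r₂ ≠ 0 := by
    rintro rfl
    have : r₁ = 0 := by simpa using e1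
    simp [this] at hdet
  have hr1 : r₁ ≠ 0 := by
    intro h; rw [h] at e1
    have : k ^ 2 * r ^ 2 * r₂ ^ 2 ≠ 0 := by positivity
    exact this (by linear_combination -e1)
  set M := k ^ 2 * s ^ 2 * t ^ 2 * r ^ 2 + r ^ 2 - s ^ 2 - t ^ 2 with hM
  have hM2 : M ^ 2 = 4 * s ^ 2 * t ^ 2 * (1 - r ^ 2) * (1 - k ^ 2 * r ^ 2) := by
    rw [JacobiRelation] at hJ; rw [hM]; linear_combination hJ
  -- `M r₁ = 2 s t (r₁ - k² r² r₄)`, and the square of `r₁ r₄` is known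
  have e3 : M * r₁ = 2 * s * t * (r₁ - k ^ 2 * r ^ 2 * r₄) := by
    apply mul_left_cancel₀ hr2; rw [hM]; linear_combination -h3
  have e5 : (1 + k ^ 2) * r₁ = 2 * k ^ 2 * r₄ := by
    have hne : s ^ 2 * t ^ 2 * r ^ 2 * r₁ ≠ 0 := by positivity
    apply mul_left_cancel₀ hne
    have e6 : M ^ 2 * r₁ ^ 2 = 4 * s ^ 2 * t ^ 2 * (r₁ - k ^ 2 * r ^ 2 * r₄) ^ 2 := by
      linear_combination (M * r₁ + 2 * s * t * (r₁ - k ^ 2 * r ^ 2 * r₄)) * e3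
    linear_combination (-1 / 4) * e6 + r₁ ^ 2 / 4 * hM2 + s ^ 2 * t ^ 2 * k ^ 2 * r ^ 4 * e1
      - s ^ 2 * t ^ 2 * k ^ 4 * r ^ 4 * e4
  have e7 : (1 - k ^ 2) ^ 2 * (k ^ 2 * r ^ 2 * r₂ ^ 2) = 0 := by
    linear_combination ((1 + k ^ 2) * r₁ + 2 * k ^ 2 * r₄) * e5 - (1 + k ^ 2) ^ 2 * e1
      + 4 * k ^ 4 * e4
  have hne : k ^ 2 * r ^ 2 * r₂ ^ 2 ≠ 0 := by positivity
  rw [mul_eq_zero, or_iff_left hne, pow_eq_zero_iff two_ne_zero] at e7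
  exact hk1 (by linear_combination -e7)

end KleinQuad

theorem sinh_sub_sq_ne_add {α β : ℂ} (hα : Complex.sinh α ≠ 0) (hβ : Complex.sinh β ≠ 0)
    (h : Complex.sinh (α - β) ≠ 0) :
    Complex.sinh (α - β) ^ 2 ≠ (Complex.sinh α + Complex.sinh β) ^ 2 ∧
    Complex.sinh (α - β) ^ 2 ≠ (Complex.sinh α - Complex.sinh β) ^ 2 := by
  have h1 := Complex.cosh_sq α
  have h2 := Complex.cosh_sq β
  have h3 := Complex.cosh_sq (α - β)
  have h4 := Complex.sinh_sub α β
  have h5 := Complex.cosh_sub α β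
  have hne := mul_ne_zero hα hβ
  have key : ∀ σ : ℂ, σ ^ 2 = 1 →
      Complex.sinh (α - β) ^ 2 ≠ (Complex.sinh α + σ * Complex.sinh β) ^ 2 := by
    intro σ hσ h0
    have : Complex.cosh (α - β) = -σ := by
      rw [h5]
      apply mul_left_cancel₀ hne
      rw [h4] at h0
      linear_combination (-1 / 2) * h0 + (1 / 2) * Complex.sinh α ^ 2 * h2 +
        (1 / 2) * Complex.sinh β ^ 2 * h1 - (1 / 2) * Complex.sinh β ^ 2 * hσ
    rw [this] at h3
    exact h (by rw [← pow_eq_zero_iff two_ne_zero]; linear_combination -h3 + hσ)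
  refine ⟨by simpa using key 1 (by norm_num), ?_⟩
  have := key (-1) (by norm_num)
  rwa [neg_one_mul, ← sub_eq_add_neg] at this

namespace ABS

theorem coeffs_indep {E : ABS} {α β : ℂ} (h : E.Admissible α β) {x A B : ℂ}
    (hp : ∀ u v, (E.coeffs α β).S x u v * A - (E.coeffs α β).T x u v * B = 0) :
    B = 0 ∧ (E ≠ H3 0 ∨ x ≠ 0 → A = 0) := by
  obtain ⟨h1, h2, h3, h4⟩ := KleinQuad.pencil_coeffs hp
  have of_c : ∀ {K : KleinQuad}, K.a ≠ 0 → K.e = 0 → K.c ≠ 0 → K.c * A = K.e * x * B →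
      (K.b * x + K.f) * A = K.a * B → B = 0 ∧ (E ≠ H3 0 ∨ x ≠ 0 → A = 0) := by
    intro K ha he hc h1 h3
    have hA : A = 0 := by simpa [he, hc] using h1
    exact ⟨by simpa [hA, ha] using h3.symm, fun _ => hA⟩
  have of_g : ∀ {K : KleinQuad}, K.a ≠ 0 → K.f = 0 → K.c = 0 → K.g ≠ 0 →
      (K.b * x + K.f) * A = K.a * B → (K.f * x + K.g) * A = (K.c * x + K.f) * B →
      B = 0 ∧ (E ≠ H3 0 ∨ x ≠ 0 → A = 0) := by
    intro K ha hf hc hg h3 h4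
    have hA : A = 0 := by simpa [hf, hc, hg] using h4
    exact ⟨by simpa [hA, ha] using h3.symm, fun _ => hA⟩
  cases E with
  | Q1 δ => exact of_c h.1 rfl (sub_ne_zero.mpr h.2.2.symm) h1 h3
  | Q2 => exact of_c h.1 rfl (sub_ne_zero.mpr h.2.2.symm) h1 h3
  | A1 δ => exact of_c h.1 rfl (sub_ne_zero.mpr h.2.2) h1 h3
  | Q3 δ => exact of_c h.1 rfl (neg_ne_zero.mpr h.2.2) h1 h3
  | A2 => exact of_g (neg_ne_zero.mpr h.2.1) rfl rfl (neg_ne_zero.mpr h.2.2) h3 h4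
  | H1 => exact of_g one_ne_zero rfl rfl (sub_ne_zero.mpr (Ne.symm h)) h3 h4
  | H2 =>
    simp only [coeffs] at h1 h2 h3 h4
    have hne : (β - α : ℂ) ≠ 0 := sub_ne_zero.mpr (Ne.symm h)
    have hA : A = 0 := by
      apply mul_left_cancel₀ hne; linear_combination (h2 + h3) / 2
    subst hA
    exact ⟨by linear_combination -h3, fun _ => rfl⟩
  | H3 δ =>
    simp only [coeffs, Admissible] at h h1 h2 h3 h4
    have hB : B = 0 := by
      apply mul_left_cancel₀ (sub_ne_zero.mpr h)
      linear_combination (-Complex.exp β) * h2 - Complex.exp α * h3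
    subst hB
    refine ⟨rfl, ?_⟩
    rintro (hδ | hx)
    · have hδ : δ ≠ 0 := by rintro rfl; exact hδ rfl
      have hne : δ * (Complex.exp α ^ 2 - Complex.exp β ^ 2) ≠ 0 :=
        mul_ne_zero hδ (sub_ne_zero.mpr h)
      apply mul_left_cancel₀ hne
      rw [two_mul, two_mul, Complex.exp_add, Complex.exp_add] at h4
      linear_combination h4
    · apply mul_left_cancel₀ (mul_ne_zero (Complex.exp_ne_zero α) hx)
      linear_combination h2
  | Q4 k =>
    obtain ⟨hs, ht, hr, hk, hk1, hJ⟩ := h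
    simp only [coeffs] at h1 h2 h3 h4
    generalize jacobiSn k α = s at *
    generalize jacobiSn k β = t at *
    generalize jacobiSn k (α - β) = r at *
    by_cases hA : A = 0
    · subst hA
      refine ⟨?_, fun _ => rfl⟩
      apply mul_left_cancel₀ ht; linear_combination h2
    exfalso
    have hx : x ≠ 0 := by
      rintro rfl
      exact mul_ne_zero hr hA (by linear_combination -h1)
    have hB : B ≠ 0 := by
      rintro rfl
      exact mul_ne_zero hr hA (by linear_combination -h1)
    -- `s² = t²` and `k² s² t² = 1` contradict the addition theorem
    have e1 : s ^ 2 = t ^ 2 := by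
      apply mul_left_cancel₀ (mul_ne_zero hx hA); linear_combination s * h2 + t * h3
    have e2 : k ^ 2 * s ^ 2 * t ^ 2 = 1 := by
      apply mul_left_cancel₀ (mul_ne_zero hr hA)
      linear_combination h1 + s * t * k ^ 2 * h4
    rw [JacobiRelation] at hJ
    have hne : 4 * t ^ 2 * r ^ 2 ≠ 0 :=
      mul_ne_zero (mul_ne_zero (by norm_num) (pow_ne_zero 2 ht)) (pow_ne_zero 2 hr)
    have e3 : (1 - s ^ 2) * (1 - k ^ 2 * s ^ 2) = 0 := by
      apply mul_left_cancel₀ hne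
      linear_combination -hJ + (s ^ 2 - t ^ 2 + 2 * (r ^ 2 * k ^ 2 * s ^ 2 * t ^ 2 - r ^ 2)) * e1
        + r ^ 4 * (k ^ 2 * s ^ 2 * t ^ 2 - 1) * e2
    rcases mul_eq_zero.mp e3 with e | e
    · exact hk1 (by linear_combination e2 + (k ^ 2 * s ^ 2) * e1 + k ^ 2 * (1 + s ^ 2) * e)
    · have : s ^ 2 = 1 := by linear_combination e2 + s ^ 2 * e + k ^ 2 * s ^ 2 * e1
      exact hk1 (by linear_combination -e - k ^ 2 * this)

theorem coeffs_generic {E : ABS} {α β : ℂ} (h : E.Admissible α β) : (E.coeffs α β).Generic := by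
  have hindep : ∀ x A B, x ≠ 0 →
      (∀ u v, (E.coeffs α β).S x u v * A - (E.coeffs α β).T x u v * B = 0) → A = 0 ∧ B = 0 :=
    fun x A B hx hp => ⟨(coeffs_indep h hp).2 (.inr hx), (coeffs_indep h hp).1⟩
  have edge : ∀ K : KleinQuad, (¬ (K.e * K.a = 0 ∧ K.b * K.c = 0 ∧ K.a ^ 2 + K.e * K.g
      = K.b ^ 2 + K.c ^ 2 ∧
      K.f * (K.a - K.b - K.c) = 0 ∧ K.a * K.g = K.f ^ 2)) → ∃ x u, K.edge x u ≠ 0 := by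
    intro K h
    by_contra! h0
    exact h (KleinQuad.edge_coeffs h0)
  cases E with
  | Q1 δ | Q2 | A1 δ =>
    obtain ⟨h1, h2, h3⟩ := h
    have h3' : β - α ≠ 0 := sub_ne_zero.mpr h3.symm
    have h3'' : α - β ≠ 0 := sub_ne_zero.mpr h3
    refine ⟨h1, neg_ne_zero.mpr h2, .inr (.inl (by simpa [coeffs])), edge _ ?_,
      edge _ ?_, fun r₁ r₂ r₄ hr =>
      KleinQuad.exists_pencilDisc_ne h1 (neg_ne_zero.mpr h2) (zero_mul _)
          (zero_mul _) ?_ hr, hindep⟩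
    · simp [coeffs, *]
    · simp [coeffs, KleinQuad.swap, *]
    · simp only [coeffs]
      intro h0
      exact mul_ne_zero h1 h2 (by linear_combination (-1 / 4) * h0)
  | Q3 δ =>
    obtain ⟨h1, h2, h3⟩ := h
    refine ⟨h1, neg_ne_zero.mpr h2, .inr (.inl (by simpa [coeffs])), edge _ ?_,
      edge _ ?_, fun r₁ r₂ r₄ hr =>
      KleinQuad.exists_pencilDisc_ne h1 (neg_ne_zero.mpr h2) (zero_mul _)
          (zero_mul _) ?_ hr, hindep⟩
    · simp [coeffs, *]
    · simp [coeffs, KleinQuad.swap, *]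
    · simp only [coeffs]
      intro h0
      exact (sinh_sub_sq_ne_add h1 h2 h3).1 (by linear_combination h0)
  | A2 =>
    obtain ⟨h1, h2, h3⟩ := h
    refine ⟨neg_ne_zero.mpr h2, h1, .inr (.inr (by simpa [coeffs])), edge _ ?_,
      edge _ ?_, fun r₁ r₂ r₄ hr =>
      KleinQuad.exists_pencilDisc_ne (neg_ne_zero.mpr h2) h1 (mul_zero _)
          (mul_zero _) ?_ hr, hindep⟩
    · simp [coeffs, *]
    · simp [coeffs, KleinQuad.swap, *]
    · simp only [coeffs]
      intro h0
      exact (sinh_sub_sq_ne_add h1 h2 h3).1 (by linear_combination h0)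
  | Q4 k =>
    obtain ⟨hs, ht, hr, hk, hk1, hJ⟩ := h
    refine ⟨hs, neg_ne_zero.mpr ht, .inr (.inl (by simpa [coeffs])), edge _ ?_,
      edge _ ?_, fun r₁ r₂ r₄ hdet =>
      KleinQuad.exists_pencilDisc_ne_of_jacobi hs ht hr hk hk1 hJ hdet, hindep⟩
    · simp [coeffs, *]
    · simp [coeffs, KleinQuad.swap, *]
  | H1 | H2 =>
    have h3 : β - α ≠ 0 := sub_ne_zero.mpr (Ne.symm h)
    have h4 : α - β ≠ 0 := sub_ne_zero.mpr h
    refine ⟨one_ne_zero, neg_ne_zero.mpr one_ne_zero, .inl (by norm_num [coeffs]),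
      edge _ ?_, edge _ ?_, fun r₁ r₂ r₄ hr =>
      KleinQuad.exists_pencilDisc_ne one_ne_zero (neg_ne_zero.mpr one_ne_zero)
          (zero_mul _) (zero_mul _) ?_ hr, hindep⟩
    · norm_num [coeffs, h3, h4]
    · norm_num [coeffs, KleinQuad.swap, h3, h4]
    · norm_num [coeffs]
  | H3 δ =>
    have h : Complex.exp α ^ 2 ≠ Complex.exp β ^ 2 := h
    have hne : Complex.exp α + Complex.exp β ≠ 0 := by
      intro h0
      exact h (by linear_combination (Complex.exp α - Complex.exp β) * h0)
    refine ⟨Complex.exp_ne_zero _, neg_ne_zero.mpr (Complex.exp_ne_zero _), .inl ?_,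
      edge _ ?_, edge _ ?_, fun r₁ r₂ r₄ hr =>
      KleinQuad.exists_pencilDisc_ne (Complex.exp_ne_zero _) 
          (neg_ne_zero.mpr (Complex.exp_ne_zero _))
        (zero_mul _) (zero_mul _) ?_ hr, hindep⟩
    · simp only [coeffs]
      intro h0
      exact hne (by linear_combination h0)
    · rintro ⟨-, -, h0, -⟩
      simp only [coeffs] at h0
      exact h (by linear_combination h0)
    · rintro ⟨-, -, h0, -⟩
      simp only [coeffs, KleinQuad.swap] at h0
      exact h (by linear_combination -h0)
    · simp only [coeffs]
      intro h0
      exact hne (by rw [← pow_eq_zero_iff two_ne_zero]; linear_combination -h0)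

/-- The diagonal biquadratic does not vanish identically on the diagonal, for the equations with
an `M₋` case. -/
theorem exists_diag_self_ne {E : ABS} {α β : ℂ} (h : E.Admissible α β) (hE : E.HasMMinus) :
    ∃ x, (E.coeffs α β).diag x x ≠ 0 := by
  by_contra! h0
  have h0' : ∀ K : KleinQuad, K.e * K.f = 0 → (∀ x, K.diag x x = 0) → K.e * K.c = 0 ∧
      K.e * K.g + K.c ^ 2 = (K.a + K.b) ^ 2 ∧ K.f * (K.c - K.a - K.b) = 0 ∧
      K.c * K.g = K.f ^ 2 := by
    intro K hef h
    have key := quartic_coeffs (c₀ := K.c * K.g - K.f ^ 2)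
      (c₁ := 2 * (K.f * (K.c - K.a - K.b))) (c₂ := K.e * K.g + K.c ^ 2 - (K.a + K.b) ^ 2)
      (c₃ := 0) (c₄ := K.e * K.c) (fun x => by
        have := h x
        simp only [KleinQuad.diag] at this
        linear_combination this - 2 * x ^ 3 * hef)
    exact ⟨key.2.2.2.2, sub_eq_zero.mp key.2.2.1, by linear_combination key.2.1 / 2,
      sub_eq_zero.mp key.1⟩
  obtain ⟨k1, k2, k3, k4⟩ := h0' _ (by cases E <;> simp [coeffs]) h0
  cases E with
  | Q1 δ | A1 δ =>
    obtain ⟨h1, h2, h3⟩ := h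
    have h3' : β - α ≠ 0 := sub_ne_zero.mpr h3.symm
    have h3'' : α - β ≠ 0 := sub_ne_zero.mpr h3
    have hδ : δ ≠ 0 := by rintro rfl; simp [HasMMinus] at hE
    simp [coeffs, *] at k4
  | Q2 =>
    obtain ⟨h1, h2, h3⟩ := h
    have h3' : β - α ≠ 0 := sub_ne_zero.mpr h3.symm
    have h3'' : α - β ≠ 0 := sub_ne_zero.mpr h3
    simp only [coeffs] at k3
    refine mul_ne_zero (mul_ne_zero h1 h2) (mul_ne_zero h3'' h3') ?_
    linear_combination k3 / 2
  | Q3 δ =>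
    obtain ⟨h1, h2, h3⟩ := h
    simp only [coeffs] at k2
    exact (sinh_sub_sq_ne_add h1 h2 h3).2 (by linear_combination k2)
  | A2 =>
    obtain ⟨h1, h2, h3⟩ := h
    simp only [coeffs] at k2
    exact (sinh_sub_sq_ne_add h1 h2 h3).2 (by linear_combination k2)
  | Q4 k =>
    obtain ⟨hs, ht, hr, hk, -⟩ := h
    simp [coeffs, *] at k1
  | H1 => simp [HasMMinus] at hE
  | H2 =>
    have h3 : β - α ≠ 0 := sub_ne_zero.mpr (Ne.symm h)
    simp [coeffs] at k4
    exact h3 (pow_eq_zero_iff two_ne_zero |>.mp k4.symm)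
  | H3 δ =>
    simp only [coeffs] at k2
    apply h
    have : Complex.exp α = Complex.exp β := by
      have : (Complex.exp α - Complex.exp β) ^ 2 = 0 := by linear_combination -k2
      exact sub_eq_zero.mp (pow_eq_zero_iff two_ne_zero |>.mp this)
    rw [this]

end ABS

/-! ### The Möbius pairs are dual pairs -/

theorem isBiaffine_of_eval {p : TriPoly} {m n k l : ℂ → ℂ}
    (hp : ∀ x t y, eval ![x, t, y] p = m t * (x * y) + n t * x + k t * y + l t) : IsBiaffine p :=
  ⟨fun x t y => by simp only [hp]; ring, fun x t y => by simp only [hp]; ring⟩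

theorem isBoundary_of_eval {p : TriPoly} {m n k l : ℂ → ℂ}
    (hp : ∀ x t y, eval ![x, t, y] p = m t * (x * y) + n t * x + k t * y + l t)
    (hc : ∀ t, ¬ (m t = 0 ∧ n t = 0 ∧ k t = 0 ∧ l t = 0))
    (hΔ : ∃ t, m t * l t - n t * k t ≠ 0) : IsBoundary p := by
  have hb := isBiaffine_of_eval hp
  have hΔ' : ∃ t, eval ![0, t, 0] p * eval ![1, t, 1] p - eval ![1, t, 0] p * eval ![0, t, 1] p
      ≠ 0 := by
    obtain ⟨t, ht⟩ := hΔ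
    refine ⟨t, ?_⟩
    simp only [hp]
    convert ht using 1; ring
  refine ⟨hb.irreducible (fun t => ?_) hΔ', hb.degreeOf_first_eq_one hΔ',
      hb.degreeOf_last_eq_one hΔ'⟩
  by_contra! h
  simp only [hp] at h
  refine hc t ⟨?_, ?_, ?_, ?_⟩
  · linear_combination h 1 1 + h 0 0 - h 1 0 - h 0 1
  · linear_combination h 1 0 - h 0 0
  · linear_combination h 0 1 - h 0 0
  · linear_combination h 0 0

namespace KleinQuad

variable {K : KleinQuad} {p : TriPoly} {A B : ℂ → ℂ}

theorem isBoundary_of_pencil (hp : ∀ u x v, eval ![u, x, v] p = K.S x u v * A x - K.T x u v * B x)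
    (hc : ∀ x, ¬ ∀ u v, K.S x u v * A x - K.T x u v * B x = 0)
    (hΔ : ∃ x, K.pencilDisc x (A x) (B x) ≠ 0) : IsBoundary p := by
  refine isBoundary_of_eval (m := fun x => K.c * A x - K.e * x * B x)
    (n := fun x => (K.a * x + K.f) * A x - K.b * B x)
    (k := fun x => (K.b * x + K.f) * A x - K.a * B x)
    (l := fun x => (K.f * x + K.g) * A x - (K.c * x + K.f) * B x) ?_ ?_ hΔ
  · intro u x v; rw [hp]; simp only [S, T]; ring
  · rintro x ⟨h1, h2, h3, h4⟩
    refine hc x fun u v => ?_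
    simp only [S, T]
    linear_combination u * v * h1 + u * h2 + v * h3 + h4

end KleinQuad

theorem isBoundary_moebius {q : TriPoly} {r₁ r₂ r₃ r₄ : ℂ}
    (hq : ∀ x u y, eval ![x, u, y] q = r₁ * (x * y) + r₂ * x + r₃ * y + r₄)
    (hr : r₁ * r₄ - r₂ * r₃ ≠ 0) : IsBoundary q := by
  refine isBoundary_of_eval (m := fun _ => r₁) (n := fun _ => r₂) (k := fun _ => r₃)
    (l := fun _ => r₄) hq ?_ ⟨0, hr⟩
  rintro - ⟨h1, h2, -, -⟩
  rw [h1, h2] at hr; simp at hr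

/-- Where `q` vanishes, `y` is the Möbius image of `x`, and there the diagonal biquadratic is the
discriminant of the pencil up to a square. -/
theorem KleinQuad.Generic.not_dvd_diag_mPlus {K : KleinQuad} (hK : K.Generic) {q : TriPoly}
    {r₁ r₂ r₄ : ℂ} (hq : ∀ x u y, eval ![x, u, y] q = r₁ * (x * y) + r₂ * x + r₂ * y + r₄)
    (hr : r₁ * r₄ - r₂ ^ 2 ≠ 0) : ¬ onXUY q ∣ diagonalBiquadratic K.poly := by
  classical
  obtain ⟨x₀, hx₀⟩ := hK.disc r₁ r₂ r₄ hr
  let A : Polynomial ℂ := Polynomial.C r₁ * Polynomial.X + Polynomial.C r₂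
  let B : Polynomial ℂ := Polynomial.C r₂ * Polynomial.X + Polynomial.C r₄
  let P : Polynomial ℂ :=
    (Polynomial.C K.c * A - Polynomial.C K.e * Polynomial.X * B) * ((Polynomial.C K.f *
      Polynomial.X + Polynomial.C K.g) * A
        - (Polynomial.C K.c * Polynomial.X + Polynomial.C K.f) * B)
    - ((Polynomial.C K.a * Polynomial.X + Polynomial.C K.f) * A - Polynomial.C K.b * B)
      * ((Polynomial.C K.b * Polynomial.X + Polynomial.C K.f) * A - Polynomial.C K.a * B)
  have hP : ∀ x, P.eval x = K.pencilDisc x (r₁ * x + r₂) (r₂ * x + r₄) := by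
    intro x; simp [P, A, B, pencilDisc]
  have hP0 : P ≠ 0 := by rintro h; rw [← hP, h] at hx₀; simp at hx₀
  have hA0 : A ≠ 0 := by
    intro h
    have h0 := congrArg (Polynomial.eval 0) h
    have h1 := congrArg (Polynomial.eval 1) h
    simp [A] at h0 h1
    rw [h0] at h1 hr
    rw [add_zero] at h1
    rw [h1] at hr
    simp at hr
  obtain ⟨x, hx⟩ : ∃ x, (P * A).eval x ≠ 0 := by
    by_contra! h
    exact mul_ne_zero hP0 hA0 (Polynomial.funext (by simpa using h))
  rw [Polynomial.eval_mul, hP] at hx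
  have hAx : r₁ * x + r₂ ≠ 0 := by
    have := right_ne_zero_of_mul hx
    simpa [A] using this
  have hy : (r₁ * x + r₂) * (-(r₂ * x + r₄) / (r₁ * x + r₂)) + (r₂ * x + r₄) = 0 := by
    field_simp; ring
  refine not_dvd_diag_of_eval ⟨x, 0, -(r₂ * x + r₄) / (r₁ * x + r₂), ?_, ?_⟩
  · rw [hq]; linear_combination hy
  · have := left_ne_zero_of_mul hx
    rw [pencilDisc_eq_diag K x hy] at this
    exact right_ne_zero_of_mul this

theorem KleinQuad.Generic.not_dvd_diag_pencil {K : KleinQuad} (hK : K.Generic) {p : TriPoly}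
    {r₁ r₂ r₄ : ℂ} (hp : ∀ u x v, eval ![u, x, v] p
      = K.S x u v * (r₁ * x + r₂) - K.T x u v * (r₂ * x + r₄))
    (hr : r₁ * r₄ - r₂ ^ 2 ≠ 0) : ¬ onXUY p ∣ diagonalBiquadratic K.poly := by
  refine not_dvd_diag_of_middle (exists_diag_ne hK.a_ne hK.b_ne) ?_
  by_contra! h
  have h' : ∀ u v x, eval ![u, x, v] p = eval ![u, 0, v] p := fun u v x => h u x 0 v
  simp only [hp, S, T] at h'
  have h1 : r₁ = 0 := by
    apply mul_left_cancel₀ hK.a_ne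
    linear_combination (1 / 2) * (h' 1 0 1 - h' 0 0 1 + h' 1 0 (-1) - h' 0 0 (-1))
  subst h1
  have h2 : r₂ ≠ 0 := by rintro rfl; simp at hr
  rcases hK.middle with hm | hm | hm
  · apply mul_ne_zero (sub_ne_zero.mpr hm) h2
    linear_combination h' 1 0 1 - h' 0 0 1
  · apply mul_ne_zero hm h2
    linear_combination (-1 / 2) * (h' 0 0 1 + h' 0 0 (-1))
  · apply mul_ne_zero hm h2
    linear_combination (-1 / 2) * (h' 1 1 1 + h' 1 1 (-1) - h' 1 0 1 - h' 1 0 (-1) - h' 0 1 1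
      - h' 0 1 (-1) + h' 0 0 1 + h' 0 0 (-1))

namespace ABS

theorem eval_coeffS (E : ABS) (α β u x v : ℂ) :
    eval ![u, x, v] (E.coeffS α β) = (E.coeffs α β).S x u v := by
  rw [coeffS, bulk_eq]
  simp [KleinQuad.poly, KleinQuad.S]

theorem eval_coeffT (E : ABS) (α β u x v : ℂ) :
    eval ![u, x, v] (E.coeffT α β) = (E.coeffs α β).T x u v := by
  rw [coeffT, bulk_eq, KleinQuad.pderiv_three_poly]
  simp [KleinQuad.T]

theorem coeffs_eq_neg_swap {E : ABS} {α β : ℂ} (h : E.Regular α β) (h' : E.Regular β α)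
    (x u v : ℂ) : (E.coeffs β α).S x u v = -(E.coeffs α β).S x v u ∧
      (E.coeffs β α).T x u v = -(E.coeffs α β).T x v u := by
  have key := coeffs_neg_swap h h'
  rw [bulk_eq] at key
  have h0 := congrArg (eval ![x, u, v, 0]) key
  have h1 := congrArg (eval ![x, u, v, 1]) key
  simp only [map_neg, KleinQuad.eval_poly] at h0 h1
  simp only [KleinQuad.swap, KleinQuad.S, KleinQuad.T] at *
  constructor
  · linear_combination h0
  · linear_combination h1 - h0

/-- Two families that satisfy one elimination identity and do not divide the diagonal biquadratic
are dual to each other, in both orders. -/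
theorem isDualTo_and_symm {E : ABS} {D : Set (ℂ × ℂ)} (hD : E.IsParameterDomain D)
    {q p : TriFamily}
    (hq : ∃ γ : ℂ, (γ = 1 ∨ γ = -1) ∧ ∀ α β, (α, β) ∈ D → q α β = C γ * rev (q β α))
    (hp : ∃ γ : ℂ, (γ = 1 ∨ γ = -1) ∧ ∀ α β, (α, β) ∈ D → p α β = C γ * rev (p β α))
    (h : ∀ α β, (α, β) ∈ D → IsBoundary (q α β) ∧ IsBoundary (p α β) ∧
      (∃ χ, (E.coeffs α β).Elim (q α β) (p α β) χ) ∧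
      ¬ onXUY (q α β) ∣ diagonalBiquadratic (E.coeffs α β).poly ∧
      ¬ onXUY (p α β) ∣ diagonalBiquadratic (E.coeffs α β).poly) :
    IsDualTo E.bulk D q p ∧ IsDualTo E.bulk D p q := by
  have hg := fun α β hαβ => (coeffs_generic (hD.admissible (α := α) (β := β) hαβ)).edge_ne
  refine ⟨isDualTo_of_elim (fun α β hαβ => (h α β hαβ).1) (fun α β hαβ => (h α β hαβ).2.1) hq hp
    fun α β hαβ => ⟨_, E.bulk_eq α β, hg α β hαβ, (h α β hαβ).2.2.1, (h α β hαβ).2.2.2.1⟩,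
    isDualTo_of_elim (fun α β hαβ => (h α β hαβ).2.1) (fun α β hαβ => (h α β hαβ).1) hp hq
    fun α β hαβ => ⟨_, E.bulk_eq α β, hg α β hαβ, ?_, (h α β hαβ).2.2.2.2⟩⟩
  obtain ⟨χ, hχ⟩ := (h α β hαβ).2.2.1
  obtain ⟨w, hw, -⟩ := hχ.symm (h α β hαβ).1 (h α β hαβ).2.1 (hg α β hαβ)
  exact ⟨w, hw⟩

theorem eval_mPlus (r₁ r₂ r₄ : ℂ → ℂ → ℂ) (α β x u y : ℂ) : eval ![x, u, y] (mPlus r₁ r₂ r₄ α β)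
    = r₁ α β * (x * y) + r₂ α β * x + r₂ α β * y + r₄ α β := by
  simp [mPlus]

theorem mPlus_parity {r₁ r₂ r₄ : ℂ → ℂ → ℂ} {α β : ℂ} (h₁ : r₁ α β = r₁ β α)
    (h₂ : r₂ α β = r₂ β α) (h₄ : r₄ α β = r₄ β α) :
    mPlus r₁ r₂ r₄ α β = C 1 * rev (mPlus r₁ r₂ r₄ β α) := by
  refine tri_ext fun x u y => ?_
  rw [map_mul, eval_rev, eval_mPlus, eval_mPlus, h₁, h₂, h₄, eval_C]; ring

theorem eval_dualMPlus {E : ABS} {r₁ r₂ r₄ : ℂ → ℂ → ℂ} {α β : ℂ}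
    (h : ¬ (E = H3 0 ∧ r₄ α β = 0)) (u x v : ℂ) : eval ![u, x, v] (E.dualMPlus r₁ r₂ r₄ α β)
    = (E.coeffs α β).S x u v * (r₁ α β * x + r₂ α β)
      - (E.coeffs α β).T x u v * (r₂ α β * x + r₄ α β) := by
  rw [dualMPlus, if_neg h, mPlusCombination]
  simp only [map_add, map_mul, map_sub, map_neg, eval_coeffS, eval_coeffT, eval_C, eval_X,
    Matrix.cons_val_one]
  ring_nf
  simp
  ring

theorem eval_dualMPlus_of_eq {r₁ r₂ r₄ : ℂ → ℂ → ℂ} {α β : ℂ} (h : r₄ α β = 0) (u x v : ℂ) :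
    eval ![u, x, v] ((H3 0).dualMPlus r₁ r₂ r₄ α β)
    = r₁ α β * x * (Complex.exp α * u - Complex.exp β * v)
      + r₂ α β * (Complex.exp α + Complex.exp β) * (u - v) := by
  rw [dualMPlus, if_pos ⟨rfl, h⟩]
  simp
  ring

theorem dualMPlus_parity {E : ABS} {r₁ r₂ r₄ : ℂ → ℂ → ℂ} {α β : ℂ} (hE : E.Regular α β)
    (hE' : E.Regular β α) (h₁ : r₁ α β = r₁ β α) (h₂ : r₂ α β = r₂ β α) (h₄ : r₄ α β = r₄ β α) :
    E.dualMPlus r₁ r₂ r₄ α β = C (-1) * rev (E.dualMPlus r₁ r₂ r₄ β α) := by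
  refine tri_ext fun u x v => ?_
  rw [map_mul, eval_rev, eval_C]
  by_cases h : E = H3 0 ∧ r₄ α β = 0
  · obtain ⟨rfl, h⟩ := h
    rw [eval_dualMPlus_of_eq h, eval_dualMPlus_of_eq (h₄ ▸ h), h₁, h₂]
    ring
  · rw [eval_dualMPlus h, eval_dualMPlus (by rwa [← h₄]), h₁, h₂, h₄,
      (coeffs_eq_neg_swap hE hE' x v u).1, (coeffs_eq_neg_swap hE hE' x v u).2]
    ring

theorem isDualTo_mPlus {E : ABS} {D : Set (ℂ × ℂ)} (hD : E.IsParameterDomain D)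
    {r₁ r₂ r₄ : ℂ → ℂ → ℂ} (h₁ : SymmOn D r₁) (h₂ : SymmOn D r₂) (h₄ : SymmOn D r₄)
    (hr : ∀ α β, (α, β) ∈ D → r₁ α β * r₄ α β - r₂ α β ^ 2 ≠ 0) :
    IsDualTo E.bulk D (mPlus r₁ r₂ r₄) (E.dualMPlus r₁ r₂ r₄) ∧
      IsDualTo E.bulk D (E.dualMPlus r₁ r₂ r₄) (mPlus r₁ r₂ r₄) := by
  refine isDualTo_and_symm hD
    ⟨1, .inl rfl, fun α β h => mPlus_parity (h₁ _ _ h) (h₂ _ _ h) (h₄ _ _ h)⟩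
    ⟨-1, .inr rfl, fun α β h => dualMPlus_parity (hD.regular _ _ h)
      (hD.regular _ _ (hD.symm _ _ h)) (h₁ _ _ h) (h₂ _ _ h) (h₄ _ _ h)⟩ fun α β h => ?_
  have hA := hD.admissible h
  have hK := coeffs_generic hA
  have hdet := hr α β h
  have hq := eval_mPlus r₁ r₂ r₄ α β
  refine ⟨isBoundary_moebius hq (by rwa [← pow_two]), ?_, ?_, hK.not_dvd_diag_mPlus hq hdet, ?_⟩
  · by_cases hE : E = H3 0 ∧ r₄ α β = 0
    · obtain ⟨rfl, h4⟩ := hE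
      have hr2 : r₂ α β ≠ 0 := by intro h0; rw [h4, h0] at hdet; simp at hdet
      have hA : Complex.exp α ^ 2 ≠ Complex.exp β ^ 2 := hA
      have hs : r₂ α β * (Complex.exp α + Complex.exp β) ≠ 0 := by
        refine mul_ne_zero hr2 fun h0 => hA ?_
        linear_combination (Complex.exp α - Complex.exp β) * h0
      refine isBoundary_of_eval (m := fun _ => 0)
        (n := fun x => r₁ α β * x * Complex.exp α + r₂ α β * (Complex.exp α + Complex.exp β))
        (k := fun x => -(r₁ α β * x * Complex.exp β) - r₂ α β * (Complex.exp α + Complex.exp β))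
        (l := fun _ => 0) ?_ ?_ ?_
      · intro u x v; rw [eval_dualMPlus_of_eq h4]; ring
      · rintro x ⟨-, h5, h6, -⟩
        have h7 : r₁ α β * x = 0 := by
          apply mul_left_cancel₀ (sub_ne_zero.mpr fun h0 : Complex.exp α = Complex.exp β =>
            hA (by rw [h0]))
          linear_combination h5 + h6
        exact hs (by linear_combination h5 - Complex.exp α * h7)
      · refine ⟨0, ?_⟩
        have := pow_ne_zero 2 hs
        intro h0
        exact this (by linear_combination h0)
    · refine KleinQuad.isBoundary_of_pencil (eval_dualMPlus hE) ?_ (hK.disc _ _ _ hdet)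
      intro x hx
      obtain ⟨hB, hAx⟩ := coeffs_indep hA hx
      -- at `x = 0` for H3(0), where `S` vanishes, `r₄ ≠ 0` is needed
      by_cases hx0 : E ≠ H3 0 ∨ x ≠ 0
      · have hA0 := hAx hx0
        exact hdet (by linear_combination -(r₂ α β) * hA0 + (r₁ α β) * hB)
      · push Not at hx0
        obtain ⟨rfl, rfl⟩ := hx0
        exact hE ⟨rfl, by simpa using hB⟩
  · by_cases hE : E = H3 0 ∧ r₄ α β = 0
    · obtain ⟨rfl, h4⟩ := hE
      refine ⟨X 0, fun x u v => ?_⟩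
      rw [eval_dualMPlus_of_eq h4, hq, hq, h4]
      simp [coeffs, KleinQuad.S, KleinQuad.T]
      ring
    · refine ⟨1, fun x u v => ?_⟩
      rw [eval_dualMPlus hE, hq, hq, map_one]
      ring
  · by_cases hE : E = H3 0 ∧ r₄ α β = 0
    · obtain ⟨rfl, h4⟩ := hE
      by_cases hr1 : r₁ α β = 0
      · obtain ⟨x, hx⟩ := exists_diag_self_ne hA (by simp [HasMMinus])
        refine KleinQuad.not_dvd_diag_of_eval ⟨x, 0, x, ?_, hx⟩
        rw [eval_dualMPlus_of_eq h4]; ring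
      · refine KleinQuad.not_dvd_diag_of_middle (KleinQuad.exists_diag_ne hK.a_ne hK.b_ne)
          ⟨1, 1, 0, 0, ?_⟩
        rw [eval_dualMPlus_of_eq h4, eval_dualMPlus_of_eq h4]
        intro h0
        exact mul_ne_zero hr1 (Complex.exp_ne_zero α) (by linear_combination h0)
    · exact hK.not_dvd_diag_pencil (eval_dualMPlus hE) hdet

theorem kappa_ne_zero {E : ABS} {α β : ℂ} (h : E.Admissible α β) : E.kappa α β ≠ 0 := by
  cases E with
  | Q1 δ | Q2 | A1 δ => exact sub_ne_zero.mpr h.2.2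
  | Q3 δ | A2 => exact h.2.2
  | Q4 k => exact h.2.2.1
  | H1 | H2 => exact sub_ne_zero.mpr h
  | H3 δ =>
    refine sub_ne_zero.mpr fun h0 => h ?_
    rw [h0]

theorem kappa_antisymm {E : ABS} {α β : ℂ} (hE : E.Regular α β) (hE' : E.Regular β α) :
    E.kappa β α = -E.kappa α β := by
  cases E with
  | Q3 δ | A2 => simp only [kappa]; rw [← Complex.sinh_neg, neg_sub]
  | Q4 k =>
    simp only [kappa]
    have h1 : AnalyticAt ℂ (jacobiSn k) (-(α - β)) := by rw [neg_sub]; exact hE'.2.2.2.2.2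
    rw [← jacobiSn_odd hE.2.2.2.2.2 h1, neg_sub]
  | _ => simp only [kappa]; ring

theorem mMinus_parity (α β : ℂ) : mMinus α β = C (-1) * rev (mMinus β α) := by
  refine tri_ext fun x u y => ?_
  simp [mMinus]

theorem eval_mMinus (α β x u y : ℂ) : eval ![x, u, y] (mMinus α β) = x - y := by
  simp [mMinus]

theorem eval_dualMMinus {E : ABS} (h : E ≠ H3 0) (α β u x v : ℂ) :
    eval ![u, x, v] (E.dualMMinus α β) = (E.kappa α β)⁻¹ *
      (-(E.coeffs α β).S x u v - (E.coeffs α β).T x u v * x) := by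
  rw [dualMMinus, if_neg h]
  simp [eval_coeffS, eval_coeffT]

theorem eval_dualMMinus_H3 (α β u x v : ℂ) :
    eval ![u, x, v] ((H3 0).dualMMinus α β) = -(u + v) := by
  simp [dualMMinus]

theorem dualMMinus_parity {E : ABS} {α β : ℂ} (hE : E.Regular α β) (hE' : E.Regular β α) :
    E.dualMMinus α β = C 1 * rev (E.dualMMinus β α) := by
  refine tri_ext fun u x v => ?_
  rw [map_mul, eval_rev, eval_C]
  by_cases h : E = H3 0
  · subst h
    rw [eval_dualMMinus_H3, eval_dualMMinus_H3]; ring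
  · rw [eval_dualMMinus h, eval_dualMMinus h, kappa_antisymm hE hE',
      (coeffs_eq_neg_swap hE hE' x v u).1, (coeffs_eq_neg_swap hE hE' x v u).2, inv_neg]
    ring

theorem isDualTo_mMinus {E : ABS} {D : Set (ℂ × ℂ)} (hD : E.IsParameterDomain D)
    (hE : E.HasMMinus) : IsDualTo E.bulk D mMinus E.dualMMinus ∧
      IsDualTo E.bulk D E.dualMMinus mMinus := by
  refine isDualTo_and_symm hD
    ⟨-1, .inr rfl, fun α β h => mMinus_parity α β⟩
    ⟨1, .inl rfl, fun α β h => dualMMinus_parity (hD.regular _ _ h)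
      (hD.regular _ _ (hD.symm _ _ h))⟩ fun α β h => ?_
  have hA := hD.admissible h
  have hK := coeffs_generic hA
  have hκ := kappa_ne_zero hA
  obtain ⟨x₀, hx₀⟩ := exists_diag_self_ne hA hE
  refine ⟨isBoundary_moebius (r₁ := 0) (r₂ := 1) (r₃ := -1) (r₄ := 0)
    (fun x u y => by rw [eval_mMinus]; ring) (by norm_num), ?_, ?_,
    KleinQuad.not_dvd_diag_of_eval ⟨x₀, 0, x₀, by rw [eval_mMinus]; ring, hx₀⟩, ?_⟩
  · by_cases h3 : E = H3 0
    · subst h3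
      exact isBoundary_moebius (r₁ := 0) (r₂ := -1) (r₃ := -1) (r₄ := 0)
        (fun x u y => by rw [eval_dualMMinus_H3]; ring) (by norm_num)
    · refine KleinQuad.isBoundary_of_pencil (K := E.coeffs α β) (A := fun _ => -(E.kappa α β)⁻¹)
        (B := fun x => (E.kappa α β)⁻¹ * x) ?_ ?_ ⟨x₀, ?_⟩
      · intro u x v; rw [eval_dualMMinus h3]; ring
      · intro x hx
        exact neg_ne_zero.mpr (inv_ne_zero hκ) ((coeffs_indep hA hx).2 (.inl h3))
      · rw [KleinQuad.pencilDisc_eq_diag (y := x₀) _ _ (by ring)]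
        exact mul_ne_zero (pow_ne_zero 2 (neg_ne_zero.mpr (inv_ne_zero hκ))) hx₀
  · by_cases h3 : E = H3 0
    · subst h3
      refine ⟨C ((H3 0).kappa α β) * X 0, fun x u v => ?_⟩
      rw [eval_dualMMinus_H3, eval_mMinus, eval_mMinus]
      simp [coeffs, KleinQuad.S, KleinQuad.T, kappa]
      ring
    · refine ⟨C (E.kappa α β), fun x u v => ?_⟩
      rw [eval_dualMMinus h3, eval_mMinus, eval_mMinus, eval_C]
      field_simp
      ring
  · by_cases h3 : E = H3 0
    · subst h3
      have hA : Complex.exp α ^ 2 ≠ Complex.exp β ^ 2 := hA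
      refine KleinQuad.not_dvd_diag_of_eval ⟨1, 0, -1, by rw [eval_dualMMinus_H3]; ring, ?_⟩
      simp only [coeffs, KleinQuad.diag]
      have : (Complex.exp α + Complex.exp β) ^ 2 ≠ 0 := by
        refine pow_ne_zero 2 fun h0 => hA ?_
        linear_combination (Complex.exp α - Complex.exp β) * h0
      intro h0
      exact this (by linear_combination h0)
    · refine KleinQuad.not_dvd_diag_of_middle (KleinQuad.exists_diag_ne hK.a_ne hK.b_ne) ?_
      by_contra! h0
      have h' : ∀ u v x, eval ![u, x, v] (E.dualMMinus α β) = eval ![u, 0, v] (E.dualMMinus α β) :=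
        fun u v x => h0 u x 0 v
      simp only [eval_dualMMinus h3, mul_right_inj' (inv_ne_zero hκ), KleinQuad.S,
        KleinQuad.T] at h'
      have e1 : (E.coeffs α β).c = 0 := by linear_combination (-1 / 2) * (h' 0 0 1 + h' 0 0 (-1))
      have e2 : (E.coeffs α β).f = 0 := by linear_combination (-1 / 4) * (h' 0 0 1 - h' 0 0 (-1))
      have e3 : (E.coeffs α β).a + (E.coeffs α β).b = 0 := by
        linear_combination -(h' 1 0 1 - h' 0 0 1)
      have e4 : (E.coeffs α β).e = 0 := by
        linear_combination -(h' 1 1 1 - h' 1 0 1 - h' 0 1 1 + h' 0 0 1)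
      -- then `diag x x = 0` for all `x`
      apply hx₀
      simp only [KleinQuad.diag, e1, e2, e4]
      linear_combination (-x₀ ^ 2 * ((E.coeffs α β).a + (E.coeffs α β).b)) * e3

end ABS

/-! ### The singular pairs are dual pairs -/

theorem exists_ne_of_second_difference {F : ℂ → ℂ} (h : F 1 + F (-1) - 2 * F 0 ≠ 0) :
    ∃ t, F t ≠ 0 := by
  by_contra! h0
  apply h; simp [h0]

/-- What has to be checked for a pair of the singular case. -/
structure SingularData (K : KleinQuad) (q p : TriPoly) : Prop where
  left : IsBoundary q
  right : IsBoundary p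
  elim : ∃ χ, K.Elim q p χ
  middle_left : ∃ x u u' y, eval ![x, u, y] q ≠ eval ![x, u', y] q
  middle_right : (∃ x u u' y, eval ![x, u, y] p ≠ eval ![x, u', y] p) ∨
    ∃ k : ℂ, k ≠ 0 ∧ (∃ x, K.diag x x ≠ 0) ∧ ∀ u x v, eval ![u, x, v] p = k * (u - v)

theorem sq_ne_sq_iff {a b : ℂ} : a ^ 2 ≠ b ^ 2 ↔ a + b ≠ 0 ∧ a - b ≠ 0 := by
  rw [← not_iff_not, not_not, not_and_or, not_not, not_not, ← sub_eq_zero, sq_sub_sq, mul_eq_zero]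

namespace ABS

theorem singularData_Q1 {δ α β ε a b c₀ c₁ : ℂ} (h : (Q1 δ).Admissible α β)
    (hε : ε = 1 ∨ ε = -1) (ha : (Q1 δ).Uniformizes ε α a) (hb : (Q1 δ).Uniformizes ε β b)
    (hc : c₀ ≠ 0 ∨ c₁ ≠ 0) : SingularData ((Q1 δ).coeffs α β)
      (C c₀ * (Q1 δ).q₀ a b + C c₁ * (Q1 δ).q₁ a b)
      (C c₀ * (Q1 δ).p₀ a b + C c₁ * (Q1 δ).p₁ a b) := by
  obtain ⟨hα, hβ, hαβ⟩ := h
  have hε2 : ε ^ 2 = 1 := by rcases hε with rfl | rfl <;> norm_num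
  simp only [Uniformizes] at ha hb
  obtain rfl : α = ε * a ^ 2 := by rw [← ha]; linear_combination -α * hε2
  obtain rfl : β = ε * b ^ 2 := by rw [← hb]; linear_combination -β * hε2
  have ha : a ≠ 0 := by rintro rfl; simp at hα
  have hb : b ≠ 0 := by rintro rfl; simp at hβ
  obtain ⟨hp, hm⟩ := sq_ne_sq_iff.mp (fun h0 : a ^ 2 = b ^ 2 => hαβ (by rw [h0]))
  have hc' : c₀ ≠ 0 ∨ c₀ = 0 ∧ c₁ ≠ 0 := by tauto
  refine ⟨isBoundary_of_eval (m := fun u => c₀ * (a + b))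
      (n := fun u => -c₀ * (a * u - δ * a * b ^ 2) + c₁ * b)
      (k := fun u => -c₀ * (b * u - δ * a ^ 2 * b) + c₁ * a)
      (l := fun u => c₁ * (a + b) * (δ * a * b - u)) ?_ ?_ ?_,
    isBoundary_of_eval (m := fun x => -c₀ * (a - b))
      (n := fun x => c₀ * a * x + c₁ * b)
      (k := fun x => -c₀ * b * x - c₁ * a)
      (l := fun x => (c₀ * δ * a * b + c₁) * (a - b) * (δ * a * b + x)) ?_ ?_ ?_,
    ⟨C (ε * b * (a + b)) * (X 0 - X 1 + C (δ * a ^ 2)), fun x u v => ?_⟩, ?_, ?_⟩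
  · intro x u y; simp [q₀, q₁]; ring
  · rintro u ⟨h1, h2, h3, h4⟩
    have e0 : c₀ = 0 :=
      mul_left_cancel₀ hp (by linear_combination h1)
    have e1 : c₁ = 0 := by
      subst e0
      exact mul_left_cancel₀ hb (by linear_combination h2)
    exact hc.elim (· e0) (· e1)
  · obtain h0 | ⟨rfl, h1⟩ := hc'
    · refine exists_ne_of_second_difference fun h => ?_
      have : c₀ ^ 2 * a * b ≠ 0 := by positivity
      exact this (by linear_combination (-1 / 2) * h)
    · refine ⟨0, fun h => ?_⟩
      have : c₁ ^ 2 * a * b ≠ 0 := by positivity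
      exact this (by linear_combination (-1) * h)
  · intro u x v; simp [p₀, p₁]; ring
  · rintro x ⟨h1, h2, h3, h4⟩
    have e0 : c₀ = 0 :=
      mul_left_cancel₀ hm (by linear_combination -h1)
    have e1 : c₁ = 0 := by
      subst e0
      exact mul_left_cancel₀ hb (by linear_combination h2)
    exact hc.elim (· e0) (· e1)
  · obtain h0 | ⟨rfl, h1⟩ := hc'
    · refine exists_ne_of_second_difference fun h => ?_
      have : c₀ ^ 2 * a * b ≠ 0 := by positivity
      exact this (by linear_combination (1 / 2) * h)
    · refine ⟨0, fun h => ?_⟩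
      have : c₁ ^ 2 * a * b ≠ 0 := by positivity
      exact this (by linear_combination h)
  · simp [coeffs, q₀, q₁, p₀, p₁, KleinQuad.S, KleinQuad.T, -mul_eq_mul_left_iff]
    linear_combination (δ^2 * ε * (a^2*b^2 *(a^2-b^2)) *(c₀*((a+b)*x-(b*u-δ*a^2*b))+c₁*a)) * hε2
  · obtain h0 | ⟨rfl, h1⟩ := hc'
    · by_contra! h
      have : c₀ * a ≠ 0 := by positivity
      simp only [q₀, q₁, map_add, map_sub, map_mul, eval_C, eval_X,
        Matrix.cons_val_zero, Matrix.cons_val_one, Matrix.cons_val] at h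
      exact this (by linear_combination (-1) * (h 1 1 0 0 - h 0 1 0 0))
    · by_contra! h
      have : c₁ * (a + b) ≠ 0 := by positivity
      simp only [q₀, q₁, map_add, map_sub, map_mul, eval_C, eval_X,
        Matrix.cons_val_zero, Matrix.cons_val_one, Matrix.cons_val] at h
      exact this (by linear_combination (-1) * (h 0 1 0 0))
  · obtain h0 | ⟨rfl, h1⟩ := hc'
    · left
      by_contra! h
      have : c₀ * a ≠ 0 := by positivity
      simp only [p₀, p₁, map_add, map_sub, map_mul, map_neg, eval_C, eval_X,
        Matrix.cons_val_zero, Matrix.cons_val_one, Matrix.cons_val] at h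
      exact this (by linear_combination (h 1 1 0 0 - h 0 1 0 0))
    · left
      by_contra! h
      have : c₁ * (a - b) ≠ 0 := by positivity
      simp only [p₀, p₁, map_add, map_sub, map_mul, map_neg, eval_C, eval_X,
        Matrix.cons_val_zero, Matrix.cons_val_one, Matrix.cons_val] at h
      exact this (by linear_combination (h 0 1 0 0))

theorem singularData_A1 {δ α β ε a b c₀ c₁ : ℂ} (h : (A1 δ).Admissible α β)
    (hε : ε = 1 ∨ ε = -1) (ha : (A1 δ).Uniformizes ε α a) (hb : (A1 δ).Uniformizes ε β b)
    (hc : c₀ ≠ 0 ∨ c₁ ≠ 0) : SingularData ((A1 δ).coeffs α β)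
      (C c₀ * (A1 δ).q₀ a b + C c₁ * (A1 δ).q₁ a b)
      (C c₀ * (A1 δ).p₀ a b + C c₁ * (A1 δ).p₁ a b) := by
  obtain ⟨hα, hβ, hαβ⟩ := h
  have hε2 : ε ^ 2 = 1 := by rcases hε with rfl | rfl <;> norm_num
  simp only [Uniformizes] at ha hb
  obtain rfl : α = ε * a ^ 2 := by rw [← ha]; linear_combination -α * hε2
  obtain rfl : β = ε * b ^ 2 := by rw [← hb]; linear_combination -β * hε2
  have ha : a ≠ 0 := by rintro rfl; simp at hα
  have hb : b ≠ 0 := by rintro rfl; simp at hβ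
  obtain ⟨hp, hm⟩ := sq_ne_sq_iff.mp (fun h0 : a ^ 2 = b ^ 2 => hαβ (by rw [h0]))
  have hc' : c₀ ≠ 0 ∨ c₀ = 0 ∧ c₁ ≠ 0 := by tauto
  refine ⟨isBoundary_of_eval (m := fun u => c₀ * (a + b))
      (n := fun u => c₀ * (a * u + δ * a * b ^ 2) + c₁ * b)
      (k := fun u => c₀ * (b * u + δ * a ^ 2 * b) + c₁ * a)
      (l := fun u => c₁ * (a + b) * (δ * a * b + u)) ?_ ?_ ?_,
    isBoundary_of_eval (m := fun x => c₀ * (a - b))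
      (n := fun x => c₀ * a * x + c₁ * b)
      (k := fun x => -c₀ * b * x - c₁ * a)
      (l := fun x => -(c₀ * δ * a * b + c₁) * (a - b) * (δ * a * b + x)) ?_ ?_ ?_,
    ⟨C (ε * b * (a + b)) * (X 0 + X 1 + C (δ * a ^ 2)), fun x u v => ?_⟩, ?_, ?_⟩
  · intro x u y; simp [q₀, q₁]; ring
  · rintro u ⟨h1, h2, h3, h4⟩
    have e0 : c₀ = 0 :=
      mul_left_cancel₀ hp (by linear_combination h1)
    have e1 : c₁ = 0 := by
      subst e0
      exact mul_left_cancel₀ hb (by linear_combination h2)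
    exact hc.elim (· e0) (· e1)
  · obtain h0 | ⟨rfl, h1⟩ := hc'
    · refine exists_ne_of_second_difference fun h => ?_
      have : c₀ ^ 2 * a * b ≠ 0 := by positivity
      exact this (by linear_combination (-1 / 2) * h)
    · refine ⟨0, fun h => ?_⟩
      have : c₁ ^ 2 * a * b ≠ 0 := by positivity
      exact this (by linear_combination (-1) * h)
  · intro u x v; simp [p₀, p₁]; ring
  · rintro x ⟨h1, h2, h3, h4⟩
    have e0 : c₀ = 0 :=
      mul_left_cancel₀ hm (by linear_combination h1)
    have e1 : c₁ = 0 := by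
      subst e0
      exact mul_left_cancel₀ hb (by linear_combination h2)
    exact hc.elim (· e0) (· e1)
  · obtain h0 | ⟨rfl, h1⟩ := hc'
    · refine exists_ne_of_second_difference fun h => ?_
      have : c₀ ^ 2 * a * b ≠ 0 := by positivity
      exact this (by linear_combination (1 / 2) * h)
    · refine ⟨0, fun h => ?_⟩
      have : c₁ ^ 2 * a * b ≠ 0 := by positivity
      exact this (by linear_combination h)
  · simp [coeffs, q₀, q₁, p₀, p₁, KleinQuad.S, KleinQuad.T, -mul_eq_mul_left_iff]
    linear_combination (-δ^2 * ε * (a^2*b^2 *(a^2-b^2)) *(c₀*((a+b)*x+(b*u+δ*a^2*b))+c₁*a)) * hε2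
  · obtain h0 | ⟨rfl, h1⟩ := hc'
    · by_contra! h
      have : c₀ * a ≠ 0 := by positivity
      simp only [q₀, q₁, map_add, map_mul, eval_C, eval_X,
        Matrix.cons_val_zero, Matrix.cons_val_one, Matrix.cons_val] at h
      exact this (by linear_combination (h 1 1 0 0 - h 0 1 0 0))
    · by_contra! h
      have : c₁ * (a + b) ≠ 0 := by positivity
      simp only [q₀, q₁, map_add, map_mul, eval_C, eval_X,
        Matrix.cons_val_zero, Matrix.cons_val_one, Matrix.cons_val] at h
      exact this (by linear_combination (h 0 1 0 0))
  · obtain h0 | ⟨rfl, h1⟩ := hc'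
    · left
      by_contra! h
      have : c₀ * a ≠ 0 := by positivity
      simp only [p₀, p₁, map_add, map_sub, map_mul, eval_C, eval_X,
        Matrix.cons_val_zero, Matrix.cons_val_one, Matrix.cons_val] at h
      exact this (by linear_combination (h 1 1 0 0 - h 0 1 0 0))
    · left
      by_contra! h
      have : c₁ * (a - b) ≠ 0 := by positivity
      simp only [p₀, p₁, map_add, map_sub, map_mul, eval_C, eval_X,
        Matrix.cons_val_zero, Matrix.cons_val_one, Matrix.cons_val] at h
      exact this (by linear_combination (-1) * (h 0 1 0 0))

theorem sinh_eq_of_exp_eq_cosh {ε α a : ℂ} (hε : ε = 1 ∨ ε = -1)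
    (h : Complex.exp (ε * α) = Complex.cosh a) : Complex.cosh a ≠ 0 ∧
    Complex.sinh α = ε * Complex.sinh a ^ 2 / (2 * Complex.cosh a) ∧
    Complex.cosh α = (Complex.cosh a ^ 2 + 1) / (2 * Complex.cosh a) := by
  have h0 : Complex.cosh a ≠ 0 := h ▸ Complex.exp_ne_zero _
  have h1 : Complex.sinh (ε * α) = Complex.sinh a ^ 2 / (2 * Complex.cosh a) := by
    rw [Complex.sinh, Complex.exp_neg, h, Complex.sinh_sq]; field_simp
  have h2 : Complex.cosh (ε * α) = (Complex.cosh a ^ 2 + 1) / (2 * Complex.cosh a) := by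
    rw [Complex.cosh, Complex.exp_neg, h]; field_simp
  refine ⟨h0, ?_, ?_⟩
  · rcases hε with rfl | rfl
    · rw [one_mul] at h1; rw [h1]; ring
    · rw [neg_one_mul, Complex.sinh_neg] at h1; rw [← neg_neg (Complex.sinh α), h1]; ring
  · rcases hε with rfl | rfl
    · rwa [one_mul] at h2
    · rwa [neg_one_mul, Complex.cosh_neg] at h2

theorem sinh_uniformize {ε α β a b : ℂ} (hε : ε = 1 ∨ ε = -1) (hα : Complex.sinh α ≠ 0)
    (hβ : Complex.sinh β ≠ 0) (hαβ : Complex.sinh (α - β) ≠ 0)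
    (ha : Complex.exp (ε * α) = Complex.cosh a) (hb : Complex.exp (ε * β) = Complex.cosh b) :
    Complex.sinh α = ε * Complex.sinh a ^ 2 / (2 * Complex.cosh a) ∧
    Complex.sinh β = ε * Complex.sinh b ^ 2 / (2 * Complex.cosh b) ∧
    Complex.sinh (α - β) = ε * (Complex.sinh a ^ 2 - Complex.sinh b ^ 2)
      / (2 * Complex.cosh a * Complex.cosh b) ∧
    Complex.cosh a ≠ 0 ∧ Complex.cosh b ≠ 0 ∧ Complex.sinh a ≠ 0 ∧ Complex.sinh b ≠ 0 ∧
    Complex.sinh a + Complex.sinh b ≠ 0 ∧ Complex.sinh a - Complex.sinh b ≠ 0 ∧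
    (Complex.sinh (a + b) ≠ 0 ∧ Complex.sinh (a - b) ≠ 0) := by
  obtain ⟨hP, hs, hc⟩ := sinh_eq_of_exp_eq_cosh hε ha
  obtain ⟨hR, hs', hc'⟩ := sinh_eq_of_exp_eq_cosh hε hb
  have hd : Complex.sinh (α - β) = ε * (Complex.sinh a ^ 2 - Complex.sinh b ^ 2)
      / (2 * Complex.cosh a * Complex.cosh b) := by
    rw [Complex.sinh_sub, hs, hs', hc, hc', Complex.sinh_sq, Complex.sinh_sq]; field_simp; ring
  have hne := sq_ne_sq_iff.mp (fun h0 : Complex.sinh a ^ 2 = Complex.sinh b ^ 2 =>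
    hαβ (by rw [hd, h0]; simp))
  have hprod : Complex.sinh (a + b) * Complex.sinh (a - b)
      = (Complex.sinh a + Complex.sinh b) * (Complex.sinh a - Complex.sinh b) := by
    rw [Complex.sinh_add, Complex.sinh_sub]
    linear_combination Complex.sinh a ^ 2 * Complex.cosh_sq b
      - Complex.sinh b ^ 2 * Complex.cosh_sq a
  refine ⟨hs, hs', hd, hP, hR, ?_, ?_, hne.1, hne.2, ?_⟩
  · intro h0; rw [h0] at hs; exact hα (by rw [hs]; simp)
  · intro h0; rw [h0] at hs'; exact hβ (by rw [hs']; simp)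
  · rw [← mul_ne_zero_iff, hprod]; exact mul_ne_zero hne.1 hne.2

theorem singularData_Q3 {α β ε a b c₀ c₁ : ℂ} (h : (Q3 0).Admissible α β)
    (hε : ε = 1 ∨ ε = -1) (ha : (Q3 0).Uniformizes ε α a) (hb : (Q3 0).Uniformizes ε β b)
    (hc : c₀ ≠ 0 ∨ c₁ ≠ 0) : SingularData ((Q3 0).coeffs α β)
      (C c₀ * (Q3 0).q₀ a b + C c₁ * (Q3 0).q₁ a b)
      (C c₀ * (Q3 0).p₀ a b + C c₁ * (Q3 0).p₁ a b) := by
  obtain ⟨hα, hβ, hαβ⟩ := h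
  obtain ⟨hs, hs', hs'', hP, hR, hA, hB, hp, hm, hp', hm'⟩ := sinh_uniformize hε hα hβ hαβ ha hb
  have hP2 := Complex.cosh_sq a
  have hR2 := Complex.cosh_sq b
  have hp'' := Complex.sinh_add a b
  have hm'' := Complex.sinh_sub a b
  set A := Complex.sinh a
  set P := Complex.cosh a
  set B := Complex.sinh b
  set R := Complex.cosh b
  have hc' : c₀ ≠ 0 ∨ c₀ = 0 ∧ c₁ ≠ 0 := by tauto
  refine ⟨isBoundary_of_eval (m := fun u => c₀ * (A + B))
      (n := fun u => -c₀ * A * R * u + c₁ * B)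
      (k := fun u => -c₀ * P * B * u + c₁ * A)
      (l := fun u => -c₁ * Complex.sinh (a + b) * u) ?_ ?_ ?_,
    isBoundary_of_eval (m := fun x => -c₀ * (A + B) * (A - B))
      (n := fun x => c₀ * (A + B) * A * R * x + c₁ * Complex.sinh (a + b) * B)
      (k := fun x => -c₀ * (A + B) * P * B * x - c₁ * Complex.sinh (a + b) * A)
      (l := fun x => c₁ * Complex.sinh (a + b) * Complex.sinh (a - b) * x) ?_ ?_ ?_,
    ⟨C (ε * B / (2 * P * R)) * (X 0 - C P * X 1), fun x u v => ?_⟩, ?_, ?_⟩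
  · intro x u y; simp [q₀, q₁]; ring
  · rintro u ⟨h1, h2, h3, h4⟩
    have e0 : c₀ = 0 :=
      mul_left_cancel₀ hp (by linear_combination h1)
    have e1 : c₁ = 0 := by
      subst e0
      exact mul_left_cancel₀ hB (by linear_combination h2)
    exact hc.elim (· e0) (· e1)
  · obtain h0 | ⟨rfl, h1⟩ := hc'
    · refine exists_ne_of_second_difference fun h => ?_
      have : c₀ ^ 2 * (A * R * P * B) ≠ 0 := by positivity
      exact this (by linear_combination (-1 / 2) * h)
    · refine ⟨0, fun h => ?_⟩
      have : c₁ ^ 2 * A * B ≠ 0 := by positivity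
      exact this (by linear_combination (-1) * h)
  · intro u x v; simp [p₀, p₁]; ring
  · rintro x ⟨h1, h2, h3, h4⟩
    have e0 : c₀ = 0 := by
      exact mul_left_cancel₀ (mul_ne_zero hp hm) (by linear_combination -h1)
    have e1 : c₁ = 0 := by
      subst e0
      exact mul_left_cancel₀ (mul_ne_zero hp' hB) (by linear_combination h2)
    exact hc.elim (· e0) (· e1)
  · obtain h0 | ⟨rfl, h1⟩ := hc'
    · refine exists_ne_of_second_difference fun h => ?_
      have : c₀ ^ 2 * (A + B) ^ 2 * (A * R * P * B) ≠ 0 := by positivity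
      exact this (by linear_combination (1 / 2) * h)
    · refine ⟨0, fun h => ?_⟩
      have : c₁ ^ 2 * Complex.sinh (a + b) ^ 2 * A * B ≠ 0 := by positivity
      exact this (by linear_combination h)
  · simp [coeffs, q₀, q₁, p₀, p₁, KleinQuad.S, KleinQuad.T, -mul_eq_mul_left_iff]
    rw [hs, hs', hs'', hp'', hm'']
    simp only [A, B, P, R, Complex.sinh, Complex.cosh, Complex.exp_neg] at hP hR ⊢
    have e1 := Complex.exp_ne_zero a
    have e2 := Complex.exp_ne_zero b
    generalize Complex.exp a = F at *
    generalize Complex.exp b = G at *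
    have hP' : F ^ 2 + 1 ≠ 0 := by intro h; apply hP; field_simp; simp [h]
    have hR' : G ^ 2 + 1 ≠ 0 := by intro h; apply hR; field_simp; simp [h]
    field_simp
    ring
  · obtain h0 | ⟨rfl, h1⟩ := hc'
    · by_contra! h
      have : c₀ * A * R ≠ 0 := by positivity
      simp only [q₀, q₁, map_add, map_sub, map_mul, eval_C, eval_X,
        Matrix.cons_val_zero, Matrix.cons_val_one, Matrix.cons_val] at h
      exact this (by linear_combination (-1) * (h 1 1 0 0 - h 0 1 0 0))
    · by_contra! h
      have : c₁ * Complex.sinh (a + b) ≠ 0 := by positivity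
      simp only [q₀, q₁, map_add, map_sub, map_mul, eval_C, eval_X,
        Matrix.cons_val_zero, Matrix.cons_val_one, Matrix.cons_val] at h
      exact this (by linear_combination (-1) * (h 0 1 0 0))
  · obtain h0 | ⟨rfl, h1⟩ := hc'
    · left
      by_contra! h
      have : c₀ * (A + B) * A * R ≠ 0 := by positivity
      simp only [p₀, p₁, map_add, map_sub, map_mul, map_neg, eval_C, eval_X,
        Matrix.cons_val_zero, Matrix.cons_val_one, Matrix.cons_val] at h
      exact this (by linear_combination (h 1 1 0 0 - h 0 1 0 0))
    · left
      by_contra! h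
      have : c₁ * Complex.sinh (a + b) * Complex.sinh (a - b) ≠ 0 := by positivity
      simp only [p₀, p₁, map_add, map_sub, map_mul, map_neg, eval_C, eval_X,
        Matrix.cons_val_zero, Matrix.cons_val_one, Matrix.cons_val] at h
      exact this (by linear_combination (h 0 1 0 0))

theorem singularData_A2 {α β ε a b c₀ c₁ : ℂ} (h : A2.Admissible α β)
    (hε : ε = 1 ∨ ε = -1) (ha : A2.Uniformizes ε α a) (hb : A2.Uniformizes ε β b)
    (hc : c₀ ≠ 0 ∨ c₁ ≠ 0) : SingularData (A2.coeffs α β)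
      (C c₀ * A2.q₀ a b + C c₁ * A2.q₁ a b)
      (C c₀ * A2.p₀ a b + C c₁ * A2.p₁ a b) := by
  obtain ⟨hα, hβ, hαβ⟩ := h
  obtain ⟨hs, hs', hs'', hP, hR, hA, hB, hp, hm, hp', hm'⟩ := sinh_uniformize hε hα hβ hαβ ha hb
  have hP2 := Complex.cosh_sq a
  have hR2 := Complex.cosh_sq b
  have hp'' := Complex.sinh_add a b
  have hm'' := Complex.sinh_sub a b
  set A := Complex.sinh a
  set P := Complex.cosh a
  set B := Complex.sinh b
  set R := Complex.cosh b
  have hc' : c₀ ≠ 0 ∨ c₀ = 0 ∧ c₁ ≠ 0 := by tauto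
  refine ⟨isBoundary_of_eval (m := fun u => c₀ * (A + B) * u)
      (n := fun u => -c₀ * A * R + c₁ * B * u)
      (k := fun u => -c₀ * P * B + c₁ * A * u)
      (l := fun u => -c₁ * Complex.sinh (a + b)) ?_ ?_ ?_,
    isBoundary_of_eval (m := fun x => c₁ * Complex.sinh (a + b) * Complex.sinh (a - b) * x)
      (n := fun x => -c₀ * (A + B) * P * B * x - c₁ * Complex.sinh (a + b) * A)
      (k := fun x => c₀ * (A + B) * A * R * x + c₁ * Complex.sinh (a + b) * B)
      (l := fun x => -c₀ * (A + B) * (A - B)) ?_ ?_ ?_,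
    ⟨C (ε * B / (2 * P * R)) * (X 0 * X 1 - C P), fun x u v => ?_⟩, ?_, ?_⟩
  · intro x u y; simp [q₀, q₁]; ring
  · rintro u ⟨h1, h2, h3, h4⟩
    have e1 : c₁ = 0 := by
      exact mul_left_cancel₀ hp' (by linear_combination -h4)
    have e0 : c₀ = 0 := by
      subst e1
      exact mul_left_cancel₀ (mul_ne_zero hA hR) (by linear_combination -h2)
    exact hc.elim (· e0) (· e1)
  · obtain h0 | ⟨rfl, h1⟩ := hc'
    · refine ⟨0, fun h => ?_⟩
      have : c₀ ^ 2 * (A * R * P * B) ≠ 0 := by positivity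
      exact this (by linear_combination (-1) * h)
    · refine ⟨1, fun h => ?_⟩
      have : c₁ ^ 2 * A * B ≠ 0 := by positivity
      exact this (by linear_combination (-1) * h)
  · intro u x v; simp [p₀, p₁]; ring
  · rintro x ⟨h1, h2, h3, h4⟩
    have e0 : c₀ = 0 := by
      exact mul_left_cancel₀ (mul_ne_zero hp hm) (by linear_combination -h4)
    have e1 : c₁ = 0 := by
      subst e0
      exact mul_left_cancel₀ (mul_ne_zero hp' hA) (by linear_combination -h2)
    exact hc.elim (· e0) (· e1)
  · obtain h0 | ⟨rfl, h1⟩ := hc'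
    · refine exists_ne_of_second_difference fun h => ?_
      have : c₀ ^ 2 * (A + B) ^ 2 * (A * R * P * B) ≠ 0 := by positivity
      exact this (by linear_combination (1 / 2) * h)
    · refine ⟨0, fun h => ?_⟩
      have : c₁ ^ 2 * Complex.sinh (a + b) ^ 2 * A * B ≠ 0 := by positivity
      exact this (by linear_combination h)
  · simp [coeffs, q₀, q₁, p₀, p₁, KleinQuad.S, KleinQuad.T, -mul_eq_mul_left_iff]
    rw [hs, hs', hs'', hp'', hm'']
    simp only [A, B, P, R, Complex.sinh, Complex.cosh, Complex.exp_neg] at hP hR ⊢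
    have e1 := Complex.exp_ne_zero a
    have e2 := Complex.exp_ne_zero b
    generalize Complex.exp a = F at *
    generalize Complex.exp b = G at *
    have hP' : F ^ 2 + 1 ≠ 0 := by intro h; apply hP; field_simp; simp [h]
    have hR' : G ^ 2 + 1 ≠ 0 := by intro h; apply hR; field_simp; simp [h]
    field_simp
    ring
  · obtain h0 | ⟨rfl, h1⟩ := hc'
    · by_contra! h
      have : c₀ * (A + B) ≠ 0 := by positivity
      simp only [q₀, q₁, map_add, map_sub, map_mul, eval_C, eval_X,
        Matrix.cons_val_zero, Matrix.cons_val_one, Matrix.cons_val] at h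
      exact this (by linear_combination (h 1 1 0 1 - h 1 1 0 0 - h 0 1 0 1 + h 0 1 0 0))
    · by_contra! h
      have : c₁ * B ≠ 0 := by positivity
      simp only [q₀, q₁, map_add, map_sub, map_mul, eval_C, eval_X,
        Matrix.cons_val_zero, Matrix.cons_val_one, Matrix.cons_val] at h
      exact this (by linear_combination (h 1 1 0 0 - h 0 1 0 0))
  · obtain h0 | ⟨rfl, h1⟩ := hc'
    · left
      by_contra! h
      have : c₀ * (A + B) * P * B ≠ 0 := by positivity
      simp only [p₀, p₁, map_add, map_sub, map_mul, map_neg, eval_C, eval_X,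
        Matrix.cons_val_zero, Matrix.cons_val_one, Matrix.cons_val] at h
      exact this (by linear_combination (-1) * (h 1 1 0 0 - h 0 1 0 0))
    · left
      by_contra! h
      have : c₁ * Complex.sinh (a + b) * Complex.sinh (a - b) ≠ 0 := by positivity
      simp only [p₀, p₁, map_add, map_sub, map_mul, map_neg, eval_C, eval_X,
        Matrix.cons_val_zero, Matrix.cons_val_one, Matrix.cons_val] at h
      exact this (by linear_combination (h 1 1 0 1 - h 1 1 0 0 - h 0 1 0 1 + h 0 1 0 0))

theorem singularData_H2 {α β ε a b c₀ c₁ : ℂ} (h : H2.Admissible α β)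
    (hε : ε = 1 ∨ ε = -1) (ha : H2.Uniformizes ε α a) (hb : H2.Uniformizes ε β b)
    (hc : c₀ ≠ 0 ∨ c₁ ≠ 0) : SingularData (H2.coeffs α β)
      (C c₀ * H2.q₀ a b + C c₁ * H2.q₁ a b)
      (C c₀ * H2.p₀ a b + C c₁ * H2.p₁ a b) := by
  simp only [Uniformizes] at ha hb
  subst ha hb
  have hm : α - β ≠ 0 := sub_ne_zero.mpr h
  have hc' : c₀ ≠ 0 ∨ c₀ = 0 ∧ c₁ ≠ 0 := by tauto
  refine ⟨isBoundary_of_eval (m := fun u => 2 * c₀)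
      (n := fun u => c₀ * (u + β) + c₁)
      (k := fun u => c₀ * (u + α) + c₁)
      (l := fun u => c₁ * (α + β + 2 * u)) ?_ ?_ ?_,
    isBoundary_of_eval (m := fun x => 0)
      (n := fun x => -c₀ * (α - β) + 2 * c₀ * x + 2 * c₁)
      (k := fun x => -c₀ * (α - β) - 2 * c₀ * x - 2 * c₁)
      (l := fun x => -c₀ * (α - β) * (α + β + 2 * x)) ?_ ?_ ?_,
    ⟨X 0 + X 1 + C α, fun x u v => ?_⟩, ?_, ?_⟩
  · intro x u y; simp [q₀, q₁]; ring
  · rintro u ⟨h1, h2, h3, h4⟩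
    have e0 : c₀ = 0 := by
      linear_combination h1 / 2
    have e1 : c₁ = 0 := by
      subst e0
      linear_combination h2
    exact hc.elim (· e0) (· e1)
  · obtain h0 | ⟨rfl, h1⟩ := hc'
    · refine exists_ne_of_second_difference fun h => ?_
      have : c₀ ^ 2 ≠ 0 := by positivity
      exact this (by linear_combination (-1 / 2) * h)
    · refine ⟨0, fun h => ?_⟩
      have : c₁ ^ 2 ≠ 0 := by positivity
      exact this (by linear_combination (-1) * h)
  · intro u x v; simp [p₀, p₁]; ring
  · rintro x ⟨h1, h2, h3, h4⟩
    have e0 : c₀ = 0 :=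
      mul_left_cancel₀ hm (by linear_combination -(h2 + h3) / 2)
    have e1 : c₁ = 0 := by
      subst e0
      linear_combination h2 / 2
    exact hc.elim (· e0) (· e1)
  · obtain h0 | ⟨rfl, h1⟩ := hc'
    · refine exists_ne_of_second_difference fun h => ?_
      have : c₀ ^ 2 ≠ 0 := by positivity
      exact this (by linear_combination (1 / 8) * h)
    · refine ⟨0, fun h => ?_⟩
      have : c₁ ^ 2 ≠ 0 := by positivity
      exact this (by linear_combination (1 / 4) * h)
  · simp [coeffs, q₀, q₁, p₀, p₁, KleinQuad.S, KleinQuad.T, -mul_eq_mul_left_iff]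
    ring
  · obtain h0 | ⟨rfl, h1⟩ := hc'
    · by_contra! h
      have : c₀ ≠ 0 := by positivity
      simp only [q₀, q₁, map_add, map_mul, eval_C, eval_X,
        Matrix.cons_val_zero, Matrix.cons_val_one, Matrix.cons_val] at h
      exact this (by linear_combination (h 1 1 0 0 - h 0 1 0 0))
    · by_contra! h
      have : c₁ ≠ 0 := by positivity
      simp only [q₀, q₁, map_add, map_mul, eval_C, eval_X,
        Matrix.cons_val_zero, Matrix.cons_val_one, Matrix.cons_val] at h
      exact this (by linear_combination (1 / 2) * (h 0 1 0 0))
  · obtain h0 | ⟨rfl, h1⟩ := hc'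
    · left
      by_contra! h
      have : c₀ ≠ 0 := by positivity
      simp only [p₀, p₁, map_add, map_sub, map_mul, map_neg, eval_C, eval_X,
        Matrix.cons_val_zero, Matrix.cons_val_one, Matrix.cons_val] at h
      exact this (by linear_combination (1 / 2) * (h 1 1 0 0 - h 0 1 0 0))
    · exact .inr ⟨2 * c₁, mul_ne_zero two_ne_zero h1,
        exists_diag_self_ne (E := H2) h (by simp [HasMMinus]), fun u x v => by simp [p₀, p₁]; ring⟩

theorem singularData_H3 {δ α β ε a b c₀ c₁ : ℂ} (hδ : δ ≠ 0) (h : (H3 δ).Admissible α β)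
    (hε : ε = 1 ∨ ε = -1) (ha : (H3 δ).Uniformizes ε α a) (hb : (H3 δ).Uniformizes ε β b)
    (hc : c₀ ≠ 0 ∨ c₁ ≠ 0) : SingularData ((H3 δ).coeffs α β)
      (C c₀ * (H3 δ).q₀ a b + C c₁ * (H3 δ).q₁ a b)
      (C c₀ * (H3 δ).p₀ a b + C c₁ * (H3 δ).p₁ a b) := by
  simp only [Uniformizes] at ha hb
  subst ha hb
  have h : Complex.exp α ^ 2 ≠ Complex.exp β ^ 2 := h
  obtain ⟨hp, hm⟩ := sq_ne_sq_iff.mp h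
  have hA := Complex.exp_ne_zero α
  have hB := Complex.exp_ne_zero β
  have hα : Complex.exp (2 * α) = Complex.exp α ^ 2 := by rw [two_mul, Complex.exp_add, pow_two]
  have hβ : Complex.exp (2 * β) = Complex.exp β ^ 2 := by rw [two_mul, Complex.exp_add, pow_two]
  set A := Complex.exp α
  set B := Complex.exp β
  have hc' : c₀ ≠ 0 ∨ c₀ = 0 ∧ c₁ ≠ 0 := by tauto
  refine ⟨isBoundary_of_eval (m := fun u => 2 * c₀ * u)
      (n := fun u => c₀ * δ * B + c₁ * u)
      (k := fun u => c₀ * δ * A + c₁ * u)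
      (l := fun u => c₁ * δ * (A + B)) ?_ ?_ ?_,
    isBoundary_of_eval (m := fun x => 0)
      (n := fun x => 2 * c₀ * x * A + c₁ * (A + B))
      (k := fun x => -2 * c₀ * x * B - c₁ * (A + B))
      (l := fun x => c₀ * δ * (A ^ 2 - B ^ 2)) ?_ ?_ ?_,
    ⟨X 0 * X 1 + C (δ * A), fun x u v => ?_⟩, ?_, ?_⟩
  · intro x u y; simp [q₀, q₁]; ring
  · rintro u ⟨h1, h2, h3, h4⟩
    have e1 : c₁ = 0 := by
      exact mul_left_cancel₀ (mul_ne_zero hδ hp) (by linear_combination h4)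
    have e0 : c₀ = 0 := by
      subst e1
      exact mul_left_cancel₀ (mul_ne_zero hδ hB) (by linear_combination h2)
    exact hc.elim (· e0) (· e1)
  · obtain h0 | ⟨rfl, h1⟩ := hc'
    · refine ⟨0, fun h => ?_⟩
      have : c₀ ^ 2 * δ ^ 2 * A * B ≠ 0 := by positivity
      exact this (by linear_combination (-1) * h)
    · refine ⟨1, fun h => ?_⟩
      have : c₁ ^ 2 ≠ 0 := by positivity
      exact this (by linear_combination (-1) * h)
  · intro u x v; simp [p₀, p₁, hα, hβ]; ring
  · rintro x ⟨h1, h2, h3, h4⟩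
    have e0 : c₀ = 0 := by
      exact mul_left_cancel₀ (mul_ne_zero hδ (mul_ne_zero hp hm)) (by linear_combination h4)
    have e1 : c₁ = 0 := by
      subst e0
      exact mul_left_cancel₀ hp (by linear_combination h2)
    exact hc.elim (· e0) (· e1)
  · obtain h0 | ⟨rfl, h1⟩ := hc'
    · refine exists_ne_of_second_difference fun h => ?_
      have : c₀ ^ 2 * A * B ≠ 0 := by positivity
      exact this (by linear_combination (1 / 8) * h)
    · refine ⟨0, fun h => ?_⟩
      have : c₁ ^ 2 * (A + B) ^ 2 ≠ 0 := by positivity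
      exact this (by linear_combination h)
  · simp [coeffs, q₀, q₁, p₀, p₁, KleinQuad.S, KleinQuad.T, -mul_eq_mul_left_iff]
    rw [hα, hβ]; ring
  · obtain h0 | ⟨rfl, h1⟩ := hc'
    · by_contra! h
      have : c₀ ≠ 0 := by positivity
      simp only [q₀, q₁, map_add, map_mul, eval_C, eval_X,
        Matrix.cons_val_zero, Matrix.cons_val_one, Matrix.cons_val] at h
      exact this (by linear_combination (1 / 2) * (h 1 1 0 1 - h 1 1 0 0 - h 0 1 0 1 + h 0 1 0 0))
    · by_contra! h
      have : c₁ ≠ 0 := by positivity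
      simp only [q₀, q₁, map_add, map_mul, eval_C, eval_X,
        Matrix.cons_val_zero, Matrix.cons_val_one, Matrix.cons_val] at h
      exact this (by linear_combination (h 1 1 0 0 - h 0 1 0 0))
  · obtain h0 | ⟨rfl, h1⟩ := hc'
    · left
      by_contra! h
      have : c₀ * A ≠ 0 := by positivity
      simp only [p₀, p₁, map_add, map_sub, map_mul, eval_C, eval_X,
        Matrix.cons_val_zero, Matrix.cons_val_one, Matrix.cons_val] at h
      exact this (by linear_combination (1 / 2) * (h 1 1 0 0 - h 0 1 0 0))
    · exact .inr ⟨c₁ * (A + B), by positivity,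
        exists_diag_self_ne (E := (H3 δ)) h (by simp [HasMMinus]), fun u x v => by
          simp [p₀, p₁, hα, hβ]; ring⟩

theorem singularData {E : ABS} {α β ε a b c₀ c₁ : ℂ} (hE : E.HasSingular) (h : E.Admissible α β)
    (hε : ε = 1 ∨ ε = -1) (ha : E.Uniformizes ε α a) (hb : E.Uniformizes ε β b)
    (hc : c₀ ≠ 0 ∨ c₁ ≠ 0) : SingularData (E.coeffs α β)
      (C c₀ * E.q₀ a b + C c₁ * E.q₁ a b) (C c₀ * E.p₀ a b + C c₁ * E.p₁ a b) := by
  cases E with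
  | Q1 δ => exact singularData_Q1 h hε ha hb hc
  | A1 δ => exact singularData_A1 h hε ha hb hc
  | Q3 δ =>
    obtain rfl : δ = 0 := hE
    exact singularData_Q3 h hε ha hb hc
  | A2 => exact singularData_A2 h hε ha hb hc
  | H2 => exact singularData_H2 h hε ha hb hc
  | H3 δ => exact singularData_H3 hE h hε ha hb hc
  | Q2 | Q4 k | H1 => exact hE.elim

theorem singularQ_parity {E : ABS} {a c₀ c₁ : ℂ → ℂ → ℂ} {α β : ℂ} (h₀ : c₀ α β = c₀ β α)
    (h₁ : c₁ α β = c₁ β α) : E.singularQ a c₀ c₁ α β = C 1 * rev (E.singularQ a c₀ c₁ β α) := by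
  refine tri_ext fun x u y => ?_
  rw [map_mul, eval_rev, eval_C]
  simp only [singularQ, h₀, h₁, map_add, map_mul, eval_C]
  cases E <;> simp [q₀, q₁, -mul_eq_mul_left_iff, add_comm (a β α) (a α β)] <;> ring

theorem singularP_parity {E : ABS} {a c₀ c₁ : ℂ → ℂ → ℂ} {α β : ℂ} (h₀ : c₀ α β = c₀ β α)
    (h₁ : c₁ α β = c₁ β α) :
    E.singularP a c₀ c₁ α β = C (-1) * rev (E.singularP a c₀ c₁ β α) := by
  refine tri_ext fun u x v => ?_
  have hs : Complex.sinh (a β α - a α β) = -Complex.sinh (a α β - a β α) := by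
    rw [← Complex.sinh_neg, neg_sub]
  rw [map_mul, eval_rev, eval_C]
  simp only [singularP, h₀, h₁, map_add, map_mul, eval_C]
  cases E <;> simp [p₀, p₁, -mul_eq_mul_left_iff, add_comm (a β α) (a α β), hs] <;> ring

theorem eval_eq_of_paramEquivAt_mPlus {q : TriFamily} {r₁ r₂ r₄ : ℂ → ℂ → ℂ} {α β : ℂ}
    (h : ParamEquivAt α β q (mPlus r₁ r₂ r₄)) (x u u' y : ℂ) :
    eval ![x, u, y] (q α β) = eval ![y, u', x] (q α β) := by
  obtain ⟨g, -, -, -, h, -⟩ := h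
  rw [h, map_mul, map_mul, eval_mPlus, eval_mPlus]
  simp only [eval_C]
  ring

theorem isDualTo_singular {E : ABS} {D : Set (ℂ × ℂ)} (hD : E.IsParameterDomain D)
    (hE : E.HasSingular) {ε : ℂ} {a c₀ c₁ : ℂ → ℂ → ℂ} (hε : ε = 1 ∨ ε = -1)
    (ha : ∀ α β, (α, β) ∈ D → E.Uniformizes ε α (a α β))
    (hb : ∀ α β, (α, β) ∈ D → E.Uniformizes ε β (a β α)) (h₀ : SymmOn D c₀) (h₁ : SymmOn D c₁)
    (hc : ∀ α β, (α, β) ∈ D → c₀ α β ≠ 0 ∨ c₁ α β ≠ 0) :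
    IsDualTo E.bulk D (E.singularQ a c₀ c₁) (E.singularP a c₀ c₁) ∧
      IsDualTo E.bulk D (E.singularP a c₀ c₁) (E.singularQ a c₀ c₁) ∧
      ∀ α β, (α, β) ∈ D →
        ¬ E.IsMPlusPairAt α β (E.singularQ a c₀ c₁) (E.singularP a c₀ c₁) ∧
        ¬ E.IsMPlusPairAt α β (E.singularP a c₀ c₁) (E.singularQ a c₀ c₁) := by
  have data := fun α β h => singularData hE (hD.admissible h) hε (ha α β h) (hb α β h) (hc α β h)
  rw [← and_assoc]
  refine ⟨isDualTo_and_symm hD ⟨1, .inl rfl, fun α β h => singularQ_parity (h₀ _ _ h) (h₁ _ _ h)⟩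
    ⟨-1, .inr rfl, fun α β h => singularP_parity (h₀ _ _ h) (h₁ _ _ h)⟩ fun α β h => ?_,
    fun α β h => ⟨?_, ?_⟩⟩
  · have hK := coeffs_generic (hD.admissible h)
    have hd := KleinQuad.exists_diag_ne hK.a_ne hK.b_ne
    have s := data α β h
    refine ⟨s.left, s.right, s.elim, KleinQuad.not_dvd_diag_of_middle hd s.middle_left, ?_⟩
    rcases s.middle_right with hm | ⟨k, -, ⟨x, hx⟩, hk⟩
    · exact KleinQuad.not_dvd_diag_of_middle hd hm
    · exact KleinQuad.not_dvd_diag_of_eval ⟨x, 0, x, (hk x 0 x).trans (by ring), hx⟩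
  · rintro ⟨r₁, r₂, r₄, -, -, -, -, hq, -⟩
    obtain ⟨x, u, u', y, hne⟩ := (data α β h).middle_left
    exact hne ((eval_eq_of_paramEquivAt_mPlus hq x u u' y).trans
      (eval_eq_of_paramEquivAt_mPlus hq x u' u' y).symm)
  · rintro ⟨r₁, r₂, r₄, -, -, -, -, hp, -⟩
    have key := eval_eq_of_paramEquivAt_mPlus hp
    rcases (data α β h).middle_right with ⟨x, u, u', y, hne⟩ | ⟨k, hk, -, hkp⟩
    · exact hne ((key x u u' y).trans (key x u' u' y).symm)
    · have := key 1 0 0 0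
      rw [show E.singularP a c₀ c₁ α β = C (c₀ α β) * E.p₀ (a α β) (a β α) + C (c₁ α β)
        * E.p₁ (a α β) (a β α) from rfl, hkp, hkp] at this
      exact hk (by linear_combination this / 2)

end ABS

/-! ### Uniqueness of the dual, and polynomials free of the middle argument -/

theorem IsBoundary.not_dvd_mul {p A B : TriPoly} (hp : IsBoundary p) (hA : A ≠ 0) (hB : B ≠ 0)
    (hA2 : degreeOf 2 A = 0) (hB0 : degreeOf 0 B = 0) : ¬ p ∣ A * B := by
  intro h
  have hne := hp.ne_zero
  rcases hp.irreducible.prime.dvd_or_dvd h with ⟨w, hw⟩ | ⟨w, hw⟩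
  · have hw0 : w ≠ 0 := by rintro rfl; exact hA (by rw [hw, mul_zero])
    rw [hw, degreeOf_mul_eq hne hw0, hp.last] at hA2
    omega
  · have hw0 : w ≠ 0 := by rintro rfl; exact hB (by rw [hw, mul_zero])
    rw [hw, degreeOf_mul_eq hne hw0, hp.first] at hB0
    omega

theorem degreeOf_rename_ux (χ : MvPolynomial (Fin 2) ℂ) :
    degreeOf 2 (rename ![1, 0] χ : TriPoly) = 0 :=
  degreeOf_rename_eq_zero (by intro j; fin_cases j <;> decide) χ

theorem degreeOf_rename_xv (χ : MvPolynomial (Fin 2) ℂ) :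
    degreeOf 0 (rename ![1, 2] χ : TriPoly) = 0 :=
  degreeOf_rename_eq_zero (by intro j; fin_cases j <;> decide) χ

theorem eval_rename_xv (χ : MvPolynomial (Fin 2) ℂ) (u x v : ℂ) :
    eval ![u, x, v] (rename ![1, 2] χ : TriPoly) = eval ![x, v] χ := by
  rw [eval_rename]; congr 2; ext i; fin_cases i <;> rfl

theorem rename_ux_ne_zero {χ : MvPolynomial (Fin 2) ℂ} (h : χ ≠ 0) :
    (rename ![1, 0] χ : TriPoly) ≠ 0 := by
  have hinj : Function.Injective (![1, 0] : Fin 2 → Fin 3) := by decide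
  intro h0
  exact h (rename_injective _ hinj (by rw [h0, map_zero]))

/-- The dual polynomial is unique up to a constant. -/
theorem KleinQuad.Elim.unique {K : KleinQuad} {q p p' : TriPoly} {χ χ' : MvPolynomial (Fin 2) ℂ}
    (h : K.Elim q p χ) (h' : K.Elim q p' χ') (hq : IsBoundary q) (hp : IsBoundary p)
    (hp' : IsBoundary p') (hK : ∃ x u, K.edge x u ≠ 0) : ∃ g : ℂ, g ≠ 0 ∧ p = C g * p' := by
  have key : rename ![1, 0] χ * p = rename ![1, 0] χ' * p' := by
    refine tri_ext fun u x v => ?_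
    rw [map_mul, map_mul, eval_rename_ux, eval_rename_ux, ← h, ← h']
  have hχ' := rename_ux_ne_zero (h'.ne_zero hq hK)
  have hdvd : p ∣ p' := by
    have h1 : p ∣ rename ![1, 0] χ' * p' := ⟨rename ![1, 0] χ, by rw [← key, mul_comm]⟩
    rcases hp.irreducible.prime.dvd_or_dvd h1 with h2 | h2
    · exact absurd (by simpa using h2) (hp.not_dvd_mul hχ' one_ne_zero (degreeOf_rename_ux χ')
        (degreeOf_one 0))
    · exact h2
  obtain ⟨w, hw⟩ := (hp.irreducible.associated_of_dvd hp'.irreducible hdvd).symm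
  obtain ⟨g, hg, hgw⟩ := MvPolynomial.isUnit_iff_eq_C_of_isReduced.mp w.isUnit
  exact ⟨g, hg.ne_zero, by rw [← hw, hgw, mul_comm]⟩

/-- The dual of a boundary polynomial is determined up to a constant factor. -/
theorem DualPair.unique {K : KleinQuad} {q p q' p' : TriPoly} (h : DualPair K q p)
    (h' : DualPair K q' p') (hK : ∃ x u, K.edge x u ≠ 0) {g : ℂ} (hg : g ≠ 0) (hq : q = C g * q') :
    ∃ g' : ℂ, g' ≠ 0 ∧ p = C g' * p' := by
  obtain ⟨χ, hχ⟩ := h.elim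
  obtain ⟨χ', hχ'⟩ := h'.elim
  have h2 : K.Elim (C g * q') (C 1 * p) χ := by rwa [← hq, C_1, one_mul]
  exact (h2.C_mul hg).unique hχ' h'.left h.right h'.right hK

theorem degreeOf_moebius {q : TriPoly} {r₁ r₂ r₃ r₄ : ℂ}
    (hq : ∀ x u y, eval ![x, u, y] q = r₁ * (x * y) + r₂ * x + r₃ * y + r₄) :
    degreeOf 1 q = 0 ∧ (r₁ = 0 → r₂ = 0 → degreeOf 0 q = 0) ∧
      (r₁ = 0 → r₃ = 0 → degreeOf 2 q = 0) := by
  have e : q = C r₁ * (X 0 * X 2) + C r₂ * X 0 + C r₃ * X 2 + C r₄ :=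
    tri_ext fun x u y => by rw [hq]; simp
  have hX : ∀ i j : Fin 3, i ≠ j → degreeOf i (X j : TriPoly) ≤ 0 := fun i j hij => by
    rw [degreeOf_X, if_neg hij]
  have hC : ∀ (i : Fin 3) (c : ℂ), degreeOf i (C c : TriPoly) ≤ 0 := fun i c => (degreeOf_C c i).le
  refine ⟨?_, ?_, ?_⟩
  · rw [e, ← Nat.le_zero]
    refine degreeOf_add_le_of_le (degreeOf_add_le_of_le (degreeOf_add_le_of_le ?_ ?_) ?_) (hC _ _)
    · exact degreeOf_mul_le_of_le (m := 0) (n := 0) (hC _ _)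
        (degreeOf_mul_le_of_le (m := 0) (n := 0) (hX _ _ (by decide)) (hX _ _ (by decide)))
    · exact degreeOf_mul_le_of_le (m := 0) (n := 0) (hC _ _) (hX _ _ (by decide))
    · exact degreeOf_mul_le_of_le (m := 0) (n := 0) (hC _ _) (hX _ _ (by decide))
  · rintro rfl rfl
    rw [e, ← Nat.le_zero, C_0, zero_mul, zero_mul, add_zero, zero_add]
    exact degreeOf_add_le_of_le
      (degreeOf_mul_le_of_le (m := 0) (n := 0) (hC _ _) (hX _ _ (by decide))) (hC _ _)
  · rintro rfl rfl
    rw [e, ← Nat.le_zero, C_0, zero_mul, zero_mul, add_zero, zero_add]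
    exact degreeOf_add_le_of_le
      (degreeOf_mul_le_of_le (m := 0) (n := 0) (hC _ _) (hX _ _ (by decide))) (hC _ _)

theorem IsBoundary.det_ne_zero {q : TriPoly} (h : IsBoundary q) {r₁ r₂ r₃ r₄ : ℂ}
    (hq : ∀ x u y, eval ![x, u, y] q = r₁ * (x * y) + r₂ * x + r₃ * y + r₄) :
    r₁ * r₄ - r₂ * r₃ ≠ 0 := by
  intro h0
  obtain ⟨-, h2, h3⟩ := degreeOf_moebius hq
  by_cases hr : r₁ = 0
  · rw [hr, zero_mul, zero_sub, neg_eq_zero, mul_eq_zero] at h0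
    rcases h0 with h0 | h0
    · have := h2 hr h0; rw [h.first] at this; omega
    · have := h3 hr h0; rw [h.last] at this; omega
  · have e : q = (C r₁⁻¹ * (C r₁ * X 0 + C r₃)) * (C r₁ * X 2 + C r₂) := by
      refine tri_ext fun x u y => ?_
      rw [hq]; simp
      field_simp
      linear_combination h0
    refine not_irreducible_mul_of_eval (w := ![-r₃ / r₁, 0, 0]) (z := ![0, 0, -r₂ / r₁]) ?_ ?_
      (e ▸ h.irreducible)
    · simp; right; field_simp; ring
    · simp; field_simp; ring

theorem IsBiaffine.eval_of_middle {q : TriPoly} (h : IsBiaffine q)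
    (hm : ∀ x u u' y, eval ![x, u, y] q = eval ![x, u', y] q) : ∃ r₁ r₂ r₃ r₄ : ℂ,
    ∀ x u y, eval ![x, u, y] q = r₁ * (x * y) + r₂ * x + r₃ * y + r₄ := by
  refine ⟨eval ![1, 0, 1] q - eval ![1, 0, 0] q - eval ![0, 0, 1] q + eval ![0, 0, 0] q,
    eval ![1, 0, 0] q - eval ![0, 0, 0] q, eval ![0, 0, 1] q - eval ![0, 0, 0] q,
    eval ![0, 0, 0] q, fun x u y => ?_⟩
  rw [hm x u 0 y, h.1, h.2 0, h.2 1]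
  ring

/-- A boundary polynomial with a dual that is free of its middle argument is symmetric or
antisymmetric: it and its reversal have the same dual. -/
theorem DualPair.moebius {K : KleinQuad} {q p : TriPoly} (h : DualPair K q p)
    (hK : ∃ x u, K.edge x u ≠ 0) (hK' : ∃ x u, K.swap.edge x u ≠ 0)
    (hm : ∀ x u u' y, eval ![x, u, y] q = eval ![x, u', y] q) :
    (∃ r₁ r₂ r₄ : ℂ, r₁ * r₄ - r₂ ^ 2 ≠ 0 ∧
      ∀ x u y, eval ![x, u, y] q = r₁ * (x * y) + r₂ * x + r₂ * y + r₄) ∨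
    ∃ g : ℂ, g ≠ 0 ∧ ∀ x u y, eval ![x, u, y] q = g * (x - y) := by
  obtain ⟨r₁, r₂, r₃, r₄, hq⟩ := h.left.isBiaffine.eval_of_middle hm
  have hdet := h.left.det_ne_zero hq
  obtain ⟨χ, hχ⟩ := h.elim
  obtain ⟨χ', hχ'⟩ := h.elim_swap
  have hdeg : degreeOf 1 χ' = 0 := by
    have := (hχ'.degree_le h.left.map_rev h.right.map_rev hK').2
    rw [(degreeOf_rev q).2.1, (degreeOf_moebius hq).1] at this
    omega
  have hχ'ev : ∀ x v v', eval ![x, v] χ' = eval ![x, v'] χ' := fun x v v' =>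
    eval_eq_of_degreeOf_eq_zero hdeg (by intro j hj; fin_cases j <;> simp_all)
  have hrev : K.Elim (rev q) p χ' := by
    intro x u v
    have := hχ' x v u
    simp only [eval_rev, KleinQuad.swap, KleinQuad.S, KleinQuad.T] at this ⊢
    rw [hχ'ev x u v, ← this, hm 1 u v x, hm 0 u v x]
    ring
  obtain ⟨w, hw, -⟩ := hχ.symm h.left h.right hK
  obtain ⟨w', hw', -⟩ := hrev.symm h.left.map_rev h.right hK
  obtain ⟨g, hg, hgq⟩ := hw'.unique hw h.right h.left.map_rev h.left hK
  have hev : ∀ x y, r₁ * (x * y) + r₂ * y + r₃ * x + r₄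
      = g * (r₁ * (x * y) + r₂ * x + r₃ * y + r₄) := by
    intro x y
    have := congrArg (eval ![x, 0, y]) hgq
    rw [eval_rev, map_mul, eval_C, hq, hq] at this
    linear_combination this
  have e4 : (g - 1) * r₄ = 0 := by linear_combination -hev 0 0
  have e3 : r₃ = g * r₂ := by linear_combination hev 1 0 + e4
  have e2 : r₂ = g * r₃ := by linear_combination hev 0 1 + e4
  have e1 : (g - 1) * r₁ = 0 := by linear_combination -hev 1 1 - e4 + e2 + e3
  by_cases hg1 : g = 1
  · subst hg1
    obtain rfl : r₃ = r₂ := by linear_combination e3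
    exact .inl ⟨r₁, r₃, r₄, by rwa [pow_two], hq⟩
  · have hg1 : g - 1 ≠ 0 := sub_ne_zero.mpr hg1
    have h1 : r₁ = 0 := by simpa [hg1] using e1
    have h4 : r₄ = 0 := by simpa [hg1] using e4
    have hr2 : r₂ ≠ 0 := by
      rintro rfl
      apply hdet; rw [h1]; ring
    have hg2 : (g - 1) * ((g + 1) * r₂) = 0 := by linear_combination -e2 - g * e3
    have hg3 : g + 1 = 0 := by simpa [hg1, hr2] using hg2
    refine .inr ⟨r₂, hr2, fun x u y => ?_⟩
    rw [hq, h1, h4, e3]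
    linear_combination y * r₂ * hg3

/-- The elimination from a multiple of `x - y` must not split into a function of `x, u` and a
function of `x, v`. -/
theorem DualPair.not_split {K : KleinQuad} {q p : TriPoly} (h : DualPair K q p) {g : ℂ}
    (hg : g ≠ 0) (hq : q = C g * ABS.mMinus 0 0) {F G : MvPolynomial (Fin 2) ℂ} (hF : F ≠ 0)
    (hG : G ≠ 0) (hsplit : ∀ x u v, K.S x u v + K.T x u v * x = eval ![x, u] F * eval ![x, v] G) :
    False := by
  obtain ⟨χ, hχ⟩ := h.elim
  have hinj : Function.Injective (![1, 2] : Fin 2 → Fin 3) := by decide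
  have hG' : (rename ![1, 2] G : TriPoly) ≠ 0 := fun h0 =>
    hG (rename_injective _ hinj (by rw [h0, map_zero]))
  refine h.right.not_dvd_mul (rename_ux_ne_zero hF) hG' (degreeOf_rename_ux F)
    (degreeOf_rename_xv G) ⟨C (-g⁻¹) * rename ![1, 0] χ, tri_ext fun u x v => ?_⟩
  have := hχ x u v
  rw [hq] at this
  simp only [map_mul, eval_C, ABS.eval_mMinus, eval_rename_ux, eval_rename_xv] at this ⊢
  rw [← hsplit]
  have h2 : eval ![u, x, v] p * (-g⁻¹ * eval ![x, u] χ)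
    = -g⁻¹ * (eval ![x, u] χ * eval ![u, x, v] p) := by ring
  rw [h2, ← this]
  field_simp
  ring

namespace ABS

/-- For Q1(0), A1(0) and H1 the elimination from `x - y` is `C (x ∓ u) (x ∓ v)` or a constant. -/
theorem not_mMinus {E : ABS} (hE : ¬ E.HasMMinus) {α β : ℂ} (hA : E.Admissible α β)
    {q p : TriPoly} (h : DualPair (E.coeffs α β) q p) {g : ℂ} (hg : g ≠ 0) :
    q ≠ C g * mMinus 0 0 := by
  intro hq
  have hX : ∀ τ : ℂ, (X 0 - C τ * X 1 : MvPolynomial (Fin 2) ℂ) ≠ 0 := by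
    intro τ h0
    have := congrArg (eval ![1, 0]) h0
    simp at this
  have hE : E = Q1 0 ∨ E = A1 0 ∨ E = H1 := by
    simpa only [HasMMinus, not_and_or, not_not] using hE
  rcases hE with rfl | rfl | rfl
  · refine h.not_split hg hq (F := C (β - α) * (X 0 - C 1 * X 1)) (G := X 0 - C 1 * X 1)
      (mul_ne_zero (C_ne_zero.mpr (sub_ne_zero.mpr hA.2.2.symm)) (hX 1)) (hX 1) fun x u v => ?_
    simp [coeffs, KleinQuad.S, KleinQuad.T]; ring
  · refine h.not_split hg hq (F := C (α - β) * (X 0 - C (-1) * X 1)) (G := X 0 - C (-1) * X 1)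
      (mul_ne_zero (C_ne_zero.mpr (sub_ne_zero.mpr hA.2.2)) (hX _)) (hX _) fun x u v => ?_
    simp [coeffs, KleinQuad.S, KleinQuad.T]; ring
  · refine h.not_split hg hq (F := C (β - α)) (G := 1)
      (C_ne_zero.mpr (sub_ne_zero.mpr (Ne.symm hA))) one_ne_zero fun x u v => ?_
    simp [coeffs, KleinQuad.S, KleinQuad.T]; ring

end ABS

/-! ### Irreducible factors of the edge biquadratics -/

theorem irreducible_of_content {P : MvPolynomial (Fin 2) ℂ} (hne : ∀ u, ∃ x, eval ![x, u] P ≠ 0)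
    (hdep : ∃ x x' u, eval ![x, u] P ≠ eval ![x', u] P)
    (hsplit : ∀ R W, P = R * W → degreeOf 0 R = 0 ∨ degreeOf 0 W = 0) : Irreducible P := by
  have unit : ∀ {R W}, P = R * W → degreeOf 0 R = 0 → IsUnit R := by
    intro R W hP hR
    have hR0 : R ≠ 0 := by rintro rfl; obtain ⟨x, hx⟩ := hne 0; simp [hP] at hx
    have hinj : Function.Injective (![0, 1] : Fin 2 → Fin 3) := by decide
    by_contra hu
    have hR' : (rename ![0, 1] R : TriPoly) ≠ 0 := fun h0 =>
      hR0 (rename_injective _ hinj (by rw [h0, map_zero]))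
    obtain ⟨t, ht⟩ := exists_root_of_not_isUnit (p := rename ![0, 1] R) (fun h => hu (by
        obtain ⟨r, hr, hr'⟩ := MvPolynomial.isUnit_iff_eq_C_of_isReduced.mp h
        have : R = C r := rename_injective _ hinj (by rw [hr', rename_C])
        rw [this]; exact hr.map C)) hR'
      ((degreeOf_rename_of_injective hinj 0).trans hR)
      (degreeOf_rename_eq_zero (by intro j; fin_cases j <;> decide) R)
    obtain ⟨x, hx⟩ := hne t
    apply hx
    rw [hP, map_mul, ← eval_rename_xu R x t 0, ht, zero_mul]
  refine ⟨fun hu => ?_, fun R W hP => ?_⟩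
  · obtain ⟨r, -, hr⟩ := MvPolynomial.isUnit_iff_eq_C_of_isReduced.mp hu
    obtain ⟨x, x', u, hx⟩ := hdep
    rw [hr] at hx; simp at hx
  · rcases hsplit R W hP with h | h
    · exact .inl (unit hP h)
    · exact .inr (unit (hP.trans (mul_comm _ _)) h)

theorem irreducible_of_affine {P : MvPolynomial (Fin 2) ℂ} {F G : ℂ → ℂ}
    (hP : ∀ x u, eval ![x, u] P = F u * x + G u) (hne : ∀ u, F u = 0 → G u ≠ 0)
    (hF : ∃ u, F u ≠ 0) : Irreducible P := by
  have hdeg : degreeOf 0 P ≤ 1 := by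
    refine degreeOf_le_one_of_eval fun w => ?_
    have e : ∀ s, Function.update w 0 s = ![s, w 1] := by
      intro s; ext j; fin_cases j <;> simp
    have e' : w = ![w 0, w 1] := by ext j; fin_cases j <;> simp
    rw [e, e]; nth_rw 1 [e']; rw [hP, hP, hP]; ring
  have hne' : ∀ u, ∃ x, eval ![x, u] P ≠ 0 := by
    intro u
    by_contra! h
    have h0 := h 0
    have h1 := h 1
    rw [hP] at h0 h1
    exact hne u (by linear_combination h1 - h0) (by linear_combination h0)
  refine irreducible_of_content hne' ?_ fun R W h => ?_
  · obtain ⟨u, hu⟩ := hF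
    refine ⟨1, 0, u, fun h => hu ?_⟩
    rw [hP, hP] at h
    linear_combination h
  · have hP0 : P ≠ 0 := by rintro h0; obtain ⟨x, hx⟩ := hne' 0; simp [h0] at hx
    rw [h] at hP0
    rw [h, degreeOf_mul_eq (left_ne_zero_of_mul hP0) (right_ne_zero_of_mul hP0)] at hdeg
    omega

/-- A polynomial of degree two in `x` is irreducible if it has no factor in `u` alone and its
discriminant is not a square. -/
theorem irreducible_of_quadratic {P : MvPolynomial (Fin 2) ℂ} {F G H : ℂ → ℂ}
    (hdeg : degreeOf 0 P ≤ 2) (hP : ∀ x u, eval ![x, u] P = F u * x ^ 2 + G u * x + H u)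
    (hne : ∀ u, ¬ (F u = 0 ∧ G u = 0 ∧ H u = 0)) (hF : ∃ u, F u ≠ 0)
    (hsq : ¬ ∃ w : Polynomial ℂ, ∀ u, G u ^ 2 - 4 * F u * H u = w.eval u ^ 2) : Irreducible P := by
  have hne' : ∀ u, ∃ x, eval ![x, u] P ≠ 0 := by
    intro u
    by_contra! h
    have h0 := h 0
    have h1 := h 1
    have h2 := h (-1)
    rw [hP] at h0 h1 h2
    exact hne u ⟨by linear_combination (h1 + h2 - 2 * h0) / 2, by linear_combination (h1 - h2) / 2,
      by linear_combination h0⟩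
  refine irreducible_of_content hne' ?_ fun R W h => ?_
  · obtain ⟨u, hu⟩ := hF
    by_contra! h
    have h1 := h 1 0 u
    have h2 := h (-1) 0 u
    rw [hP, hP] at h1 h2
    exact hu (by linear_combination (h1 + h2) / 2)
  · have hP0 : P ≠ 0 := by rintro h0; obtain ⟨x, hx⟩ := hne' 0; simp [h0] at hx
    rw [h] at hP0
    rw [h, degreeOf_mul_eq (left_ne_zero_of_mul hP0) (right_ne_zero_of_mul hP0)] at hdeg
    by_contra! h0
    have hsplit : ∀ R : MvPolynomial (Fin 2) ℂ, degreeOf 0 R = 1 → ∃ r s : Polynomial ℂ,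
        ∀ x u, eval ![x, u] R = r.eval u * x + s.eval u := by
      intro R hR
      have hev : ∀ (c u : ℂ), (aeval ![Polynomial.C c, Polynomial.X] R : Polynomial ℂ).eval u
          = eval ![c, u] R := by
        intro c u
        rw [← Polynomial.coe_aeval_eq_eval, MvPolynomial.comp_aeval_apply,
          ← MvPolynomial.coe_aeval_eq_eval, RingHom.coe_coe]
        congr 2
        ext i; fin_cases i <;> simp
      refine ⟨aeval ![Polynomial.C 1, Polynomial.X] R - aeval ![Polynomial.C 0, Polynomial.X] R,
        aeval ![Polynomial.C 0, Polynomial.X] R, fun x u => ?_⟩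
      rw [eval_affine (i := 0) hR.le (w := ![x, u]) (w₀ := ![0, u]) (w₁ := ![1, u]) rfl rfl
        (by intro j hj; fin_cases j <;> simp_all) (by intro j hj; fin_cases j <;> simp_all),
        Polynomial.eval_sub, hev, hev]
      simp only [Matrix.cons_val_zero]
      ring
    obtain ⟨r, s, hr⟩ := hsplit R (by omega)
    obtain ⟨r', s', hr'⟩ := hsplit W (by omega)
    refine hsq ⟨r * s' - s * r', fun u => ?_⟩
    have hev : ∀ x, F u * x ^ 2 + G u * x + H u
        = (r.eval u * x + s.eval u) * (r'.eval u * x + s'.eval u) := by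
      intro x; rw [← hP, h, map_mul, hr, hr']
    have h0 := hev 0
    have h1 := hev 1
    have h2 := hev (-1)
    have e0 : H u = s.eval u * s'.eval u := by linear_combination h0
    have e1 : G u = r.eval u * s'.eval u + s.eval u * r'.eval u := by
      linear_combination (h1 - h2) / 2
    have e2 : F u = r.eval u * r'.eval u := by linear_combination (h1 + h2 - 2 * h0) / 2
    rw [e0, e1, e2]
    simp
    ring

theorem isUnit_of_isUnit_rename {χ : MvPolynomial (Fin 2) ℂ}
    (h : IsUnit (rename ![1, 0] χ : MvPolynomial (Fin 2) ℂ)) : IsUnit χ := by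
  have hinj : Function.Injective (![1, 0] : Fin 2 → Fin 2) := by decide
  obtain ⟨r, hr, hr'⟩ := MvPolynomial.isUnit_iff_eq_C_of_isReduced.mp h
  have : χ = C r := rename_injective _ hinj (by rw [hr', rename_C])
  rw [this]; exact hr.map C

theorem exists_eq_C_mul_of_associated {σ : Type*} {P R : MvPolynomial σ ℂ} (h : Associated R P) :
    ∃ k : ℂ, k ≠ 0 ∧ P = C k * R := by
  obtain ⟨w, hw⟩ := h
  obtain ⟨k, hk, hkw⟩ := MvPolynomial.isUnit_iff_eq_C_of_isReduced.mp w.isUnit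
  exact ⟨k, hk.ne_zero, by rw [← hw, hkw, mul_comm]⟩

/-- The factors of a product of two irreducible polynomials. -/
theorem factor_of_two_irreducible {σ : Type*} {π₁ π₂ P R : MvPolynomial σ ℂ} {c : ℂ} (hc : c ≠ 0)
    (h₁ : Irreducible π₁) (h₂ : Irreducible π₂) (h : C c * (π₁ * π₂) = P * R) :
    IsUnit P ∨ IsUnit R ∨ Associated π₁ P ∨ Associated π₂ P := by
  have hu : IsUnit (C c : MvPolynomial σ ℂ) := (isUnit_iff_ne_zero.mpr hc).map C
  have key : ∀ {π₁ π₂ P R : MvPolynomial σ ℂ}, Irreducible π₁ → Irreducible π₂ →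
      C c * (π₁ * π₂) = P * R → π₁ ∣ P → IsUnit R ∨ Associated π₁ P := by
    rintro π₁ π₂ P R h₁ h₂ h ⟨w, rfl⟩
    have h' : C c * π₂ = w * R := by
      apply mul_left_cancel₀ h₁.ne_zero; linear_combination h
    have hirr : Irreducible (w * R) := by
      rw [← h']; exact (irreducible_isUnit_mul hu).mpr h₂
    rcases hirr.isUnit_or_isUnit rfl with hw | hR
    · exact .inr (associated_mul_unit_right π₁ w hw)
    · exact .inl hR
  have hdvd : π₁ ∣ P * R := ⟨C c * π₂, by rw [← h]; ring⟩
  rcases h₁.prime.dvd_or_dvd hdvd with hd | hd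
  · rcases key h₁ h₂ h hd with h | h
    · exact .inr (.inl h)
    · exact .inr (.inr (.inl h))
  · rcases key h₁ h₂ (h.trans (mul_comm P R)) hd with h' | h'
    · exact .inl h'
    · obtain ⟨w, hw⟩ := h'
      have h3 : C c * π₂ = P * (w : MvPolynomial σ ℂ) := by
        apply mul_left_cancel₀ h₁.ne_zero
        rw [← hw] at h
        linear_combination h
      obtain ⟨z, hz⟩ : ∃ z : (MvPolynomial σ ℂ)ˣ, (z : MvPolynomial σ ℂ) = C c := hu
      refine .inr (.inr (.inr ⟨z * w⁻¹, ?_⟩))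
      rw [Units.val_mul, hz]
      calc π₂ * (C c * ((w⁻¹ : (MvPolynomial σ ℂ)ˣ) : MvPolynomial σ ℂ))
            = (C c * π₂) * ((w⁻¹ : (MvPolynomial σ ℂ)ˣ) : MvPolynomial σ ℂ) := by ring
        _ = P := by rw [h3, mul_assoc, Units.mul_inv, mul_one]

/-! ### Coefficients of a dual pair -/

theorem eval_eq_zero_of_ne_zero {p : Polynomial ℂ} (h : ∀ s, s ≠ 0 → p.eval s = 0) (s : ℂ) :
    p.eval s = 0 := by
  have : Polynomial.X * p = 0 := Polynomial.funext fun s => by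
    by_cases hs : s = 0
    · simp [hs]
    · simp [h s hs]
  rcases mul_eq_zero.mp this with h0 | h0
  · exact absurd h0 Polynomial.X_ne_zero
  · simp [h0]

/-- A polynomial in three arguments which does not involve the middle one. -/
def IsMiddleFree (q : TriPoly) : Prop :=
  ∀ x u u' y, eval ![x, u, y] q = eval ![x, u', y] q

theorem isMiddleFree_of_degreeOf {q : TriPoly} (h : degreeOf 1 q = 0) : IsMiddleFree q :=
  fun x u u' y => eval_eq_of_degreeOf_eq_zero h (by intro j hj; fin_cases j <;> simp_all)

theorem IsMiddleFree.of_rev {q : TriPoly} (h : IsMiddleFree (rev q)) : IsMiddleFree q :=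
  fun x u u' y => by simpa using h y u u' x

theorem eval_middle_affine {p : TriPoly} (h : degreeOf 1 p ≤ 1) (u x v : ℂ) :
    eval ![u, x, v] p
      = eval ![u, 0, v] p + x * (eval ![u, 1, v] p - eval ![u, 0, v] p) := by
  rw [eval_affine (i := 1) h (w := ![u, x, v]) (w₀ := ![u, 0, v]) (w₁ := ![u, 1, v]) rfl rfl
    (by intro j hj; fin_cases j <;> simp_all) (by intro j hj; fin_cases j <;> simp_all)]
  simp only [Matrix.cons_val_one, Matrix.cons_val_zero]

/-- A boundary polynomial depends on its boundary arguments. -/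
theorem IsBoundary.not_middle_only {q : TriPoly} (h : IsBoundary q) {D : Polynomial ℂ}
    (hq : ∀ x u y, eval ![x, u, y] q = D.eval u) : False := by
  have hD : D.natDegree = 0 := by
    by_contra hd
    obtain ⟨t, ht⟩ := IsAlgClosed.exists_root D (by
      intro h0; exact hd (Polynomial.natDegree_eq_zero_iff_degree_le_zero.mpr h0.le))
    obtain ⟨x, y, hxy⟩ := exists_eval_ne_zero_of_irreducible h.irreducible (by rw [h.first]; simp)
      h.first.le h.last.le t
    exact hxy (by rw [hq]; exact ht)
  have := (degreeOf_moebius (q := q) (r₁ := 0) (r₂ := 0) (r₃ := 0) (r₄ := D.coeff 0) (by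
    intro x u y
    rw [hq, Polynomial.eq_C_of_natDegree_eq_zero hD]; simp)).2.1 rfl rfl
  rw [h.first] at this
  omega

/-- A boundary polynomial does not vanish identically at `z = 0`: it would be divisible by `z`. -/
theorem IsBoundary.exists_eval_last_zero {q : TriPoly} (h : IsBoundary q) :
    ∃ x u, eval ![x, u, 0] q ≠ 0 := by
  by_contra! h0
  obtain ⟨a, b, c, d, rfl, -⟩ := exists_eq_biaffine h.first.le h.last.le
  have hfac : biaffine a b c d
      = (Polynomial.aeval (X 1) a * X 0 + Polynomial.aeval (X 1) c) * X 2 := by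
    refine tri_ext fun x u y => ?_
    have := h0 x u
    simp only [eval_biaffine, map_mul, map_add, eval_polynomial_aeval, eval_X,
      Matrix.cons_val_zero, Matrix.cons_val_one, Matrix.cons_val] at this ⊢
    linear_combination this
  rcases h.irreducible.isUnit_or_isUnit hfac with hu | hu
  · obtain ⟨r, -, hr⟩ := MvPolynomial.isUnit_iff_eq_C_of_isReduced.mp hu
    have := (degreeOf_moebius (q := biaffine a b c d) (r₁ := 0) (r₂ := 0) (r₃ := r) (r₄ := 0) (by
      intro x u y
      rw [hfac, hr]; simp)).2.1 rfl rfl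
    rw [h.first] at this
    omega
  · exact (hu.map (eval 0)).ne_zero (by simp)

namespace KleinQuad

theorem Elim.degree_middle_le {K : KleinQuad} {q p : TriPoly} {χ : MvPolynomial (Fin 2) ℂ}
    (h : K.Elim q p χ) (hq : IsBoundary q) (hp : IsBoundary p) (hK : ∃ x u, K.edge x u ≠ 0) :
    degreeOf 1 q + degreeOf 1 K.edgePoly ≤ 2 + degreeOf 1 χ := by
  obtain ⟨χ', h', he⟩ := h.symm hq hp hK
  have hd := (h'.degree_le hp hq hK).1
  have hinj : Function.Injective (![1, 0] : Fin 2 → Fin 2) := by decide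
  have hr := degreeOf_rename_of_injective (p := χ') hinj 0
  simp only [Matrix.cons_val_zero] at hr
  have hχ := h.ne_zero hq hK
  have hχ' : (rename ![1, 0] χ' : MvPolynomial (Fin 2) ℂ) ≠ 0 := fun h0 =>
    h'.ne_zero hp hK (rename_injective _ hinj (by rw [h0, map_zero]))
  rw [he, degreeOf_neg, degreeOf_mul_eq hχ hχ', hr]
  omega

theorem degreeOf_edgePoly_one {K : KleinQuad} {x u : ℂ} (h : K.edge x u ≠ K.edge x 0) :
    1 ≤ degreeOf 1 K.edgePoly := by
  by_contra hd
  refine h ?_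
  rw [← eval_edgePoly, ← eval_edgePoly]
  exact eval_eq_of_degreeOf_eq_zero (i := 1) (by omega) (by intro j hj; fin_cases j <;> simp_all)

/-- A quadratic with nonzero second difference has degree two. -/
theorem degreeOf_edgePoly_two {K : KleinQuad} {x : ℂ}
    (h : K.edge x 1 + K.edge x (-1) - 2 * K.edge x 0 ≠ 0) : 2 ≤ degreeOf 1 K.edgePoly := by
  by_contra hd
  refine h ?_
  have := eval_affine (i := 1) (p := K.edgePoly) (by omega) (w := ![x, -1]) (w₀ := ![x, 0])
    (w₁ := ![x, 1]) rfl rfl (by intro j hj; fin_cases j <;> simp_all)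
    (by intro j hj; fin_cases j <;> simp_all)
  rw [eval_edgePoly, eval_edgePoly, eval_edgePoly] at this
  rw [this]
  simp only [Matrix.cons_val_one, Matrix.cons_val_fin_one]
  ring

/-- The two elimination identities of a dual pair, in terms of the coefficients of `q`. -/
theorem Elim.exists_coeffs {K : KleinQuad} {q p : TriPoly} {χ χ' : MvPolynomial (Fin 2) ℂ}
    (h : K.Elim q p χ) (h' : K.swap.Elim (rev q) (rev p) χ') (hq : IsBoundary q) :
    ∃ A B C D : Polynomial ℂ, (A.natDegree ≤ degreeOf 1 q ∧ B.natDegree ≤ degreeOf 1 q ∧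
        C.natDegree ≤ degreeOf 1 q ∧ D.natDegree ≤ degreeOf 1 q) ∧
      (∀ x u y, eval ![x, u, y] q
        = A.eval u * (x * y) + B.eval u * x + C.eval u * y + D.eval u) ∧
      (∀ x u v, K.S x u v * (A.eval u * x + C.eval u) - K.T x u v * (B.eval u * x + D.eval u)
        = eval ![x, u] χ * eval ![u, x, v] p) ∧
      (∀ x u v, K.S x u v * (A.eval v * x + B.eval v) - K.T x u v * (C.eval v * x + D.eval v)
        = eval ![x, v] χ' * eval ![u, x, v] p) := by
  obtain ⟨A, B, C, D, hqe, hdeg⟩ := exists_eq_biaffine hq.first.le hq.last.le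
  have hev : ∀ x u y, eval ![x, u, y] q
        = A.eval u * (x * y) + B.eval u * x + C.eval u * y + D.eval u := by
    intro x u y; rw [hqe, eval_biaffine]
  refine ⟨A, B, C, D, hdeg, hev, fun x u v => ?_, fun x u v => ?_⟩
  · rw [← h x u v, hev, hev]; ring
  · have := h' x v u
    rw [eval_rev, eval_rev, eval_rev, hev, hev] at this
    rw [← this]
    simp only [S, T, swap]
    ring

theorem Elim.exists_affine_coeffs {K : KleinQuad} {q p : TriPoly} {χ χ' : MvPolynomial (Fin 2) ℂ}
    (h : K.Elim q p χ) (h' : K.swap.Elim (rev q) (rev p) χ') (hq : IsBoundary q)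
    (hm : degreeOf 1 q ≤ 1) :
    ∃ A₀ A₁ B₀ B₁ C₀ C₁ D₀ D₁ : ℂ,
      (∀ x u y, eval ![x, u, y] q = (A₀ + A₁ * u) * (x * y) + (B₀ + B₁ * u) * x
        + (C₀ + C₁ * u) * y + (D₀ + D₁ * u)) ∧
      (∀ x u v, K.S x u v * ((A₀ + A₁ * u) * x + (C₀ + C₁ * u))
        - K.T x u v * ((B₀ + B₁ * u) * x + (D₀ + D₁ * u)) = eval ![x, u] χ * eval ![u, x, v] p) ∧
      (∀ x u v, K.S x u v * ((A₀ + A₁ * v) * x + (B₀ + B₁ * v))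
        - K.T x u v * ((C₀ + C₁ * v) * x + (D₀ + D₁ * v)) = eval ![x, v] χ' *
            eval ![u, x, v] p) := by
  obtain ⟨A, B, C, D, ⟨hA, hB, hC, hD⟩, hev, h1, h2⟩ := h.exists_coeffs h' hq
  have key : ∀ P : Polynomial ℂ, P.natDegree ≤ degreeOf 1 q → ∀ u,
      P.eval u = P.coeff 0 + P.coeff 1 * u := by
    intro P hP u
    conv_lhs => rw [Polynomial.eq_X_add_C_of_natDegree_le_one (hP.trans hm)]
    simp; ring
  refine ⟨A.coeff 0, A.coeff 1, B.coeff 0, B.coeff 1, C.coeff 0, C.coeff 1, D.coeff 0, D.coeff 1,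
    ?_, ?_, ?_⟩
  · intro x u y; rw [hev, key A hA, key B hB, key C hC, key D hD]
  · intro x u v; rw [← h1, key A hA, key B hB, key C hC, key D hD]
  · intro x u v; rw [← h2, key A hA, key B hB, key C hC, key D hD]

theorem Elim.isMiddleFree_of_isUnit {K : KleinQuad} {q p : TriPoly} {χ : MvPolynomial (Fin 2) ℂ}
    (h : K.Elim q p χ) (hq : IsBoundary q) (hp : IsBoundary p) (hK : ∃ x u, K.edge x u ≠ 0)
    (hd : 2 ≤ degreeOf 1 K.edgePoly) (hχ : IsUnit χ) :
    IsMiddleFree q := by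
  obtain ⟨k, -, rfl⟩ := MvPolynomial.isUnit_iff_eq_C_of_isReduced.mp hχ
  have := h.degree_middle_le hq hp hK
  rw [degreeOf_C] at this
  exact isMiddleFree_of_degreeOf (by omega)

end KleinQuad

/-- If the edge biquadratic is irreducible and of degree two in each variable, one of the two
polynomials of a dual pair does not involve its middle argument. -/
theorem DualPair.isMiddleFree_of_irreducible {K : KleinQuad} {q p : TriPoly} (h : DualPair K q p)
    (hK : ∃ x u, K.edge x u ≠ 0) (hd : 2 ≤ degreeOf 1 K.edgePoly) (hirr : Irreducible K.edgePoly) :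
    IsMiddleFree q ∨ IsMiddleFree p := by
  obtain ⟨χ, hχ⟩ := h.elim
  obtain ⟨χ', hχ', he⟩ := hχ.symm h.left h.right hK
  rcases hirr.isUnit_or_isUnit (he.trans (neg_mul _ _).symm) with hu | hu
  · exact .inl (hχ.isMiddleFree_of_isUnit h.left h.right hK hd ((IsUnit.neg_iff _).mp hu))
  · exact .inr (hχ'.isMiddleFree_of_isUnit h.right h.left hK hd (isUnit_of_isUnit_rename hu))

/-! ### Equations with an irreducible edge biquadratic -/

theorem not_exists_sq {P : Polynomial ℂ} {t : ℂ} (h : P.eval t = 0)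
    (h' : P.derivative.eval t ≠ 0) : ¬ ∃ w : Polynomial ℂ, ∀ u, P.eval u = w.eval u ^ 2 := by
  rintro ⟨w, hw⟩
  have hP : P = w ^ 2 := Polynomial.funext fun u => by rw [hw, Polynomial.eval_pow]
  have hwt : w.eval t = 0 := by
    rw [hw] at h; exact pow_eq_zero_iff (two_ne_zero) |>.mp h
  apply h'
  rw [hP, pow_two, Polynomial.derivative_mul, Polynomial.eval_add, Polynomial.eval_mul,
    Polynomial.eval_mul, hwt]
  ring

namespace KleinQuad

theorem degreeOf_edgePoly_le (K : KleinQuad) : degreeOf 0 K.edgePoly ≤ 2 := by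
  have hX : degreeOf 0 (X 0 : MvPolynomial (Fin 2) ℂ) ≤ 1 := by rw [degreeOf_X, if_pos rfl]
  have hX1 : degreeOf 0 (X 1 : MvPolynomial (Fin 2) ℂ) ≤ 0 := by
    rw [degreeOf_X, if_neg (by decide)]
  have hX1' : degreeOf 0 (X 1 : MvPolynomial (Fin 2) ℂ) ≤ 1 := hX1.trans (by omega)
  have hC : ∀ c : ℂ, degreeOf 0 (C c : MvPolynomial (Fin 2) ℂ) ≤ 1 := fun c =>
    (degreeOf_C c 0).le.trans (by omega)
  have hmul : ∀ (c : ℂ) {p : MvPolynomial (Fin 2) ℂ}, degreeOf 0 p ≤ 1 →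
      degreeOf 0 (C c * p) ≤ 1 := fun c p hp => (degreeOf_C_mul_le p 0 c).trans hp
  have hXX : degreeOf 0 (X 0 * X 1 : MvPolynomial (Fin 2) ℂ) ≤ 1 :=
    degreeOf_mul_le_of_le (m := 1) (n := 0) hX hX1
  exact degreeOf_sub_le_of_le
    (degreeOf_mul_le_of_le (m := 1) (n := 1) (degreeOf_add_le_of_le (hmul _ hXX) (hC _))
      (degreeOf_add_le_of_le (degreeOf_add_le_of_le (hmul _ hXX)
        (hmul _ (degreeOf_add_le_of_le hX hX1'))) (hC _)))
    (degreeOf_mul_le_of_le (m := 1) (n := 1)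
      (degreeOf_add_le_of_le (degreeOf_add_le_of_le (hmul _ hX1') (hmul _ hX)) (hC _))
      (degreeOf_add_le_of_le (degreeOf_add_le_of_le (hmul _ hX) (hmul _ hX1')) (hC _)))

theorem irreducible_edgePoly {K : KleinQuad} {P : Polynomial ℂ} {t : ℂ} (ht : P.eval t = 0)
    (ht' : P.derivative.eval t ≠ 0) {F G H : ℂ → ℂ}
    (he : ∀ x u, K.edge x u = F u * x ^ 2 + G u * x + H u)
    (hne : ∀ u, ¬ (F u = 0 ∧ G u = 0 ∧ H u = 0)) (hF : ∃ u, F u ≠ 0) {r : ℂ} (hr : r ≠ 0)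
    (hP : ∀ u, G u ^ 2 - 4 * F u * H u = r ^ 2 * P.eval u) : Irreducible K.edgePoly := by
  refine irreducible_of_quadratic K.degreeOf_edgePoly_le
    (fun x u => (K.eval_edgePoly x u).trans (he x u)) hne hF ?_
  rintro ⟨w, hw⟩
  refine not_exists_sq ht ht' ⟨Polynomial.C r⁻¹ * w, fun u => ?_⟩
  rw [Polynomial.eval_mul, Polynomial.eval_C, mul_pow, ← hw, hP, inv_pow, ← mul_assoc,
    inv_mul_cancel₀ (pow_ne_zero 2 hr), one_mul]

end KleinQuad

theorem sinh_edge (α β : ℂ) :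
    Complex.sinh α ^ 2 - Complex.sinh β ^ 2 - Complex.sinh (α - β) ^ 2
      = 2 * Complex.sinh β * Complex.sinh (α - β) * Complex.cosh α := by
  rw [Complex.sinh_sub]
  linear_combination (Complex.sinh β ^ 2) * Complex.cosh_sq α
    - Complex.sinh α ^ 2 * Complex.cosh_sq β

namespace ABS

theorem irreducible_edge_Q2 {α β : ℂ} (h : Q2.Admissible α β) :
    Irreducible (Q2.coeffs α β).edgePoly := by
  obtain ⟨hα, hβ, hne⟩ := h
  have hne' := sub_ne_zero.mpr hne
  have hF : -(β * (α - β)) ≠ 0 := neg_ne_zero.mpr (mul_ne_zero hβ hne')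
  refine KleinQuad.irreducible_edgePoly (P := Polynomial.X) (t := 0) (by simp) (by simp)
    (F := fun _ => -(β * (α - β))) (G := fun u => 2 * β * (α - β) * (u + α ^ 2))
    (H := fun u => -(β * (α - β)) * (u ^ 2 - 2 * α ^ 2 * u + α ^ 4)) ?_
    (fun u h0 => hF h0.1) ⟨0, hF⟩ (r := 4 * α * β * (α - β)) ?_ ?_
  · intro x u
    simp only [KleinQuad.edge, coeffs]
    ring
  · exact mul_ne_zero (mul_ne_zero (mul_ne_zero (by norm_num) hα) hβ) hne'
  · intro u
    simp only [Polynomial.eval_X]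
    ring

theorem irreducible_edge_Q3 {δ α β : ℂ} (hδ : δ ≠ 0) (h : (Q3 δ).Admissible α β) :
    Irreducible ((Q3 δ).coeffs α β).edgePoly := by
  obtain ⟨ha, hb, hc⟩ := h
  have hrel := sinh_edge α β
  have hcosh := Complex.cosh_sq α
  obtain ⟨t, ht⟩ := IsAlgClosed.exists_pow_nat_eq (-δ) (n := 2) (by omega)
  have ht0 : t ≠ 0 := by rintro rfl; exact hδ (by simpa using ht.symm)
  simp only [coeffs]
  generalize Complex.sinh α = a at *
  generalize Complex.sinh β = b at *
  generalize Complex.sinh (α - β) = c at *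
  generalize Complex.cosh α = z at *
  refine KleinQuad.irreducible_edgePoly (P := Polynomial.X ^ 2 + Polynomial.C δ) (t := t)
    (by simp [ht]) (by simp [ht0])
    (F := fun _ => -(b * c)) (G := fun u => 2 * b * c * z * u)
    (H := fun u => -(b * c) * u ^ 2 + δ * a ^ 2 * b * c) ?_
    (fun u h0 => neg_ne_zero.mpr (mul_ne_zero hb hc) h0.1) ⟨0, neg_ne_zero.mpr (mul_ne_zero hb hc)⟩
    (r := 2 * a * b * c) ?_ ?_
  · intro x u
    simp only [KleinQuad.edge]
    linear_combination (x * u) * hrel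
  · exact mul_ne_zero (mul_ne_zero (mul_ne_zero two_ne_zero ha) hb) hc
  · intro u
    simp only [Polynomial.eval_X, Polynomial.eval_add, Polynomial.eval_pow, Polynomial.eval_C]
    linear_combination (4 * b ^ 2 * c ^ 2 * u ^ 2) * hcosh

theorem irreducible_edge_Q4 {k α β : ℂ} (h : (Q4 k).Admissible α β) :
    Irreducible ((Q4 k).coeffs α β).edgePoly := by
  obtain ⟨ha, hb, hc, hk, hk1, hrel⟩ := h
  simp only [coeffs, JacobiRelation] at *
  generalize jacobiSn k α = a at *
  generalize jacobiSn k β = b at *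
  generalize jacobiSn k (α - β) = c at *
  have hbc := mul_ne_zero hb hc
  refine KleinQuad.irreducible_edgePoly
    (P := (Polynomial.C 1 - Polynomial.X ^ 2) * (Polynomial.C 1 - 
        Polynomial.C (k ^ 2) * Polynomial.X ^ 2))
    (t := 1) (by simp) ?_
    (F := fun u => b * c * (k ^ 2 * a ^ 2 * u ^ 2 - 1))
    (G := fun u => (a ^ 2 + k ^ 2 * a ^ 2 * b ^ 2 * c ^ 2 - b ^ 2 - c ^ 2) * u)
    (H := fun u => b * c * (a ^ 2 - u ^ 2)) ?_ ?_ ?_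
    (r := 2 * a * b * c) ?_ ?_
  · simp [Polynomial.derivative_mul]
    exact sub_ne_zero.mpr (Ne.symm hk1)
  · intro x u
    simp only [KleinQuad.edge]
    ring
  · rintro u ⟨h1, h3, h2⟩
    have h1' : k ^ 2 * a ^ 2 * u ^ 2 - 1 = 0 := (mul_eq_zero.mp h1).resolve_left hbc
    have h2' : a ^ 2 - u ^ 2 = 0 := (mul_eq_zero.mp h2).resolve_left hbc
    have hu : u ≠ 0 := by rintro rfl; simp at h1'
    have h3' := (mul_eq_zero.mp h3).resolve_right hu
    rw [h3', zero_pow two_ne_zero, eq_comm] at hrel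
    have h4 : 4 * b ^ 2 * c ^ 2 ≠ 0 :=
      mul_ne_zero (mul_ne_zero (by norm_num) (pow_ne_zero 2 hb)) (pow_ne_zero 2 hc)
    rcases mul_eq_zero.mp hrel with h5 | h5
    · have h6 := (mul_eq_zero.mp h5).resolve_left h4
      exact hk1 (by linear_combination h1' + k ^ 2 * a ^ 2 * h2'
        + k ^ 2 * (1 + a ^ 2) * h6)
    · have h7 : a ^ 2 = 1 := by linear_combination h1' + k ^ 2 * a ^ 2 * h2' + a ^ 2 * h5
      exact hk1 (by linear_combination -h5 - k ^ 2 * h7)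
  · exact ⟨0, by simp [hb, hc]⟩
  · exact mul_ne_zero (mul_ne_zero (mul_ne_zero two_ne_zero ha) hb) hc
  · intro u
    simp only [Polynomial.eval_X, Polynomial.eval_sub, Polynomial.eval_mul, Polynomial.eval_pow,
      Polynomial.eval_C]
    linear_combination u ^ 2 * hrel

theorem isMiddleFree_of_irreducible_edge {E : ABS} {α β : ℂ} (hE : E = Q2 ∨ 
    (∃ δ, δ ≠ 0 ∧ E = Q3 δ) ∨
      ∃ k, E = Q4 k) (hA : E.Admissible α β) {q p : TriPoly} (h : DualPair (E.coeffs α β) q p) :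
    IsMiddleFree q ∨ IsMiddleFree p := by
  have hd : (E.coeffs α β).b * (E.coeffs α β).c ≠ 0 → 2 ≤ degreeOf 1 (E.coeffs α β).edgePoly :=
    fun h0 => KleinQuad.degreeOf_edgePoly_two (x := 0) (by
      intro h1
      simp only [KleinQuad.edge] at h1
      exact h0 (by linear_combination (-1 / 2) * h1))
  have hK := (coeffs_generic hA).edge_ne
  rcases hE with rfl | ⟨δ, hδ, rfl⟩ | ⟨k, rfl⟩
  · exact h.isMiddleFree_of_irreducible hK
      (hd (mul_ne_zero (neg_ne_zero.mpr hA.2.1) (sub_ne_zero.mpr (Ne.symm hA.2.2))))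
      (irreducible_edge_Q2 hA)
  · exact h.isMiddleFree_of_irreducible hK
      (hd (mul_ne_zero (neg_ne_zero.mpr hA.2.1) (neg_ne_zero.mpr hA.2.2)))
      (irreducible_edge_Q3 hδ hA)
  · exact h.isMiddleFree_of_irreducible hK
      (hd (mul_ne_zero (neg_ne_zero.mpr hA.2.1) (neg_ne_zero.mpr hA.2.2.1)))
      (irreducible_edge_Q4 hA)

end ABS

/-! ### The equations H1, H2 and H3 -/

theorem exists_eq_C_of_isUnit {σ : Type*} {χ : MvPolynomial σ ℂ} (h : IsUnit χ) :
    ∃ k : ℂ, k ≠ 0 ∧ χ = C k := by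
  obtain ⟨k, hk, rfl⟩ := MvPolynomial.isUnit_iff_eq_C_of_isReduced.mp h
  exact ⟨k, hk.ne_zero, rfl⟩

/-- Coefficient extraction for a polynomial of degree two in two variables; it suffices to know its
values for nonzero arguments. -/
theorem quadratic_coeffs {c₀ c₁ c₂ c₁₁ c₁₂ c₂₂ : ℂ} (h : ∀ u v, u ≠ 0 → v ≠ 0 →
      c₀ + c₁ * u + c₂ * v + c₁₁ * u ^ 2 + c₁₂ * (u * v) + c₂₂ * v ^ 2 = 0) :
    c₀ = 0 ∧ c₁ = 0 ∧ c₂ = 0 ∧ c₁₁ = 0 ∧ c₁₂ = 0 ∧ c₂₂ = 0 := by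
  have h1 := h 1 1 (by norm_num) (by norm_num)
  have h2 := h 1 (-1) (by norm_num) (by norm_num)
  have h3 := h (-1) 1 (by norm_num) (by norm_num)
  have h4 := h (-1) (-1) (by norm_num) (by norm_num)
  have h5 := h 2 1 (by norm_num) (by norm_num)
  have h6 := h 1 2 (by norm_num) (by norm_num)
  have e₁₂ : c₁₂ = 0 := by linear_combination (h1 - h2 - h3 + h4) / 4
  have e₁ : c₁ = 0 := by linear_combination (h1 + h2 - h3 - h4) / 4
  have e₂ : c₂ = 0 := by linear_combination (h1 - h2 + h3 - h4) / 4
  have e₁₁ : c₁₁ = 0 := by linear_combination (h5 - h1 - e₁ - e₁₂) / 3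
  have e₂₂ : c₂₂ = 0 := by linear_combination (h6 - h1 - e₂ - e₁₂) / 3
  exact ⟨by linear_combination (h1 + h2 + h3 + h4) / 4 - e₁₁ - e₂₂, e₁, e₂, e₁₁, e₁₂, e₂₂⟩

/-- Coefficient extraction for a polynomial of degree two in one variable. -/
theorem eq_zero_of_quadratic {c₀ c₁ c₂ : ℂ} (h : ∀ x, c₀ + c₁ * x + c₂ * x ^ 2 = 0) :
    c₀ = 0 ∧ c₁ = 0 ∧ c₂ = 0 := by
  have h0 := h 0
  have h1 := h 1
  have h2 := h (-1)
  exact ⟨by linear_combination h0, by linear_combination (h1 - h2) / 2,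
    by linear_combination (h1 + h2) / 2 - h0⟩

/-- A relation `k' W(u) = k W(v)` off the diagonal forces `W = 0` if `k' ≠ k`. -/
theorem eq_zero_of_offdiagonal {W : ℂ → ℂ} {k k' : ℂ} (hk' : k' ≠ 0) (hne : k' ≠ k)
    (h : ∀ u v, u ≠ v → k' * W u = k * W v) (v : ℂ) : W v = 0 := by
  have h1 := h v (v + 1) (by simp)
  have h2 := h (v + 2) (v + 1) (by norm_num)
  have h3 := h (v + 2) v (by simp)
  have e : k' * (W v - W (v + 2)) = 0 := by linear_combination h1 - h2
  have e' := (mul_eq_zero.mp e).resolve_left hk'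
  have e'' : (k' - k) * W v = 0 := by linear_combination h3 + k' * e'
  exact (mul_eq_zero.mp e'').resolve_left (sub_ne_zero.mpr hne)

theorem IsBoundary.exists_coeff_ne_zero {q : TriPoly} (h : IsBoundary q)
    {A₀ A₁ B₀ B₁ C₀ C₁ D₀ D₁ : ℂ} (hq : ∀ x u y, eval ![x, u, y] q = (A₀ + A₁ * u) * (x * y)
      + (B₀ + B₁ * u) * x + (C₀ + C₁ * u) * y + (D₀ + D₁ * u)) :
    ¬ (A₀ = 0 ∧ A₁ = 0 ∧ B₀ = 0 ∧ B₁ = 0 ∧ C₀ = 0 ∧ C₁ = 0) := by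
  rintro ⟨rfl, rfl, rfl, rfl, rfl, rfl⟩
  refine h.not_middle_only (D := Polynomial.C D₀ + Polynomial.C D₁ * Polynomial.X) fun x u y => ?_
  rw [hq]; simp

theorem KleinQuad.Elim.unit_or_edge {K : KleinQuad} {q p : TriPoly} {χ : MvPolynomial (Fin 2) ℂ}
    (h : K.Elim q p χ) (hq : IsBoundary q) (hp : IsBoundary p) (hK : ∃ x u, K.edge x u ≠ 0)
    (hirr : Irreducible K.edgePoly) :
    (∃ k, k ≠ 0 ∧ χ = C k) ∨
      (∃ k, k ≠ 0 ∧ ∀ x u, eval ![x, u] χ = k * K.edge x u) ∧ ∃ k, k ≠ 0 ∧ K.Elim p q (C k) := by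
  obtain ⟨χ', h', he⟩ := h.symm hq hp hK
  rcases hirr.isUnit_or_isUnit (he.trans (neg_mul _ _).symm) with hu | hu
  · exact .inl (exists_eq_C_of_isUnit ((IsUnit.neg_iff _).mp hu))
  · obtain ⟨k, hk, rfl⟩ := exists_eq_C_of_isUnit (isUnit_of_isUnit_rename hu)
    refine .inr ⟨⟨-k⁻¹, neg_ne_zero.mpr (inv_ne_zero hk), fun x u => ?_⟩, k, hk, h'⟩
    rw [← K.eval_edgePoly, he, rename_C, map_neg, map_mul, eval_C]
    field_simp

theorem KleinQuad.Elim.middle_le_one {K : KleinQuad} {q p : TriPoly}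
    {χ : MvPolynomial (Fin 2) ℂ} (h : K.Elim q p χ) (hq : IsBoundary q) (hp : IsBoundary p)
    (hK : ∃ x u, K.edge x u ≠ 0) {x x' u : ℂ} (hx : eval ![x, u] χ ≠ eval ![x', u] χ) :
    degreeOf 1 p ≤ 1 := by
  have h1 := (h.degree_le hq hp hK).1
  have h2 : degreeOf 0 χ ≠ 0 := fun h0 => hx
    (eval_eq_of_degreeOf_eq_zero h0 (by intro j hj; fin_cases j <;> simp_all))
  omega

namespace ABS

/-- The edge biquadratic of H1 is constant, so both elimination factors are constants `k`, `k'`: for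
`k = k'` the identities make `q` free of its middle argument, otherwise `p`. -/
theorem isMiddleFree_H1 {α β : ℂ} (hA : H1.Admissible α β) {q p : TriPoly}
    (h : DualPair (H1.coeffs α β) q p) : IsMiddleFree q ∨ IsMiddleFree p := by
  have hg : β - α ≠ 0 := sub_ne_zero.mpr (Ne.symm hA)
  obtain ⟨χ, hχ⟩ := h.elim
  obtain ⟨χ', hχ'⟩ := h.elim_swap
  have unit : ∀ {K : KleinQuad} {q p : TriPoly} {χ : MvPolynomial (Fin 2) ℂ}, K.Elim q p χ →
      IsBoundary q → IsBoundary p → (∃ g : ℂ, g ≠ 0 ∧ ∀ x u, K.edge x u = g) →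
      ∃ k, k ≠ 0 ∧ χ = C k := by
    rintro K q p χ hχ hq hp ⟨g, hg, he⟩
    obtain ⟨χs, -, h1⟩ := hχ.symm hq hp ⟨0, 0, by rw [he]; exact hg⟩
    have h2 : K.edgePoly = C g := MvPolynomial.funext fun z => by
      have hz : z = ![z 0, z 1] := by ext i; fin_cases i <;> rfl
      rw [hz, K.eval_edgePoly, he, eval_C]
    refine exists_eq_C_of_isUnit (isUnit_of_mul_isUnit_left (y := -rename ![1, 0] χs) ?_)
    rw [mul_neg, ← h1, h2]
    exact (isUnit_iff_ne_zero.mpr hg).map C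
  obtain ⟨k, hk, rfl⟩ := unit hχ h.left h.right
    ⟨β - α, hg, by intro x u; simp only [KleinQuad.edge, coeffs]; ring⟩
  obtain ⟨k', hk', rfl⟩ := unit hχ' h.left.map_rev h.right.map_rev
    ⟨-(β - α), neg_ne_zero.mpr hg, by
      intro x u; simp only [KleinQuad.edge, KleinQuad.swap, coeffs]; ring⟩
  obtain ⟨A, B, C', D, -, hq, h1, h2⟩ := hχ.exists_coeffs hχ' h.left
  simp only [KleinQuad.S, KleinQuad.T, coeffs, eval_C] at h1 h2
  generalize β - α = g at *
  have key : ∀ u v, (g * (k' * C'.eval u - k * B.eval v) + 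
      (u - v) * (k' * D.eval u - k * D.eval v) = 0)
      ∧ (g * (k' * A.eval u - k * A.eval v) + (u - v) *
          (k' * (B.eval u + C'.eval u) - k * (B.eval v + C'.eval v)) = 0)
      ∧ (u - v) * (k' * A.eval u - k * A.eval v) = 0 := by
    intro u v
    refine eq_zero_of_quadratic fun x => ?_
    linear_combination k' * h1 x u v - k * h2 x u v
  have off : ∀ u v, u ≠ v → k' * A.eval u = k * A.eval v := fun u v huv =>
    sub_eq_zero.mp ((mul_eq_zero.mp (key u v).2.2).resolve_left (sub_ne_zero.mpr huv))
  have off' : ∀ u v, u ≠ v → k' * (B.eval u + C'.eval u) = k * (B.eval v + C'.eval v) := by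
    intro u v huv
    refine sub_eq_zero.mp ((mul_eq_zero.mp ?_).resolve_left (sub_ne_zero.mpr huv))
    linear_combination (key u v).2.1 - g * off u v huv
  by_cases hkk : k' = k
  · subst hkk
    left
    have hdiag : ∀ u, C'.eval u = B.eval u := by
      intro u
      have : g * k' * (C'.eval u - B.eval u) = 0 := by linear_combination (key u u).1
      exact sub_eq_zero.mp ((mul_eq_zero.mp this).resolve_left (mul_ne_zero hg hk'))
    intro x u u' y
    by_cases huu : u = u'
    · rw [huu]
    have hAA : A.eval u = A.eval u' := mul_left_cancel₀ hk' (off u u' huu)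
    have hBB : B.eval u = B.eval u' := by
      have := mul_left_cancel₀ hk' (off' u u' huu)
      rw [hdiag, hdiag] at this
      linear_combination this / 2
    have hDD : D.eval u = D.eval u' := by
      have e : k' * (u - u') * (D.eval u - D.eval u') = 0 := by
        have := (key u u').1
        rw [hdiag] at this
        linear_combination this - g * k' * hBB
      exact sub_eq_zero.mp ((mul_eq_zero.mp e).resolve_left
        (mul_ne_zero hk' (sub_ne_zero.mpr huu)))
    rw [hq, hq, hdiag, hdiag, hAA, hBB, hDD]
  · right
    have hA0 := eq_zero_of_offdiagonal (W := fun u => A.eval u) hk' hkk off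
    have hW0 := eq_zero_of_offdiagonal (W := fun u => B.eval u + C'.eval u) hk' hkk off'
    have hp : ∀ u x v, k * eval ![u, x, v] p = g * C'.eval u + (u - v) * D.eval u := by
      intro u x v
      rw [← h1]
      linear_combination ((x * (u - v) + g) * x) * hA0 u + (u - v) * x * hW0 u
    intro u x x' v
    refine mul_left_cancel₀ hk ?_
    rw [hp, hp]

theorem irreducible_edge_H2 {K : KleinQuad} {a f γ : ℂ} (ha : a ≠ 0) (hf : f ≠ 0)
    (he : ∀ x u, K.edge x u = 2 * a * f * (x + u + γ)) : Irreducible K.edgePoly :=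
  irreducible_of_affine (F := fun _ => 2 * a * f) (G := fun u => 2 * a * f * (u + γ))
    (fun x u => by rw [K.eval_edgePoly, he]; ring)
    (fun u h0 => absurd h0 (by simp [ha, hf])) ⟨0, by simp [ha, hf]⟩

theorem edge_H2 (α β x u : ℂ) :
    (H2.coeffs α β).edge x u = 2 * 1 * (β - α) * (x + u + α) := by
  simp only [KleinQuad.edge, coeffs]; ring

theorem edge_swap_H2 (α β x u : ℂ) :
    (H2.coeffs α β).swap.edge x u = 2 * (-1) * (β - α) * (x + u + β) := by
  simp only [KleinQuad.edge, KleinQuad.swap, coeffs]; ring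

/-- For H2 with constant elimination factor `k`, either the other factor is a constant `k'`, and
then `k' = k` gives a polynomial free of its middle argument while `k' = -k` gives the singular
case, or it is the edge biquadratic, which would leave `q` with its middle argument only. Other
values of `k'` are impossible for the same reason. -/
theorem singular_of_elim_const_H2 {α β : ℂ} (hA : H2.Admissible α β) {q p : TriPoly}
    (h : DualPair (H2.coeffs α β) q p) {k : ℂ} (hk : k ≠ 0)
    (hχ : (H2.coeffs α β).Elim q p (C k)) :
    IsMiddleFree q ∨ ∃ c₀ c₁ : ℂ, q = C c₀ * H2.p₀ α β + C c₁ * H2.p₁ α β := by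
  have hf : β - α ≠ 0 := sub_ne_zero.mpr (Ne.symm hA)
  have hgen := coeffs_generic hA
  obtain ⟨χ', hχ'⟩ := h.elim_swap
  have hm : degreeOf 1 q ≤ 1 := by
    have h1 := hχ.degree_middle_le h.left h.right hgen.edge_ne
    have h2 := KleinQuad.degreeOf_edgePoly_one (K := H2.coeffs α β) (x := 0) (u := 1) (by
      rw [edge_H2, edge_H2]
      intro h0
      exact hf (by linear_combination h0 / 2))
    rw [degreeOf_C] at h1
    omega
  obtain ⟨A₀, A₁, B₀, B₁, C₀, C₁, D₀, D₁, hq, h1, h2⟩ := hχ.exists_affine_coeffs hχ' h.left hm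
  rcases hχ'.unit_or_edge h.left.map_rev h.right.map_rev hgen.edge_swap_ne
    (irreducible_edge_H2 (by norm_num) hf (edge_swap_H2 α β)) with
        ⟨k', hk', rfl⟩ | ⟨⟨k', hk', hev⟩, -⟩
  · simp only [KleinQuad.S, KleinQuad.T, coeffs, eval_C] at h1 h2
    have hg : β ^ 2 - α ^ 2 = (β - α) * (α + β) := by ring
    have hp₀ : ∀ x u y, eval ![x, u, y] (H2.p₀ α β)
        = (β - α) * (x + y) + 2 * (u * (x - y)) + (β - α) * (α + β + 2 * u) := by
      intro x u y; simp [p₀]; ring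
    have hp₁ : ∀ x u y, eval ![x, u, y] (H2.p₁ α β) = 2 * (x - y) := by
      intro x u y; simp [p₁]
    rw [hg] at h1 h2
    generalize β - α = f at *
    generalize α + β = s at *
    have key := fun u v => eq_zero_of_quadratic (c₀ := k' * ((f * (u + v) + f * s) * (C₀ + C₁ * u)
          - (v - u + f) * (D₀ + D₁ * u)) - k * ((f * (u + v) + f * s) * (B₀ + B₁ * v)
          - (v - u + f) * (D₀ + D₁ * v)))
        (c₁ := k' * ((u - v + f) * (C₀ + C₁ * u) + (f * (u + v) + f * s) * (A₀ + A₁ * u)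
          - (v - u + f) * (B₀ + B₁ * u)) - k * ((u - v + f) * (B₀ + B₁ * v)
          + (f * (u + v) + f * s) * (A₀ + A₁ * v) - (v - u + f) * (C₀ + C₁ * v)))
        (c₂ := (u - v + f) * (k' * (A₀ + A₁ * u) - k * (A₀ + A₁ * v)))
        fun x => by linear_combination k' * h1 x u v - k * h2 x u v
    obtain ⟨a1, -, -, a2, -, -⟩ := quadratic_coeffs (c₀ := f * (k' - k) * A₀)
      (c₁ := (k' - k) * A₀ + f * k' * A₁) (c₂ := -(k' - k) * A₀ - f * k * A₁) (c₁₁ := k' * A₁)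
      (c₁₂ := -(k' * A₁) - k * A₁) (c₂₂ := k * A₁)
      fun u v _ _ => by linear_combination (key u v).2.2
    have hA1 : A₁ = 0 := (mul_eq_zero.mp a2).resolve_left hk'
    have hA0 : (k' - k) * A₀ = 0 := by
      rw [mul_assoc] at a1; exact (mul_eq_zero.mp a1).resolve_left hf
    subst hA1
    obtain ⟨b1, b2, b3, b4, b5, b6⟩ := quadratic_coeffs
      (c₀ := f * (k' + k) * (C₀ - B₀))
      (c₁ := (k' - k) * (C₀ + B₀) + f * k' * (C₁ - B₁))
      (c₂ := -(k' - k) * (C₀ + B₀) + f * k * (C₁ - B₁))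
      (c₁₁ := k' * (B₁ + C₁)) (c₁₂ := -(k' + k) * (B₁ + C₁)) (c₂₂ := k * (B₁ + C₁))
      fun u v _ _ => by
        linear_combination (key u v).2.1 - (f * (u + v) + f * s) * hA0
    have hBC : B₁ + C₁ = 0 := (mul_eq_zero.mp b4).resolve_left hk'
    by_cases hkk : k' = k
    · subst hkk
      left
      have e0 : C₀ - B₀ = 0 := by
        refine (mul_eq_zero.mp b1).resolve_left (mul_ne_zero hf ?_)
        rw [← two_mul]; exact mul_ne_zero two_ne_zero hk'
      have e1 : C₁ - B₁ = 0 := by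
        have : f * k' * (C₁ - B₁) = 0 := by linear_combination b2
        exact (mul_eq_zero.mp this).resolve_left (mul_ne_zero hf hk')
      have hB1 : B₁ = 0 := by linear_combination (hBC - e1) / 2
      have hC1 : C₁ = 0 := by linear_combination (hBC + e1) / 2
      subst hB1 hC1
      have hD1 : D₁ = 0 := by
        have : 2 * k' * f ^ 2 * D₁ = 0 := by
          linear_combination (key 0 f).1 - k' * (f * f + f * s) * e0
        exact (mul_eq_zero.mp this).resolve_left
          (mul_ne_zero (mul_ne_zero two_ne_zero hk') (pow_ne_zero 2 hf))
      intro x u u' y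
      rw [hq, hq, hD1]
      ring
    · right
      have hA0' := (mul_eq_zero.mp hA0).resolve_left (sub_ne_zero.mpr hkk)
      by_cases hkk' : k' + k = 0
      · have hk'' : k' = -k := by linear_combination hkk'
        subst hk''
        have hW : B₀ + C₀ = f * B₁ := by
          apply mul_left_cancel₀ (mul_ne_zero two_ne_zero hk)
          linear_combination -b2 - k * f * hBC
        have hD0 : D₀ = f * s * B₁ / 2 := by
          have : k * f * (2 * D₀ - f * s * B₁) = 0 := by
            linear_combination (key 0 0).1 + k * f * s * hW
          have := (mul_eq_zero.mp this).resolve_left (mul_ne_zero hk hf)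
          linear_combination this / 2
        have hD1 : D₁ = f * B₁ := by
          have : 2 * k * f * (D₁ - f * B₁) = 0 := by
            linear_combination (key 1 1).1 + k * (2 * f + f * s) * (hW + hBC) - 2 * k * f * hD0
          have := (mul_eq_zero.mp this).resolve_left (mul_ne_zero (mul_ne_zero two_ne_zero hk) hf)
          linear_combination this
        refine ⟨B₁ / 2, (B₀ - B₁ * f / 2) / 2, tri_ext fun x u y => ?_⟩
        simp only [map_add, map_mul, eval_C, hp₀, hp₁, hq]
        linear_combination (x * y) * hA0' + u * y * hBC + y * hW + hD0 + u * hD1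
      · exfalso
        have e0 : C₀ - B₀ = 0 := (mul_eq_zero.mp b1).resolve_left (mul_ne_zero hf hkk')
        have e1 : C₁ - B₁ = 0 := by
          have : f * (k' + k) * (C₁ - B₁) = 0 := by linear_combination b2 + b3
          exact (mul_eq_zero.mp this).resolve_left (mul_ne_zero hf hkk')
        have e2 : C₀ + B₀ = 0 := by
          have : (k' - k) * (C₀ + B₀) = 0 := by linear_combination b2 - f * k' * e1
          exact (mul_eq_zero.mp this).resolve_left (sub_ne_zero.mpr hkk)
        exact h.left.exists_coeff_ne_zero hq ⟨hA0', rfl, by linear_combination (e2 - e0) / 2,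
          by linear_combination (hBC - e1) / 2, by linear_combination (e2 + e0) / 2,
          by linear_combination (hBC + e1) / 2⟩
  · exfalso
    have hn : degreeOf 1 p ≤ 1 := by
      have := hχ'.middle_le_one h.left.map_rev h.right.map_rev hgen.edge_swap_ne (x := 0) (x' := 1)
        (u := 0) (by
          rw [hev, hev, edge_swap_H2, edge_swap_H2]
          intro h0
          have := mul_left_cancel₀ hk' h0
          exact hf (by linear_combination this / 2))
      rwa [(degreeOf_rev p).2.1] at this
    simp only [edge_swap_H2] at hev
    simp only [KleinQuad.S, KleinQuad.T, coeffs, eval_C, hev] at h1 h2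
    generalize β - α = f at *
    have key := fun u v => eq_zero_of_quadratic (c₀ := 
        (f * (u + v) + (β ^ 2 - α ^ 2)) * (C₀ + C₁ * u)
          - (v - u + f) * (D₀ + D₁ * u) - k * eval ![u, 0, v] p)
        (c₁ := (u - v + f) * (C₀ + C₁ * u) + (f * (u + v) + (β ^ 2 - α ^ 2)) * (A₀ + A₁ * u)
          - (v - u + f) * (B₀ + B₁ * u) - k * (eval ![u, 1, v] p - eval ![u, 0, v] p))
        (c₂ := (u - v + f) * (A₀ + A₁ * u))
        fun x => by linear_combination h1 x u v + k * eval_middle_affine hn u x v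
    obtain ⟨a1, -, a2, -, a3, -⟩ := quadratic_coeffs (c₀ := f * A₀)
      (c₁ := A₀ + f * A₁) (c₂ := -A₀) (c₁₁ := A₁) (c₁₂ := -A₁) (c₂₂ := 0)
      fun u v _ _ => by linear_combination (key u v).2.2
    have hA0 : A₀ = 0 := neg_eq_zero.mp a2
    have hA1 : A₁ = 0 := neg_eq_zero.mp a3
    subst hA0 hA1
    have hP : ∀ u v, eval ![u, 1, v] p - eval ![u, 0, v] p = 0 := by
      intro u v
      have := (eq_zero_of_quadratic
        (c₀ := (f * (u + v) + (β ^ 2 - α ^ 2)) * (B₀ + B₁ * v) - (v - u + f) * (D₀ + D₁ * v)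
          - k' * (2 * (-1) * f * (v + β)) * eval ![u, 0, v] p)
        (c₁ := (u - v + f) * (B₀ + B₁ * v) - (v - u + f) * (C₀ + C₁ * v)
          + 2 * k' * f * (eval ![u, 0, v] p + (v + β) * (eval ![u, 1, v] p - eval ![u, 0, v] p)))
        (c₂ := 2 * k' * f * (eval ![u, 1, v] p - eval ![u, 0, v] p))
        fun x => by
          linear_combination h2 x u v
            + k' * (2 * (-1) * f * (x + v + β)) * eval_middle_affine hn u x v).2.2
      exact (mul_eq_zero.mp this).resolve_left (mul_ne_zero (mul_ne_zero two_ne_zero hk') hf)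
    obtain ⟨b1, b2, b3, b4, -, -⟩ := quadratic_coeffs (c₀ := f * (C₀ - B₀))
      (c₁ := C₀ + f * C₁ + B₀ - f * B₁) (c₂ := -(C₀ + B₀)) (c₁₁ := C₁ + B₁)
      (c₁₂ := -(C₁ + B₁)) (c₂₂ := 0)
      fun u v _ _ => by linear_combination (key u v).2.1 + k * hP u v
    have b1' := (mul_eq_zero.mp b1).resolve_left hf
    have hB0 : B₀ = 0 := by linear_combination (-b3 - b1') / 2
    have hC0 : C₀ = 0 := by linear_combination (-b3 + b1') / 2
    have b2' : f * (C₁ - B₁) = 0 := by linear_combination b2 + b3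
    have b2'' := (mul_eq_zero.mp b2').resolve_left hf
    exact h.left.exists_coeff_ne_zero hq ⟨rfl, rfl, hB0, by linear_combination (b4 - b2'') / 2, hC0,
      by linear_combination (b4 + b2'') / 2⟩

end ABS

/-- Comparison of the two eliminations when both factors agree up to a constant and
`S = x l(u, v) + g`, `T = l(v, u)` with `l = a u + b v`. -/
theorem flat_comparison {a b g k k' : ℂ} (ha : a ≠ 0) (hb : b ≠ 0) (hab : a ^ 2 ≠ b ^ 2) 
    (hk : k ≠ 0)
    (hk' : k' ≠ 0) {q : TriPoly} (hqb : IsBoundary q) {A₀ A₁ B₀ B₁ C₀ C₁ D₀ D₁ : ℂ}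
    (hq : ∀ x u y, eval ![x, u, y] q = (A₀ + A₁ * u) * (x * y) + (B₀ + B₁ * u) * x
        + (C₀ + C₁ * u) * y + (D₀ + D₁ * u))
    (h : ∀ x u v, k' * ((x * (a * u + b * v) + g) * ((A₀ + A₁ * u) * x + (C₀ + C₁ * u))
        - (a * v + b * u) * ((B₀ + B₁ * u) * x + (D₀ + D₁ * u)))
      = k * ((x * (a * u + b * v) + g) * ((A₀ + A₁ * v) * x + (B₀ + B₁ * v))
        - (a * v + b * u) * ((C₀ + C₁ * v) * x + (D₀ + D₁ * v)))) :
    IsMiddleFree q ∨ A₀ = 0 ∧ A₁ = 0 ∧ C₀ = -B₀ ∧ D₁ = 0 ∧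
      ∃ w, B₁ = a * w ∧ C₁ = b * w ∧ D₀ = g * w / 2 := by
  obtain ⟨hs, hd⟩ := sq_ne_sq_iff.mp hab
  have key := fun u v => eq_zero_of_quadratic
      (c₀ := k' * (g * (C₀ + C₁ * u) - (a * v + b * u) * (D₀ + D₁ * u))
        - k * (g * (B₀ + B₁ * v) - (a * v + b * u) * (D₀ + D₁ * v)))
      (c₁ := k' * ((a * u + b * v) * (C₀ + C₁ * u) + g * (A₀ + A₁ * u)
        - (a * v + b * u) * (B₀ + B₁ * u)) - k * ((a * u + b * v) * (B₀ + B₁ * v)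
        + g * (A₀ + A₁ * v) - (a * v + b * u) * (C₀ + C₁ * v)))
      (c₂ := (a * u + b * v) * (k' * (A₀ + A₁ * u) - k * (A₀ + A₁ * v)))
      fun x => by linear_combination h x u v
  obtain ⟨-, a1, -, a2, -, -⟩ := quadratic_coeffs (c₀ := 0)
    (c₁ := a * (k' - k) * A₀) (c₂ := b * (k' - k) * A₀) (c₁₁ := a * k' * A₁)
    (c₁₂ := b * k' * A₁ - a * k * A₁) (c₂₂ := -(b * k * A₁))
    fun u v _ _ => by linear_combination (key u v).2.2
  have hA1 : A₁ = 0 := (mul_eq_zero.mp a2).resolve_left (mul_ne_zero ha hk')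
  have hA0 : (k' - k) * A₀ = 0 := by
    rw [mul_assoc] at a1; exact (mul_eq_zero.mp a1).resolve_left ha
  subst hA1
  obtain ⟨-, b1, b2, b3, b4, -⟩ := quadratic_coeffs (c₀ := 0)
    (c₁ := k' * (a * C₀ - b * B₀) - k * (a * B₀ - b * C₀))
    (c₂ := k' * (b * C₀ - a * B₀) - k * (b * B₀ - a * C₀))
    (c₁₁ := k' * (a * C₁ - b * B₁)) (c₁₂ := (k' + k) * (b * C₁ - a * B₁))
    (c₂₂ := k * (a * C₁ - b * B₁))
    fun u v _ _ => by linear_combination (key u v).2.1 - g * hA0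
  have hBC : a * C₁ - b * B₁ = 0 := (mul_eq_zero.mp b3).resolve_left hk'
  have zero : k' + k ≠ 0 → B₁ = 0 ∧ C₁ = 0 := by
    intro hkk
    have h4 := (mul_eq_zero.mp b4).resolve_left hkk
    have hab' := sub_ne_zero.mpr hab
    exact ⟨(mul_eq_zero.mp (by linear_combination b * hBC - a * h4 :
        (a ^ 2 - b ^ 2) * B₁ = 0)).resolve_left hab',
      (mul_eq_zero.mp (by linear_combination a * hBC - b * h4 :
        (a ^ 2 - b ^ 2) * C₁ = 0)).resolve_left hab'⟩
  by_cases hkk : k' = k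
  · subst hkk
    left
    obtain ⟨rfl, rfl⟩ := zero (by rw [← two_mul]; exact mul_ne_zero two_ne_zero hk')
    have hC0 : C₀ - B₀ = 0 := by
      have : k' * (a + b) * (C₀ - B₀) = 0 := by linear_combination b1
      exact (mul_eq_zero.mp this).resolve_left (mul_ne_zero hk' hs)
    have hD1 : D₁ = 0 := by
      have : k' * b * D₁ = 0 := by linear_combination -(key 1 0).1 + k' * g * hC0
      exact (mul_eq_zero.mp this).resolve_left (mul_ne_zero hk' hb)
    intro x u u' y
    rw [hq, hq, hD1]
    ring
  · right
    have hA0' := (mul_eq_zero.mp hA0).resolve_left (sub_ne_zero.mpr hkk)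
    by_cases hkk' : k' + k = 0
    · have hk'' : k' = -k := by linear_combination hkk'
      subst hk''
      have hC0 : C₀ + B₀ = 0 := by
        have : k * (a - b) * (C₀ + B₀) = 0 := by linear_combination -b1
        exact (mul_eq_zero.mp this).resolve_left (mul_ne_zero hk hd)
      obtain ⟨w, rfl⟩ : ∃ w, B₁ = a * w := ⟨B₁ / a, by field_simp⟩
      have hC1 : C₁ = b * w := by
        apply mul_left_cancel₀ ha; linear_combination hBC
      subst hC1
      obtain ⟨-, d1, -, d2, -, -⟩ := quadratic_coeffs (c₀ := g * (C₀ + B₀))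
        (c₁ := g * w * b - 2 * b * D₀) (c₂ := g * w * a - 2 * a * D₀)
        (c₁₁ := -(b * D₁)) (c₁₂ := -(a * D₁) - b * D₁) (c₂₂ := -(a * D₁))
        fun u v _ _ => by
          apply mul_left_cancel₀ hk
          linear_combination -(key u v).1
      refine ⟨hA0', rfl, by linear_combination hC0, ?_, w, rfl, rfl, ?_⟩
      · exact (mul_eq_zero.mp (neg_eq_zero.mp d2)).resolve_left hb
      · apply mul_left_cancel₀ hb
        linear_combination -d1 / 2
    · exfalso
      obtain ⟨rfl, rfl⟩ := zero hkk'
      have e1 : C₀ - B₀ = 0 := by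
        have : (k' + k) * (a + b) * (C₀ - B₀) = 0 := by linear_combination b1 + b2
        exact (mul_eq_zero.mp this).resolve_left (mul_ne_zero hkk' hs)
      have e2 : C₀ + B₀ = 0 := by
        have : (k' - k) * (a - b) * (C₀ + B₀) = 0 := by linear_combination b1 - b2
        exact (mul_eq_zero.mp this).resolve_left (mul_ne_zero (sub_ne_zero.mpr hkk) hd)
      exact hqb.exists_coeff_ne_zero hq ⟨hA0', rfl, by linear_combination (e2 - e1) / 2, rfl,
        by linear_combination (e2 + e1) / 2, rfl⟩

namespace ABS

theorem irreducible_edge_H3 {K : KleinQuad} {c γ : ℂ} (hc : c ≠ 0) (hγ : γ ≠ 0)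
    (he : ∀ x u, K.edge x u = c * (x * u + γ)) : Irreducible K.edgePoly :=
  irreducible_of_affine (F := fun u => c * u) (G := fun _ => c * γ)
    (fun x u => by rw [K.eval_edgePoly, he]; ring)
    (fun _ _ => mul_ne_zero hc hγ) ⟨1, by simpa using hc⟩

theorem edge_H3 (δ α β x u : ℂ) : ((H3 δ).coeffs α β).edge x u
    = (Complex.exp α ^ 2 - Complex.exp β ^ 2) * (x * u + δ * Complex.exp α) := by
  simp only [KleinQuad.edge, coeffs, two_mul, Complex.exp_add]; ring

theorem edge_swap_H3 (δ α β x u : ℂ) : ((H3 δ).coeffs α β).swap.edge x u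
    = (Complex.exp β ^ 2 - Complex.exp α ^ 2) * (x * u + δ * Complex.exp β) := by
  simp only [KleinQuad.edge, KleinQuad.swap, coeffs, two_mul, Complex.exp_add]; ring

/-- For H3 with constant elimination factor, the same alternatives as for H2. -/
theorem singular_of_elim_const_H3 {δ α β : ℂ} (hδ : δ ≠ 0) (hA : (H3 δ).Admissible α β)
    {q p : TriPoly} (h : DualPair ((H3 δ).coeffs α β) q p) {k : ℂ} (hk : k ≠ 0)
    (hχ : ((H3 δ).coeffs α β).Elim q p (C k)) :
    IsMiddleFree q ∨ ∃ c₀ c₁ : ℂ, q = C c₀ * (H3 δ).p₀ α β + C c₁ * (H3 δ).p₁ α β := by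
  have hgen := coeffs_generic hA
  have ha := Complex.exp_ne_zero α
  have hb := Complex.exp_ne_zero β
  have hc : Complex.exp α ^ 2 - Complex.exp β ^ 2 ≠ 0 := sub_ne_zero.mpr hA
  have hc' : Complex.exp β ^ 2 - Complex.exp α ^ 2 ≠ 0 := sub_ne_zero.mpr (Ne.symm hA)
  obtain ⟨hs, -⟩ := sq_ne_sq_iff.mp (show Complex.exp α ^ 2 ≠ Complex.exp β ^ 2 from hA)
  obtain ⟨χ', hχ'⟩ := h.elim_swap
  have hm : degreeOf 1 q ≤ 1 := by
    have h1 := hχ.degree_middle_le h.left h.right hgen.edge_ne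
    have h2 := KleinQuad.degreeOf_edgePoly_one (K := (H3 δ).coeffs α β) (x := 1) (u := 1) (by
      rw [edge_H3, edge_H3]
      intro h0
      exact hc (by linear_combination h0))
    rw [degreeOf_C] at h1
    omega
  obtain ⟨A₀, A₁, B₀, B₁, C₀, C₁, D₀, D₁, hq, h1, h2⟩ := hχ.exists_affine_coeffs hχ' h.left hm
  rcases hχ'.unit_or_edge h.left.map_rev h.right.map_rev hgen.edge_swap_ne
    (irreducible_edge_H3 hc' (mul_ne_zero hδ hb) (edge_swap_H3 δ α β))
    with ⟨k', hk', rfl⟩ | ⟨⟨k', hk', hev⟩, -⟩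
  · simp only [KleinQuad.S, KleinQuad.T, coeffs, eval_C] at h1 h2
    have hab : Complex.exp α ^ 2 ≠ (-Complex.exp β) ^ 2 := by rw [neg_sq]; exact hA
    rcases flat_comparison ha (neg_ne_zero.mpr hb) hab hk hk' h.left hq
        (g := δ * (Complex.exp (2 * α) - Complex.exp (2 * β)))
        (fun x u v => by linear_combination k' * h1 x u v - k * h2 x u v) with
      hmf | ⟨rfl, rfl, rfl, rfl, w, rfl, rfl, rfl⟩
    · exact .inl hmf
    · refine .inr ⟨w / 2, B₀ / (Complex.exp α + Complex.exp β), tri_ext fun x u y => ?_⟩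
      rw [hq]
      simp [p₀, p₁]
      field_simp
      ring
  · exfalso
    have hn : degreeOf 1 p ≤ 1 := by
      have := hχ'.middle_le_one h.left.map_rev h.right.map_rev hgen.edge_swap_ne (x := 1) (x' := 0)
        (u := 1) (by
          rw [hev, hev, edge_swap_H3, edge_swap_H3]
          intro h0
          exact hc' (by linear_combination mul_left_cancel₀ hk' h0))
      rwa [(degreeOf_rev p).2.1] at this
    simp only [edge_swap_H3] at hev
    simp only [KleinQuad.S, KleinQuad.T, coeffs, eval_C, hev] at h1 h2
    generalize δ * (Complex.exp (2 * α) - Complex.exp (2 * β)) = g at *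
    generalize δ * Complex.exp β = γ at *
    generalize Complex.exp α = a at *
    generalize Complex.exp β = b at *
    have key := fun u v => eq_zero_of_quadratic (c₀ := g * (C₀ + C₁ * u)
          - (a * v - b * u) * (D₀ + D₁ * u) - k * eval ![u, 0, v] p)
        (c₁ := (a * u - b * v) * (C₀ + C₁ * u) + g * (A₀ + A₁ * u)
          - (a * v - b * u) * (B₀ + B₁ * u) - k * (eval ![u, 1, v] p - eval ![u, 0, v] p))
        (c₂ := (a * u - b * v) * (A₀ + A₁ * u))
        fun x => by linear_combination h1 x u v + k * eval_middle_affine hn u x v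
    obtain ⟨-, a1, -, a2, -, -⟩ := quadratic_coeffs (c₀ := 0)
      (c₁ := a * A₀) (c₂ := -(b * A₀)) (c₁₁ := a * A₁) (c₁₂ := -(b * A₁)) (c₂₂ := 0)
      fun u v _ _ => by linear_combination (key u v).2.2
    have hA0 : A₀ = 0 := (mul_eq_zero.mp a1).resolve_left ha
    have hA1 : A₁ = 0 := (mul_eq_zero.mp a2).resolve_left ha
    subst hA0 hA1
    have hP : ∀ u v, v ≠ 0 → eval ![u, 1, v] p - eval ![u, 0, v] p = 0 := by
      intro u v hv
      have := (eq_zero_of_quadratic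
        (c₀ := g * (B₀ + B₁ * v) - (a * v - b * u) * (D₀ + D₁ * v)
          - k' * (b ^ 2 - a ^ 2) * γ * eval ![u, 0, v] p)
        (c₁ := (a * u - b * v) * (B₀ + B₁ * v) - (a * v - b * u) * (C₀ + C₁ * v)
          - k' * (b ^ 2 - a ^ 2) * (v * eval ![u, 0, v] p
            + γ * (eval ![u, 1, v] p - eval ![u, 0, v] p)))
        (c₂ := -(k' * (b ^ 2 - a ^ 2) * v * (eval ![u, 1, v] p - eval ![u, 0, v] p)))
        fun x => by
          linear_combination h2 x u v
            + k' * ((b ^ 2 - a ^ 2) * (x * v + γ)) * eval_middle_affine hn u x v).2.2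
      exact (mul_eq_zero.mp (neg_eq_zero.mp this)).resolve_left
        (mul_ne_zero (mul_ne_zero hk' hc') hv)
    obtain ⟨-, b1, b2, b3, b4, -⟩ := quadratic_coeffs (c₀ := 0) (c₁ := a * C₀ + b * B₀)
      (c₂ := -(b * C₀) - a * B₀) (c₁₁ := a * C₁ + b * B₁) (c₁₂ := -(b * C₁) - a * B₁) (c₂₂ := 0)
      fun u v _ hv => by linear_combination (key u v).2.1 + k * hP u v hv
    refine h.left.exists_coeff_ne_zero hq ⟨rfl, rfl, ?_, ?_, ?_, ?_⟩ <;>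
      apply mul_left_cancel₀ hc
    · linear_combination -a * b2 - b * b1
    · linear_combination -a * b4 - b * b3
    · linear_combination a * b1 + b * b2
    · linear_combination a * b3 + b * b4

/-- For H2 and H3(`δ ≠ 0`) the edge biquadratic is irreducible, so one of the two elimination
factors is constant. -/
theorem classify_H2_H3 {E : ABS} {α β : ℂ} (hE : E = H2 ∨ ∃ δ, δ ≠ 0 ∧ E = H3 δ)
    (hA : E.Admissible α β) {q p : TriPoly} (h : DualPair (E.coeffs α β) q p) :
    IsMiddleFree q ∨ IsMiddleFree p ∨ ∃ c₀ c₁ : ℂ,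
      q = C c₀ * E.p₀ α β + C c₁ * E.p₁ α β ∨ p = C c₀ * E.p₀ α β + C c₁ * E.p₁ α β := by
  have hgen := coeffs_generic hA
  have key : ∀ {q p : TriPoly}, DualPair (E.coeffs α β) q p →
      ∀ {k : ℂ}, k ≠ 0 → (E.coeffs α β).Elim q p (C k) →
      IsMiddleFree q ∨ ∃ c₀ c₁ : ℂ, q = C c₀ * E.p₀ α β + C c₁ * E.p₁ α β := by
    intro q p h k hk hχ
    rcases hE with rfl | ⟨δ, hδ, rfl⟩
    · exact singular_of_elim_const_H2 hA h hk hχ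
    · exact singular_of_elim_const_H3 hδ hA h hk hχ
  have hirr : Irreducible (E.coeffs α β).edgePoly := by
    rcases hE with rfl | ⟨δ, hδ, rfl⟩
    · exact irreducible_edge_H2 one_ne_zero (sub_ne_zero.mpr (Ne.symm hA)) (edge_H2 α β)
    · exact irreducible_edge_H3 (sub_ne_zero.mpr hA) (mul_ne_zero hδ (Complex.exp_ne_zero α))
        (edge_H3 δ α β)
  obtain ⟨χ, hχ⟩ := h.elim
  rcases hχ.unit_or_edge h.left h.right hgen.edge_ne hirr with ⟨k, hk, rfl⟩ | ⟨-, k, hk, hχ'⟩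
  · rcases key h hk hχ with h1 | ⟨c₀, c₁, h1⟩
    · exact .inl h1
    · exact .inr (.inr ⟨c₀, c₁, .inl h1⟩)
  · rcases key (h.symm hgen.edge_ne hgen.edge_swap_ne) hk hχ' with h1 | ⟨c₀, c₁, h1⟩
    · exact .inr (.inl h1)
    · exact .inr (.inr ⟨c₀, c₁, .inr h1⟩)

end ABS

/-! ### The equation H3(0) -/

theorem eval_eq_of_middle_ne_zero {p : TriPoly} {f : ℂ → ℂ → ℂ}
    (h : ∀ u x v, x ≠ 0 → eval ![u, x, v] p = f u v) (u x v : ℂ) : eval ![u, x, v] p = f u v := by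
  have hev : ∀ s, (aeval ![Polynomial.C u, Polynomial.X, Polynomial.C v] p : Polynomial ℂ).eval s
      = eval ![u, s, v] p := by
    intro s
    rw [← Polynomial.coe_aeval_eq_eval, MvPolynomial.comp_aeval_apply,
      ← MvPolynomial.coe_aeval_eq_eval, RingHom.coe_coe]
    congr 2
    ext i; fin_cases i <;> simp
  have := eval_eq_zero_of_ne_zero
    (p := aeval ![Polynomial.C u, Polynomial.X, Polynomial.C v] p - Polynomial.C (f u v))
    (fun s hs => by rw [Polynomial.eval_sub, hev, h u s v hs, Polynomial.eval_C, sub_self]) x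
  rw [Polynomial.eval_sub, hev, Polynomial.eval_C] at this
  exact sub_eq_zero.mp this

theorem IsBoundary.exists_eval_ne_zero {p : TriPoly} (hp : IsBoundary p) (t : ℂ) :
    ∃ u v, u ≠ 0 ∧ v ≠ 0 ∧ eval ![u, t, v] p ≠ 0 := by
  by_contra! h0
  obtain ⟨u, v, huv⟩ := exists_eval_ne_zero_of_irreducible hp.irreducible
    (by rw [hp.first]; simp) hp.first.le hp.last.le t
  have h1 : ∀ u, u ≠ 0 → ∀ v, eval ![u, t, v] p = 0 := by
    intro u hu v
    have e1 := hp.isBiaffine.2 u t (-1)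
    rw [h0 _ _ hu (by norm_num), h0 _ _ hu one_ne_zero] at e1
    rw [hp.isBiaffine.2, h0 _ _ hu one_ne_zero]
    linear_combination (v - 1) * e1 / 2
  have e1 := hp.isBiaffine.1 (-1) t v
  rw [h1 _ (by norm_num), h1 _ one_ne_zero] at e1
  rw [hp.isBiaffine.1, h1 _ one_ne_zero] at huv
  exact huv (by linear_combination (u - 1) * e1 / 2)

theorem eq_monomial_of_mul {c : ℂ} (hc : c ≠ 0) {P R : MvPolynomial (Fin 2) ℂ}
    (h : C c * (X 0 * X 1) = P * R) :
    ∃ k : ℂ, k ≠ 0 ∧ ∃ i j : Fin 2, P = C k * (X 0 ^ (i : ℕ) * X 1 ^ (j : ℕ)) := by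
  have hX : ∀ i : Fin 2, Irreducible (X i : MvPolynomial (Fin 2) ℂ) := fun i =>
    (MvPolynomial.X_prime (i := i)).irreducible
  rcases factor_of_two_irreducible hc (hX 0) (hX 1) h with hu | hu | hu | hu
  · obtain ⟨k, hk, rfl⟩ := exists_eq_C_of_isUnit hu
    exact ⟨k, hk, 0, 0, by simp⟩
  · obtain ⟨k, hk, rfl⟩ := exists_eq_C_of_isUnit hu
    refine ⟨c / k, div_ne_zero hc hk, 1, 1, ?_⟩
    have hk' : (C k : MvPolynomial (Fin 2) ℂ) ≠ 0 := C_ne_zero.mpr hk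
    apply mul_right_cancel₀ hk'
    rw [← h, mul_right_comm, ← C_mul, div_mul_cancel₀ _ hk]
    simp
  · obtain ⟨k, hk, rfl⟩ := exists_eq_C_mul_of_associated hu
    exact ⟨k, hk, 1, 0, by simp⟩
  · obtain ⟨k, hk, rfl⟩ := exists_eq_C_mul_of_associated hu
    exact ⟨k, hk, 0, 1, by simp⟩

namespace KleinQuad

/-- The coefficients of `a (x u + v y) + b (x v + u y)`. -/
def bilinear (a b : ℂ) : KleinQuad := ⟨0, a, b, 0, 0, 0⟩

theorem edge_bilinear (a b x u : ℂ) : (bilinear a b).edge x u = (a ^ 2 - b ^ 2) * (x * u) := by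
  simp only [edge, bilinear]; ring

theorem edgePoly_bilinear (a b : ℂ) :
    (bilinear a b).edgePoly = C (a ^ 2 - b ^ 2) * (X 0 * X 1) :=
  MvPolynomial.funext fun z => by
    have hz : z = ![z 0, z 1] := by ext i; fin_cases i <;> rfl
    rw [hz, eval_edgePoly, edge_bilinear]; simp

theorem exists_edge_bilinear_ne_zero {a b : ℂ} (hab : a ^ 2 ≠ b ^ 2) :
    ∃ x u, (bilinear a b).edge x u ≠ 0 :=
  ⟨1, 1, by rw [edge_bilinear]; simpa using sub_ne_zero.mpr hab⟩

theorem Elim.eq_monomial {a b : ℂ} {q p : TriPoly} {χ : MvPolynomial (Fin 2) ℂ}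
    (h : (bilinear a b).Elim q p χ) (hq : IsBoundary q) (hp : IsBoundary p) (hab : a ^ 2 ≠ b ^ 2) :
    ∃ k : ℂ, k ≠ 0 ∧ ∃ i j : Fin 2, ∀ x u, eval ![x, u] χ = k * (x ^ (i : ℕ) * u ^ (j : ℕ)) := by
  obtain ⟨χ', -, he⟩ := h.symm hq hp (exists_edge_bilinear_ne_zero hab)
  rw [edgePoly_bilinear, ← mul_neg] at he
  obtain ⟨k, hk, i, j, rfl⟩ := eq_monomial_of_mul (sub_ne_zero.mpr hab) he
  exact ⟨k, hk, i, j, fun x u => by simp⟩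

/-- The exponents of `x` and `u` in the elimination factor can be read off from `q`, and hence do
not change under the exchange of `u` and `v`. -/
theorem Elim.exponent_le {a b : ℂ} (ha : a ≠ 0) (hb : b ≠ 0) {q p : TriPoly}
    {χ χ' : MvPolynomial (Fin 2) ℂ} (h : (bilinear a b).Elim q p χ)
    (h' : (bilinear b a).Elim (rev q) (rev p) χ') (hq : IsBoundary q) (hp : IsBoundary p)
    {k k' : ℂ} (hk' : k' ≠ 0) {i j i' j' : Fin 2}
    (hχ : ∀ x u, eval ![x, u] χ = k * (x ^ (i : ℕ) * u ^ (j : ℕ)))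
    (hχ' : ∀ x u, eval ![x, u] χ' = k' * (x ^ (i' : ℕ) * u ^ (j' : ℕ))) : i ≤ i' ∧ j ≤ j' := by
  obtain ⟨A, B, C', D, -, hqe, h1, h2⟩ := h.exists_coeffs h' hq
  simp only [S, T, bilinear, hχ, hχ'] at h1 h2
  constructor
  · by_contra hi
    obtain ⟨rfl, rfl⟩ : i = 1 ∧ i' = 0 := by omega
    have hD : ∀ u, D.eval u = 0 := by
      intro u
      have := h1 0 u ((1 - b * u) / a)
      have e : a * ((1 - b * u) / a) = 1 - b * u := by field_simp
      simp at this
      rw [e] at this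
      simpa using this
    have hp0 : ∀ u v, v ≠ 0 → eval ![u, 0, v] p = 0 := by
      intro u v hv
      have := h2 0 u v
      simpa [hD, hv, hk'] using this
    obtain ⟨u, v, -, hv, huv⟩ := hp.exists_eval_ne_zero 0
    exact huv (hp0 u v hv)
  · by_contra hj
    obtain ⟨rfl, rfl⟩ : j = 1 ∧ j' = 0 := by omega
    obtain ⟨c0, c1, c2⟩ := eq_zero_of_quadratic (c₀ := -(a * D.eval 0))
      (c₁ := b * C'.eval 0 - a * B.eval 0) (c₂ := b * A.eval 0) fun x => by
        have := h1 x 0 1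
        simp at this
        linear_combination this
    have hA := (mul_eq_zero.mp c2).resolve_left hb
    have hD := (mul_eq_zero.mp (neg_eq_zero.mp c0)).resolve_left ha
    obtain ⟨P, R, P', R', hpe, -⟩ := exists_eq_biaffine hp.first.le hp.last.le
    have hp0 : ∀ u x, x ≠ 0 → eval ![u, x, 0] p = 0 := by
      intro u x hx
      have := h2 x u 0
      simp [hA, hD] at this
      have e : k' * x ^ (i' : ℕ) * eval ![u, x, 0] p = 0 := by
        rw [mul_assoc, ← mul_assoc, ← this]
        linear_combination -(u * x) * c1
      exact (mul_eq_zero.mp e).resolve_left (mul_ne_zero hk' (pow_ne_zero _ hx))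
    obtain ⟨u, x, hux⟩ := hp.exists_eval_last_zero
    apply hux
    simp only [hpe, eval_biaffine] at hp0 ⊢
    have hR' : ∀ s, s ≠ 0 → R'.eval s = 0 := fun s hs => by simpa using hp0 0 s hs
    have hR : ∀ s, s ≠ 0 → R.eval s = 0 := fun s hs => by simpa [hR' s hs] using hp0 1 s hs
    rw [eval_eq_zero_of_ne_zero hR, eval_eq_zero_of_ne_zero hR']
    ring

end KleinQuad

open KleinQuad in
theorem DualPair.isMiddleFree_bilinear {a b : ℂ} (ha : a ≠ 0) (hb : b ≠ 0) (hab : a ^ 2 ≠ b ^ 2)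
    {q p : TriPoly} (h : DualPair (bilinear a b) q p) : IsMiddleFree q ∨ IsMiddleFree p := by
  have hK := exists_edge_bilinear_ne_zero hab
  have hK' : ∃ x u, (bilinear a b).swap.edge x u ≠ 0 := exists_edge_bilinear_ne_zero (Ne.symm hab)
  have exps : ∀ {q p : TriPoly}, DualPair (bilinear a b) q p →
      ∀ {χ : MvPolynomial (Fin 2) ℂ}, (bilinear a b).Elim q p χ →
      ∃ χ' : MvPolynomial (Fin 2) ℂ, (bilinear b a).Elim (rev q) (rev p) χ' ∧
      ∃ k k' : ℂ, k ≠ 0 ∧ k' ≠ 0 ∧ ∃ i j : Fin 2,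
      (∀ x u, eval ![x, u] χ = k * (x ^ (i : ℕ) * u ^ (j : ℕ))) ∧
      (∀ x u, eval ![x, u] χ' = k' * (x ^ (i : ℕ) * u ^ (j : ℕ))) := by
    intro q p h χ hχ
    obtain ⟨χ', hχ'⟩ := h.elim_swap
    change (bilinear b a).Elim (rev q) (rev p) χ' at hχ'
    obtain ⟨k, hk, i, j, hev⟩ := hχ.eq_monomial h.left h.right hab
    obtain ⟨k', hk', i', j', hev'⟩ := hχ'.eq_monomial h.left.map_rev h.right.map_rev (Ne.symm hab)
    have e1 := hχ.exponent_le ha hb hχ' h.left h.right hk' hev hev'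
    have e2 := hχ'.exponent_le hb ha (by rw [rev_rev, rev_rev]; exact hχ) h.left.map_rev
      h.right.map_rev hk hev' hev
    obtain rfl := le_antisymm e1.1 e2.1
    obtain rfl := le_antisymm e1.2 e2.2
    exact ⟨χ', hχ', k, k', hk, hk', i, j, hev, hev'⟩
  -- the cases of a factor `k` or `k x`
  have low : ∀ {q p : TriPoly}, DualPair (bilinear a b) q p → ∀ {χ χ' : MvPolynomial (Fin 2) ℂ},
      (bilinear a b).Elim q p χ → (bilinear b a).Elim (rev q) (rev p) χ' →
      ∀ {k k' : ℂ}, k ≠ 0 → k' ≠ 0 → ∀ i : Fin 2, (∀ x u, eval ![x, u] χ = k * x ^ (i : ℕ)) →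
      (∀ x u, eval ![x, u] χ' = k' * x ^ (i : ℕ)) → IsMiddleFree q ∨ IsMiddleFree p := by
    intro q p h χ χ' hχ hχ' k k' hk hk' i hev hev'
    have hm : degreeOf 1 q ≤ 1 := by
      have h1 := hχ.degree_middle_le h.left h.right hK
      have h2 := degreeOf_edgePoly_one (K := bilinear a b) (x := 1) (u := 1) (by
        rw [edge_bilinear, edge_bilinear]
        simpa using sub_ne_zero.mpr hab)
      have h3 : degreeOf 1 χ = 0 := by
        have : χ = C k * X 0 ^ (i : ℕ) := MvPolynomial.funext fun z => by
          have hz : z = ![z 0, z 1] := by ext i; fin_cases i <;> rfl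
          rw [hz, hev]; simp
        rw [this]
        refine Nat.le_zero.mp ((degreeOf_C_mul_le _ _ _).trans ((degreeOf_pow_le _ _ _).trans ?_))
        rw [degreeOf_X, if_neg (by decide), mul_zero]
      omega
    obtain ⟨A₀, A₁, B₀, B₁, C₀, C₁, D₀, D₁, hq, h1, h2⟩ := hχ.exists_affine_coeffs hχ' h.left hm
    simp only [S, T, bilinear, hev, hev'] at h1 h2
    rcases flat_comparison ha hb hab hk hk' h.left hq (g := 0)
        (fun x u v => by linear_combination k' * h1 x u v - k * h2 x u v) with
      hmf | ⟨rfl, rfl, rfl, rfl, w, rfl, rfl, rfl⟩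
    · exact .inl hmf
    · right
      have hp : ∀ u x v, x * ((a * u + b * v) * (-B₀ + b * w * u) - 
          (a * v + b * u) * (B₀ + a * w * u))
          = k * x ^ (i : ℕ) * eval ![u, x, v] p := by
        intro u x v; rw [← h1]; ring
      obtain rfl | rfl : i = 0 ∨ i = 1 := by omega
      · exfalso
        obtain ⟨u, v, -, -, huv⟩ := h.right.exists_eval_ne_zero 0
        apply huv
        simpa [hk] using (hp u 0 v).symm
      · have := eval_eq_of_middle_ne_zero (p := p) (f := fun u v => k⁻¹ *
            ((a * u + b * v) * (-B₀ + b * w * u) - (a * v + b * u) * (B₀ + a * w * u)))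
          (fun u x v hx => by
            have e := hp u x v
            apply mul_left_cancel₀ (mul_ne_zero hk hx)
            rw [Fin.val_one, pow_one] at e
            rw [← e]
            field_simp)
        intro u x x' v
        rw [this, this]
  obtain ⟨χ, hχ⟩ := h.elim
  obtain ⟨χ', hχ', k, k', hk, hk', i, j, hev, hev'⟩ := exps h hχ
  obtain rfl | rfl : j = 0 ∨ j = 1 := by omega
  · exact low h hχ hχ' hk hk' i (by simpa using hev) (by simpa using hev')
  obtain rfl | rfl : i = 0 ∨ i = 1 := by omega
  · -- the factor `k u` would force `q` to vanish at `u = 0`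
    exfalso
    obtain ⟨A, B, C', D, -, hq, h1, h2⟩ := hχ.exists_coeffs hχ' h.left
    simp only [S, T, bilinear, hev, hev', Fin.val_zero, Fin.val_one, pow_zero, pow_one] at h1 h2
    have hs := (sq_ne_sq_iff.mp hab)
    have key := fun u v => eq_zero_of_quadratic
      (c₀ := -((a * v + b * u) * (k' * v * D.eval u - k * u * D.eval v)))
      (c₁ := k' * v * ((a * u + b * v) * C'.eval u - (a * v + b * u) * B.eval u)
        - k * u * ((a * u + b * v) * B.eval v - (a * v + b * u) * C'.eval v))
      (c₂ := (a * u + b * v) * (k' * v * A.eval u - k * u * A.eval v))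
      fun x => by linear_combination k' * v * h1 x u v - k * u * h2 x u v
    by_cases hkk : k' = k
    · subst hkk
      have hD : D.eval 0 = 0 := by
        have : b * k' * D.eval 0 = 0 := by linear_combination (key 1 0).1
        exact (mul_eq_zero.mp this).resolve_left (mul_ne_zero hb hk')
      have hA : A.eval 0 = 0 := by
        have : a * k' * A.eval 0 = 0 := by linear_combination -(key 1 0).2.2
        exact (mul_eq_zero.mp this).resolve_left (mul_ne_zero ha hk')
      have hCB : ∀ s, (C' - B).eval s = 0 := eval_eq_zero_of_ne_zero fun s hs0 => by
        have : 2 * k' * (a + b) * s ^ 2 * (C' - B).eval s = 0 := by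
          rw [Polynomial.eval_sub]
          linear_combination (key s s).2.1
        exact (mul_eq_zero.mp this).resolve_left
          (mul_ne_zero (mul_ne_zero (mul_ne_zero two_ne_zero hk') hs.1) (pow_ne_zero 2 hs0))
      simp only [Polynomial.eval_sub] at hCB
      have hB : (B + B.comp (-Polynomial.X)).eval 0 = 0 := eval_eq_zero_of_ne_zero (fun s hs0 => by
        have : -(2 * k' * (a - b) * s ^ 2) * (B + B.comp (-Polynomial.X)).eval s = 0 := by
          simp only [Polynomial.eval_add, Polynomial.eval_comp, Polynomial.eval_neg,
            Polynomial.eval_X]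
          linear_combination (key s (-s)).2.1 + k' * (a - b) * s ^ 2 * (hCB s + hCB (-s))
        exact (mul_eq_zero.mp this).resolve_left (neg_ne_zero.mpr
          (mul_ne_zero (mul_ne_zero (mul_ne_zero two_ne_zero hk') hs.2) (pow_ne_zero 2 hs0)))) 0
      simp only [Polynomial.eval_add, Polynomial.eval_comp, Polynomial.eval_neg,
        Polynomial.eval_X, neg_zero] at hB
      obtain ⟨x, y, -, -, hxy⟩ := h.left.exists_eval_ne_zero 0
      apply hxy
      rw [hq]
      linear_combination x * y * hA + hD + (x + y) * hB / 2 + y * hCB 0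
    · have hD : ∀ s, D.eval s = 0 := eval_eq_zero_of_ne_zero fun s hs0 => by
        have : (a + b) * (k' - k) * s ^ 2 * D.eval s = 0 := by linear_combination -(key s s).1
        exact (mul_eq_zero.mp this).resolve_left
          (mul_ne_zero (mul_ne_zero hs.1 (sub_ne_zero.mpr hkk)) (pow_ne_zero 2 hs0))
      obtain ⟨u, v, hu, -, huv⟩ := h.right.exists_eval_ne_zero 0
      have := h1 0 u v
      rw [hD] at this
      simp [hk, hu] at this
      exact huv this
  · -- the factor is `k x u`, and the factor of the reversed duality is constant
    obtain ⟨χs, hχs, he⟩ := hχ.symm h.left h.right hK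
    have h' := h.symm hK hK'
    obtain ⟨χ₁', hχ₁', k₁, k₁', hk₁, hk₁', i₁, j₁, hev₁, hev₁'⟩ := exps h' hχs
    have hval : ∀ x u, (a ^ 2 - b ^ 2) * (x * u)
        = -(k * (x * u) * (k₁ * (u ^ (i₁ : ℕ) * x ^ (j₁ : ℕ)))) := by
      intro x u
      have := congrArg (eval ![x, u]) he
      rw [eval_edgePoly, edge_bilinear, map_neg, map_mul, hev, eval_rename,
        show (![x, u] ∘ ![1, 0] : Fin 2 → ℂ) = ![u, x] by ext i; fin_cases i <;> rfl, hev₁] at this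
      simpa using this
    have h11 := hval 1 1
    have h12 := hval 1 2
    have h21 := hval 2 1
    have hkk := mul_ne_zero hk hk₁
    obtain rfl : i₁ = 0 := by
      by_contra hi
      obtain rfl : i₁ = 1 := by omega
      simp at h11 h12
      exact hkk (by linear_combination (h12 - 2 * h11) / 2)
    obtain rfl : j₁ = 0 := by
      by_contra hi
      obtain rfl : j₁ = 1 := by omega
      simp at h11 h21
      exact hkk (by linear_combination (h21 - 2 * h11) / 2)
    exact (low h' hχs hχ₁' hk₁ hk₁' 0 (by simpa using hev₁) (by simpa using hev₁')).symm

theorem ABS.isMiddleFree_H3 {α β : ℂ} (hA : (ABS.H3 0).Admissible α β) {q p : TriPoly}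
    (h : DualPair ((ABS.H3 0).coeffs α β) q p) : IsMiddleFree q ∨ IsMiddleFree p := by
  refine DualPair.isMiddleFree_bilinear (a := Complex.exp α) (b := -Complex.exp β)
    (Complex.exp_ne_zero α) (neg_ne_zero.mpr (Complex.exp_ne_zero β)) (by rw [neg_sq]; exact hA) ?_
  have e : (ABS.H3 0).coeffs α β = KleinQuad.bilinear (Complex.exp α) (-Complex.exp β) := by
    simp [ABS.coeffs, KleinQuad.bilinear]
  rwa [e] at h

/-! ### Edge biquadratics with two simple factors -/

/-- The coefficients of `q` when both elimination factors have degree one. The bulk polynomial is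
given by `S = a x u + b x v + c u v + g`, `T = a v + b u + c x`; the five relations between the
constants say that `S = (t - ν u) T` on the line `x = l u + s` where the factor `x - l u - s`
vanishes. The identities are only needed for nonzero `u`, `v`, so that the lemma also applies after
the inversion of these variables. -/
theorem coeffs_of_linear_factor {a b c g l ν s t k σ A₀ A₁ B₀ B₁ C₀ C₁ D₀ D₁ : ℂ} {m : ℂ → ℂ}
    {P₀ P₁ : ℂ → ℂ → ℂ} (ha : a ≠ 0) (hc : c ≠ 0) (hl : l ≠ 0) (hν : ν ≠ 0)
    (hσ : σ ≠ 0) (r₁ : l * b + c = -(ν * a)) (r₂ : b * s = t * a)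
    (r₃ : l * a = -(ν * (b + c * l))) (r₄ : s * a = t * (b + c * l) - ν * c * s)
    (r₅ : g = t * c * s)
    (h1 : ∀ x u v, u ≠ 0 → v ≠ 0 → (a * (x * u) + b * (x * v) + c * (u * v) + g)
        * ((A₀ + A₁ * u) * x + (C₀ + C₁ * u)) - (a * v + b * u + c * x)
        * ((B₀ + B₁ * u) * x + (D₀ + D₁ * u)) = k * (x - l * u - s) * (P₀ u v + x * P₁ u v))
    (h2 : ∀ x u v, u ≠ 0 → v ≠ 0 → (a * (x * u) + b * (x * v) + c * (u * v) + g)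
        * ((A₀ + A₁ * v) * x + (B₀ + B₁ * v)) - (a * v + b * u + c * x)
        * ((C₀ + C₁ * v) * x + (D₀ + D₁ * v)) = σ * k * (x - m v) * (P₀ u v + x * P₁ u v))
    (hne : ¬ (A₀ = 0 ∧ A₁ = 0 ∧ B₀ = 0 ∧ B₁ = 0 ∧ C₀ = 0 ∧ C₁ = 0)) :
    A₁ = 0 ∧ σ ^ 2 * b * ν = -(a * l) ∧ l * A₀ = -((1 + σ) * C₁) ∧ l * B₁ = σ * ν * C₁ ∧
      C₀ = σ * B₀ ∧ D₁ = t * (l * A₀ + C₁) - ν * (s * A₀ + C₀) - l * B₀ - s * B₁ ∧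
      D₀ = t * (s * A₀ + C₀) - s * B₀ := by
  have hE : ∀ u, u ≠ 0 → (t - ν * u) * ((A₀ + A₁ * u) * (l * u + s) + (C₀ + C₁ * u))
      - ((B₀ + B₁ * u) * (l * u + s) + (D₀ + D₁ * u)) = 0 := by
    intro u hu
    apply mul_left_cancel₀ ha
    have e1 := h1 (l * u + s) u 1 hu one_ne_zero
    have e2 := h1 (l * u + s) u 2 hu two_ne_zero
    have hS : ∀ v, a * ((l * u + s) * u) + b * ((l * u + s) * v) + c * (u * v) + g
        = (t - ν * u) * (a * v + b * u + c * (l * u + s)) := by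
      intro v
      linear_combination (u * v) * r₁ + v * r₂ + u ^ 2 * r₃ + u * r₄ + r₅
    rw [hS] at e1 e2
    linear_combination e2 - e1
  obtain ⟨-, d0, d1, d2, d3⟩ := quartic_coeffs (c₀ := 0) (c₁ := t * (s * A₀ + C₀) - s * B₀ - D₀)
    (c₂ := t * (l * A₀ + s * A₁ + C₁) - ν * (s * A₀ + C₀) - l * B₀ - s * B₁ - D₁)
    (c₃ := t * l * A₁ - ν * (l * A₀ + s * A₁ + C₁) - l * B₁) (c₄ := -(ν * l * A₁)) (fun u => by
      by_cases hu : u = 0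
      · rw [hu]; ring
      · linear_combination u * hE u hu)
  have hA1 : A₁ = 0 := (mul_eq_zero.mp (neg_eq_zero.mp d3)).resolve_left (mul_ne_zero hν hl)
  subst hA1
  have k1 := fun u v (hu : u ≠ 0) (hv : v ≠ 0) => eq_zero_of_quadratic
    (c₀ := (c * (u * v) + g) * (C₀ + C₁ * u) - (a * v + b * u) * (D₀ + D₁ * u)
      + k * (l * u + s) * P₀ u v)
    (c₁ := (a * u + b * v) * (C₀ + C₁ * u) + (c * (u * v) + g) * A₀ - c * (D₀ + D₁ * u)
      - (a * v + b * u) * (B₀ + B₁ * u) - k * (P₀ u v - (l * u + s) * P₁ u v))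
    (c₂ := (a * u + b * v) * A₀ - c * (B₀ + B₁ * u) - k * P₁ u v)
    fun x => by linear_combination h1 x u v hu hv
  have k2 := fun u v (hu : u ≠ 0) (hv : v ≠ 0) => eq_zero_of_quadratic
    (c₀ := (c * (u * v) + g) * (B₀ + B₁ * v) - (a * v + b * u) * (D₀ + D₁ * v)
      + σ * k * m v * P₀ u v)
    (c₁ := (a * u + b * v) * (B₀ + B₁ * v) + (c * (u * v) + g) * A₀ - c * (D₀ + D₁ * v)
      - (a * v + b * u) * (C₀ + C₁ * v) - σ * k * (P₀ u v - m v * P₁ u v))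
    (c₂ := (a * u + b * v) * A₀ - c * (C₀ + C₁ * v) - σ * k * P₁ u v)
    fun x => by linear_combination h2 x u v hu hv
  obtain ⟨f0, f1, f2, -, -, -⟩ := quadratic_coeffs (c₀ := -(c * (σ * B₀ - C₀)))
    (c₁ := (σ - 1) * a * A₀ - σ * c * B₁) (c₂ := (σ - 1) * b * A₀ + c * C₁)
    (c₁₁ := 0) (c₁₂ := 0) (c₂₂ := 0)
    fun u v hu hv => by linear_combination σ * (k1 u v hu hv).2.2 - (k2 u v hu hv).2.2
  have hC0 : C₀ = σ * B₀ := by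
    have := (mul_eq_zero.mp (neg_eq_zero.mp f0)).resolve_left hc
    linear_combination -this
  have r₆ : l * a * (1 - ν ^ 2) + ν * b * (1 - l ^ 2) = 0 := by
    linear_combination r₃ - ν * l * r₁
  have hquad : σ ^ 2 * b * ν = -(a * l) := by
    by_cases hA0 : A₀ = 0
    · subst hA0
      have hB1 : B₁ = 0 := by
        have : σ * c * B₁ = 0 := by linear_combination -f1
        exact (mul_eq_zero.mp this).resolve_left (mul_ne_zero hσ hc)
      have hC1 : C₁ = 0 := by
        have : c * C₁ = 0 := by linear_combination f2
        exact (mul_eq_zero.mp this).resolve_left hc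
      subst hB1 hC1
      have hB0 : B₀ ≠ 0 := fun h0 => hne ⟨rfl, rfl, h0, rfl, by rw [hC0, h0, mul_zero], rfl⟩
      have hD1 : D₁ = -(ν * σ + l) * B₀ := by linear_combination -d1 - ν * hC0
      have hP1 : ∀ u v, u ≠ 0 → v ≠ 0 → k * P₁ u v = -(c * B₀) := fun u v hu hv => by
        linear_combination -(k1 u v hu hv).2.2
      have e : ∀ u, u ≠ 0 → σ * ((a * u + b) * C₀ - c * (D₀ + D₁ * u) - (a + b * u) * B₀
          - (l * u + s) * (c * B₀)) - ((a * u + b) * B₀ - c * (D₀ + D₁) - (a + b * u) * C₀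
          - σ * m 1 * (c * B₀)) = 0 := fun u hu => by
        linear_combination σ * (k1 u 1 hu one_ne_zero).2.1 - (k2 u 1 hu one_ne_zero).2.1
          - (σ * (l * u + s) - σ * m 1) * hP1 u 1 hu one_ne_zero
      have e' : B₀ * (σ ^ 2 * (a + c * ν) - a) = 0 := by
        linear_combination e 2 two_ne_zero - e 1 one_ne_zero - (σ * a + b) * hC0 + σ * c * hD1
      have := (mul_eq_zero.mp e').resolve_left hB0
      linear_combination -l * this + σ ^ 2 * r₃
    · have hX : ν * σ * l * c - ν * σ * (σ - 1) * b + l * (σ - 1) * a = 0 := by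
        apply mul_left_cancel₀ hA0
        linear_combination -σ * c * d2 + l * f1 - ν * σ * f2
      linear_combination -hX + σ * r₆ + ν * σ * l * r₁
  have hAC : l * A₀ = -((1 + σ) * C₁) := by
    apply mul_left_cancel₀ (mul_ne_zero hν hc)
    linear_combination (1 + σ) * ν * f2 + A₀ * (r₃ - hquad)
  exact ⟨rfl, hquad, hAC, by linear_combination -d2 - ν * hAC, hC0, by linear_combination -d1,
    by linear_combination -d0⟩

/-- An irreducible polynomial in `x` and `u` of degree at most one in `u` which involves `x`. -/
structure IsSimpleFactor (π : MvPolynomial (Fin 2) ℂ) : Prop where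
  irreducible : Irreducible π
  degree : degreeOf 1 π ≤ 1
  depends : ∃ x x' u, eval ![x, u] π ≠ eval ![x', u] π

theorem isSimpleFactor_of_affine {F G : ℂ → ℂ} {π : MvPolynomial (Fin 2) ℂ}
    (hπ : ∀ x u, eval ![x, u] π = F u * x + G u) (hne : ∀ u, F u = 0 → G u ≠ 0)
    (hF : ∃ u, F u ≠ 0) (hdeg : degreeOf 1 π ≤ 1) : IsSimpleFactor π := by
  refine ⟨irreducible_of_affine hπ hne hF, hdeg, ?_⟩
  obtain ⟨u, hu⟩ := hF
  refine ⟨1, 0, u, fun h0 => hu ?_⟩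
  rw [hπ, hπ] at h0
  linear_combination h0

theorem isSimpleFactor_line (l s : ℂ) : IsSimpleFactor (X 0 - C l * X 1 - C s) := by
  refine isSimpleFactor_of_affine (F := fun _ => 1) (G := fun u => -(l * u) - s)
    (fun x u => by simp; ring) (fun u h => absurd h one_ne_zero) ⟨0, one_ne_zero⟩ ?_
  refine degreeOf_sub_le_of_le (degreeOf_sub_le_of_le ?_ ((degreeOf_C_mul_le _ _ _).trans ?_)) ?_
  · rw [degreeOf_X, if_neg (by decide)]; omega
  · rw [degreeOf_X, if_pos rfl]
  · rw [degreeOf_C]; omega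

theorem isSimpleFactor_hyperbola {l : ℂ} (hl : l ≠ 0) : IsSimpleFactor (X 0 * X 1 - C l) := by
  refine isSimpleFactor_of_affine (F := fun u => u) (G := fun _ => -l)
    (fun x u => by simp; ring) (fun _ _ => neg_ne_zero.mpr hl) ⟨1, one_ne_zero⟩ ?_
  refine degreeOf_sub_le_of_le (degreeOf_mul_le_of_le (m := 0) (n := 1) ?_ ?_) ?_
  · rw [degreeOf_X, if_neg (by decide)]
  · rw [degreeOf_X, if_pos rfl]
  · rw [degreeOf_C]; omega

/-- If the two edge biquadratics split into two simple factors, either one polynomial of the dual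
pair does not involve its middle argument, or both elimination factors are simple. -/
theorem DualPair.simple_factor {K : KleinQuad} {q p : TriPoly} (h : DualPair K q p)
    (hK : ∃ x u, K.edge x u ≠ 0) (hK' : ∃ x u, K.swap.edge x u ≠ 0)
    (hd : 2 ≤ degreeOf 1 K.edgePoly) (hd' : 2 ≤ degreeOf 1 K.swap.edgePoly)
    {π π' : Bool → MvPolynomial (Fin 2) ℂ} (hπ : ∀ i, IsSimpleFactor (π i))
    (hπ' : ∀ i, IsSimpleFactor (π' i)) {c c' : ℂ} (hc : c ≠ 0) (hc' : c' ≠ 0)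
    (he : K.edgePoly = C c * (π true * π false))
    (he' : K.swap.edgePoly = C c' * (π' true * π' false)) :
    IsMiddleFree q ∨ IsMiddleFree p ∨ (degreeOf 1 q ≤ 1 ∧ degreeOf 1 p ≤ 1 ∧
      ∃ (i j : Bool) (k k' : ℂ), k ≠ 0 ∧ k' ≠ 0 ∧ K.Elim q p (C k * π i) ∧
        K.swap.Elim (rev q) (rev p) (C k' * π' j)) := by
  have key : ∀ {K : KleinQuad} {q p : TriPoly} {χ : MvPolynomial (Fin 2) ℂ}
      {π : Bool → MvPolynomial (Fin 2) ℂ} {c : ℂ}, K.Elim q p χ → IsBoundary q → IsBoundary p →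
      (∃ x u, K.edge x u ≠ 0) → 2 ≤ degreeOf 1 K.edgePoly → (∀ i, IsSimpleFactor (π i)) → c ≠ 0 →
      K.edgePoly = C c * (π true * π false) →
      IsMiddleFree q ∨ IsMiddleFree p ∨ ∃ (i : Bool) (k : ℂ), k ≠ 0 ∧ χ = C k * π i := by
    intro K q p χ π c hχ hq hp hK hd hπ hc he
    obtain ⟨χ', hχ', he2⟩ := hχ.symm hq hp hK
    rw [he, ← mul_neg] at he2
    rcases factor_of_two_irreducible hc (hπ _).irreducible (hπ _).irreducible he2 with
      hu | hu | hu | hu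
    · exact .inl (hχ.isMiddleFree_of_isUnit hq hp hK hd hu)
    · exact .inr (.inl (hχ'.isMiddleFree_of_isUnit hp hq hK hd
        (isUnit_of_isUnit_rename ((IsUnit.neg_iff _).mp hu))))
    · obtain ⟨k, hk, hkχ⟩ := exists_eq_C_mul_of_associated hu
      exact .inr (.inr ⟨_, k, hk, hkχ⟩)
    · obtain ⟨k, hk, hkχ⟩ := exists_eq_C_mul_of_associated hu
      exact .inr (.inr ⟨_, k, hk, hkχ⟩)
  obtain ⟨χ, hχ⟩ := h.elim
  obtain ⟨χ', hχ'⟩ := h.elim_swap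
  rcases key hχ h.left h.right hK hd hπ hc he with hm | hm | ⟨i, k, hk, rfl⟩
  · exact .inl hm
  · exact .inr (.inl hm)
  rcases key hχ' h.left.map_rev h.right.map_rev hK' hd' hπ' hc' he' with hm | hm | ⟨j, k', hk', rfl⟩
  · exact .inl hm.of_rev
  · exact .inr (.inl hm.of_rev)
  refine .inr (.inr ⟨?_, ?_, i, j, k, k', hk, hk', hχ, hχ'⟩)
  · have h1 := hχ.degree_middle_le h.left h.right hK
    have h2 := (degreeOf_C_mul_le (π i) 1 k).trans (hπ i).degree
    omega
  · obtain ⟨x, x', u, hx⟩ := (hπ i).depends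
    exact hχ.middle_le_one h.left h.right hK (x := x) (x' := x') (u := u) (by
      rw [map_mul, map_mul, eval_C, eval_C]
      exact fun h0 => hx (mul_left_cancel₀ hk h0))

/-- The relations between the constants of a line `x = l u + s` on which
`S = (t - ν u) T` for `S = a x u + b x v + c u v + g`, `T = a v + b u + c x`. -/
structure IsFactorLine (a b c g l ν s t : ℂ) : Prop where
  slope_ne : l ≠ 0
  slope_ne' : ν ≠ 0
  r₁ : l * b + c = -(ν * a)
  r₂ : b * s = t * a
  r₃ : l * a = -(ν * (b + c * l))
  r₄ : s * a = t * (b + c * l) - ν * c * s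
  r₅ : g = t * c * s

/-- The classification for `S = a x u + b x v + c u v + g`, `T = a v + b u + c x`, when the edge
biquadratics split into two linear factors. -/
theorem DualPair.coeffs_of_lines {a b c g : ℂ} (ha : a ≠ 0) (hb : b ≠ 0) (hc : c ≠ 0)
    {l ν s t l' s' : Bool → ℂ} (hline : ∀ i, IsFactorLine a b c g (l i) (ν i) (s i) (t i))
    (he : ∀ x u, (⟨0, a, b, c, 0, g⟩ : KleinQuad).edge x u = -(b * c)
      * ((x - l true * u - s true) * (x - l false * u - s false)))
    (he' : ∀ x u, (⟨0, b, a, c, 0, g⟩ : KleinQuad).edge x u = -(a * c)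
      * ((x - l' true * u - s' true) * (x - l' false * u - s' false)))
    {q p : TriPoly} (h : DualPair ⟨0, a, b, c, 0, g⟩ q p)
    (hK : ∃ x u, (⟨0, a, b, c, 0, g⟩ : KleinQuad).edge x u ≠ 0)
    (hK' : ∃ x u, (⟨0, b, a, c, 0, g⟩ : KleinQuad).edge x u ≠ 0) :
    IsMiddleFree q ∨ IsMiddleFree p ∨ ∃ (i : Bool) (σ A₀ B₀ B₁ C₁ : ℂ), σ ≠ 0 ∧
      σ ^ 2 * b * ν i = -(a * l i) ∧ l i * A₀ = -((1 + σ) * C₁) ∧ l i * B₁ = σ * ν i * C₁ ∧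
      ∀ x u y, eval ![x, u, y] q = A₀ * (x * y) + (B₀ + B₁ * u) * x + (σ * B₀ + C₁ * u) * y
        + (t i * (s i * A₀ + σ * B₀) - s i * B₀
          + (t i * (l i * A₀ + C₁) - ν i * (s i * A₀ + σ * B₀) - l i * B₀ - s i * B₁) * u) := by
  have hdeg : ∀ {a b : ℂ}, b ≠ 0 → 2 ≤ degreeOf 1 (⟨0, a, b, c, 0, g⟩ : KleinQuad).edgePoly :=
    fun {a b} hb => KleinQuad.degreeOf_edgePoly_two (x := 0) (by
      intro h0
      simp only [KleinQuad.edge] at h0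
      exact mul_ne_zero hb hc (by linear_combination (-1 / 2) * h0))
  have hpoly : ∀ {K : KleinQuad} {d : ℂ} {l s : Bool → ℂ}, (∀ x u, K.edge x u = d
      * ((x - l true * u - s true) * (x - l false * u - s false))) → K.edgePoly
      = C d * ((X 0 - C (l true) * X 1 - C (s true)) * 
          (X 0 - C (l false) * X 1 - C (s false))) := by
    intro K d l s hK
    refine MvPolynomial.funext fun z => ?_
    have hz : z = ![z 0, z 1] := by ext i; fin_cases i <;> rfl
    rw [hz, K.eval_edgePoly, hK]
    simp
  rcases h.simple_factor hK hK' (hdeg hb) (hdeg ha)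
    (π := fun i => X 0 - C (l i) * X 1 - C (s i)) (π' := fun i => X 0 - C (l' i) * X 1 - C (s' i))
    (fun i => isSimpleFactor_line _ _) (fun i => isSimpleFactor_line _ _)
    (neg_ne_zero.mpr (mul_ne_zero hb hc)) (neg_ne_zero.mpr (mul_ne_zero ha hc))
    (hpoly he) (hpoly he') with hm | hm | ⟨hm, hn, i, j, k, k', hk, hk', hχ, hχ'⟩
  · exact .inl hm
  · exact .inr (.inl hm)
  obtain ⟨A₀, A₁, B₀, B₁, C₀, C₁, D₀, D₁, hq, h1, h2⟩ := hχ.exists_affine_coeffs hχ' h.left hm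
  simp only [KleinQuad.S, KleinQuad.T, map_mul, map_sub, eval_C, eval_X, Matrix.cons_val_zero,
    Matrix.cons_val_one] at h1 h2
  obtain ⟨rfl, e1, e2, e3, rfl, rfl, rfl⟩ := coeffs_of_linear_factor (σ := k' / k) (k := k)
    (A₀ := A₀) (A₁ := A₁) (B₀ := B₀) (B₁ := B₁) (C₀ := C₀) (C₁ := C₁) (D₀ := D₀) (D₁ := D₁)
    (m := fun v => l' j * v + s' j) (P₀ := fun u v => eval ![u, 0, v] p)
    (P₁ := fun u v => eval ![u, 1, v] p - eval ![u, 0, v] p) ha hc (hline i).slope_ne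
    (hline i).slope_ne' (div_ne_zero hk' hk) (hline i).r₁ (hline i).r₂ (hline i).r₃ (hline i).r₄
    (hline i).r₅ (fun x u v _ _ => by
      rw [← eval_middle_affine hn]
      linear_combination h1 x u v)
    (fun x u v _ _ => by
      rw [← eval_middle_affine hn, div_mul_cancel₀ _ hk]
      linear_combination h2 x u v) (h.left.exists_coeff_ne_zero hq)
  refine .inr (.inr ⟨i, k' / k, A₀, B₀, B₁, C₁, div_ne_zero hk' hk, e1, e2, e3, fun x u y => ?_⟩)
  rw [hq]
  ring

/-! ### The equations Q1, A1, Q3(0) and A2 -/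

/-- The hyperbola `z ^ 2 - w ^ 2 = 1` is parametrized by `cosh` and `sinh`, as `z + w` is an
exponential. -/
theorem exists_cosh_sinh {z w : ℂ} (h : z ^ 2 - w ^ 2 = 1) :
    ∃ a : ℂ, Complex.cosh a = z ∧ Complex.sinh a = w := by
  have hzw : z + w ≠ 0 := by
    intro h0
    have : (z + w) * (z - w) = 1 := by linear_combination h
    rw [h0, zero_mul] at this
    exact zero_ne_one this
  have hinv : (z + w)⁻¹ = z - w := inv_eq_of_mul_eq_one_right (by linear_combination h)
  refine ⟨Complex.log (z + w), ?_, ?_⟩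
  · rw [Complex.cosh, Complex.exp_neg, Complex.exp_log hzw, hinv]; ring
  · rw [Complex.sinh, Complex.exp_neg, Complex.exp_log hzw, hinv]; ring

namespace ABS

/-- `q` is a member of the singular family, at the parameter values `α, β`. -/
def IsSingularQ (E : ABS) (α β : ℂ) (q : TriPoly) : Prop :=
  ∃ ε a b c₀ c₁ : ℂ, (ε = 1 ∨ ε = -1) ∧ E.Uniformizes ε α a ∧ E.Uniformizes ε β b ∧
    q = C c₀ * E.q₀ a b + C c₁ * E.q₁ a b

/-- `q` is a member of the dual singular family, at the parameter values `α, β`. -/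
def IsSingularP (E : ABS) (α β : ℂ) (q : TriPoly) : Prop :=
  ∃ ε a b c₀ c₁ : ℂ, (ε = 1 ∨ ε = -1) ∧ E.Uniformizes ε α a ∧ E.Uniformizes ε β b ∧
    q = C c₀ * E.p₀ a b + C c₁ * E.p₁ a b

/-- The lines `x = τ u ± δ a` on which the edge biquadratic of Q1 and A1 vanishes. -/
theorem isFactorLine_Q1 {a b τ δ η : ℂ} (hτ : τ = 1 ∨ τ = -1) (hη : η = 1 ∨ η = -1) :
    IsFactorLine a b (-(τ * (a + b))) (-(τ * (δ ^ 2 * a * b * (a + b)))) τ τ (η * δ * a)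
      (η * δ * b) := by
  rcases hτ with rfl | rfl <;> rcases hη with rfl | rfl <;>
    constructor <;> first | ring1 | norm_num

/-- The sign `± 1` of a Boolean. -/
def sign (i : Bool) : ℂ := if i then 1 else -1

theorem sign_eq (i : Bool) : sign i = 1 ∨ sign i = -1 := by cases i <;> simp [sign]

/-- The polynomial `q` for Q1 (`τ = 1`) and A1 (`τ = -1`); the parameters of the singular case are
`b = B` and `a = σ B`, where `σ` is the ratio of the two elimination factors. -/
theorem coeffs_Q1_A1 {E : ABS} {τ δ α β : ℂ} (hE : E = Q1 δ ∧ τ = 1 ∨ E = A1 δ ∧ τ = -1)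
    (hA : E.Admissible α β) {q p : TriPoly} (h : DualPair (E.coeffs α β) q p) :
    IsMiddleFree q ∨ IsMiddleFree p ∨ ∃ ε σ B c₀ c₁ : ℂ, (ε = 1 ∨ ε = -1) ∧
      ε * α = (σ * B) ^ 2 ∧ ε * β = B ^ 2 ∧ ∀ x u y, eval ![x, u, y] q
        = c₀ * ((σ * B + B) * (x * y) - (σ * B * τ * u - δ * (σ * B) * B ^ 2) * x
          - (B * τ * u - δ * (σ * B) ^ 2 * B) * y)
        + c₁ * (B * x + σ * B * y + (σ * B + B) * (δ * (σ * B) * B - τ * u)) := by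
  have hτ : τ = 1 ∨ τ = -1 := by rcases hE with ⟨-, h⟩ | ⟨-, h⟩ <;> simp [h]
  have hτ2 : τ * τ = 1 := by rcases hτ with rfl | rfl <;> norm_num
  have hgen := coeffs_generic hA
  have hadm : α ≠ 0 ∧ β ≠ 0 ∧ α ≠ β := by rcases hE with ⟨rfl, -⟩ | ⟨rfl, -⟩ <;> exact hA
  obtain ⟨hα, hβ, hne⟩ := hadm
  have hc : E.coeffs α β = ⟨0, α, -β, -(τ * (α + -β)), 0,
      -(τ * (δ ^ 2 * α * (-β) * (α + -β)))⟩ := by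
    rcases hE with ⟨rfl, rfl⟩ | ⟨rfl, rfl⟩ <;> simp only [coeffs, KleinQuad.mk.injEq] <;>
      refine ⟨trivial, trivial, trivial, ?_, trivial, ?_⟩ <;> ring
  rw [hc] at h hgen
  have hτ0 : τ ≠ 0 := left_ne_zero_of_mul (hτ2.trans_ne one_ne_zero)
  have hs : -(τ * (α + -β)) ≠ 0 :=
    neg_ne_zero.mpr (mul_ne_zero hτ0 (by rw [← sub_eq_add_neg]; exact sub_ne_zero.mpr hne))
  rcases DualPair.coeffs_of_lines hα (neg_ne_zero.mpr hβ) hs (l := fun _ => τ) (ν := fun _ => τ)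
    (s := fun i => sign i * δ * α) (t := fun i => sign i * δ * (-β)) (l' := fun _ => τ)
    (s' := fun i => sign i * δ * β) (fun i => isFactorLine_Q1 hτ (sign_eq i))
    (fun x u => by
      rcases hτ with rfl | rfl <;> simp only [KleinQuad.edge, sign, if_true, Bool.false_eq_true,
        if_false] <;> ring)
    (fun x u => by
      rcases hτ with rfl | rfl <;> simp only [KleinQuad.edge, sign, if_true, Bool.false_eq_true,
        if_false] <;> ring)
    h hgen.edge_ne hgen.edge_swap_ne with hm | hm | ⟨i, σ, A₀, B₀, B₁, C₁, hσ, e1, e2, e3, hq⟩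
  · exact .inl hm
  · exact .inr (.inl hm)
  refine .inr (.inr ?_)
  obtain ⟨ε, hε, hi⟩ : ∃ ε : ℂ, (ε = 1 ∨ ε = -1) ∧ sign i = -ε :=
    ⟨-sign i, by rcases sign_eq i with h | h <;> simp [h], by ring⟩
  have hεε : ε * ε = 1 := by rcases hε with rfl | rfl <;> norm_num
  obtain ⟨B, hB⟩ := IsAlgClosed.exists_pow_nat_eq (ε * β) (n := 2) (by omega)
  have hB0 : B ≠ 0 := by
    rintro rfl
    have : β = 0 := by linear_combination -β * hεε - ε * hB
    exact hβ this
  have hαβ : α = σ ^ 2 * β := by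
    apply mul_left_cancel₀ hτ0
    linear_combination e1
  have hβ' : β = ε * B ^ 2 := by linear_combination -β * hεε - ε * hB
  obtain ⟨c₀, rfl⟩ : ∃ c₀, C₁ = -(τ * B * c₀) := ⟨-(τ * C₁ / B), by
    field_simp; linear_combination -C₁ * hτ2⟩
  obtain ⟨c₁, rfl⟩ : ∃ c₁, B₀ = c₁ * B + c₀ * δ * (σ * B) * B ^ 2 :=
    ⟨(B₀ - c₀ * δ * (σ * B) * B ^ 2) / B, by field_simp; ring⟩
  have hA0 : A₀ = (1 + σ) * B * c₀ := by
    apply mul_left_cancel₀ hτ0; linear_combination e2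
  have hB1 : B₁ = -(σ * τ * B * c₀) := by
    apply mul_left_cancel₀ hτ0; linear_combination e3
  refine ⟨ε, σ, B, c₀, c₁, hε, ?_, hB.symm, fun x u y => ?_⟩
  · rw [hαβ, hβ']; linear_combination σ ^ 2 * B ^ 2 * hεε
  · rw [hq]
    simp only [hi]
    subst hA0 hB1
    rw [hαβ, hβ']
    rcases hε with rfl | rfl <;> rcases hτ with rfl | rfl <;> ring

theorem classify_Q1_A1 {E : ABS} {δ α β : ℂ} (hE : E = Q1 δ ∨ E = A1 δ) (hA : E.Admissible α β)
    {q p : TriPoly} (h : DualPair (E.coeffs α β) q p) :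
    IsMiddleFree q ∨ IsMiddleFree p ∨ E.IsSingularQ α β q := by
  have hE' : ∃ τ : ℂ, E = Q1 δ ∧ τ = 1 ∨ E = A1 δ ∧ τ = -1 := by
    rcases hE with h | h
    · exact ⟨1, .inl ⟨h, rfl⟩⟩
    · exact ⟨-1, .inr ⟨h, rfl⟩⟩
  obtain ⟨τ, hE'⟩ := hE'
  rcases coeffs_Q1_A1 hE' hA h with hm | hm | ⟨ε, σ, B, c₀, c₁, hε, h1, h2, hq⟩
  · exact .inl hm
  · exact .inr (.inl hm)
  refine .inr (.inr ⟨ε, σ * B, B, c₀, c₁, hε, ?_, ?_, tri_ext fun x u y => ?_⟩)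
  · rcases hE with rfl | rfl <;> exact h1
  · rcases hE with rfl | rfl <;> exact h2
  · rw [hq]
    rcases hE' with ⟨rfl, rfl⟩ | ⟨rfl, rfl⟩
    · simp [q₀, q₁]
    · simp [q₀, q₁]; ring

theorem exp_sign_mul (i : Bool) (α : ℂ) :
    Complex.exp (sign i * α) = Complex.cosh α + sign i * Complex.sinh α := by
  cases i
  · simp [sign, Complex.cosh, Complex.sinh]; ring
  · simp [sign, Complex.cosh, Complex.sinh]; ring

/-- The lines `x = exp (± α) u` on which the edge biquadratic of Q3(0) vanishes. -/
theorem isFactorLine_Q3 (α β : ℂ) (i : Bool) :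
    IsFactorLine (Complex.sinh α) (-Complex.sinh β) (-Complex.sinh (α - β)) 0
      (Complex.exp (sign i * α)) (Complex.exp (sign i * β)) 0 0 := by
  have hi : sign i * sign i = 1 := by rcases sign_eq i with h | h <;> rw [h] <;> ring
  have h1 := Complex.cosh_sq α
  have h2 := Complex.cosh_sq β
  refine ⟨Complex.exp_ne_zero _, Complex.exp_ne_zero _, ?_, by ring, ?_, by ring, by ring⟩
  · rw [exp_sign_mul, exp_sign_mul, Complex.sinh_sub]; ring
  · rw [exp_sign_mul, exp_sign_mul, Complex.sinh_sub]
    rcases sign_eq i with h | h <;> rw [h]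
    · linear_combination
        (Complex.sinh α * (Complex.cosh α + Complex.sinh α) * (-1)) * h2
        + (Complex.sinh β * (Complex.cosh β + Complex.sinh β)) * h1
    · linear_combination
        (Complex.sinh α * (Complex.cosh α - Complex.sinh α) * (-1)) * h2
        + (Complex.sinh β * (Complex.cosh β - Complex.sinh β)) * h1

theorem exp_sign_mul_exp (α : ℂ) :
    Complex.exp (sign true * α) * Complex.exp (sign false * α) = 1 := by
  rw [← Complex.exp_add]; simp [sign]

theorem exp_sign_add_exp (α : ℂ) :
    Complex.exp (sign true * α) + Complex.exp (sign false * α) = 2 * Complex.cosh α := by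
  rw [exp_sign_mul, exp_sign_mul]; simp only [sign, if_true, Bool.false_eq_true, if_false]; ring

theorem sinh_edge_swap (α β : ℂ) :
    Complex.sinh β ^ 2 - Complex.sinh α ^ 2 - Complex.sinh (α - β) ^ 2
      = -(2 * Complex.sinh α * Complex.sinh (α - β) * Complex.cosh β) := by
  have h := sinh_edge β α
  rw [← neg_sub α β, Complex.sinh_neg] at h
  linear_combination h

/-- The parameters `a`, `b` of the singular case of Q3(0) and A2, from the ratio `σ` of the
elimination factors. -/
theorem exists_uniformizing {α β σ : ℂ} {i : Bool} (hβ : Complex.sinh β ≠ 0)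
    (h : σ ^ 2 * -Complex.sinh β * Complex.exp (sign i * β)
      = -(Complex.sinh α * Complex.exp (sign i * α))) :
    ∃ a b : ℂ, Complex.exp (sign i * α) = Complex.cosh a ∧ 
        Complex.exp (sign i * β) = Complex.cosh b ∧
      Complex.sinh b ≠ 0 ∧ Complex.sinh a = σ * Complex.sinh b := by
  have hi : sign i * sign i = 1 := by rcases sign_eq i with h | h <;> rw [h] <;> ring
  have hsq : ∀ z : ℂ, Complex.exp (sign i * z) ^ 2 - 1
      = 2 * sign i * Complex.sinh z * Complex.exp (sign i * z) := by
    intro z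
    rw [exp_sign_mul]
    linear_combination Complex.cosh_sq z - Complex.sinh z ^ 2 * hi
  obtain ⟨r, hr⟩ := IsAlgClosed.exists_pow_nat_eq (Complex.exp (sign i * β) ^ 2 - 1) (n := 2)
    (by omega)
  have hr0 : r ≠ 0 := by
    rintro rfl
    rw [hsq] at hr
    have : sign i ≠ 0 := left_ne_zero_of_mul (hi.trans_ne one_ne_zero)
    exact mul_ne_zero (mul_ne_zero (mul_ne_zero two_ne_zero this) hβ) (Complex.exp_ne_zero _)
      (by rw [← hr]; norm_num)
  obtain ⟨b, hb, hb'⟩ := exists_cosh_sinh (z := Complex.exp (sign i * β)) (w := r)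
    (by rw [hr]; ring)
  obtain ⟨a, ha, ha'⟩ := exists_cosh_sinh (z := Complex.exp (sign i * α)) (w := σ * r) (by
    linear_combination hsq α + 2 * sign i * h - σ ^ 2 * hr - σ ^ 2 * hsq β)
  exact ⟨a, b, ha.symm, hb.symm, by rwa [hb'], by rw [ha', hb']⟩

/-- The lines of Q3(0) pass through the origin and have slopes `exp (± α)`. -/
theorem classify_Q3 {α β : ℂ} (hA : (Q3 0).Admissible α β)
    {q p : TriPoly} (h : DualPair ((Q3 0).coeffs α β) q p) :
    IsMiddleFree q ∨ IsMiddleFree p ∨ (Q3 0).IsSingularQ α β q := by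
  have hgen := coeffs_generic hA
  obtain ⟨hα, hβ, hαβ⟩ := hA
  have hc : (Q3 0).coeffs α β
      = ⟨0, Complex.sinh α, -Complex.sinh β, -Complex.sinh (α - β), 0, 0⟩ := by
    simp [coeffs]
  rw [hc] at h hgen
  rcases DualPair.coeffs_of_lines hα (neg_ne_zero.mpr hβ) (neg_ne_zero.mpr hαβ)
    (l := fun i => Complex.exp (sign i * α)) (ν := fun i => Complex.exp (sign i * β))
    (s := fun _ => 0) (t := fun _ => 0) (l' := fun i => Complex.exp (sign i * β))
    (s' := fun _ => 0) (isFactorLine_Q3 α β)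
    (fun x u => by
      simp only [KleinQuad.edge]
      linear_combination (x * u) * sinh_edge α β
        - Complex.sinh β * Complex.sinh (α - β) * x * u * exp_sign_add_exp α
        + Complex.sinh β * Complex.sinh (α - β) * u ^ 2 * exp_sign_mul_exp α)
    (fun x u => by
      simp only [KleinQuad.edge]
      linear_combination (x * u) * sinh_edge_swap α β
        + Complex.sinh α * Complex.sinh (α - β) * x * u * exp_sign_add_exp β
        - Complex.sinh α * Complex.sinh (α - β) * u ^ 2 * exp_sign_mul_exp β)
    h hgen.edge_ne hgen.edge_swap_ne with hm | hm | ⟨i, σ, A₀, B₀, B₁, C₁, hσ, e1, e2, e3, hq⟩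
  · exact .inl hm
  · exact .inr (.inl hm)
  refine .inr (.inr ?_)
  obtain ⟨a, b, ha, hb, hb0, hab⟩ := exists_uniformizing hβ e1
  have hl := Complex.exp_ne_zero (sign i * α)
  obtain ⟨c₀, rfl⟩ : ∃ c₀, C₁ = -(Complex.exp (sign i * α) * Complex.sinh b * c₀) :=
    ⟨-(C₁ / (Complex.exp (sign i * α) * Complex.sinh b)), by field_simp⟩
  obtain ⟨c₁, rfl⟩ : ∃ c₁, B₀ = c₁ * Complex.sinh b := ⟨B₀ / Complex.sinh b, by field_simp⟩
  obtain rfl : A₀ = (1 + σ) * Complex.sinh b * c₀ := by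
    apply mul_left_cancel₀ hl; linear_combination e2
  obtain rfl : B₁ = -(σ * Complex.exp (sign i * β) * Complex.sinh b * c₀) := by
    apply mul_left_cancel₀ hl; linear_combination e3
  refine ⟨sign i, a, b, c₀, c₁, sign_eq i, ha, hb, tri_ext fun x u y => ?_⟩
  rw [hq]
  simp only [q₀, q₁, map_add, map_sub, map_mul, eval_C, eval_X, Matrix.cons_val_zero,
    Matrix.cons_val_one, Matrix.cons_val, Complex.sinh_add, hab, ← ha, ← hb]
  ring

/-- The case A2 is carried to Q3(0) by the inversion of `u` and `v`. -/
theorem classify_A2 {α β : ℂ} (hA : A2.Admissible α β)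
    {q p : TriPoly} (h : DualPair (A2.coeffs α β) q p) :
    IsMiddleFree q ∨ IsMiddleFree p ∨ A2.IsSingularQ α β q := by
  have hgen := coeffs_generic hA
  obtain ⟨hα, hβ, hαβ⟩ := hA
  have hd : 2 ≤ degreeOf 1 (A2.coeffs α β).edgePoly :=
    KleinQuad.degreeOf_edgePoly_two (x := 1) (by
      intro h0
      simp only [KleinQuad.edge, coeffs] at h0
      exact mul_ne_zero hαβ hβ (by linear_combination h0 / 2))
  have hd' : 2 ≤ degreeOf 1 (A2.coeffs α β).swap.edgePoly :=
    KleinQuad.degreeOf_edgePoly_two (x := 1) (by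
      intro h0
      simp only [KleinQuad.edge, KleinQuad.swap, coeffs] at h0
      exact mul_ne_zero hαβ hα (by linear_combination -h0 / 2))
  rcases h.simple_factor hgen.edge_ne hgen.edge_swap_ne hd hd'
    (π := fun i => X 0 * X 1 - C (Complex.exp (sign i * α)))
    (π' := fun i => X 0 * X 1 - C (Complex.exp (sign i * β)))
    (fun i => isSimpleFactor_hyperbola (Complex.exp_ne_zero _))
    (fun i => isSimpleFactor_hyperbola (Complex.exp_ne_zero _))
    (mul_ne_zero hβ hαβ) (neg_ne_zero.mpr (mul_ne_zero hα hαβ))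
    (MvPolynomial.funext fun z => by
      have hz : z = ![z 0, z 1] := by ext i; fin_cases i <;> rfl
      rw [hz, KleinQuad.eval_edgePoly]
      simp only [KleinQuad.edge, coeffs, map_sub, map_mul, eval_C, eval_X, Matrix.cons_val_zero,
        Matrix.cons_val_one]
      linear_combination -(z 0 * z 1) * sinh_edge α β
        + Complex.sinh β * Complex.sinh (α - β) * z 0 * z 1 * exp_sign_add_exp α
        - Complex.sinh β * Complex.sinh (α - β) * exp_sign_mul_exp α)
    (MvPolynomial.funext fun z => by
      have hz : z = ![z 0, z 1] := by ext i; fin_cases i <;> rfl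
      rw [hz, KleinQuad.eval_edgePoly]
      simp only [KleinQuad.edge, KleinQuad.swap, coeffs, map_sub, map_neg, map_mul, eval_C, eval_X,
        Matrix.cons_val_zero, Matrix.cons_val_one]
      linear_combination -(z 0 * z 1) * sinh_edge_swap α β
        - Complex.sinh α * Complex.sinh (α - β) * z 0 * z 1 * exp_sign_add_exp β
        + Complex.sinh α * Complex.sinh (α - β) * exp_sign_mul_exp β)
    with hm | hm | ⟨hm, hn, i, j, k, k', hk, hk', hχ, hχ'⟩
  · exact .inl hm
  · exact .inr (.inl hm)
  refine .inr (.inr ?_)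
  obtain ⟨A₀, A₁, B₀, B₁, C₀, C₁, D₀, D₁, hq, h1, h2⟩ := hχ.exists_affine_coeffs hχ' h.left hm
  simp only [KleinQuad.S, KleinQuad.T, coeffs, map_mul, map_sub, eval_C, eval_X,
    Matrix.cons_val_zero, Matrix.cons_val_one] at h1 h2
  have hl := isFactorLine_Q3 α β i
  obtain ⟨rfl, e1, e2, e3, rfl, hD0, hD1⟩ := coeffs_of_linear_factor (σ := k' / k) (k := k)
    (A₀ := A₁) (A₁ := A₀) (B₀ := B₁) (B₁ := B₀) (C₀ := C₁) (C₁ := C₀) (D₀ := D₁) (D₁ := D₀)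
    (m := fun v => Complex.exp (sign j * β) * v) (P₀ := fun u v => u * v * eval ![u⁻¹, 0, v⁻¹] p)
    (P₁ := fun u v => u * v * (eval ![u⁻¹, 1, v⁻¹] p - eval ![u⁻¹, 0, v⁻¹] p)) hα
    (neg_ne_zero.mpr hαβ) hl.slope_ne hl.slope_ne' (div_ne_zero hk' hk) hl.r₁ hl.r₂ hl.r₃ hl.r₄
    hl.r₅ (fun x u v hu hv => by
      have e := h1 x u⁻¹ v⁻¹
      rw [eval_middle_affine hn] at e
      generalize Complex.exp (sign i * α) = w at e ⊢
      generalize eval ![u⁻¹, 0, v⁻¹] p = p₀ at e ⊢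
      generalize eval ![u⁻¹, 1, v⁻¹] p = p₁ at e ⊢
      field_simp at e
      linear_combination e)
    (fun x u v hu hv => by
      have e := h2 x u⁻¹ v⁻¹
      rw [eval_middle_affine hn] at e
      rw [div_mul_cancel₀ _ hk]
      generalize Complex.exp (sign j * β) = w at e ⊢
      generalize eval ![u⁻¹, 0, v⁻¹] p = p₀ at e ⊢
      generalize eval ![u⁻¹, 1, v⁻¹] p = p₁ at e ⊢
      field_simp at e
      linear_combination e)
    (fun ⟨e1, e2, e3, e4, e5, e6⟩ => h.left.exists_coeff_ne_zero hq ⟨e2, e1, e4, e3, e6, e5⟩)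
  generalize k' / k = σ at *
  obtain ⟨a, b, ha, hb, hb0, hab⟩ := exists_uniformizing hβ e1
  have hl0 := hl.slope_ne
  obtain ⟨c₀, rfl⟩ : ∃ c₀, C₀ = -(Complex.exp (sign i * α) * Complex.sinh b * c₀) :=
    ⟨-(C₀ / (Complex.exp (sign i * α) * Complex.sinh b)), by field_simp⟩
  obtain ⟨c₁, rfl⟩ : ∃ c₁, B₁ = c₁ * Complex.sinh b := ⟨B₁ / Complex.sinh b, by field_simp⟩
  obtain rfl : A₁ = (1 + σ) * Complex.sinh b * c₀ := by
    apply mul_left_cancel₀ hl0; linear_combination e2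
  obtain rfl : B₀ = -(σ * Complex.exp (sign i * β) * Complex.sinh b * c₀) := by
    apply mul_left_cancel₀ hl0; linear_combination e3
  refine ⟨sign i, a, b, c₀, c₁, sign_eq i, ha, hb, tri_ext fun x u y => ?_⟩
  rw [hq, hD0, hD1]
  simp only [q₀, q₁, map_add, map_sub, map_mul, eval_C, eval_X, Matrix.cons_val_zero,
    Matrix.cons_val_one, Matrix.cons_val, Complex.sinh_add, hab, ← ha, ← hb]
  ring

end ABS

/-! ### Assembling the classification -/

namespace ABS

/-- Each equation falls under one of the cases by the factorization of its edge biquadratic. For H2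
and H3(`δ ≠ 0`) either `q` or `p` belongs to the family of `p₀`, `p₁`: the one from which the
elimination factor is constant. -/
theorem classify {E : ABS} {α β : ℂ} (hA : E.Admissible α β) {q p : TriPoly}
    (h : DualPair (E.coeffs α β) q p) : IsMiddleFree q ∨ IsMiddleFree p ∨
      (E.HasSingular ∧ (E.IsSingularQ α β q ∨ E.IsSingularP α β q ∨ E.IsSingularP α β p)) := by
  have middle : IsMiddleFree q ∨ IsMiddleFree p → IsMiddleFree q ∨ IsMiddleFree p ∨
      (E.HasSingular ∧ (E.IsSingularQ α β q ∨ E.IsSingularP α β q ∨ E.IsSingularP α β p)) :=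
    fun h => h.imp_right .inl
  have sing : E.HasSingular → IsMiddleFree q ∨ IsMiddleFree p ∨ E.IsSingularQ α β q →
      IsMiddleFree q ∨ IsMiddleFree p ∨
      (E.HasSingular ∧ (E.IsSingularQ α β q ∨ E.IsSingularP α β q ∨ E.IsSingularP α β p)) :=
    fun hE h => h.imp_right (Or.imp_right fun h => ⟨hE, .inl h⟩)
  have dual : (E = H2 ∨ ∃ δ, δ ≠ 0 ∧ E = H3 δ) → IsMiddleFree q ∨ IsMiddleFree p ∨
      (E.HasSingular ∧ (E.IsSingularQ α β q ∨ E.IsSingularP α β q ∨ E.IsSingularP α β p)) := by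
    intro hE
    have hS : E.HasSingular := by
      rcases hE with rfl | ⟨δ, hδ, rfl⟩
      · trivial
      · exact hδ
    have hU : ∀ a, E.Uniformizes 1 a a := by
      rcases hE with rfl | ⟨δ, hδ, rfl⟩ <;> exact fun a => rfl
    rcases classify_H2_H3 hE hA h with hm | hm | ⟨c₀, c₁, hs | hs⟩
    · exact .inl hm
    · exact .inr (.inl hm)
    · exact .inr (.inr ⟨hS, .inr (.inl ⟨1, α, β, c₀, c₁, .inl rfl, hU α, hU β, hs⟩)⟩)
    · exact .inr (.inr ⟨hS, .inr (.inr ⟨1, α, β, c₀, c₁, .inl rfl, hU α, hU β, hs⟩)⟩)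
  cases E with
  | Q1 δ => exact sing trivial (classify_Q1_A1 (.inl rfl) hA h)
  | A1 δ => exact sing trivial (classify_Q1_A1 (.inr rfl) hA h)
  | Q2 => exact middle (isMiddleFree_of_irreducible_edge (.inl rfl) hA h)
  | Q4 k => exact middle (isMiddleFree_of_irreducible_edge (.inr (.inr ⟨k, rfl⟩)) hA h)
  | Q3 δ =>
    by_cases hδ : δ = 0
    · subst hδ; exact sing rfl (classify_Q3 hA h)
    · exact middle (isMiddleFree_of_irreducible_edge (.inr (.inl ⟨δ, hδ, rfl⟩)) hA h)
  | A2 => exact sing trivial (classify_A2 hA h)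
  | H1 => exact middle (isMiddleFree_H1 hA h)
  | H2 => exact dual (.inl rfl)
  | H3 δ =>
    by_cases hδ : δ = 0
    · subst hδ; exact middle (isMiddleFree_H3 hA h)
    · exact dual (.inr ⟨δ, hδ, rfl⟩)

theorem IsParameterDomain.dualPair {E : ABS} {D : Set (ℂ × ℂ)} (hD : E.IsParameterDomain D)
    {q p : TriFamily} (h : IsDualTo E.bulk D q p) {α β : ℂ} (hm : (α, β) ∈ D) :
    DualPair (E.coeffs α β) (q α β) (p α β) :=
  h.dualPair hm (hD.symm _ _ hm) (E.bulk_eq α β)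
    (coeffs_neg_swap (hD.regular _ _ hm) (hD.regular _ _ (hD.symm _ _ hm)))

theorem paramEquivAt_of_dualPair {E : ABS} {D : Set (ℂ × ℂ)} {α β : ℂ} (hA : E.Admissible α β)
    (hm : (β, α) ∈ D) {q p q' p' : TriFamily} (hq : IsBoundaryPolynomial D q)
    (hp : IsBoundaryPolynomial D p) (hq' : IsBoundaryPolynomial D q')
    (hp' : IsBoundaryPolynomial D p') (h : DualPair (E.coeffs α β) (q α β) (p α β))
    (h' : DualPair (E.coeffs α β) (q' α β) (p' α β)) {g : ℂ} (hg : g ≠ 0)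
    (hgq : q α β = C g * q' α β) : ParamEquivAt α β q q' ∧ ParamEquivAt α β p p' := by
  obtain ⟨γ₁, hγ₁, e₁⟩ := hq.parity
  obtain ⟨γ₂, hγ₂, e₂⟩ := hp.parity
  obtain ⟨γ₃, hγ₃, e₃⟩ := hq'.parity
  obtain ⟨γ₄, hγ₄, e₄⟩ := hp'.parity
  obtain ⟨g', hg', hgp⟩ := h.unique h' (coeffs_generic hA).edge_ne hg hgq
  exact ⟨paramEquivAt_of_eq hg hγ₁ hγ₃ (e₁ _ _ hm) (e₃ _ _ hm) hgq,
    paramEquivAt_of_eq hg' hγ₂ hγ₄ (e₂ _ _ hm) (e₄ _ _ hm) hgp⟩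

/-- A polynomial free of its middle argument is of the form `M₊` or `M₋`, and its partner is the
dual by uniqueness. -/
theorem classify_of_isMiddleFree {E : ABS} {D : Set (ℂ × ℂ)} (hD : E.IsParameterDomain D)
    {α β : ℂ} (hm : (α, β) ∈ D) {q p : TriFamily} (hq : IsBoundaryPolynomial D q)
    (hp : IsBoundaryPolynomial D p) (h : DualPair (E.coeffs α β) (q α β) (p α β))
    (hfree : IsMiddleFree (q α β)) :
    E.IsMPlusPairAt α β q p ∨ E.HasMMinus ∧ E.IsMMinusPairAt α β q p := by
  have hA := hD.admissible hm
  have hgen := coeffs_generic hA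
  have hm' := hD.symm _ _ hm
  rcases h.moebius hgen.edge_ne hgen.edge_swap_ne hfree with ⟨r₁, r₂, r₄, hr, hev⟩ | ⟨g, hg, hev⟩
  · left
    have hdual := (isDualTo_mPlus hD (r₁ := fun _ _ => r₁) (r₂ := fun _ _ => r₂)
      (r₄ := fun _ _ => r₄) (fun _ _ _ => rfl) (fun _ _ _ => rfl) (fun _ _ _ => rfl)
      (fun _ _ _ => hr)).1
    refine ⟨_, _, _, rfl, rfl, rfl, hr, paramEquivAt_of_dualPair hA hm' hq hp hdual.boundary_q
      hdual.boundary_p h (hD.dualPair hdual hm) one_ne_zero (tri_ext fun x u y => ?_)⟩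
    rw [hev, map_mul, eval_mPlus, eval_C, one_mul]
  · right
    have hgq : q α β = C g * mMinus α β := tri_ext fun x u y => by
      rw [hev, map_mul, eval_mMinus, eval_C]
    have hE : E.HasMMinus := by
      by_contra hE
      exact not_mMinus hE hA h hg hgq
    have hdual := (isDualTo_mMinus hD hE).1
    exact ⟨hE, paramEquivAt_of_dualPair hA hm' hq hp hdual.boundary_q hdual.boundary_p h
      (hD.dualPair hdual hm) hg hgq⟩

theorem Admissible.ne {E : ABS} {α β : ℂ} (hA : E.Admissible α β) (hE : E.HasSingular) :
    α ≠ β := by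
  rintro rfl
  cases E with
  | Q1 δ => exact hA.2.2 rfl
  | A1 δ => exact hA.2.2 rfl
  | Q3 δ => exact hA.2.2 (by simp)
  | A2 => exact hA.2.2 (by simp)
  | H2 => exact hA rfl
  | H3 δ => exact hA rfl
  | _ => exact hE

open Classical in
/-- The singular families through given values of the parameters at `(α, β)`. -/
theorem exists_singular_families {E : ABS} {D : Set (ℂ × ℂ)} (hD : E.IsParameterDomain D)
    (hE : E.HasSingular) {α β : ℂ} (hm : (α, β) ∈ D) {ε a b c₀ c₁ : ℂ} (hε : ε = 1 ∨ ε = -1)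
    (ha : E.Uniformizes ε α a) (hb : E.Uniformizes ε β b) (hc : c₀ ≠ 0 ∨ c₁ ≠ 0) :
    ∃ f : ℂ → ℂ → ℂ, f α β = a ∧ f β α = b ∧
      IsDualTo E.bulk {(α, β), (β, α)} (E.singularQ f (fun _ _ => c₀) (fun _ _ => c₁))
        (E.singularP f (fun _ _ => c₀) (fun _ _ => c₁)) := by
  have hne := (hD.admissible hm).ne hE
  have hm' := hD.symm _ _ hm
  have hD' : E.IsParameterDomain {(α, β), (β, α)} := by
    refine ⟨?_, ?_, ?_⟩
    · rintro s t (h | h)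
      · obtain ⟨rfl, rfl⟩ := Prod.mk.inj h; simp
      · obtain ⟨rfl, rfl⟩ := Prod.mk.inj h; simp
    · rintro s t (h | h)
      · rw [Prod.mk.inj h |>.1, Prod.mk.inj h |>.2]; exact hD.regular _ _ hm
      · rw [Prod.mk.inj h |>.1, Prod.mk.inj h |>.2]; exact hD.regular _ _ hm'
    · rintro s t (h | h)
      · rw [Prod.mk.inj h |>.1, Prod.mk.inj h |>.2]; exact hD.irreducible _ _ hm
      · rw [Prod.mk.inj h |>.1, Prod.mk.inj h |>.2]; exact hD.irreducible _ _ hm'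
  set f : ℂ → ℂ → ℂ := fun s _ => if s = α then a else b with hf
  have h1 : ∀ t, f α t = a := fun t => if_pos rfl
  have h2 : ∀ t, f β t = b := fun t => if_neg (Ne.symm hne)
  refine ⟨f, h1 β, h2 α, (isDualTo_singular hD' hE hε ?_ ?_ (fun _ _ _ => rfl) (fun _ _ _ => rfl)
    (fun _ _ _ => hc)).1⟩
  · rintro s t (h | h)
    · rw [Prod.mk.inj h |>.1, Prod.mk.inj h |>.2, h1 β]; exact ha
    · rw [Prod.mk.inj h |>.1, Prod.mk.inj h |>.2, h2 α]; exact hb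
  · rintro s t (h | h)
    · rw [Prod.mk.inj h |>.1, Prod.mk.inj h |>.2, h2 α]; exact hb
    · rw [Prod.mk.inj h |>.1, Prod.mk.inj h |>.2, h1 β]; exact ha

theorem _root_.IsBoundaryPolynomial.mono {D D' : Set (ℂ × ℂ)} {q : TriFamily}
    (h : IsBoundaryPolynomial D q) (hD : D' ⊆ D) : IsBoundaryPolynomial D' q :=
  ⟨fun α β hm => h.irreducible α β (hD hm), fun α β hm => h.affine_first α β (hD hm),
    fun α β hm => h.affine_last α β (hD hm), h.parity.imp fun _ hγ =>
      ⟨hγ.1, fun α β hm => hγ.2 α β (hD hm)⟩⟩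

/-- A member of either singular family at `(α, β)` belongs to a singular pair: the families of the
pair exist on `{(α, β), (β, α)}`, and the dual is unique. -/
theorem isSingularPairAt_of_eq {E : ABS} {D : Set (ℂ × ℂ)} (hD : E.IsParameterDomain D)
    (hE : E.HasSingular) {α β : ℂ} (hm : (α, β) ∈ D) {q p : TriFamily}
    (hq : IsBoundaryPolynomial D q) (hp : IsBoundaryPolynomial D p)
    (h : DualPair (E.coeffs α β) (q α β) (p α β))
    (hs : E.IsSingularQ α β (q α β) ∨ E.IsSingularP α β (p α β)) :
    E.IsSingularPairAt α β q p := by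
  have hA := hD.admissible hm
  have hgen := coeffs_generic hA
  have hm' := hD.symm _ _ hm
  have hsub : ({(α, β), (β, α)} : Set (ℂ × ℂ)) ⊆ D := by
    rintro z (rfl | rfl)
    · exact hm
    · exact hm'
  have nonzero : ∀ {c₀ c₁ : ℂ} {r s t : TriPoly}, t ≠ 0 → t = C c₀ * r + C c₁ * s →
      c₀ ≠ 0 ∨ c₁ ≠ 0 := by
    intro c₀ c₁ r s t ht he
    by_contra! hc
    exact ht (by rw [he, hc.1, hc.2]; simp)
  have build : ∀ {ε a b c₀ c₁ : ℂ}, (ε = 1 ∨ ε = -1) → E.Uniformizes ε α a → E.Uniformizes ε β b →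
      (c₀ ≠ 0 ∨ c₁ ≠ 0) → (q α β = C c₀ * E.q₀ a b + C c₁ * E.q₁ a b ∨
        p α β = C c₀ * E.p₀ a b + C c₁ * E.p₁ a b) → E.IsSingularPairAt α β q p := by
    intro ε a b c₀ c₁ hε ha hb hc he
    obtain ⟨f, rfl, rfl, hdual⟩ := exists_singular_families hD hE hm hε ha hb hc
    have hpair := hdual.dualPair (.inl rfl) (.inr rfl) (E.bulk_eq α β)
      (coeffs_neg_swap (hD.regular _ _ hm) (hD.regular _ _ hm'))
    refine ⟨ε, f, fun _ _ => c₀, fun _ _ => c₁, hε, ha, hb, rfl, rfl, hc, ?_⟩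
    rcases he with he | he
    · exact paramEquivAt_of_dualPair hA (.inr rfl) (hq.mono hsub) (hp.mono hsub)
        hdual.boundary_q hdual.boundary_p h hpair one_ne_zero (by rw [C_1, one_mul]; exact he)
    · exact (paramEquivAt_of_dualPair hA (.inr rfl) (hp.mono hsub) (hq.mono hsub)
        hdual.boundary_p hdual.boundary_q (h.symm hgen.edge_ne hgen.edge_swap_ne)
        (hpair.symm hgen.edge_ne hgen.edge_swap_ne) one_ne_zero
        (by rw [C_1, one_mul]; exact he)).symm
  rcases hs with ⟨ε, a, b, c₀, c₁, hε, ha, hb, he⟩ | ⟨ε, a, b, c₀, c₁, hε, ha, hb, he⟩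
  · exact build hε ha hb (nonzero h.left.ne_zero he) (.inl he)
  · exact build hε ha hb (nonzero h.right.ne_zero he) (.inr he)

theorem classify_at {E : ABS} {D : Set (ℂ × ℂ)} (hD : E.IsParameterDomain D) {q p : TriFamily}
    (h : IsDualTo E.bulk D q p) {α β : ℂ} (hm : (α, β) ∈ D) :
    (E.IsMPlusPairAt α β q p ∨ E.IsMPlusPairAt α β p q) ∨
      (E.HasMMinus ∧ (E.IsMMinusPairAt α β q p ∨ E.IsMMinusPairAt α β p q)) ∨
      (E.HasSingular ∧ (E.IsSingularPairAt α β q p ∨ E.IsSingularPairAt α β p q)) := by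
  have hA := hD.admissible hm
  have hgen := coeffs_generic hA
  have hpair := hD.dualPair h hm
  have hpair' := hpair.symm hgen.edge_ne hgen.edge_swap_ne
  rcases classify hA hpair with hf | hf | ⟨hE, hs | hs | hs⟩
  · rcases classify_of_isMiddleFree hD hm h.boundary_q h.boundary_p hpair hf with h1 | ⟨hE, h1⟩
    · exact .inl (.inl h1)
    · exact .inr (.inl ⟨hE, .inl h1⟩)
  · rcases classify_of_isMiddleFree hD hm h.boundary_p h.boundary_q hpair' hf with h1 | ⟨hE, h1⟩
    · exact .inl (.inr h1)
    · exact .inr (.inl ⟨hE, .inr h1⟩)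
  · exact .inr (.inr ⟨hE, .inl
      (isSingularPairAt_of_eq hD hE hm h.boundary_q h.boundary_p hpair (.inl hs))⟩)
  · exact .inr (.inr ⟨hE, .inr
      (isSingularPairAt_of_eq hD hE hm h.boundary_p h.boundary_q hpair' (.inr hs))⟩)
  · exact .inr (.inr ⟨hE, .inl
      (isSingularPairAt_of_eq hD hE hm h.boundary_q h.boundary_p hpair (.inr hs))⟩)

end ABS

end

theorem theorem2p1 (E : ABS) (D : Set (ℂ × ℂ)) (hD : E.IsParameterDomain D) :
    -- every pair of dual boundary polynomials belongs to one of the three categories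
    (∀ q p : TriFamily, IsDualTo E.bulk D q p → ∀ α β, (α, β) ∈ D →
      (E.IsMPlusPairAt α β q p ∨ E.IsMPlusPairAt α β p q) ∨
      (E.HasMMinus ∧ (E.IsMMinusPairAt α β q p ∨ E.IsMMinusPairAt α β p q)) ∨
      (E.HasSingular ∧ (E.IsSingularPairAt α β q p ∨ E.IsSingularPairAt α β p q))) ∧
    -- the three-parameter family `M₊` exists for every equation
    (∀ r₁ r₂ r₄ : ℂ → ℂ → ℂ, SymmOn D r₁ → SymmOn D r₂ → SymmOn D r₄ →
      (∀ α β, (α, β) ∈ D → r₁ α β * r₄ α β - r₂ α β ^ 2 ≠ 0) →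
      IsDualTo E.bulk D (ABS.mPlus r₁ r₂ r₄) (E.dualMPlus r₁ r₂ r₄) ∧
      IsDualTo E.bulk D (E.dualMPlus r₁ r₂ r₄) (ABS.mPlus r₁ r₂ r₄)) ∧
    -- the `M₋` pair exists except for Q1(0), A1(0), H1
    (E.HasMMinus →
      IsDualTo E.bulk D ABS.mMinus E.dualMMinus ∧ IsDualTo E.bulk D E.dualMMinus ABS.mMinus) ∧
    -- and for these three equations no dual pair contains a multiple of `x - y`
    (¬ E.HasMMinus → ∀ q p : TriFamily, IsDualTo E.bulk D q p → ∀ α β, (α, β) ∈ D →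
      ¬ ParamEquivAt α β q ABS.mMinus ∧ ¬ ParamEquivAt α β p ABS.mMinus) ∧
    -- the two-parameter family of the singular case exists for the listed equations, and it is
    -- not obtained from the first category
    (E.HasSingular → ∀ (ε : ℂ) (a c₀ c₁ : ℂ → ℂ → ℂ), (ε = 1 ∨ ε = -1) →
      (∀ α β, (α, β) ∈ D → E.Uniformizes ε α (a α β)) →
      (∀ α β, (α, β) ∈ D → E.Uniformizes ε β (a β α)) →
      SymmOn D c₀ → SymmOn D c₁ → (∀ α β, (α, β) ∈ D → c₀ α β ≠ 0 ∨ c₁ α β ≠ 0) →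
      IsDualTo E.bulk D (E.singularQ a c₀ c₁) (E.singularP a c₀ c₁) ∧
      IsDualTo E.bulk D (E.singularP a c₀ c₁) (E.singularQ a c₀ c₁) ∧
      ∀ α β, (α, β) ∈ D →
        ¬ E.IsMPlusPairAt α β (E.singularQ a c₀ c₁) (E.singularP a c₀ c₁) ∧
        ¬ E.IsMPlusPairAt α β (E.singularP a c₀ c₁) (E.singularQ a c₀ c₁)) := by
  refine ⟨fun q p h α β hm => ABS.classify_at hD h hm,
    fun r₁ r₂ r₄ h₁ h₂ h₄ hr => ABS.isDualTo_mPlus hD h₁ h₂ h₄ hr,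
    fun hE => ABS.isDualTo_mMinus hD hE, fun hE q p h α β hm => ?_,
    fun hE ε a c₀ c₁ hε ha hb h₀ h₁ hc => ABS.isDualTo_singular hD hE hε ha hb h₀ h₁ hc⟩
  have hA := hD.admissible hm
  have hgen := ABS.coeffs_generic hA
  have hpair := hD.dualPair h hm
  exact ⟨fun ⟨_, _, hg, _, hq, _⟩ => ABS.not_mMinus hE hA hpair hg hq,
    fun ⟨_, _, hg, _, hp, _⟩ =>
      ABS.not_mMinus hE hA (hpair.symm hgen.edge_ne hgen.edge_swap_ne) hg hp⟩
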